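/- **Setting.** Let $\{K_\sigma\}_{\sigma\in\mathcal J}$ be a finite family of pairwise disjoint, compact, strictly convex obstacles in $\mathbb R^2$ with smooth boundary, let $|\alpha|=1$, and let $(K_j)_{j\ge 0}$ be a sequence in this family with $K_{j+1}\ne K_j$ satisfying the no-occlusion condition $\{x+t\alpha: x\in K_0,\ t\ge 0\}\cap K_1=\varnothing$ and the visibility condition $K_{j+1}\cap\overline{\mathrm{co}}(K_j\cup K_{j+2})=\varnothing$ $(j\ge 0)$. Let $\nu$ be the exterior unit normal, $\gamma_j$ a counterclockwise arc-length parametrization of $\partial K_j$, of period $P_j$, and $G(x,y)=\frac i4H^{(1)}_0(k|x-y|)$, $k>0$. *Fields.* Let $u_{-1}(x,k)=e^{ik\alpha\cdot x}$. For $0\le j\le m$ let $\eta_j$ be the total field on $\partial K_j$ and let $$u_j(x,k)=\int_{\partial K_j}\frac{\partial G(x,y)}{\partial\nu(y)}\,\eta_j(y,k)\,ds(y),\qquad x\in\mathbb R^2\setminus K_j ,$$ be the scattered field; that is, $(\Delta+k^2)u_j=0$ in $\mathbb R^2\setminus K_j$, $\partial_\nu u_j=-\partial_\nu u_{j-1}$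 on $\partial K_j$, $\sqrt r(\partial_ru_j-iku_j)\to0$ as $r=|x|\to\infty$ (uniformly in direction), and $\eta_j=u_j+u_{j-1}$ on $\partial K_j$. *Rays.* For $m\ge1$ and $x\in\partial K_m$ let $(\mathcal X_0,\dots,\mathcal X_m)\in\partial K_0\times\dots\times\partial K_m$ be the broken ray with $\mathcal X_m=x$, $\alpha\cdot\nu(\mathcal X_0)<0$, $\frac{\mathcal X_1-\mathcal X_0}{|\mathcal X_1-\mathcal X_0|}=\alpha-2(\alpha\cdot\nu(\mathcal X_0))\nu(\mathcal X_0)$ and, for $0<j<m$, $(\mathcal X_{j+1}-\mathcal X_j)\cdot\nu(\mathcal X_j)>0$ and $e_{j}=e_{j-1}-2(e_{j-1}\cdot\nu(\mathcal X_j))\nu(\mathcal X_j)$, where $e_j=\frac{\mathcal X_{j+1}-\mathcal X_j}{|\mathcal X_{j+1}-\mathcal X_j|}$. On $\partial K_m$ put $\varphi_0(x)=\alpha\cdot x$, $\alpha_0^{\rm inc}=\alpha$, and for $m\ge1$ $\varphi_m(x)=\alpha\cdot\mathcal X_0+\sum_{j=0}^{m-1}|\mathcal X_{j+1}-\mathcal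 X_j|$, $\alpha_m^{\rm inc}(x)=e_{m-1}$; let $\alpha^{\rm ref}_m=\alpha^{\rm inc}_m-2(\alpha^{\rm inc}_m\cdot\nu)\nu$. Let $\partial K_m^{\rm IL}$, $\partial K_m^{\rm SB}$, $\partial K_m^{\rm SR}$ be the sets of $y\in\partial K_m$ with $\alpha^{\rm inc}_m(y)\cdot\nu(y)<0$, $=0$, $>0$. Let $O^{\rm IL}_m=\bigcup_{y\in\partial K^{\rm IL}_m}\{y+t\alpha^{\rm ref}_m(y):t>0\}$; for $x\in O_m^{\rm IL}$ let $y(x)\in\partial K_m^{\rm IL}$ be the point whose reflected half-ray contains $x$, let $t_x\in[0,P_m)$ with $\gamma_m(t_x)=y(x)$, and let $\psi_m(x)=|x-y(x)|+\varphi_m(y(x))$. Put $\eta_m^{\rm slow}=e^{-ik\varphi_m}\eta_m$ on $\partial K_m$ and $u_m^{\rm slow}=e^{-ik\psi_m}u_m$ on $O^{\rm IL}_m$. *Symbols.* $f\in S^\mu_{\varrho,\delta}(U\times(0,\infty))$ means that $f$ is smooth on $U\times(0,\infty)$ and for every compact $S\subset U$, $k_0>0$, multi-index $\zeta$ and $n\ge0$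 there is $C$ with $|D_x^\zeta D_k^nf(x,k)|\le C(1+k)^{\mu-\varrho n+\delta|\zeta|}$ for $x\in S$, $k\ge k_0$; on subsets of $\partial K_m$ the arc-length parameter is used. $f\sim\sum_{p\ge0}k^{-p}A_p$ on $U$ means that all $A_p$ are smooth on $U$ and $f-\sum_{p<N}k^{-p}A_p\in S^{-N}_{1,0}(U\times(0,\infty))$ for all $N\ge 0$. **Hypothesis** (for the given $m\ge0$). (i) $\eta_m^{\rm slow}\in S^0_{1,0}(\partial K_m^{\rm IL}\times(0,\infty))$ and $\eta_m^{\rm slow}\sim\sum_{j\ge0}k^{-j}a_{m,j}$ on $\partial K_m^{\rm IL}$. (ii) $\eta_m^{\rm slow}\in S^{-N}_{1,0}(\partial K_m^{\rm SR}\times(0,\infty))$ for all $N$. (iii) $\eta_m^{\rm slow}\in S^0_{2/3,1/3}(\partial K_m\times(0,\infty))$ and $$\eta_m^{\rm slow}\sim\sum_{p,q,r\ge0,\ \ell\le-1}k^{-\frac{1+2p+3q+r+\ell}3+\min(\ell+1,0)}\,b_{p,q,r,\ell}(y)\,(\Psi^{r,\ell})^{(p)}(k^{1/3}Z(y))\quad\text{on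 }\partial K_m,$$ meaning that for each $\beta\in\mathbb N_0$ the difference of $\eta_m^{\rm slow}$ and the finitely many terms whose order $\vartheta(p,q,r,\ell)=\frac{2(\ell+1)-2p-3q-r}3$ exceeds $-\beta/3$ is in $S^{-\beta/3}_{2/3,1/3}$. Here $b_{p,q,r,\ell}$, $\Psi^{r,\ell}$ are smooth and complex-valued; $Z$ is real and smooth on $\partial K_m$, positive on $\partial K_m^{\rm IL}$, negative on $\partial K_m^{\rm SR}$, with a zero of exactly first order at each point of $\partial K_m^{\rm SB}$; and $\Psi^{r,\ell}(\tau)\sim\sum_{j\ge0} c_{r,\ell,j}\tau^{1+\ell-2r-3j}$ as $\tau\to\infty$, while all derivatives of $\Psi^{r,\ell}$ decrease faster than any power of $|\tau|$ as $\tau\to-\infty$. **Conclusion.** $u_m^{\rm slow}\in S^0_{1,0}(O_m^{\rm IL}\times(0,\infty))$ and $u_m^{\rm slow}(x,k)\sim\sum_{p\ge0}k^{-p}A_{m,p}(x)$ on $O_m^{\rm IL}$, where $$A_{m,p}(x)=\sum_{j+s+q=p}\frac i4\,c_{1,s}\,S_q\!\left[\frac{x-\gamma_m(t)}{|x-\gamma_m(t)|}\cdot\nu(\gamma_m(t))\,\frac{a_{m,j}(\gamma_m(t))}{|x-\gamma_m(t)|^{s+1/2}},\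 \varphi_m(\gamma_m(t))+|x-\gamma_m(t)|\right](t_x),$$ $$c_{1,s}=\frac{i^{s}\,\Gamma(s+\frac32)}{\sqrt\pi\,e^{3\pi i/4}\,s!\,2^{s-1/2}\,\Gamma(\frac32-s)},\qquad S_q[f,\psi](t_0)=e^{\frac{i\pi\sigma(2q+1)}4}\,\frac{\Gamma(q+\frac12)}{(2q)!}\,\frac{d^{2q}}{dt^{2q}}\Big[h(t)^{q+\frac12}f(t)\Big]_{t=t_0},$$ with $\sigma=\operatorname{sign}\psi''(t_0)$ and $h(t)=\dfrac{(t-t_0)^2}{\sigma(\psi(t)-\psi(t_0))}$, $h(t_0)=2/|\psi''(t_0)|$. -/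

import Mathlib

open Set Filter Topology
open scoped ContDiff RealInnerProductSpace

noncomputable section

namespace MultipleScattering

/-- The Euclidean plane. -/
abbrev Plane : Type := EuclideanSpace ℝ (Fin 2)

/-- Clockwise rotation by a right angle; it sends the unit tangent of a counterclockwise oriented
closed convex curve to its exterior unit normal. -/
def rot (v : Plane) : Plane := !₂[v 1, -v 0]

/-- `v / |v|`. -/
def unitVec (v : Plane) : Plane := ‖v‖⁻¹ • v

/-- The direction of the ray with direction `v` after reflection at a point with unit normal `n`. -/
def reflect (v n : Plane) : Plane := v - (2 * ⟪v, n⟫) • n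

/-! ### Obstacles -/

/-- A smooth compact strictly convex obstacle in the plane, together with a counterclockwise
arc-length parametrization of its boundary. -/
structure Obstacle where
  carrier : Set Plane
  isCompact : IsCompact carrier
  strictConvex : StrictConvex ℝ carrier
  γ : ℝ → Plane
  period : ℝ
  period_pos : 0 < period
  smooth : ContDiff ℝ ∞ γ
  periodic : Function.Periodic γ period
  injOn : InjOn γ (Ico 0 period)
  range_eq : range γ = frontier carrier
  unit_speed : ∀ s, ‖deriv γ s‖ = 1
  /-- The right-hand normal of the parametrization is the exterior one. -/
  outward : ∀ s, ∀ x ∈ carrier, ⟪x - γ s, rot (deriv γ s)⟫ ≤ 0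

namespace Obstacle

/-- The arc-length parameter in `[0, P)` of a boundary point. -/
def param (O : Obstacle) (y : Plane) : ℝ := Function.invFunOn O.γ (Ico 0 O.period) y

/-- The exterior unit normal `ν(y)` at a boundary point `y`. -/
def normal (O : Obstacle) (y : Plane) : Plane := rot (deriv O.γ (O.param y))

end Obstacle

/-! ### Hörmander classes and asymptotic expansions -/

/-- `f ∈ S^μ_{ϱ,δ}(U × (0,∞))` for an open subset `U` of `ℝ` or `ℝ²`. The norm of the `i`-th
Fréchet derivative in `x` controls all partial derivatives `D_x^ζ` with `|ζ| = i`. -/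
def IsHormander {V : Type*} [NormedAddCommGroup V] [NormedSpace ℝ V]
    (U : Set V) (μ ϱ δ : ℝ) (f : V → ℝ → ℂ) : Prop :=
  ContDiffOn ℝ ∞ (Function.uncurry f) (U ×ˢ Ioi (0 : ℝ)) ∧
  ∀ S : Set V, S ⊆ U → IsCompact S → ∀ k₀ : ℝ, 0 < k₀ → ∀ i n : ℕ, ∃ C : ℝ,
    ∀ x ∈ S, ∀ k : ℝ, k₀ ≤ k →
      ‖iteratedFDeriv ℝ i (fun x' => iteratedDeriv n (fun k' => f x' k') k) x‖
        ≤ C * (1 + k) ^ (μ - ϱ * n + δ * i)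

/-- The classical asymptotic expansion `f(x,k) ∼ ∑_{p ≥ 0} k^{-p} A_p(x)` on `U × (0,∞)`, with
smooth coefficients: the remainder after the terms `p < N` lies in `S^{-N}_{1,0}`. -/
def HasClassicalExpansion {V : Type*} [NormedAddCommGroup V] [NormedSpace ℝ V]
    (U : Set V) (f : V → ℝ → ℂ) (A : ℕ → V → ℂ) : Prop :=
  (∀ p, ContDiffOn ℝ ∞ (A p) U) ∧
  ∀ N : ℕ, IsHormander U (-(N : ℝ)) 1 0
    (fun x k => f x k - ∑ p ∈ Finset.range N, ((k : ℂ) ^ p)⁻¹ * A p x)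

/-! ### Hankel functions, Green function, double-layer potential -/

/-- The Hankel function of the first kind `H_s^{(1)}(z)`, `z > 0`, of order `s`, by its classical
absolutely convergent integral
`(2/(πz))^{1/2} e^{i(z - sπ/2 - π/4)} / Γ(s+1/2) ∫_0^∞ e^{-u} u^{s-1/2} (1 + iu/(2z))^{s-1/2} du`. -/
def hankelOne (s : ℕ) (z : ℝ) : ℂ :=
  ((Real.sqrt (2 / (Real.pi * z)) / Real.Gamma ((s : ℝ) + 1 / 2) : ℝ) : ℂ) *
    Complex.exp (Complex.I * ((z - s * Real.pi / 2 - Real.pi / 4 : ℝ) : ℂ)) *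
    ∫ u in Ioi (0 : ℝ), ((Real.exp (-u) * u ^ ((s : ℝ) - 1 / 2) : ℝ) : ℂ) *
      (1 + Complex.I * ((u / (2 * z) : ℝ) : ℂ)) ^ ((s : ℂ) - 1 / 2)

/-- The outgoing Green function `G(x,y) = (i/4) H_0^{(1)}(k|x-y|)` of the Helmholtz equation. -/
def green (k : ℝ) (x y : Plane) : ℂ := Complex.I / 4 * hankelOne 0 (k * ‖x - y‖)

/-- The double-layer potential `∫_{∂K} ∂G(x,y)/∂ν(y) η(y,k) ds(y)`. -/
def doubleLayer (O : Obstacle) (η : Plane → ℝ → ℂ) (x : Plane) (k : ℝ) : ℂ :=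
  ∫ s in (0 : ℝ)..O.period,
    fderiv ℝ (fun y => green k x y) (O.γ s) (O.normal (O.γ s)) * η (O.γ s) k

/-! ### The iterated sound hard scattering problems -/

/-- The plane wave `e^{ik α·x}`. -/
def planeWave (α x : Plane) (k : ℝ) : ℂ := Complex.exp (Complex.I * ((k * ⟪α, x⟫ : ℝ) : ℂ))

/-- `u` is the field scattered by the sound hard obstacle `O` for the incident field `w`. -/
structure SolvesSoundHard (O : Obstacle) (k : ℝ) (w u : Plane → ℂ) : Prop where
  smooth : ContDiffOn ℝ ∞ u O.carrierᶜ
  helmholtz : ∀ x ∉ O.carrier, Laplacian.laplacian u x + (k : ℂ) ^ 2 * u x = 0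
  neumann : ∀ y ∈ frontier O.carrier,
    Tendsto (fun t : ℝ => fderiv ℝ u (y + t • O.normal y) (O.normal y)) (𝓝[>] 0)
      (𝓝 (-fderiv ℝ w y (O.normal y)))
  radiation : ∀ ε : ℝ, 0 < ε → ∃ R : ℝ, ∀ x : Plane, R ≤ ‖x‖ →
    Real.sqrt ‖x‖ * ‖fderiv ℝ u x (unitVec x) - Complex.I * (k : ℂ) * u x‖ ≤ ε

/-- The field incident on `K_j`: the plane wave for `j = 0`, and the field
`u_{j-1}`, the double-layer potential of `η_{j-1}`, scattered by `K_{j-1}` for `j ≥ 1`. -/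
def incidentField (K : ℕ → Obstacle) (α : Plane) (η : ℕ → Plane → ℝ → ℂ) :
    ℕ → Plane → ℝ → ℂ
  | 0 => planeWave α
  | j + 1 => doubleLayer (K j) (η j)

/-- `η_0, …, η_m` are the multiple scattering total fields: the field `u_j`, the double-layer
potential of `η_j`, solves the `j`-th iterated scattering problem, and `η_j` is the boundary value
on `∂K_j` (from outside) of `u_j` plus the incident field. -/
def AreTotalFields (K : ℕ → Obstacle) (α : Plane) (m : ℕ) (η : ℕ → Plane → ℝ → ℂ) : Prop :=
  ∀ j ≤ m, ∀ k : ℝ, 0 < k →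
    SolvesSoundHard (K j) k (fun x => incidentField K α η j x k)
      (fun x => doubleLayer (K j) (η j) x k) ∧
    ∀ y ∈ frontier (K j).carrier,
      Tendsto (fun x => doubleLayer (K j) (η j) x k + incidentField K α η j x k)
        (𝓝[(K j).carrierᶜ] y) (𝓝 (η j y k))

/-! ### Geometry of the rays -/

/-- No-occlusion condition. -/
def NoOcclusion (K : ℕ → Obstacle) (α : Plane) : Prop :=
  {z : Plane | ∃ x ∈ (K 0).carrier, ∃ t : ℝ, 0 ≤ t ∧ z = x + t • α} ∩ (K 1).carrier = ∅

/-- Visibility condition. -/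
def Visibility (K : ℕ → Obstacle) : Prop :=
  ∀ j : ℕ, (K (j + 1)).carrier ∩
    closure (convexHull ℝ ((K j).carrier ∪ (K (j + 2)).carrier)) = ∅

/-- `(X_0, …, X_m)` is the broken ray that ends at `x ∈ ∂K_m` (`m ≥ 1`); only the entries
`X j`, `j ≤ m`, matter. -/
structure IsBrokenRay (K : ℕ → Obstacle) (α : Plane) (m : ℕ) (x : Plane) (X : ℕ → Plane) :
    Prop where
  mem : ∀ j ≤ m, X j ∈ frontier (K j).carrier
  lit : ⟪α, (K 0).normal (X 0)⟫ < 0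
  refl_zero : unitVec (X 1 - X 0) = reflect α ((K 0).normal (X 0))
  outgoing : ∀ j, 0 < j → j < m → 0 < ⟪X (j + 1) - X j, (K j).normal (X j)⟫
  refl_succ : ∀ j, 0 < j → j < m →
    unitVec (X (j + 1) - X j) = reflect (unitVec (X j - X (j - 1))) ((K j).normal (X j))
  last : X m = x

/-- The points `𝒳^m_j(x)` of the broken ray ending at `x ∈ ∂K_m`, `m ≥ 1`. -/
def brokenRay (K : ℕ → Obstacle) (α : Plane) (m : ℕ) (x : Plane) : ℕ → Plane :=
  Classical.epsilon (IsBrokenRay K α m x)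

/-- The multiple scattering phase `φ_m` on `∂K_m`. -/
def phase (K : ℕ → Obstacle) (α : Plane) (m : ℕ) (x : Plane) : ℝ :=
  if m = 0 then ⟪α, x⟫
  else ⟪α, brokenRay K α m x 0⟫ +
    ∑ j ∈ Finset.range m, ‖brokenRay K α m x (j + 1) - brokenRay K α m x j‖

/-- The direction `α^inc_m(y)` of the ray incident at `y ∈ ∂K_m`. -/
def incDir (K : ℕ → Obstacle) (α : Plane) (m : ℕ) (y : Plane) : Plane :=
  if m = 0 then α else unitVec (brokenRay K α m y m - brokenRay K α m y (m - 1))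

/-- The direction `α^ref_m(y)` of the ray reflected at `y ∈ ∂K_m`. -/
def refDir (K : ℕ → Obstacle) (α : Plane) (m : ℕ) (y : Plane) : Plane :=
  reflect (incDir K α m y) ((K m).normal y)

/-- The illuminated region `∂K^IL_m`. -/
def illuminated (K : ℕ → Obstacle) (α : Plane) (m : ℕ) : Set Plane :=
  {y | y ∈ frontier (K m).carrier ∧ ⟪incDir K α m y, (K m).normal y⟫ < 0}

/-- The shadow region `∂K^SR_m`. -/
def shadow (K : ℕ → Obstacle) (α : Plane) (m : ℕ) : Set Plane :=
  {y | y ∈ frontier (K m).carrier ∧ 0 < ⟪incDir K α m y, (K m).normal y⟫}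

/-- The shadow boundary `∂K^SB_m`. -/
def shadowBoundary (K : ℕ → Obstacle) (α : Plane) (m : ℕ) : Set Plane :=
  {y | y ∈ frontier (K m).carrier ∧ ⟪incDir K α m y, (K m).normal y⟫ = 0}

/-- The reflected half-ray `ray_m(y)`. -/
def ray (K : ℕ → Obstacle) (α : Plane) (m : ℕ) (y : Plane) : Set Plane :=
  {x | ∃ t : ℝ, 0 < t ∧ x = y + t • refDir K α m y}

/-- The open illuminated region `O^IL_m`. -/
def openIlluminated (K : ℕ → Obstacle) (α : Plane) (m : ℕ) : Set Plane :=
  ⋃ y ∈ illuminated K α m, ray K α m y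

/-- The point `y(x) ∈ ∂K^IL_m` with `x ∈ ray_m(y(x))`, for `x ∈ O^IL_m`. -/
def reflPoint (K : ℕ → Obstacle) (α : Plane) (m : ℕ) (x : Plane) : Plane :=
  Classical.epsilon (fun y => y ∈ illuminated K α m ∧ x ∈ ray K α m y)

/-- The reflected phase `ψ_m(x) = |x - y(x)| + φ_m(y(x))` on `O^IL_m`. -/
def reflPhase (K : ℕ → Obstacle) (α : Plane) (m : ℕ) (x : Plane) : ℝ :=
  ‖x - reflPoint K α m x‖ + phase K α m (reflPoint K α m x)

/-! ### Envelopes -/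

/-- The envelope `η^slow_m = e^{-ikφ_m} η_m` of a field `η_m` on `∂K_m`. -/
def etaSlow (K : ℕ → Obstacle) (α : Plane) (m : ℕ) (η : Plane → ℝ → ℂ) (y : Plane) (k : ℝ) : ℂ :=
  Complex.exp (-Complex.I * ((k * phase K α m y : ℝ) : ℂ)) * η y k

/-- The envelope `u^slow_m = e^{-ikψ_m} u_m` of the scattered field `u_m`, the double-layer
potential of `η_m`. -/
def uSlow (K : ℕ → Obstacle) (α : Plane) (m : ℕ) (η : Plane → ℝ → ℂ) (x : Plane) (k : ℝ) : ℂ :=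
  Complex.exp (-Complex.I * ((k * reflPhase K α m x : ℝ) : ℂ)) * doubleLayer (K m) η x k

/-! ### Asymptotic behaviour of the total field on the boundary -/

/-- `3 ϑ(p,q,r,ℓ)`, where `ϑ(p,q,r,ℓ)` is the order of the term with index `(p,q,r,ℓ)` in the
expansion across the shadow boundary. -/
def threeTheta (p q r : ℕ) (l : ℤ) : ℤ :=
  -(1 + 2 * p + 3 * q + r + l) + 3 * min (l + 1) 0 +
    if 1 + l - 2 * r - p < 0 then 0 else 1 + l - 2 * r - p

/-- The indices `(p,q,r,ℓ)`, `p,q,r ≥ 0`, `ℓ ≤ -1`, of the (finitely many) terms of order greater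
than `-β/3`. Since `3ϑ = 2(ℓ+1) - 2p - 3q - r` for `ℓ ≤ -1`, they all lie in the given box. -/
def indexSet (β : ℕ) : Finset (ℕ × ℕ × ℕ × ℤ) :=
  (Finset.range β ×ˢ Finset.range β ×ˢ Finset.range β ×ˢ Finset.Icc (-(β : ℤ)) (-1)).filter
    (fun i => 0 < (β : ℤ) + threeTheta i.1 i.2.1 i.2.2.1 i.2.2.2)

/-- The term `k^{-(1+2p+3q+r+ℓ)/3 + (ℓ+1)_-} b_{p,q,r,ℓ}(y) (Ψ^{r,ℓ})^{(p)}(k^{1/3} Z(y))`. -/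
def shadowTerm (b : ℕ → ℕ → ℕ → ℤ → Plane → ℂ) (Ψ : ℕ → ℤ → ℝ → ℂ) (Z : Plane → ℝ)
    (p q r : ℕ) (l : ℤ) (y : Plane) (k : ℝ) : ℂ :=
  ((k ^ (-(1 + 2 * p + 3 * q + r + l : ℝ) / 3 + min (l + 1 : ℝ) 0) : ℝ) : ℂ) *
    b p q r l y * iteratedDeriv p (Ψ r l) (k ^ (1 / 3 : ℝ) * Z y)

/-- The functions `Ψ^{r,ℓ}`: smooth, with the expansion `∑_j c_{r,ℓ,j} τ^{1+ℓ-2r-3j}` as `τ → ∞`,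
and rapidly decreasing in the sense of Schwartz as `τ → -∞`. -/
structure IsProfileFamily (Ψ : ℕ → ℤ → ℝ → ℂ) (c : ℕ → ℤ → ℕ → ℂ) : Prop where
  smooth : ∀ r : ℕ, ∀ l : ℤ, l ≤ -1 → ContDiff ℝ ∞ (Ψ r l)
  expansion : ∀ r : ℕ, ∀ l : ℤ, l ≤ -1 → ∀ N : ℕ, ∃ C : ℝ, ∀ τ : ℝ, 1 ≤ τ →
    ‖Ψ r l τ - ∑ j ∈ Finset.range N, c r l j * (τ : ℂ) ^ (1 + l - 2 * r - 3 * j : ℤ)‖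
      ≤ C * τ ^ (1 + l - 2 * r - 3 * N : ℤ)
  decay : ∀ r : ℕ, ∀ l : ℤ, l ≤ -1 → ∀ n N : ℕ, ∃ C : ℝ, ∀ τ : ℝ, τ ≤ 0 →
    ‖iteratedDeriv n (Ψ r l) τ‖ ≤ C * ((1 + |τ|) ^ N)⁻¹

/-- `Z` is smooth on `∂K_m`, positive on the illuminated region, negative on the shadow region,
and vanishes exactly to first order on the shadow boundary. -/
structure IsShadowBoundaryFunction (K : ℕ → Obstacle) (α : Plane) (m : ℕ) (Z : Plane → ℝ) :
    Prop where
  smooth : ContDiff ℝ ∞ (fun s => Z ((K m).γ s))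
  pos : ∀ y ∈ illuminated K α m, 0 < Z y
  neg : ∀ y ∈ shadow K α m, Z y < 0
  zero : ∀ y ∈ shadowBoundary K α m, Z y = 0
  first_order : ∀ s, (K m).γ s ∈ shadowBoundary K α m → deriv (fun s' => Z ((K m).γ s')) s ≠ 0

/-- The asymptotic behaviour, as `k → ∞`, of the envelope of the total field `η_m` on `∂K_m`.
Hörmander classes on open subsets of `∂K_m` are understood in the arc-length parameter. -/
structure HasBoundaryAsymptotics (K : ℕ → Obstacle) (α : Plane) (m : ℕ)
    (η : Plane → ℝ → ℂ) (a : ℕ → Plane → ℂ) : Prop where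
  /-- On the illuminated region the envelope is in `S^0_{1,0}` … -/
  illuminated_class : IsHormander ((K m).γ ⁻¹' illuminated K α m) 0 1 0
    (fun s k => etaSlow K α m η ((K m).γ s) k)
  /-- … and has a classical expansion with smooth coefficients `a_{m,j}`. -/
  illuminated_expansion : HasClassicalExpansion ((K m).γ ⁻¹' illuminated K α m)
    (fun s k => etaSlow K α m η ((K m).γ s) k) (fun j s => a j ((K m).γ s))
  /-- Rapid decrease in the sense of Schwartz on compact subsets of the shadow region. -/
  shadow_decay : ∀ N : ℕ, IsHormander ((K m).γ ⁻¹' shadow K α m) (-(N : ℝ)) 1 0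
    (fun s k => etaSlow K α m η ((K m).γ s) k)
  /-- On the whole boundary the envelope is in `S^0_{2/3,1/3}` … -/
  global_class : IsHormander univ 0 (2 / 3) (1 / 3)
    (fun s k => etaSlow K α m η ((K m).γ s) k)
  /-- … and the expansion across the shadow boundary holds on the whole boundary (in particular
  near the shadow boundary): the remainder after all terms of order greater than `-β/3` is in
  `S^{-β/3}_{2/3,1/3}`. -/
  global_expansion : ∃ (b : ℕ → ℕ → ℕ → ℤ → Plane → ℂ) (Ψ : ℕ → ℤ → ℝ → ℂ)
      (c : ℕ → ℤ → ℕ → ℂ) (Z : Plane → ℝ),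
    (∀ p q r : ℕ, ∀ l : ℤ, l ≤ -1 → ContDiff ℝ ∞ (fun s => b p q r l ((K m).γ s))) ∧
    IsProfileFamily Ψ c ∧
    IsShadowBoundaryFunction K α m Z ∧
    ∀ β : ℕ, IsHormander univ (-(β : ℝ) / 3) (2 / 3) (1 / 3)
      (fun s k => etaSlow K α m η ((K m).γ s) k -
        ∑ i ∈ indexSet β, shadowTerm b Ψ Z i.1 i.2.1 i.2.2.1 i.2.2.2 ((K m).γ s) k)

/-! ### The coefficients `A_{m,p}` -/

/-- The coefficients `c_{s,n}` of the expansion of `H_s^{(1)}` at infinity. -/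
def hankelCoeff (s n : ℕ) : ℂ :=
  Complex.I ^ n * (Real.Gamma ((s : ℝ) + n + 1 / 2) : ℂ) /
    ((Real.sqrt Real.pi : ℂ) * Complex.exp (Complex.I * Real.pi * (2 * s + 1) / 4) *
      (n.factorial : ℂ) * (((2 : ℝ) ^ ((n : ℝ) - 1 / 2) : ℝ) : ℂ) *
      (Real.Gamma ((s : ℝ) - n + 1 / 2) : ℂ))

/-- `h(t) = (t - t₀)² / (σ (ψ(t) - ψ(t₀)))`, `σ = sign ψ''(t₀)`, with its limit `2 / |ψ''(t₀)|`
as the value at the stationary point `t₀`. -/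
def statPhaseH (ψ : ℝ → ℝ) (t₀ t : ℝ) : ℝ :=
  if t = t₀ then 2 / |iteratedDeriv 2 ψ t₀|
  else (t - t₀) ^ 2 / (Real.sign (iteratedDeriv 2 ψ t₀) * (ψ t - ψ t₀))

/-- The stationary phase coefficient
`S_q[f,ψ](t₀) = e^{iπσ(2q+1)/4} Γ(q+1/2)/(2q)! (d/dt)^{2q} [h^{q+1/2} f] (t₀)`. -/
def statPhaseCoeff (q : ℕ) (f : ℝ → ℂ) (ψ : ℝ → ℝ) (t₀ : ℝ) : ℂ :=
  Complex.exp (Complex.I * Real.pi * (Real.sign (iteratedDeriv 2 ψ t₀) : ℂ) * (2 * q + 1) / 4) *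
    ((Real.Gamma ((q : ℝ) + 1 / 2) / ((2 * q).factorial : ℝ) : ℝ) : ℂ) *
    iteratedDeriv (2 * q)
      (fun t => ((statPhaseH ψ t₀ t ^ ((q : ℝ) + 1 / 2) : ℝ) : ℂ) * f t) t₀

/-- The functions `f_{m,j,s,q}(x)`. -/
def fieldTerm (K : ℕ → Obstacle) (α : Plane) (m : ℕ) (a : ℕ → Plane → ℂ)
    (j s q : ℕ) (x : Plane) : ℂ :=
  Complex.I / 4 * hankelCoeff 1 s *
    statPhaseCoeff q
      (fun t => ((⟪unitVec (x - (K m).γ t), (K m).normal ((K m).γ t)⟫ /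
          ‖x - (K m).γ t‖ ^ ((s : ℝ) + 1 / 2) : ℝ) : ℂ) * a j ((K m).γ t))
      (fun t => phase K α m ((K m).γ t) + ‖x - (K m).γ t‖)
      ((K m).param (reflPoint K α m x))

/-- The coefficients `A_{m,p}(x) = ∑_{j+s+q=p} f_{m,j,s,q}(x)`. -/
def fieldCoeff (K : ℕ → Obstacle) (α : Plane) (m : ℕ) (a : ℕ → Plane → ℂ)
    (p : ℕ) (x : Plane) : ℂ :=
  ∑ i ∈ Finset.Nat.antidiagonalTuple 3 p, fieldTerm K α m a (i 0) (i 1) (i 2) x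

end MultipleScattering

end

/-! In arc length, `u_m^slow` is the oscillatory integral `√k ∫ e^{ik(Φ(t,x) - ψ_m(x))} s(t,x,1/k)
η_m^slow(γ_m(t),k) dt` (`uSlow_eq`). Here Φ(t,x) = φ_m(γ_m(t)) + |x - γ_m(t)| is `layerPhase`. The
factor s is `layerSymbol`, smooth up to 1/k = 0 because H_1^{(1)}(z) is z^{-1/2} e^{iz} times a
smooth function of 1/z. The theorem is the method of stationary phase for this integral; the
geometry decides where it is stationary.

Stationary points. The tangential derivative of φ_m is that of the incident direction, so ∂_tΦ =
⟨α^inc - (x-γ)/|x-γ|, γ'⟩. At a zero, two unit vectors share their tangential component: x lies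
ahead of γ(t) either on the straight prolongation of the incident ray or on its reflection. What
controls both cases is monotonicity of the ray field, ⟨e - e', x - x'⟩ ≥ 0 for rays of equal order
through x and x' (`IncRay.monotone`): reflection at a convex obstacle and free flight can only
increase this quantity. Hence the reflection point of a given x is unique (`reflect_point_unique`),
and a reflected ray never meets a prolonged incident ray (`IncRay.not_shadow`). So y(x) is the only
stationary point outside the shadow region (`stationary_point_unique`), and monotonicity, convexity
and nontangential incidence make it a nondegenerate minimum (`iteratedDeriv_two_layerPhase_pos`).

Existence and smoothness of rays. A broken ray to every point exists by Fermat's principle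
(`exists_incRay`): at a minimiser of the travel time the ray is either reflected or goes straight
on, and no-occlusion and visibility exclude the latter. Smooth dependence on the end point follows
by induction on m from the inverse function theorem (`smoothRays`).

Splitting the integral. Near y(x), the classical expansion of η_m^slow and of the kernel feed a
stationary phase expansion in a Morse coordinate w = τ/κ (`exists_isPhase`,
`IsPhase.oscInt_asymptotics`). Near stationary points in the shadow, η_m^slow is O(k^{-∞})
(`layerPiece_shadow`). On the rest there is no stationary point, and since η_m^slow lies in
S^0_{2/3,1/3} also across the shadow boundary, each integration by parts gains k^{-2/3}
(`layerPiece_nonstationary`). Together this gives a locally uniform expansion of the function itself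
(`exists_chart_hasSupExpansion`).

Derivatives. The expansion is never differentiated term by term. All derivatives of u_m^slow grow at
most polynomially in k, and interpolation between a function and its second derivative turns rapid
smallness of a late remainder into smallness of its derivatives
(`hasClassicalExpansion_of_hasOrder`). The coefficients have the form S_q because, by Lagrange
inversion, the w-derivatives at 0 of an amplitude f dτ/dw are (d/dτ)^n[κ^{n+1} f], and the function
h of the statement is κ². -/

noncomputable section

namespace MultipleScattering

/-! ### Directional derivatives and their iterates -/

section DirDeriv

variable {E G : Type*} [NormedAddCommGroup E] [NormedSpace ℝ E]
  [NormedAddCommGroup G] [NormedSpace ℝ G]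

/-- The derivative of `F` in the direction `v`. -/
def dirD (v : E) (F : E → G) (p : E) : G := fderiv ℝ F p v

theorem contDiffOn_dirD {Ω : Set E} (hΩ : IsOpen Ω) {F : E → G} (hF : ContDiffOn ℝ ∞ F Ω) (v : E) :
    ContDiffOn ℝ ∞ (dirD v F) Ω := by
  have h := ((contDiffOn_infty_iff_fderiv_of_isOpen hΩ).1 hF).2
  exact h.clm_apply contDiffOn_const

theorem contDiffOn_dirD_iterate {Ω : Set E} (hΩ : IsOpen Ω) {F : E → G}
    (hF : ContDiffOn ℝ ∞ F Ω) (v : E) (n : ℕ) :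
    ContDiffOn ℝ ∞ ((dirD v)^[n] F) Ω := by
  induction n with
  | zero => exact hF
  | succ n ih =>
    rw [Function.iterate_succ_apply']
    exact contDiffOn_dirD hΩ ih v

theorem hasDerivAt_comp_line {Ω : Set E} (hΩ : IsOpen Ω) {F : E → G}
    (hF : ContDiffOn ℝ ∞ F Ω) {c : ℝ → E} {v : E} {t : ℝ} (hc : HasDerivAt c v t) (ht : c t ∈ Ω) :
    HasDerivAt (fun τ => F (c τ)) (dirD v F (c t)) t := by
  have h1 : DifferentiableAt ℝ F (c t) :=
    (hF.contDiffAt (hΩ.mem_nhds ht)).differentiableAt (by simp)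
  exact h1.hasFDerivAt.comp_hasDerivAt t hc

/-- Along a line of constant velocity the chain rule produces no lower-order terms, so iterated
derivatives of a slice are iterates of one operator on jointly smooth functions. This yields
smoothness of slice derivatives in the parameter. -/
theorem iteratedDeriv_comp_line {Ω : Set E} (hΩ : IsOpen Ω) {F : E → G}
    (hF : ContDiffOn ℝ ∞ F Ω) {c : ℝ → E} {v : E} (hc : ∀ t, HasDerivAt c v t) (n : ℕ) {t : ℝ}
    (ht : c t ∈ Ω) :
    iteratedDeriv n (fun τ => F (c τ)) t = (dirD v)^[n] F (c t) := by
  induction n generalizing t with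
  | zero => simp
  | succ n ih =>
    rw [iteratedDeriv_succ, Function.iterate_succ_apply']
    have hev : iteratedDeriv n (fun τ => F (c τ)) =ᶠ[𝓝 t] fun τ => (dirD v)^[n] F (c τ) := by
      have : ∀ᶠ τ in 𝓝 t, c τ ∈ Ω := (hc t).continuousAt.eventually (hΩ.mem_nhds ht)
      filter_upwards [this] with τ hτ using ih hτ
    rw [hev.deriv_eq]
    exact (hasDerivAt_comp_line hΩ (contDiffOn_dirD_iterate hΩ hF v n) (hc t) ht).deriv

theorem norm_iteratedFDeriv_dirD_le {Ω : Set E} (hΩ : IsOpen Ω) {F : E → G}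
    (hF : ContDiffOn ℝ ∞ F Ω) (v : E) (i : ℕ) {p : E} (hp : p ∈ Ω) :
    ‖iteratedFDeriv ℝ i (dirD v F) p‖ ≤ ‖v‖ * ‖iteratedFDeriv ℝ (i + 1) F p‖ := by
  have h := ((contDiffOn_infty_iff_fderiv_of_isOpen hΩ).1 hF).2
  have h2 := norm_iteratedFDeriv_clm_apply_const (𝕜 := ℝ) (c := v) (n := i) (N := ∞)
    (h.contDiffAt (hΩ.mem_nhds hp)) (by exact_mod_cast le_top)
  rw [norm_iteratedFDeriv_fderiv] at h2
  exact h2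

theorem norm_iteratedFDeriv_dirD_iterate_le {Ω : Set E} (hΩ : IsOpen Ω) {F : E → G}
    (hF : ContDiffOn ℝ ∞ F Ω) (v : E) (hv : ‖v‖ ≤ 1) (n i : ℕ) {p : E} (hp : p ∈ Ω) :
    ‖iteratedFDeriv ℝ i ((dirD v)^[n] F) p‖ ≤ ‖iteratedFDeriv ℝ (i + n) F p‖ := by
  induction n generalizing i with
  | zero => simp
  | succ n ih =>
    rw [Function.iterate_succ_apply']
    refine (norm_iteratedFDeriv_dirD_le hΩ (contDiffOn_dirD_iterate hΩ hF v n) v i hp).trans ?_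
    refine (mul_le_of_le_one_left (norm_nonneg _) hv).trans ?_
    refine (ih (i + 1)).trans (le_of_eq ?_)
    rw [show i + 1 + n = i + (n + 1) by omega]

end DirDeriv

/-! ### Derivative bounds on open sets and on slices -/

section Slices

variable {D E G : Type*} [NormedAddCommGroup D] [NormedSpace ℝ D] [NormedAddCommGroup E]
  [NormedSpace ℝ E] [NormedAddCommGroup G] [NormedSpace ℝ G]

theorem norm_iteratedFDeriv_comp_le_of_isOpen {s : Set D} {t : Set E} (hs : IsOpen s)
    (ht : IsOpen t) {g : E → G} {f : D → E} (hg : ContDiffOn ℝ ∞ g t) (hf : ContDiffOn ℝ ∞ f s)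
    (hst : MapsTo f s t) {x : D} (hx : x ∈ s) {n : ℕ} {C R : ℝ}
    (hC : ∀ i ≤ n, ‖iteratedFDeriv ℝ i g (f x)‖ ≤ C)
    (hR : ∀ i, 1 ≤ i → i ≤ n → ‖iteratedFDeriv ℝ i f x‖ ≤ R ^ i) :
    ‖iteratedFDeriv ℝ n (fun y => g (f y)) x‖ ≤ n.factorial * C * R ^ n := by
  have h := norm_iteratedFDerivWithin_comp_le (𝕜 := ℝ) (n := n) (N := ∞) hg hf
    (by exact_mod_cast le_top) ht.uniqueDiffOn hs.uniqueDiffOn hst hx (C := C) (D := R)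
    (fun i hi => by rw [iteratedFDerivWithin_of_isOpen i ht (hst hx)]; exact hC i hi)
    (fun i h1 hi => by rw [iteratedFDerivWithin_of_isOpen i hs hx]; exact hR i h1 hi)
  rwa [iteratedFDerivWithin_of_isOpen n hs hx] at h

theorem norm_iteratedFDeriv_mul_le_of_isOpen {A : Type*} [NormedRing A] [NormedAlgebra ℝ A]
    {s : Set D} (hs : IsOpen s) {f g : D → A}
    (hf : ContDiffOn ℝ ∞ f s) (hg : ContDiffOn ℝ ∞ g s) {x : D} (hx : x ∈ s) (n : ℕ) :
    ‖iteratedFDeriv ℝ n (fun y => f y * g y) x‖ ≤ ∑ i ∈ Finset.range (n + 1),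
      (n.choose i : ℝ) * ‖iteratedFDeriv ℝ i f x‖ * ‖iteratedFDeriv ℝ (n - i) g x‖ := by
  have h := norm_iteratedFDerivWithin_mul_le (𝕜 := ℝ) (n := n) (N := ∞) hf hg hs.uniqueDiffOn hx
    (by exact_mod_cast le_top)
  simpa only [iteratedFDerivWithin_of_isOpen _ hs hx] using h

theorem continuousOn_iteratedFDeriv_of_isOpen {s : Set D} (hs : IsOpen s) {f : D → G}
    (hf : ContDiffOn ℝ ∞ f s) (n : ℕ) : ContinuousOn (iteratedFDeriv ℝ n f) s :=
  (hf.continuousOn_iteratedFDerivWithin (by exact_mod_cast le_top) hs.uniqueDiffOn).congr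
    fun x hx => (iteratedFDerivWithin_of_isOpen n hs hx).symm

theorem norm_iteratedFDeriv_inr_le (a : D) (i : ℕ) (x : E) (hi : 1 ≤ i) :
    ‖iteratedFDeriv ℝ i (fun y : E => (a, y)) x‖ ≤ 1 := by
  obtain ⟨j, rfl⟩ : ∃ j, i = j + 1 := ⟨i - 1, by omega⟩
  have hfd : fderiv ℝ (fun y : E => (a, y)) = fun _ => ContinuousLinearMap.inr ℝ D E := by
    ext1 y
    exact (hasFDerivAt_prodMk_right a y).fderiv
  rw [← norm_iteratedFDeriv_fderiv, hfd]
  rcases Nat.eq_zero_or_pos j with rfl | hj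
  · rw [norm_iteratedFDeriv_zero]; exact ContinuousLinearMap.norm_inr_le_one ℝ D E
  · rw [iteratedFDeriv_const_of_ne (by omega)]; simp

theorem norm_iteratedFDeriv_inl_le (a : E) (i : ℕ) (x : D) (hi : 1 ≤ i) :
    ‖iteratedFDeriv ℝ i (fun y : D => (y, a)) x‖ ≤ 1 := by
  obtain ⟨j, rfl⟩ : ∃ j, i = j + 1 := ⟨i - 1, by omega⟩
  have hfd : fderiv ℝ (fun y : D => (y, a)) = fun _ => ContinuousLinearMap.inl ℝ D E := by
    ext1 y
    exact (hasFDerivAt_prodMk_left y a).fderiv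
  rw [← norm_iteratedFDeriv_fderiv, hfd]
  rcases Nat.eq_zero_or_pos j with rfl | hj
  · rw [norm_iteratedFDeriv_zero]; exact ContinuousLinearMap.norm_inl_le_one ℝ D E
  · rw [iteratedFDeriv_const_of_ne (by omega)]; simp

/-- A smooth function has, on a compact set of parameters, uniformly bounded derivatives in the
second variable. -/
theorem exists_bound_iteratedFDeriv_slice {Ω : Set (D × E)} (hΩ : IsOpen Ω) {F : D × E → G}
    (hF : ContDiffOn ℝ ∞ F Ω) {C : Set (D × E)} (hC : IsCompact C) (hCΩ : C ⊆ Ω) (n : ℕ) :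
    ∃ c : ℝ, ∀ p ∈ C, ‖iteratedFDeriv ℝ n (fun y => F (p.1, y)) p.2‖ ≤ c := by
  have hb : ∀ i, ∃ c : ℝ, ∀ p ∈ C, ‖iteratedFDeriv ℝ i F p‖ ≤ c := fun i =>
    hC.exists_bound_of_continuousOn ((continuousOn_iteratedFDeriv_of_isOpen hΩ hF i).mono hCΩ)
  choose c hc using hb
  refine ⟨n.factorial * (∑ i ∈ Finset.range (n + 1), |c i|) * 1 ^ n, fun p hp => ?_⟩
  have hs : IsOpen {y : E | (p.1, y) ∈ Ω} := hΩ.preimage (by fun_prop)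
  refine norm_iteratedFDeriv_comp_le_of_isOpen hs hΩ hF (f := fun y : E => (p.1, y))
    (by fun_prop) (fun y hy => hy) (hCΩ hp) (fun i hi => ?_) (fun i hi _ => ?_)
  · refine (hc i p hp).trans ((le_abs_self _).trans ?_)
    exact Finset.single_le_sum (f := fun i => |c i|) (fun _ _ => abs_nonneg _)
      (Finset.mem_range.2 (by omega))
  · simpa using norm_iteratedFDeriv_inr_le p.1 i p.2 hi

end Slices

/-! ### Partial derivatives in one real variable -/

section FirstVariable

variable {V G : Type*} [NormedAddCommGroup V] [NormedSpace ℝ V]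
  [NormedAddCommGroup G] [NormedSpace ℝ G]

theorem iteratedDeriv_fst_eq {Ω : Set (ℝ × V)} (hΩ : IsOpen Ω) {F : ℝ × V → G}
    (hF : ContDiffOn ℝ ∞ F Ω) (n : ℕ) {t : ℝ} {x : V} (ht : (t, x) ∈ Ω) :
    iteratedDeriv n (fun τ => F (τ, x)) t = (dirD ((1 : ℝ), (0 : V)))^[n] F (t, x) :=
  iteratedDeriv_comp_line hΩ hF (c := fun τ => (τ, x))
    (fun τ => (hasDerivAt_id τ).prodMk (hasDerivAt_const τ x)) n ht

theorem contDiffOn_iteratedDeriv_fst {Ω : Set (ℝ × V)} (hΩ : IsOpen Ω) {F : ℝ × V → G}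
    (hF : ContDiffOn ℝ ∞ F Ω) (n : ℕ) :
    ContDiffOn ℝ ∞ (fun p : ℝ × V => iteratedDeriv n (fun τ => F (τ, p.2)) p.1) Ω :=
  (contDiffOn_dirD_iterate hΩ hF _ n).congr fun _ hp => iteratedDeriv_fst_eq hΩ hF n hp

theorem contDiffOn_deriv_fst {Ω : Set (ℝ × V)} (hΩ : IsOpen Ω) {F : ℝ × V → G}
    (hF : ContDiffOn ℝ ∞ F Ω) :
    ContDiffOn ℝ ∞ (fun p : ℝ × V => deriv (fun τ => F (τ, p.2)) p.1) Ω := by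
  simpa using contDiffOn_iteratedDeriv_fst hΩ hF 1

theorem exists_bound_iteratedDeriv_fst {Ω : Set (ℝ × V)} (hΩ : IsOpen Ω) {F : ℝ × V → G}
    (hF : ContDiffOn ℝ ∞ F Ω) {C : Set (ℝ × V)} (hC : IsCompact C) (hCΩ : C ⊆ Ω) (n : ℕ) :
    ∃ c : ℝ, ∀ p ∈ C, ‖iteratedDeriv n (fun τ => F (τ, p.2)) p.1‖ ≤ c :=
  hC.exists_bound_of_continuousOn ((contDiffOn_iteratedDeriv_fst hΩ hF n).continuousOn.mono hCΩ)

theorem iteratedDeriv_snd_eq {Ω : Set (V × ℝ)} (hΩ : IsOpen Ω) {F : V × ℝ → G}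
    (hF : ContDiffOn ℝ ∞ F Ω) (n : ℕ) {t : ℝ} {x : V} (ht : (x, t) ∈ Ω) :
    iteratedDeriv n (fun τ => F (x, τ)) t = (dirD ((0 : V), (1 : ℝ)))^[n] F (x, t) :=
  iteratedDeriv_comp_line hΩ hF (c := fun τ => (x, τ))
    (fun τ => (hasDerivAt_const τ x).prodMk (hasDerivAt_id τ)) n ht

/-- Mixed derivatives are controlled by the joint Fréchet derivatives. -/
theorem norm_iteratedFDeriv_iteratedDeriv_le {Ω : Set (V × ℝ)} (hΩ : IsOpen Ω) {F : V × ℝ → G}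
    (hF : ContDiffOn ℝ ∞ F Ω) (i n : ℕ) {x : V} {k : ℝ} (hp : (x, k) ∈ Ω) {C : ℝ}
    (hC : ∀ j ≤ i + n, ‖iteratedFDeriv ℝ j F (x, k)‖ ≤ C) :
    ‖iteratedFDeriv ℝ i (fun x' => iteratedDeriv n (fun k' => F (x', k')) k) x‖
      ≤ i.factorial * C := by
  have hs : IsOpen {y : V | (y, k) ∈ Ω} := hΩ.preimage (by fun_prop)
  have hev : (fun x' => iteratedDeriv n (fun k' => F (x', k')) k) =ᶠ[𝓝 x]
      fun x' => (dirD ((0 : V), (1 : ℝ)))^[n] F (x', k) := by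
    filter_upwards [hs.mem_nhds hp] with y hy using iteratedDeriv_snd_eq hΩ hF n hy
  rw [hev.iteratedFDeriv ℝ i |>.eq_of_nhds]
  have := norm_iteratedFDeriv_comp_le_of_isOpen (R := 1) (C := C) hs hΩ
    (contDiffOn_dirD_iterate hΩ hF ((0 : V), (1 : ℝ)) n) (f := fun y : V => (y, k))
    (by fun_prop) (fun y hy => hy) (x := x) hp (n := i) (fun j hj => ?_) (fun j hj _ => ?_)
  · simpa using this
  · refine (norm_iteratedFDeriv_dirD_iterate_le hΩ hF _ (by simp [Prod.norm_def]) n j hp).trans ?_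
    exact hC _ (by omega)
  · simpa using norm_iteratedFDeriv_inl_le k j x hj

end FirstVariable

/-! ### Differentiation under the integral sign -/

section ParametricIntegral

variable {E : Type} [NormedAddCommGroup E] [NormedSpace ℝ E]

theorem contDiffOn_fderiv_snd {G : Type} [NormedAddCommGroup G] [NormedSpace ℝ G]
    {U : Set ℝ} {B : Set E} (hU : IsOpen U) (hB : IsOpen B) {F : ℝ × E → G}
    (hF : ContDiffOn ℝ ∞ F (U ×ˢ B)) :
    ContDiffOn ℝ ∞ (fun p : ℝ × E => fderiv ℝ (fun y => F (p.1, y)) p.2) (U ×ˢ B) := by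
  have hΩ : IsOpen (U ×ˢ B) := hU.prod hB
  have h := ((contDiffOn_infty_iff_fderiv_of_isOpen hΩ).1 hF).2
  have h2 : ContDiffOn ℝ ∞ (fun p => (fderiv ℝ F p).comp (ContinuousLinearMap.inr ℝ ℝ E))
      (U ×ˢ B) := h.clm_comp contDiffOn_const
  refine h2.congr fun p hp => ?_
  have h1 : DifferentiableAt ℝ F (p.1, p.2) :=
    (hF.contDiffAt (hΩ.mem_nhds hp)).differentiableAt (by simp)
  exact (h1.hasFDerivAt.comp p.2 (hasFDerivAt_prodMk_right p.1 p.2)).fderiv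

variable [ProperSpace E]

theorem hasFDerivAt_parametric_integral {G : Type} [NormedAddCommGroup G] [NormedSpace ℝ G]
    {U : Set ℝ} {B : Set E} (hU : IsOpen U) (hB : IsOpen B) {F : ℝ × E → G}
    (hF : ContDiffOn ℝ ∞ F (U ×ˢ B)) {a b : ℝ} (hab : uIcc a b ⊆ U) {x : E} (hx : x ∈ B) :
    HasFDerivAt (fun y => ∫ t in a..b, F (t, y))
      (∫ t in a..b, fderiv ℝ (fun y => F (t, y)) x) x := by
  have hΩ : IsOpen (U ×ˢ B) := hU.prod hB
  obtain ⟨ε, hε, hball⟩ := Metric.nhds_basis_closedBall.mem_iff.1 (hB.mem_nhds hx)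
  have hfd : ContinuousOn (fderiv ℝ F) (U ×ˢ B) :=
    (hF.continuousOn_fderiv_of_isOpen hΩ (by simp))
  have hslice : ∀ t ∈ U, ∀ y ∈ B, HasFDerivAt (fun y => F (t, y))
      ((fderiv ℝ F (t, y)).comp (ContinuousLinearMap.inr ℝ ℝ E)) y := fun t ht y hy => by
    have h1 : DifferentiableAt ℝ F (t, y) :=
      (hF.contDiffAt (hΩ.mem_nhds ⟨ht, hy⟩)).differentiableAt (by simp)
    exact h1.hasFDerivAt.comp y (hasFDerivAt_prodMk_right t y)
  have hcont : ∀ y ∈ B, ContinuousOn (fun t => F (t, y)) (uIcc a b) := fun y hy =>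
    hF.continuousOn.comp (by fun_prop) fun t ht => ⟨hab ht, hy⟩
  have hcont' : ContinuousOn (fun t => fderiv ℝ (fun y => F (t, y)) x) (uIcc a b) := by
    have h0 : ContinuousOn (fun t => fderiv ℝ F (t, x)) (uIcc a b) :=
      hfd.comp (by fun_prop) fun t ht => ⟨hab ht, hx⟩
    have : ContinuousOn (fun t => (fderiv ℝ F (t, x)).comp (ContinuousLinearMap.inr ℝ ℝ E))
        (uIcc a b) := h0.clm_comp continuousOn_const
    exact this.congr fun t ht => (hslice t (hab ht) x hx).fderiv
  obtain ⟨c, hc⟩ := (isCompact_uIcc.prod (isCompact_closedBall x ε)).exists_bound_of_continuousOn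
    (hfd.mono (prod_mono hab hball))
  have huI : uIoc a b ⊆ uIcc a b := uIoc_subset_uIcc
  refine intervalIntegral.hasFDerivAt_integral_of_dominated_of_fderiv_le
    (F := fun y t => F (t, y)) (F' := fun y t => fderiv ℝ (fun y => F (t, y)) y)
    (bound := fun _ => c) (s := Metric.closedBall x ε) (Metric.closedBall_mem_nhds x hε) ?_ ?_ ?_
    ?_ ?_ ?_
  · filter_upwards [hB.mem_nhds hx] with y hy
    exact ((hcont y hy).mono huI).aestronglyMeasurable measurableSet_uIoc
  · exact (hcont x hx).intervalIntegrable
  · exact (hcont'.mono huI).aestronglyMeasurable measurableSet_uIoc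
  · refine Eventually.of_forall fun t ht y hy => ?_
    rw [(hslice t (hab (huI ht)) y (hball hy)).fderiv]
    refine (ContinuousLinearMap.opNorm_comp_le _ _).trans ?_
    refine (mul_le_of_le_one_right (norm_nonneg _)
      (ContinuousLinearMap.norm_inr_le_one ℝ ℝ E)).trans ?_
    exact hc _ ⟨huI ht, hy⟩
  · exact intervalIntegrable_const
  · refine Eventually.of_forall fun t ht y hy => ?_
    exact ((hslice t (hab (huI ht)) y (hball hy)).differentiableAt).hasFDerivAt

/-- The derivative of the integral is an integral of the same kind with values in `E →L[ℝ] G`, so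
the induction on the order must leave the codomain free. -/
theorem contDiffOn_parametric_integral {G : Type} [NormedAddCommGroup G] [NormedSpace ℝ G]
    {U : Set ℝ} {B : Set E} (hU : IsOpen U) (hB : IsOpen B) {F : ℝ × E → G}
    (hF : ContDiffOn ℝ ∞ F (U ×ˢ B)) {a b : ℝ} (hab : uIcc a b ⊆ U) :
    ContDiffOn ℝ ∞ (fun y => ∫ t in a..b, F (t, y)) B := by
  rw [contDiffOn_infty]
  intro n
  induction n generalizing G with
  | zero =>
    refine contDiffOn_zero.2 fun y hy => ?_
    exact (hasFDerivAt_parametric_integral hU hB hF hab hy).continuousAt.continuousWithinAt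
  | succ n ih =>
    have h1 := fun y hy => hasFDerivAt_parametric_integral hU hB hF hab (x := y) hy
    rw [Nat.cast_add, Nat.cast_one, contDiffOn_succ_iff_fderiv_of_isOpen hB]
    refine ⟨fun y hy => (h1 y hy).differentiableAt.differentiableWithinAt, by simp, ?_⟩
    refine (ih (contDiffOn_fderiv_snd hU hB hF)).congr fun y hy => (h1 y hy).fderiv

theorem norm_iteratedFDeriv_parametric_integral_le {G : Type} [NormedAddCommGroup G]
    [NormedSpace ℝ G]
    {U : Set ℝ} {B : Set E} (hU : IsOpen U) (hB : IsOpen B) {F : ℝ × E → G}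
    (hF : ContDiffOn ℝ ∞ F (U ×ˢ B)) {a b : ℝ} (hab : uIcc a b ⊆ U) {x : E} (hx : x ∈ B) (n : ℕ)
    {C : ℝ} (hC : ∀ t ∈ uIcc a b, ‖iteratedFDeriv ℝ n (fun y => F (t, y)) x‖ ≤ C) :
    ‖iteratedFDeriv ℝ n (fun y => ∫ t in a..b, F (t, y)) x‖ ≤ C * |b - a| := by
  induction n generalizing G with
  | zero =>
    simp only [norm_iteratedFDeriv_zero] at hC ⊢
    exact intervalIntegral.norm_integral_le_of_norm_le_const fun t ht => hC t (uIoc_subset_uIcc ht)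
  | succ n ih =>
    rw [← norm_iteratedFDeriv_fderiv]
    have hev : fderiv ℝ (fun y => ∫ t in a..b, F (t, y)) =ᶠ[𝓝 x]
        fun y => ∫ t in a..b, fderiv ℝ (fun y => F (t, y)) y := by
      filter_upwards [hB.mem_nhds hx] with y hy
        using (hasFDerivAt_parametric_integral hU hB hF hab hy).fderiv
    rw [(hev.iteratedFDeriv ℝ n).eq_of_nhds]
    refine ih (F := fun p => fderiv ℝ (fun y => F (p.1, y)) p.2) (contDiffOn_fderiv_snd hU hB hF)
      fun t ht => ?_
    have := hC t ht
    rw [← norm_iteratedFDeriv_fderiv] at this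
    exact this

end ParametricIntegral

/-! ### Hadamard's lemma with parameters -/

section Hadamard

variable {V G : Type} [NormedAddCommGroup V] [NormedSpace ℝ V]
  [NormedAddCommGroup G] [NormedSpace ℝ G]

/-- The smooth quotient `(F(τ,x) - F(0,x)) / τ`. -/
def hadamardQuot (F : ℝ × V → G) (p : ℝ × V) : G :=
  ∫ v in (0 : ℝ)..1, deriv (fun τ => F (τ, p.2)) (v * p.1)

theorem contDiffOn_hadamardQuot [ProperSpace V] {δ : ℝ} {B : Set V} (hB : IsOpen B) {F : ℝ × V → G}
    (hF : ContDiffOn ℝ ∞ F (Ioo (-δ) δ ×ˢ B)) :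
    ContDiffOn ℝ ∞ (hadamardQuot F) (Ioo (-δ) δ ×ˢ B) := by
  have hΩ : IsOpen (Ioo (-δ) δ ×ˢ B) := isOpen_Ioo.prod hB
  have hd := contDiffOn_deriv_fst hΩ hF
  intro p hp
  -- The integrand has to be smooth for `v` in an open set around `[0,1]`. Restricting to `|τ| < δ'
  -- < δ` leaves the room `|v| < δ/δ'`.
  obtain ⟨δ', h1, h2⟩ := exists_between (abs_lt.2 hp.1)
  have hδ' : 0 < δ' := (abs_nonneg _).trans_lt h1
  have hr : 1 < δ / δ' := by rwa [one_lt_div hδ']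
  have hB' : IsOpen (Ioo (-δ') δ' ×ˢ B) := isOpen_Ioo.prod hB
  have key : ContDiffOn ℝ ∞ (hadamardQuot F) (Ioo (-δ') δ' ×ˢ B) := by
    refine contDiffOn_parametric_integral (U := Ioo (-(δ / δ')) (δ / δ')) isOpen_Ioo hB'
      (F := fun z : ℝ × (ℝ × V) => deriv (fun τ => F (τ, z.2.2)) (z.1 * z.2.1)) ?_ ?_
    · refine hd.comp (f := fun z : ℝ × (ℝ × V) => (z.1 * z.2.1, z.2.2))
        (by fun_prop) fun z hz => ⟨?_, hz.2.2⟩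
      have e1 : |z.1| < δ / δ' := abs_lt.2 hz.1
      have e2 : |z.2.1| < δ' := abs_lt.2 hz.2.1
      refine abs_lt.1 ?_
      rw [abs_mul]
      calc |z.1| * |z.2.1| ≤ |z.1| * δ' := by gcongr
        _ < δ / δ' * δ' := by gcongr
        _ = δ := by field_simp
    · rw [uIcc_of_le zero_le_one]
      exact fun v hv => ⟨by linarith [hv.1], by linarith [hv.2]⟩
  exact (key.contDiffAt (hB'.mem_nhds ⟨abs_lt.1 h1, hp.2⟩)).contDiffWithinAt

/-- The fundamental theorem of calculus for `v ↦ F (vτ, x)` on `[0,1]`. -/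
theorem smul_hadamardQuot [CompleteSpace G] {δ : ℝ} {B : Set V} (hB : IsOpen B) {F : ℝ × V → G}
    (hF : ContDiffOn ℝ ∞ F (Ioo (-δ) δ ×ˢ B)) {τ : ℝ} {x : V} (hτ : τ ∈ Ioo (-δ) δ) (hx : x ∈ B) :
    τ • hadamardQuot F (τ, x) = F (τ, x) - F (0, x) := by
  have hΩ : IsOpen (Ioo (-δ) δ ×ˢ B) := isOpen_Ioo.prod hB
  have hd := contDiffOn_deriv_fst hΩ hF
  have hmem : ∀ v ∈ uIcc (0 : ℝ) 1, v * τ ∈ Ioo (-δ) δ := by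
    rw [uIcc_of_le zero_le_one]
    intro v hv
    refine abs_lt.1 ?_
    rw [abs_mul, abs_of_nonneg hv.1]
    exact (mul_le_of_le_one_left (abs_nonneg _) hv.2).trans_lt (abs_lt.2 hτ)
  have hderiv : ∀ v ∈ uIcc (0 : ℝ) 1, HasDerivAt (fun v => F (v * τ, x))
      (τ • deriv (fun τ => F (τ, x)) (v * τ)) v := fun v hv => by
    have h1 : HasDerivAt (fun τ => F (τ, x)) (deriv (fun τ => F (τ, x)) (v * τ)) (v * τ) := by
      have := hasDerivAt_comp_line hΩ hF (c := fun s => (s, x)) (t := v * τ)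
        ((hasDerivAt_id _).prodMk (hasDerivAt_const _ x)) ⟨hmem v hv, hx⟩
      exact this.differentiableAt.hasDerivAt
    have h2 : HasDerivAt (fun v => v * τ) τ v := by simpa using (hasDerivAt_id v).mul_const τ
    exact h1.scomp v h2
  have hcont : ContinuousOn (fun v => deriv (fun τ => F (τ, x)) (v * τ)) (uIcc 0 1) :=
    hd.continuousOn.comp (f := fun v => (v * τ, x)) (by fun_prop) fun v hv => ⟨hmem v hv, hx⟩
  have := intervalIntegral.integral_eq_sub_of_hasDerivAt hderiv
    (continuousOn_const.smul hcont).intervalIntegrable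
  simpa [hadamardQuot, intervalIntegral.integral_smul] using this

theorem hadamardQuot_zero {X : Type} [CompleteSpace G] (F : ℝ × X → G) (x : X) :
    hadamardQuot F (0, x) = deriv (fun τ => F (τ, x)) 0 := by
  simp [hadamardQuot]

end Hadamard

/-! ### Interpolation of derivatives (Landau's inequality) -/

section Interpolation

variable {V : Type} [NormedAddCommGroup V]

/-- `g(x,k) ≤ C (1+k)^e` for `x` in a compact subset of `B` and `k ≥ k₀`. -/
def HasOrder (B : Set V) (e : ℤ) (g : V × ℝ → ℝ) : Prop :=
  ∀ S ⊆ B, IsCompact S → ∀ k₀ : ℝ, 0 < k₀ → ∃ C : ℝ, ∀ x ∈ S, ∀ k : ℝ, k₀ ≤ k →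
    g (x, k) ≤ C * (1 + k) ^ e

theorem HasOrder.mono {B : Set V} {e e' : ℤ} {g : V × ℝ → ℝ} (h : HasOrder B e g) (he : e ≤ e') :
    HasOrder B e' g := by
  intro S hS hSc k₀ hk₀
  obtain ⟨C, hC⟩ := h S hS hSc k₀ hk₀
  refine ⟨|C|, fun x hx k hk => (hC x hx k hk).trans ?_⟩
  have hk1 : 1 ≤ 1 + k := by linarith
  have hk2 : 0 < 1 + k := by linarith
  calc C * (1 + k) ^ e ≤ |C| * (1 + k) ^ e := by
        gcongr
        exact le_abs_self C
    _ ≤ |C| * (1 + k) ^ e' := by gcongr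

theorem HasOrder.add {B : Set V} {e : ℤ} {f g h : V × ℝ → ℝ} (hf : HasOrder B e f)
    (hg : HasOrder B e g) (hh : ∀ x ∈ B, ∀ k : ℝ, 0 < k → h (x, k) ≤ f (x, k) + g (x, k)) :
    HasOrder B e h := by
  intro S hS hSc k₀ hk₀
  obtain ⟨C, hC⟩ := hf S hS hSc k₀ hk₀
  obtain ⟨C', hC'⟩ := hg S hS hSc k₀ hk₀
  refine ⟨C + C', fun x hx k hk => (hh x (hS hx) k (by linarith)).trans ?_⟩
  linarith [hC x hx k hk, hC' x hx k hk, add_mul C C' ((1 + k) ^ e)]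

variable [NormedSpace ℝ V] [ProperSpace V]

/-- On a ball of radius `h`, `|G'| ≲ |G|/h + h|G''|`. With `h` of size `k^{-(L+N)}` both terms are
of order `k^{-N}`. -/
theorem hasOrder_norm_fderiv {W : Type} [NormedAddCommGroup W] [NormedSpace ℝ W] {B : Set V}
    (hB : IsOpen B) {G : V × ℝ → W} (hG : ContDiffOn ℝ ∞ G (B ×ˢ Ioi 0)) {L : ℕ}
    (h2 : HasOrder B L fun p => ‖iteratedFDeriv ℝ 2 G p‖) {N : ℕ}
    (h0 : HasOrder B (-(L + 2 * N : ℕ)) fun p => ‖G p‖) :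
    HasOrder B (-(N : ℕ)) fun p => ‖fderiv ℝ G p‖ := by
  intro S hS hSc k₀ hk₀
  have hΩ : IsOpen (B ×ˢ Ioi (0 : ℝ)) := hB.prod isOpen_Ioi
  obtain ⟨ρ₀, hρ₀, hth⟩ := hSc.exists_cthickening_subset_open hB hS
  -- `ρ₀` keeps the ball over `B`, `k₀/2` keeps it away from `k = 0`, and `1/2` keeps `1 + k`
  -- comparable on it up to a factor 2.
  set ρ : ℝ := min ρ₀ (min (k₀ / 2) (1 / 2)) with hρdef
  have hρ : 0 < ρ := by positivity
  have hρ1 : ρ ≤ 1 / 2 := (min_le_right _ _).trans (min_le_right _ _)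
  have hρk : ρ ≤ k₀ / 2 := (min_le_right _ _).trans (min_le_left _ _)
  set S' := Metric.cthickening ρ S
  have hS' : S' ⊆ B := (Metric.cthickening_mono (min_le_left _ _) S).trans hth
  have hS'c : IsCompact S' := hSc.cthickening
  obtain ⟨C2, hC2⟩ := h2 S' hS' hS'c (k₀ / 2) (by positivity)
  obtain ⟨C0, hC0⟩ := h0 S' hS' hS'c (k₀ / 2) (by positivity)
  refine ⟨2 * (|C0| * 2 ^ (L + 2 * N)) / ρ + |C2| * 2 ^ L * ρ, fun x hx k hk => ?_⟩
  have hk0 : 0 < k := by linarith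
  set K := 1 + k with hK
  have hK1 : 1 ≤ K := by linarith
  have hK0 : 0 < K := by linarith
  set δ : ℝ := ρ * (K ^ (L + N))⁻¹ with hδdef
  have hδ : 0 < δ := by positivity
  have hδρ : δ ≤ ρ := mul_le_of_le_one_right hρ.le (inv_le_one_of_one_le₀ (one_le_pow₀ hK1))
  set p : V × ℝ := (x, k)
  have hball : ∀ q ∈ Metric.closedBall p δ, q.1 ∈ S' ∧ k₀ / 2 ≤ q.2 ∧ K / 2 ≤ 1 + q.2 ∧
      1 + q.2 ≤ 2 * K := fun q hq => by
    rw [Metric.mem_closedBall, Prod.dist_eq, max_le_iff] at hq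
    have h4 := abs_le.1 (Real.dist_eq q.2 k ▸ hq.2)
    refine ⟨Metric.mem_cthickening_of_dist_le q.1 x ρ S hx (hq.1.trans hδρ), ?_, ?_, ?_⟩ <;>
      linarith [h4.1, h4.2]
  have hmemΩ : ∀ q ∈ Metric.closedBall p δ, q ∈ B ×ˢ Ioi (0 : ℝ) := fun q hq =>
    ⟨hS' (hball q hq).1, lt_of_lt_of_le (by positivity) (hball q hq).2.1⟩
  have hG0 : ∀ q ∈ Metric.closedBall p δ, ‖G q‖ ≤ |C0| * 2 ^ (L + 2 * N) * (K ^ (L + 2 * N))⁻¹ := by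
    intro q hq
    obtain ⟨a1, a2, a3, a4⟩ := hball q hq
    refine (hC0 q.1 a1 q.2 a2).trans ?_
    have hq0 : 0 < 1 + q.2 := by linarith
    rw [zpow_neg, zpow_natCast]
    calc C0 * ((1 + q.2) ^ (L + 2 * N))⁻¹ ≤ |C0| * ((K / 2) ^ (L + 2 * N))⁻¹ := by
          gcongr
          exact le_abs_self C0
      _ = _ := by rw [div_pow, inv_div]; ring
  have hG2 : ∀ q ∈ Metric.closedBall p δ, ‖fderiv ℝ (fderiv ℝ G) q‖ ≤ |C2| * 2 ^ L * K ^ L := by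
    intro q hq
    obtain ⟨a1, a2, a3, a4⟩ := hball q hq
    have e : ‖fderiv ℝ (fderiv ℝ G) q‖ = ‖iteratedFDeriv ℝ 2 G q‖ := by
      rw [← norm_iteratedFDeriv_fderiv, norm_iteratedFDeriv_one]
    rw [e]
    refine (hC2 q.1 a1 q.2 a2).trans ?_
    have hq0 : 0 < 1 + q.2 := by linarith
    rw [zpow_natCast]
    calc C2 * (1 + q.2) ^ L ≤ |C2| * (2 * K) ^ L := by
          gcongr
          exact le_abs_self C2
      _ = _ := by rw [mul_pow]; ring
  have hconv : Convex ℝ (Metric.closedBall p δ) := convex_closedBall p δ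
  have hpmem : p ∈ Metric.closedBall p δ := Metric.mem_closedBall_self hδ.le
  have hfd := ((contDiffOn_infty_iff_fderiv_of_isOpen hΩ).1 hG).2
  have hlip : ∀ q ∈ Metric.closedBall p δ,
      ‖fderiv ℝ G q - fderiv ℝ G p‖ ≤ |C2| * 2 ^ L * K ^ L * δ := fun q hq => by
    refine (hconv.norm_image_sub_le_of_norm_fderiv_le (𝕜 := ℝ) (f := fderiv ℝ G)
      (fun z hz => (hfd.contDiffAt (hΩ.mem_nhds (hmemΩ z hz))).differentiableAt (by simp))
      hG2 hpmem hq).trans ?_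
    gcongr
    exact mem_closedBall_iff_norm.1 hq
  refine ContinuousLinearMap.opNorm_le_of_unit_norm (by positivity) fun v hv => ?_
  have hqmem : p + δ • v ∈ Metric.closedBall p δ := by
    rw [mem_closedBall_iff_norm, add_sub_cancel_left, norm_smul, hv, mul_one, Real.norm_eq_abs,
      abs_of_pos hδ]
  have hmv := hconv.norm_image_sub_le_of_norm_fderiv_le' (𝕜 := ℝ) (f := G)
      (fun z hz => (hG.contDiffAt (hΩ.mem_nhds (hmemΩ z hz))).differentiableAt (by simp))
      hlip hpmem hqmem
  rw [add_sub_cancel_left, map_smul, norm_smul δ v, hv, mul_one, Real.norm_eq_abs,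
    abs_of_pos hδ] at hmv
  have hmul : δ * ‖fderiv ℝ G p v‖ ≤ 2 * (|C0| * 2 ^ (L + 2 * N) * (K ^ (L + 2 * N))⁻¹) +
      |C2| * 2 ^ L * K ^ L * δ * δ := by
    have e : δ * ‖fderiv ℝ G p v‖ = ‖δ • fderiv ℝ G p v‖ := by
      rw [norm_smul, Real.norm_eq_abs, abs_of_pos hδ]
    rw [e]
    have e2 : δ • fderiv ℝ G p v = (G (p + δ • v) - G p) -
      (G (p + δ • v) - G p - δ • fderiv ℝ G p v) := by abel
    rw [e2]
    refine (norm_sub_le _ _).trans ?_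
    have := norm_sub_le (G (p + δ • v)) (G p)
    linarith [hG0 _ hqmem, hG0 _ hpmem]
  rw [zpow_neg, zpow_natCast]
  refine le_of_mul_le_mul_left (hmul.trans (le_of_eq ?_)) hδ
  rw [hδdef]
  field_simp
  ring

/-- The essential point is the order of quantifiers: `M` depends on the growth exponents `L` only,
not on `G`. In the application `G` is a remainder truncated at an index chosen after `M`. The
induction replaces `G` by `fderiv ℝ G`, so `W` must vary. -/
theorem exists_hasOrder_iteratedFDeriv (n N : ℕ) (L : ℕ → ℕ) :
    ∃ M : ℕ, ∀ {W : Type} [NormedAddCommGroup W] [NormedSpace ℝ W] {B : Set V}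
    (_ : IsOpen B) {G : V × ℝ → W} (_ : ContDiffOn ℝ ∞ G (B ×ˢ Ioi 0))
    (_ : ∀ j, HasOrder B (L j) fun p => ‖iteratedFDeriv ℝ j G p‖)
    (_ : HasOrder B (-(M : ℕ)) fun p => ‖G p‖),
    HasOrder B (-(N : ℕ)) fun p => ‖iteratedFDeriv ℝ n G p‖ := by
  induction n generalizing L with
  | zero =>
    refine ⟨N, fun hB G hG hL h0 => ?_⟩
    simpa using h0
  | succ n ih =>
    obtain ⟨M, hM⟩ := ih fun j => L (j + 1)
    refine ⟨L 2 + 2 * M, fun {W} _ _ {B} hB {G} hG hL h0 => ?_⟩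
    have h1 := hasOrder_norm_fderiv hB hG (hL 2) h0
    have hfd := ((contDiffOn_infty_iff_fderiv_of_isOpen (hB.prod isOpen_Ioi)).1 hG).2
    have := hM hB hfd (fun j => by simpa only [norm_iteratedFDeriv_fderiv] using hL (j + 1)) h1
    simpa only [norm_iteratedFDeriv_fderiv] using this

end Interpolation

/-! ### Smooth functions of `1/k` -/

section InverseParameter

variable {V : Type} [NormedAddCommGroup V] [NormedSpace ℝ V]

theorem exists_bound_iteratedFDeriv_inv (n : ℕ) {k₀ : ℝ} (hk₀ : 0 < k₀) :
    ∃ c : ℝ, ∀ k : ℝ, k₀ ≤ k → ‖iteratedFDeriv ℝ n (fun k : ℝ => k⁻¹) k‖ ≤ c := by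
  refine ⟨n.factorial * (k₀ ^ (1 + n))⁻¹, fun k hk => ?_⟩
  have hk0 : 0 < k := hk₀.trans_le hk
  rw [norm_iteratedFDeriv_eq_norm_iteratedDeriv, iteratedDeriv_eq_iterate, iter_deriv_inv]
  rw [show (-1 - (n : ℤ)) = -((1 + n : ℕ) : ℤ) by push_cast; ring, zpow_neg, zpow_natCast]
  rw [norm_mul, norm_mul, norm_inv, norm_pow, norm_pow, norm_neg, norm_one, one_pow, one_mul,
    Real.norm_of_nonneg hk0.le]
  simp only [RCLike.norm_natCast]
  gcongr

theorem exists_bound_iteratedFDeriv_invMap (n : ℕ) {k₀ : ℝ} (hk₀ : 0 < k₀) :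
    ∃ R : ℝ, ∀ x : V, ∀ k : ℝ, k₀ ≤ k → ∀ i, 1 ≤ i → i ≤ n →
      ‖iteratedFDeriv ℝ i (fun p : V × ℝ => (p.1, p.2⁻¹)) (x, k)‖ ≤ R ^ i := by
  choose c hc using fun i => exists_bound_iteratedFDeriv_inv i hk₀
  set A := ∑ i ∈ Finset.range (n + 1), |c i| with hA
  have hA0 : 0 ≤ A := Finset.sum_nonneg fun _ _ => abs_nonneg _
  have hcA : ∀ i ≤ n, c i ≤ A := fun i hi => (le_abs_self _).trans
    (Finset.single_le_sum (f := fun i => |c i|) (fun _ _ => abs_nonneg _)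
      (Finset.mem_range.2 (by omega)))
  refine ⟨1 + n.factorial * A, fun x k hk i hi hin => ?_⟩
  have hk0 : 0 < k := hk₀.trans_le hk
  have h1 : 1 ≤ 1 + n.factorial * A := by have := mul_nonneg n.factorial.cast_nonneg hA0; linarith
  refine le_trans ?_ (le_self_pow₀ h1 (by omega))
  have hs : IsOpen {p : V × ℝ | 0 < p.2} := isOpen_lt continuous_const continuous_snd
  have hinv : ContDiffOn ℝ ∞ (fun k : ℝ => k⁻¹) (Ioi 0) :=
    contDiffOn_id.inv fun k hk => ne_of_gt hk
  have hsnd : ∀ j, 1 ≤ j → ‖iteratedFDeriv ℝ j (fun p : V × ℝ => p.2) (x, k)‖ ≤ 1 := by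
    intro j hj
    obtain ⟨l, rfl⟩ : ∃ l, j = l + 1 := ⟨j - 1, by omega⟩
    have hfd : fderiv ℝ (fun p : V × ℝ => p.2) = fun _ => ContinuousLinearMap.snd ℝ V ℝ := by
      ext1 y
      exact hasFDerivAt_snd.fderiv
    rw [← norm_iteratedFDeriv_fderiv, hfd]
    rcases Nat.eq_zero_or_pos l with rfl | hl
    · rw [norm_iteratedFDeriv_zero]; exact ContinuousLinearMap.norm_snd_le ℝ V ℝ
    · rw [iteratedFDeriv_const_of_ne (by omega)]; simp
  have hfst : ‖iteratedFDeriv ℝ i (fun p : V × ℝ => p.1) (x, k)‖ ≤ 1 := by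
    obtain ⟨l, rfl⟩ : ∃ l, i = l + 1 := ⟨i - 1, by omega⟩
    have hfd : fderiv ℝ (fun p : V × ℝ => p.1) = fun _ => ContinuousLinearMap.fst ℝ V ℝ := by
      ext1 y
      exact hasFDerivAt_fst.fderiv
    rw [← norm_iteratedFDeriv_fderiv, hfd]
    rcases Nat.eq_zero_or_pos l with rfl | hl
    · rw [norm_iteratedFDeriv_zero]; exact ContinuousLinearMap.norm_fst_le ℝ V ℝ
    · rw [iteratedFDeriv_const_of_ne (by omega)]; simp
  have hinvs : ‖iteratedFDeriv ℝ i (fun p : V × ℝ => p.2⁻¹) (x, k)‖ ≤ n.factorial * A := by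
    have := norm_iteratedFDeriv_comp_le_of_isOpen (R := 1) (C := A) (n := i) hs isOpen_Ioi hinv
      (f := fun p : V × ℝ => p.2) (by fun_prop) (fun p hp => hp) (x := (x, k)) hk0
      (fun j hj => (hc j k hk).trans (hcA j (by omega))) (fun j hj _ => by simpa using hsnd j hj)
    rw [one_pow, mul_one] at this
    refine this.trans ?_
    gcongr
  have hca : ContDiffAt ℝ i (fun p : V × ℝ => p.2⁻¹) (x, k) :=
    (contDiffAt_snd.inv hk0.ne')
  rw [iteratedFDeriv_prodMk contDiffAt_fst hca le_rfl, ContinuousMultilinearMap.opNorm_prod]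
  refine max_le (hfst.trans h1) (hinvs.trans (by linarith))

/-- For `k ≥ k₀` the variable `1/k` ranges in the compact interval `[0, 1/k₀]`, so smoothness up to
`1/k = 0` gives bounds uniform as `k → ∞`; the derivatives of `k ↦ 1/k` are bounded as well. -/
theorem exists_bound_iteratedFDeriv_comp_inv {U : Set ℝ} {B : Set V} (hU : IsOpen U)
    (hB : IsOpen B) {H : ℝ × (V × ℝ) → ℂ} (hH : ContDiffOn ℝ ∞ H (U ×ˢ (B ×ˢ univ)))
    {T : Set ℝ} (hT : IsCompact T) (hTU : T ⊆ U) {S : Set V} (hS : IsCompact S) (hSB : S ⊆ B)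
    {k₀ : ℝ} (hk₀ : 0 < k₀) (n : ℕ) :
    ∃ c : ℝ, ∀ t ∈ T, ∀ x ∈ S, ∀ k : ℝ, k₀ ≤ k →
      ‖iteratedFDeriv ℝ n (fun p : V × ℝ => H (t, (p.1, p.2⁻¹))) (x, k)‖ ≤ c := by
  have hΩ : IsOpen (U ×ˢ (B ×ˢ (univ : Set ℝ))) := hU.prod (hB.prod isOpen_univ)
  have hC : IsCompact (T ×ˢ (S ×ˢ Icc 0 k₀⁻¹)) := hT.prod (hS.prod isCompact_Icc)
  have hCΩ : T ×ˢ (S ×ˢ Icc 0 k₀⁻¹) ⊆ U ×ˢ (B ×ˢ (univ : Set ℝ)) :=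
    prod_mono hTU (prod_mono hSB (subset_univ _))
  choose c hc using fun i => exists_bound_iteratedFDeriv_slice hΩ hH hC hCΩ i
  obtain ⟨R, hR⟩ := exists_bound_iteratedFDeriv_invMap (V := V) n hk₀
  refine ⟨n.factorial * (∑ i ∈ Finset.range (n + 1), |c i|) * R ^ n, fun t ht x hx k hk => ?_⟩
  have hk0 : 0 < k := hk₀.trans_le hk
  have hs : IsOpen (B ×ˢ Ioi (0 : ℝ)) := hB.prod isOpen_Ioi
  have hslice : ContDiffOn ℝ ∞ (fun y : V × ℝ => H (t, y)) (B ×ˢ univ) :=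
    hH.comp (by fun_prop) fun y hy => ⟨hTU ht, hy⟩
  refine norm_iteratedFDeriv_comp_le_of_isOpen hs (hB.prod isOpen_univ)
    hslice (f := fun p : V × ℝ => (p.1, p.2⁻¹)) ?_ (fun p hp => ⟨hp.1, mem_univ _⟩)
    (x := (x, k)) ⟨hSB hx, hk0⟩ (fun i hi => ?_) (fun i hi hin => hR x k hk i hi hin)
  · exact contDiffOn_fst.prodMk (contDiffOn_snd.inv fun p hp => ne_of_gt hp.2)
  · have h5 := hc i (t, (x, k⁻¹)) ⟨ht, hx, (inv_pos.2 hk0).le, inv_anti₀ hk₀ hk⟩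
    refine h5.trans ((le_abs_self _).trans ?_)
    exact Finset.single_le_sum (f := fun i => |c i|) (fun _ _ => abs_nonneg _)
      (Finset.mem_range.2 (by omega))

end InverseParameter

/-! ### Symbol classes and classical expansions -/

section Hormander

variable {V : Type} [NormedAddCommGroup V] [NormedSpace ℝ V]

theorem contDiffOn_iteratedDeriv_snd {B : Set V} (hB : IsOpen B) {F : V × ℝ → ℂ}
    (hF : ContDiffOn ℝ ∞ F (B ×ˢ Ioi 0)) (n : ℕ) {k : ℝ} (hk : 0 < k) :
    ContDiffOn ℝ ∞ (fun x' => iteratedDeriv n (fun k' => F (x', k')) k) B := by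
  have h := contDiffOn_dirD_iterate (hB.prod isOpen_Ioi) hF ((0 : V), (1 : ℝ)) n
  refine (h.comp (f := fun x' => (x', k)) (by fun_prop) fun y hy => ⟨hy, hk⟩).congr fun y hy => ?_
  exact iteratedDeriv_snd_eq (hB.prod isOpen_Ioi) hF n ⟨hy, hk⟩

theorem mixedDeriv_add {B : Set V} (hB : IsOpen B) {F G : V × ℝ → ℂ}
    (hF : ContDiffOn ℝ ∞ F (B ×ˢ Ioi 0)) (hG : ContDiffOn ℝ ∞ G (B ×ˢ Ioi 0))
    (i n : ℕ) {x : V} (hx : x ∈ B) {k : ℝ} (hk : 0 < k) :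
    iteratedFDeriv ℝ i (fun x' => iteratedDeriv n (fun k' => F (x', k') + G (x', k')) k) x =
      iteratedFDeriv ℝ i (fun x' => iteratedDeriv n (fun k' => F (x', k')) k) x +
      iteratedFDeriv ℝ i (fun x' => iteratedDeriv n (fun k' => G (x', k')) k) x := by
  have hev : (fun x' => iteratedDeriv n (fun k' => F (x', k') + G (x', k')) k) =ᶠ[𝓝 x]
      fun x' => iteratedDeriv n (fun k' => F (x', k')) k +
        iteratedDeriv n (fun k' => G (x', k')) k := by
    filter_upwards [hB.mem_nhds hx] with y hy
    have hc : ∀ {H : V × ℝ → ℂ}, ContDiffOn ℝ ∞ H (B ×ˢ Ioi 0) →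
        ContDiffAt ℝ n (fun k' => H (y, k')) k := fun hH => by
      have h1 := (hH.contDiffAt ((hB.prod isOpen_Ioi).mem_nhds
        (show (y, k) ∈ B ×ˢ Ioi (0 : ℝ) from ⟨hy, hk⟩)))
      exact (h1.comp k (by fun_prop : ContDiffAt ℝ ∞ (fun k' => (y, k')) k)).of_le
        (by exact_mod_cast le_top)
    exact iteratedDeriv_fun_add (hc hF) (hc hG)
  rw [(hev.iteratedFDeriv ℝ i).eq_of_nhds]
  have hc : ∀ {H : V × ℝ → ℂ}, ContDiffOn ℝ ∞ H (B ×ˢ Ioi 0) →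
      ContDiffAt ℝ i (fun x' => iteratedDeriv n (fun k' => H (x', k')) k) x := fun hH =>
    ((contDiffOn_iteratedDeriv_snd hB hH n hk).contDiffAt (hB.mem_nhds hx)).of_le
      (by exact_mod_cast le_top)
  exact iteratedFDeriv_add_apply (hc hF) (hc hG)

theorem IsHormander.add {B : Set V} (hB : IsOpen B) {μ ϱ δ : ℝ} {f g : V → ℝ → ℂ}
    (hf : IsHormander B μ ϱ δ f) (hg : IsHormander B μ ϱ δ g) :
    IsHormander B μ ϱ δ (fun x k => f x k + g x k) := by
  refine ⟨hf.1.add hg.1, fun S hS hSc k₀ hk₀ i n => ?_⟩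
  obtain ⟨C, hC⟩ := hf.2 S hS hSc k₀ hk₀ i n
  obtain ⟨C', hC'⟩ := hg.2 S hS hSc k₀ hk₀ i n
  refine ⟨C + C', fun x hx k hk => ?_⟩
  have := mixedDeriv_add hB hf.1 hg.1 i n (hS hx) (hk₀.trans_le hk)
  simp only [Function.uncurry_apply_pair] at this
  rw [this, add_mul]
  exact (norm_add_le _ _).trans (add_le_add (hC x hx k hk) (hC' x hx k hk))

theorem IsHormander.mono_order {B : Set V} {μ μ' ϱ δ : ℝ} {f : V → ℝ → ℂ}
    (hf : IsHormander B μ ϱ δ f) (h : μ ≤ μ') : IsHormander B μ' ϱ δ f := by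
  refine ⟨hf.1, fun S hS hSc k₀ hk₀ i n => ?_⟩
  obtain ⟨C, hC⟩ := hf.2 S hS hSc k₀ hk₀ i n
  refine ⟨|C|, fun x hx k hk => (hC x hx k hk).trans ?_⟩
  have h1 : 1 ≤ 1 + k := by linarith
  have h2 : 0 ≤ (1 + k) ^ (μ - ϱ * n + δ * i) := Real.rpow_nonneg (by linarith) _
  calc C * (1 + k) ^ (μ - ϱ * n + δ * i) ≤ |C| * (1 + k) ^ (μ - ϱ * n + δ * i) := by
        gcongr
        exact le_abs_self C
    _ ≤ _ := by gcongr

theorem iteratedDeriv_inv_pow (p n : ℕ) : ∃ c : ℂ, ∀ k : ℝ, 0 < k →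
    iteratedDeriv n (fun k' : ℝ => ((k' : ℂ) ^ p)⁻¹) k = c * ((k : ℂ) ^ (p + n))⁻¹ := by
  induction n with
  | zero => exact ⟨1, fun k _ => by simp⟩
  | succ n ih =>
    obtain ⟨c, hc⟩ := ih
    refine ⟨-c * (p + n : ℕ), fun k hk => ?_⟩
    rw [iteratedDeriv_succ]
    have hev : iteratedDeriv n (fun k' : ℝ => ((k' : ℂ) ^ p)⁻¹) =ᶠ[𝓝 k]
        fun k' => c * ((k' : ℂ) ^ (p + n))⁻¹ := by
      filter_upwards [lt_mem_nhds hk] with y hy using hc y hy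
    rw [hev.deriv_eq]
    have hk' : (k : ℂ) ≠ 0 := by exact_mod_cast hk.ne'
    have h1 : HasDerivAt (fun k' : ℝ => (k' : ℂ)) 1 k := Complex.ofRealCLM.hasDerivAt
    have h2 := ((h1.pow (p + n)).inv (pow_ne_zero _ hk')).const_mul c
    have h3 : HasDerivAt (fun k' : ℝ => c * ((k' : ℂ) ^ (p + n))⁻¹)
      (c * (-((p + n : ℕ) * (k : ℂ) ^ (p + n - 1) * 1) / ((k : ℂ) ^ (p + n)) ^ 2)) k := h2
    rw [h3.deriv]
    rcases Nat.eq_zero_or_pos (p + n) with h | h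
    · simp [h]
    · obtain ⟨r, hr⟩ : ∃ r, p + n = r + 1 := ⟨p + n - 1, by omega⟩
      rw [show p + (n + 1) = r + 2 by omega, hr]
      simp only [Nat.add_sub_cancel]
      field_simp
      ring

theorem isHormander_term {B : Set V} {A : V → ℂ} (hB : IsOpen B) (hA : ContDiffOn ℝ ∞ A B)
    (p : ℕ) : IsHormander B (-(p : ℝ)) 1 0 (fun x k => ((k : ℂ) ^ p)⁻¹ * A x) := by
  constructor
  · have h1 : ContDiffOn ℝ ∞ (fun q : V × ℝ => ((q.2 : ℂ) ^ p)⁻¹) (B ×ˢ Ioi 0) := by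
      refine ContDiffOn.inv ?_ fun q hq => pow_ne_zero _ (by exact_mod_cast (ne_of_gt hq.2))
      exact ((Complex.ofRealCLM.contDiff.comp contDiff_snd).pow p).contDiffOn
    exact h1.mul (hA.comp contDiffOn_fst fun q hq => hq.1)
  · intro S hS hSc k₀ hk₀ i n
    obtain ⟨c, hc⟩ := iteratedDeriv_inv_pow p n
    obtain ⟨C, hC⟩ := hSc.exists_bound_of_continuousOn
      ((continuousOn_iteratedFDeriv_of_isOpen hB hA i).mono hS)
    have hk1 : 0 < k₀ / (1 + k₀) := by positivity
    refine ⟨‖c‖ * |C| * ((k₀ / (1 + k₀)) ^ (p + n))⁻¹, fun x hx k hk => ?_⟩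
    have hk0 : 0 < k := hk₀.trans_le hk
    have e1 : (fun x' => iteratedDeriv n (fun k' : ℝ => ((k' : ℂ) ^ p)⁻¹ * A x') k) =
        fun x' => (c * ((k : ℂ) ^ (p + n))⁻¹) • A x' := by
      ext x'
      rw [iteratedDeriv_mul_const_field, hc k hk0, smul_eq_mul]
    have hAx : ContDiffAt ℝ i A x := (hA.contDiffAt (hB.mem_nhds (hS hx))).of_le
      (by exact_mod_cast le_top)
    rw [e1, iteratedFDeriv_const_smul_apply' hAx, norm_smul, norm_mul, norm_inv, norm_pow,
      Complex.norm_real, Real.norm_of_nonneg hk0.le]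
    have e2 : (1 + k) ^ (-(p : ℝ) - 1 * n + 0 * i) = ((1 + k) ^ (p + n))⁻¹ := by
      rw [show (-(p : ℝ) - 1 * n + 0 * i) = -((p + n : ℕ) : ℝ) by push_cast; ring,
        Real.rpow_neg (by linarith), Real.rpow_natCast]
    rw [e2]
    -- For `k ≥ k₀`, `k` and `1 + k` are comparable; this is the optimal constant.
    have e3 : k₀ / (1 + k₀) * (1 + k) ≤ k := by
      rw [div_mul_eq_mul_div, div_le_iff₀ (by linarith)]
      nlinarith
    have e4 : (k ^ (p + n))⁻¹ ≤ ((k₀ / (1 + k₀)) ^ (p + n))⁻¹ * ((1 + k) ^ (p + n))⁻¹ := by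
      rw [← mul_inv, ← mul_pow]
      gcongr
    calc ‖c‖ * (k ^ (p + n))⁻¹ * ‖iteratedFDeriv ℝ i A x‖
        ≤ ‖c‖ * (((k₀ / (1 + k₀)) ^ (p + n))⁻¹ * ((1 + k) ^ (p + n))⁻¹) * |C| := by
          gcongr
          exact (hC x hx).trans (le_abs_self C)
      _ = _ := by ring

theorem isHormander_sum_term {B : Set V} {A : ℕ → V → ℂ} (hB : IsOpen B)
    (hA : ∀ p, ContDiffOn ℝ ∞ (A p) B) (N : ℕ) (s : Finset ℕ) (hs : ∀ p ∈ s, N ≤ p) :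
    IsHormander B (-(N : ℝ)) 1 0 (fun x k => ∑ p ∈ s, ((k : ℂ) ^ p)⁻¹ * A p x) := by
  induction s using Finset.induction_on with
  | empty =>
    refine ⟨by simpa [Function.uncurry_def] using contDiffOn_const,
      fun S hS hSc k₀ hk₀ i n => ⟨0, fun x hx k hk => ?_⟩⟩
    simp [iteratedDeriv_fun_const_zero]
  | insert p s hp ih =>
    simp only [Finset.sum_insert hp]
    refine IsHormander.add hB ((isHormander_term hB (hA p) p).mono_order ?_)
      (ih fun q hq => hs q (Finset.mem_insert_of_mem hq))
    have := hs p (Finset.mem_insert_self p s)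
    simpa using this

theorem IsHormander.of_locally {U : Set V} {μ ϱ δ : ℝ} {f : V → ℝ → ℂ}
    (h : ∀ x ∈ U, ∃ B, IsOpen B ∧ x ∈ B ∧ B ⊆ U ∧ IsHormander B μ ϱ δ f) [ProperSpace V] :
    IsHormander U μ ϱ δ f := by
  constructor
  · rintro ⟨x, k⟩ ⟨hx, hk⟩
    obtain ⟨B, hB, hxB, hBU, hf⟩ := h x hx
    exact (hf.1.contDiffAt ((hB.prod isOpen_Ioi).mem_nhds ⟨hxB, hk⟩)).contDiffWithinAt
  · intro S hS hSc k₀ hk₀ i n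
    refine hSc.induction_on (p := fun S => ∃ C : ℝ, ∀ x ∈ S, ∀ k : ℝ, k₀ ≤ k →
      ‖iteratedFDeriv ℝ i (fun x' => iteratedDeriv n (fun k' => f x' k') k) x‖
        ≤ C * (1 + k) ^ (μ - ϱ * n + δ * i)) ⟨0, by simp⟩ ?_ ?_ ?_
    · rintro s t hst ⟨C, hC⟩
      exact ⟨C, fun x hx => hC x (hst hx)⟩
    · rintro s t ⟨C, hC⟩ ⟨C', hC'⟩
      refine ⟨max C C', fun x hx k hk => ?_⟩
      have h2 : 0 ≤ (1 + k) ^ (μ - ϱ * n + δ * i) := Real.rpow_nonneg (by linarith) _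
      rcases hx with hx | hx
      · exact (hC x hx k hk).trans (by gcongr; exact le_max_left _ _)
      · exact (hC' x hx k hk).trans (by gcongr; exact le_max_right _ _)
    · intro x hx
      obtain ⟨B, hB, hxB, hBU, hf⟩ := h x (hS hx)
      obtain ⟨ε, hε, hball⟩ := Metric.nhds_basis_closedBall.mem_iff.1 (hB.mem_nhds hxB)
      refine ⟨Metric.closedBall x ε,
        mem_nhdsWithin_of_mem_nhds (Metric.closedBall_mem_nhds x hε), ?_⟩
      exact hf.2 _ hball (isCompact_closedBall x ε) k₀ hk₀ i n

/-- A function with polynomially bounded derivatives that has a locally uniform asymptotic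
expansion has this expansion in the sense of symbols. -/
theorem hasClassicalExpansion_of_hasOrder [ProperSpace V] {B : Set V} (hB : IsOpen B)
    {f : V → ℝ → ℂ} {A : ℕ → V → ℂ} (hf : ContDiffOn ℝ ∞ (Function.uncurry f) (B ×ˢ Ioi 0))
    (hA : ∀ p, ContDiffOn ℝ ∞ (A p) B)
    (hpoly : ∀ n, ∃ L : ℕ, HasOrder B L fun p => ‖iteratedFDeriv ℝ n (Function.uncurry f) p‖)
    (hasym : ∀ N : ℕ, HasOrder B (-(N : ℤ)) fun q =>
      ‖f q.1 q.2 - ∑ p ∈ Finset.range N, ((q.2 : ℂ) ^ p)⁻¹ * A p q.1‖) :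
    HasClassicalExpansion B f A := by
  have hΩ : IsOpen (B ×ˢ Ioi (0 : ℝ)) := hB.prod isOpen_Ioi
  choose L hL using hpoly
  set T : ℕ → V × ℝ → ℂ := fun M q => ∑ p ∈ Finset.range M, ((q.2 : ℂ) ^ p)⁻¹ * A p q.1 with hT
  have hTs : ∀ M, ContDiffOn ℝ ∞ (T M) (B ×ˢ Ioi 0) := fun M =>
    (isHormander_sum_term hB hA 0 (Finset.range M) (by simp)).1
  have hTb : ∀ M j, HasOrder B 0 fun q => ‖iteratedFDeriv ℝ j (T M) q‖ := by
    intro M j S hS hSc k₀ hk₀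
    -- The partial sums are polynomials in `1/k` with smooth coefficients, so compactness in `(x,
    -- 1/k)` bounds all their derivatives. The integration parameter is a dummy here.
    have hH : ContDiffOn ℝ ∞ (fun z : ℝ × (V × ℝ) =>
        ∑ p ∈ Finset.range M, ((z.2.2 : ℂ) ^ p) * A p z.2.1)
        (univ ×ˢ (B ×ˢ univ)) := by
      refine ContDiffOn.sum fun p _ => ContDiffOn.mul ?_ ?_
      · exact ((Complex.ofRealCLM.contDiff.comp
          (contDiff_snd.comp contDiff_snd)).pow p).contDiffOn
      · exact (hA p).comp (contDiff_fst.comp contDiff_snd).contDiffOn fun z hz => hz.2.1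
    obtain ⟨c, hc⟩ := exists_bound_iteratedFDeriv_comp_inv isOpen_univ hB hH
      (isCompact_singleton (x := (0 : ℝ))) (subset_univ _) hSc hS hk₀ j
    refine ⟨c, fun x hx k hk => ?_⟩
    have := hc 0 rfl x hx k hk
    simpa [hT] using this
  set R : ℕ → V × ℝ → ℂ := fun M q => f q.1 q.2 - T M q with hR
  have hRs : ∀ M, ContDiffOn ℝ ∞ (R M) (B ×ˢ Ioi 0) := fun M => hf.sub (hTs M)
  -- The growth exponents of the remainders do not depend on the truncation index, because the
  -- subtracted terms have bounded derivatives. This removes the circularity in the choice of `M`.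
  have hRb : ∀ M j, HasOrder B (L j) fun q => ‖iteratedFDeriv ℝ j (R M) q‖ := by
    intro M j
    refine (hL j).add ((hTb M j).mono (by positivity)) fun x hx k hk => ?_
    have hm : (x, k) ∈ B ×ˢ Ioi (0 : ℝ) := ⟨hx, hk⟩
    have e : iteratedFDeriv ℝ j (R M) (x, k) = iteratedFDeriv ℝ j (Function.uncurry f) (x, k) -
        iteratedFDeriv ℝ j (T M) (x, k) := by
      have h1 := (hf.contDiffAt (hΩ.mem_nhds hm)).of_le
        (show (j : WithTop ℕ∞) ≤ ∞ by exact_mod_cast le_top)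
      have h2 := ((hTs M).contDiffAt (hΩ.mem_nhds hm)).of_le
        (show (j : WithTop ℕ∞) ≤ ∞ by exact_mod_cast le_top)
      exact iteratedFDeriv_sub_apply h1 h2
    rw [e]
    exact norm_sub_le _ _
  refine ⟨hA, fun N => ⟨hRs N, fun S hS hSc k₀ hk₀ i n => ?_⟩⟩
  choose M' hM' using fun j => exists_hasOrder_iteratedFDeriv (V := V) j (N + n) L
  -- Truncation so late that interpolation gives order `-(N+n)` for every joint derivative up to
  -- order `i + n`; the surplus terms `N ≤ p < M` are symbols of order `-N` by inspection.
  set M := N + ∑ j ∈ Finset.range (i + n + 1), M' j with hMdef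
  have hbound : ∀ j ≤ i + n, HasOrder B (-((N + n : ℕ) : ℤ)) fun q => ‖iteratedFDeriv ℝ j (R M) q‖ := by
    intro j hj
    refine hM' j hB (hRs M) (hRb M) ((hasym M).mono ?_)
    have : M' j ≤ ∑ j ∈ Finset.range (i + n + 1), M' j :=
      Finset.single_le_sum (f := M') (fun _ _ => Nat.zero_le _) (Finset.mem_range.2 (by omega))
    omega
  choose! C hC using fun j (hj : j ≤ i + n) => hbound j hj S hS hSc k₀ hk₀
  obtain ⟨C₂, hC₂⟩ := (isHormander_sum_term hB hA N (Finset.Ico N M)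
    (fun p hp => (Finset.mem_Ico.1 hp).1)).2 S hS hSc k₀ hk₀ i n
  refine ⟨i.factorial * (∑ j ∈ Finset.range (i + n + 1), |C j|) + C₂, fun x hx k hk => ?_⟩
  have hk0 : 0 < k := hk₀.trans_le hk
  have hsplit : ∀ x' k', f x' k' - ∑ p ∈ Finset.range N, ((k' : ℂ) ^ p)⁻¹ * A p x' =
      R M (x', k') + (fun q : V × ℝ => ∑ p ∈ Finset.Ico N M, ((q.2 : ℂ) ^ p)⁻¹ * A p q.1) (x', k') := by
    intro x' k'
    simp only [hR, hT]
    rw [← Finset.sum_range_add_sum_Ico (fun p => ((k' : ℂ) ^ p)⁻¹ * A p x') (show N ≤ M by omega)]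
    ring
  simp only [hsplit]
  have hadd := mixedDeriv_add hB (hRs M) (isHormander_sum_term hB hA N (Finset.Ico N M)
    (fun p hp => (Finset.mem_Ico.1 hp).1)).1 i n (hS hx) hk0
  simp only [Function.uncurry_apply_pair] at hadd
  rw [hadd]
  refine (norm_add_le _ _).trans ?_
  rw [add_mul]
  refine add_le_add ?_ (hC₂ x hx k hk)
  have e2 : (1 + k) ^ (-(N : ℝ) - 1 * n + 0 * i) = (1 + k) ^ (-((N + n : ℕ) : ℤ)) := by
    rw [← Real.rpow_intCast]
    congr 1
    push_cast; ring
  rw [e2, mul_assoc]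
  refine norm_iteratedFDeriv_iteratedDeriv_le hΩ (hRs M) i n ⟨hS hx, hk0⟩ fun j hj => ?_
  refine (hC j hj x hx k hk).trans ?_
  have h1k : 0 < 1 + k := by linarith
  gcongr
  exact (le_abs_self _).trans (Finset.single_le_sum (f := fun j => |C j|)
    (fun _ _ => abs_nonneg _) (Finset.mem_range.2 (by omega)))

theorem HasClassicalExpansion.of_locally {U : Set V} {f : V → ℝ → ℂ}
    {A : ℕ → V → ℂ} [ProperSpace V]
    (h : ∀ x ∈ U, ∃ B, IsOpen B ∧ x ∈ B ∧ B ⊆ U ∧ HasClassicalExpansion B f A) :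
    HasClassicalExpansion U f A := by
  refine ⟨fun p x hx => ?_, fun N => IsHormander.of_locally fun x hx => ?_⟩
  · obtain ⟨B, hB, hxB, hBU, hf⟩ := h x hx
    exact ((hf.1 p).contDiffAt (hB.mem_nhds hxB)).contDiffWithinAt
  · obtain ⟨B, hB, hxB, hBU, hf⟩ := h x hx
    exact ⟨B, hB, hxB, hBU, hf.2 N⟩

theorem HasClassicalExpansion.isHormander {U : Set V} {f : V → ℝ → ℂ}
    {A : ℕ → V → ℂ} (h : HasClassicalExpansion U f A) : IsHormander U 0 1 0 f := by
  simpa using h.2 0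

end Hormander

/-! ### Hankel functions from their integral representation -/

section Hankel

open MeasureTheory

/-- The integrand of `hankelInt`. -/
def hankelIntegrand (p c y u : ℝ) : ℂ :=
  ((Real.exp (-u) * u ^ p : ℝ) : ℂ) * (1 + Complex.I * ((u * y : ℝ) : ℂ)) ^ (c : ℂ)

/-- `∫_0^∞ e^{-u} u^p (1 + iuy)^c du`. -/
def hankelInt (p c y : ℝ) : ℂ := ∫ u in Ioi (0 : ℝ), hankelIntegrand p c y u

theorem one_add_I_mul_mem_slitPlane (r : ℝ) : 1 + Complex.I * (r : ℂ) ∈ Complex.slitPlane := by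
  left; simp

theorem norm_one_add_I_mul_ge (r : ℝ) : 1 ≤ ‖1 + Complex.I * (r : ℂ)‖ := by
  have := Complex.abs_re_le_norm (1 + Complex.I * (r : ℂ))
  simpa using this

theorem norm_one_add_I_mul_le (r : ℝ) : ‖1 + Complex.I * (r : ℂ)‖ ≤ 1 + |r| := by
  refine (norm_add_le _ _).trans ?_
  simp

/-- Since `|1 + iuy| ≥ 1`, powers increase with the exponent, and `c ≤ 1` allows the linear bound `1
+ u|y|`. -/
theorem norm_hankelIntegrand_le {p c : ℝ} (hc : c ≤ 1) (y : ℝ) {u : ℝ} (hu : 0 < u) :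
    ‖hankelIntegrand p c y u‖ ≤ Real.exp (-u) * u ^ p + |y| * (Real.exp (-u) * u ^ (p + 1)) := by
  rw [hankelIntegrand, norm_mul, Complex.norm_real, Complex.norm_cpow_real,
    Real.norm_of_nonneg (by positivity)]
  have h1 : ‖1 + Complex.I * ((u * y : ℝ) : ℂ)‖ ^ c ≤ 1 + u * |y| := by
    refine (Real.rpow_le_rpow_of_exponent_le (norm_one_add_I_mul_ge _) hc).trans ?_
    rw [Real.rpow_one]
    refine (norm_one_add_I_mul_le _).trans ?_
    rw [abs_mul, abs_of_pos hu]
  calc Real.exp (-u) * u ^ p * ‖1 + Complex.I * ((u * y : ℝ) : ℂ)‖ ^ c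
      ≤ Real.exp (-u) * u ^ p * (1 + u * |y|) := by gcongr
    _ = _ := by rw [Real.rpow_add hu, Real.rpow_one]; ring

theorem integrableOn_exp_mul_rpow {p : ℝ} (hp : -1 < p) :
    IntegrableOn (fun u : ℝ => Real.exp (-u) * u ^ p) (Ioi 0) := by
  have := Real.GammaIntegral_convergent (s := p + 1) (by linarith)
  simpa using this

theorem continuousOn_hankelIntegrand (p c y : ℝ) :
    ContinuousOn (hankelIntegrand p c y) (Ioi 0) := by
  unfold hankelIntegrand
  refine ContinuousOn.mul ?_ ?_
  · refine Complex.continuous_ofReal.comp_continuousOn ?_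
    refine ContinuousOn.mul (by fun_prop) ?_
    exact continuousOn_id.rpow_const fun u hu => Or.inl (ne_of_gt hu)
  · refine ContinuousOn.cpow_const (by fun_prop) fun u _ => one_add_I_mul_mem_slitPlane _

theorem integrableOn_hankelIntegrand {p c : ℝ} (hp : -1 < p) (hc : c ≤ 1) (y : ℝ) :
    IntegrableOn (hankelIntegrand p c y) (Ioi 0) := by
  refine Integrable.mono' ((integrableOn_exp_mul_rpow hp).add
    ((integrableOn_exp_mul_rpow (p := p + 1) (by linarith)).const_mul |y|))
    ((continuousOn_hankelIntegrand p c y).aestronglyMeasurable measurableSet_Ioi) ?_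
  exact (ae_restrict_iff' measurableSet_Ioi).2 (Eventually.of_forall fun u hu =>
    norm_hankelIntegrand_le hc y hu)

theorem hasDerivAt_one_add_I_mul_cpow_left (c u y : ℝ) :
    HasDerivAt (fun y : ℝ => (1 + Complex.I * ((u * y : ℝ) : ℂ)) ^ (c : ℂ))
      (Complex.I * u * c * (1 + Complex.I * ((u * y : ℝ) : ℂ)) ^ ((c - 1 : ℝ) : ℂ)) y := by
  have h0 : HasDerivAt (fun y : ℝ => ((u * y : ℝ) : ℂ)) ((u : ℝ) : ℂ) y := by
    have : HasDerivAt (fun y : ℝ => u * y) u y := by simpa using (hasDerivAt_id y).const_mul u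
    exact this.ofReal_comp
  have h1 : HasDerivAt (fun y : ℝ => 1 + Complex.I * ((u * y : ℝ) : ℂ)) (Complex.I * u) y :=
    (h0.const_mul Complex.I).const_add 1
  have h2 := ((hasDerivAt_id (1 + Complex.I * ((u * y : ℝ) : ℂ))).cpow_const (c := (c : ℂ))
    (one_add_I_mul_mem_slitPlane _)).scomp y h1
  refine h2.congr_deriv ?_
  simp only [id_eq, smul_eq_mul]
  push_cast
  ring

/-- Differentiation in `y` raises `p` and lowers `c` by one, which preserves `-1 < p` and `c ≤ 1`.
The integral is therefore smooth in `y` on the whole line, in particular at `y = 0`, which stands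
for `k = ∞`. -/
theorem hasDerivAt_hankelInt {p c : ℝ} (hp : -1 < p) (hc : c ≤ 1) (y : ℝ) :
    HasDerivAt (hankelInt p c) (Complex.I * c * hankelInt (p + 1) (c - 1) y) y := by
  have key := hasDerivAt_integral_of_dominated_loc_of_deriv_le (μ := volume.restrict (Ioi (0 : ℝ)))
    (F := fun y u => hankelIntegrand p c y u)
    (F' := fun y u => Complex.I * c * hankelIntegrand (p + 1) (c - 1) y u)
    (bound := fun u => |c| * (Real.exp (-u) * u ^ (p + 1) +
      (|y| + 1) * (Real.exp (-u) * u ^ (p + 1 + 1))))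
    (x₀ := y) (s := Metric.ball y 1) (Metric.ball_mem_nhds y one_pos) ?_ ?_ ?_ ?_ ?_ ?_
  · have h := key.2
    rw [integral_const_mul] at h
    exact h
  · exact Eventually.of_forall fun z =>
      (continuousOn_hankelIntegrand p c z).aestronglyMeasurable measurableSet_Ioi
  · exact integrableOn_hankelIntegrand hp hc y
  · exact ((continuousOn_hankelIntegrand (p + 1) (c - 1) y).aestronglyMeasurable
      measurableSet_Ioi).const_mul _
  · refine (ae_restrict_iff' measurableSet_Ioi).2 (Eventually.of_forall fun u hu z hz => ?_)
    have hz' : |z| ≤ |y| + 1 := by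
      have h1 : |z - y| < 1 := by simpa [Real.dist_eq] using hz
      have h2 := abs_sub_abs_le_abs_sub z y
      linarith
    rw [norm_mul, norm_mul, Complex.norm_I, one_mul, Complex.norm_real, Real.norm_eq_abs]
    gcongr
    refine (norm_hankelIntegrand_le (by linarith) z hu).trans ?_
    have hu' : (0 : ℝ) < u := hu
    gcongr
  · exact ((integrableOn_exp_mul_rpow (p := p + 1) (by linarith)).add
      ((integrableOn_exp_mul_rpow (p := p + 1 + 1) (by linarith)).const_mul (|y| + 1))).const_mul |c|
  · refine (ae_restrict_iff' measurableSet_Ioi).2 (Eventually.of_forall fun u hu z hz => ?_)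
    have h := (hasDerivAt_one_add_I_mul_cpow_left c u z).const_mul
      (((Real.exp (-u) * u ^ p : ℝ) : ℂ))
    refine h.congr_deriv ?_
    rw [hankelIntegrand, Real.rpow_add hu, Real.rpow_one]
    push_cast
    ring

theorem contDiff_hankelInt {p c : ℝ} (hp : -1 < p) (hc : c ≤ 1) :
    ContDiff ℝ ∞ (hankelInt p c) := by
  rw [contDiff_infty]
  intro n
  induction n generalizing p c with
  | zero =>
    exact contDiff_zero.2 (continuous_iff_continuousAt.2 fun y =>
      (hasDerivAt_hankelInt hp hc y).continuousAt)
  | succ n ih =>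
    rw [Nat.cast_add, Nat.cast_one, contDiff_succ_iff_deriv]
    refine ⟨fun y => (hasDerivAt_hankelInt hp hc y).differentiableAt, by simp, ?_⟩
    have : deriv (hankelInt p c) = fun y => Complex.I * c * hankelInt (p + 1) (c - 1) y :=
      funext fun y => (hasDerivAt_hankelInt hp hc y).deriv
    rw [this]
    exact contDiff_const.mul (ih (by linarith) (by linarith))

theorem iteratedDeriv_hankelInt {p c : ℝ} (hp : -1 < p) (hc : c ≤ 1) (n : ℕ) (y : ℝ) :
    iteratedDeriv n (hankelInt p c) y =
      Complex.I ^ n * (∏ j ∈ Finset.range n, (c - j) : ℝ) * hankelInt (p + n) (c - n) y := by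
  induction n generalizing y with
  | zero => simp
  | succ n ih =>
    rw [iteratedDeriv_succ, funext ih]
    have h := (hasDerivAt_hankelInt (p := p + n) (c := c - n) (by have := n.cast_nonneg (α := ℝ); linarith)
      (by have := n.cast_nonneg (α := ℝ); linarith) y).const_mul
      (Complex.I ^ n * (∏ j ∈ Finset.range n, (c - j) : ℝ))
    rw [h.deriv, Finset.prod_range_succ, pow_succ]
    push_cast
    rw [show p + ((n : ℝ) + 1) = p + n + 1 by ring, show c - ((n : ℝ) + 1) = c - n - 1 by ring]
    ring

theorem hankelInt_zero {p c : ℝ} (hp : -1 < p) : hankelInt p c 0 = Real.Gamma (p + 1) := by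
  rw [Real.Gamma_eq_integral (by linarith), hankelInt, ← integral_complex_ofReal]
  refine setIntegral_congr_fun measurableSet_Ioi fun u hu => ?_
  simp [hankelIntegrand]

theorem hankelInt_add_one {p c : ℝ} (hp : -1 < p) (hc : c ≤ 0) (y : ℝ) :
    hankelInt p (c + 1) y = hankelInt p c y + Complex.I * y * hankelInt (p + 1) c y := by
  rw [hankelInt, hankelInt, hankelInt, ← integral_const_mul, ← integral_add
    (integrableOn_hankelIntegrand hp (by linarith) y)
    ((integrableOn_hankelIntegrand (by linarith) (by linarith) y).const_mul _)]
  refine setIntegral_congr_fun measurableSet_Ioi fun u hu => ?_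
  have hu' : (0 : ℝ) < u := hu
  have hz : 1 + Complex.I * ((u * y : ℝ) : ℂ) ≠ 0 :=
    Complex.slitPlane_ne_zero (one_add_I_mul_mem_slitPlane _)
  simp only [hankelIntegrand]
  rw [show ((c + 1 : ℝ) : ℂ) = (c : ℂ) + 1 by push_cast; ring, Complex.cpow_add _ _ hz,
    Complex.cpow_one, Real.rpow_add hu', Real.rpow_one]
  push_cast
  ring

/-- Integrate the derivative of `e^{-u} u^{1/2} (1 + iuy)^c` over the half-line; the boundary terms
vanish at both ends. -/
theorem hankelInt_half_eq {c : ℝ} (hc : c ≤ 1) (y : ℝ) :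
    hankelInt (1 / 2) c y = 1 / 2 * hankelInt (-1 / 2) c y +
      Complex.I * y * c * hankelInt (1 / 2) (c - 1) y := by
  have hderiv : ∀ u ∈ Ioi (0 : ℝ), HasDerivAt (hankelIntegrand (1 / 2) c y)
      (-hankelIntegrand (1 / 2) c y u + (1 / 2 * hankelIntegrand (-1 / 2) c y u +
        Complex.I * y * c * hankelIntegrand (1 / 2) (c - 1) y u)) u := by
    intro u hu
    have hu' : (0 : ℝ) < u := hu
    have h1 : HasDerivAt (fun u : ℝ => Real.exp (-u) * u ^ (1 / 2 : ℝ))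
        (-Real.exp (-u) * u ^ (1 / 2 : ℝ) + Real.exp (-u) * (1 / 2 * u ^ (1 / 2 - 1 : ℝ))) u := by
      have a1 : HasDerivAt (fun u : ℝ => Real.exp (-u)) (-Real.exp (-u)) u := by
        simpa using (hasDerivAt_id u).neg.exp
      exact a1.mul (Real.hasDerivAt_rpow_const (Or.inl hu'.ne'))
    have h2 := hasDerivAt_one_add_I_mul_cpow_left c y u
    have h3 := h1.ofReal_comp.mul h2
    have e : hankelIntegrand (1 / 2) c y = fun u : ℝ =>
        ((Real.exp (-u) * u ^ (1 / 2 : ℝ) : ℝ) : ℂ) *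
          (1 + Complex.I * ((y * u : ℝ) : ℂ)) ^ (c : ℂ) := by
      ext u; rw [hankelIntegrand, mul_comm u y]
    rw [e]
    refine h3.congr_deriv ?_
    simp only [hankelIntegrand]
    rw [mul_comm u y, show (1 / 2 - 1 : ℝ) = -1 / 2 by norm_num]
    push_cast
    ring
  have i1 := integrableOn_hankelIntegrand (p := 1 / 2) (c := c) (by norm_num) hc y
  have i2 := integrableOn_hankelIntegrand (p := -1 / 2) (c := c) (by norm_num) hc y
  have i3 := integrableOn_hankelIntegrand (p := 1 / 2) (c := c - 1) (by norm_num) (by linarith) y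
  have i4 : IntegrableOn (fun u => 1 / 2 * hankelIntegrand (-1 / 2) c y u +
      Complex.I * y * c * hankelIntegrand (1 / 2) (c - 1) y u) (Ioi 0) :=
    (i2.const_mul (1 / 2 : ℂ)).add (i3.const_mul (Complex.I * y * c))
  have i5 : IntegrableOn (fun u => -hankelIntegrand (1 / 2) c y u +
      (1 / 2 * hankelIntegrand (-1 / 2) c y u +
      Complex.I * y * c * hankelIntegrand (1 / 2) (c - 1) y u)) (Ioi 0) := i1.neg.add i4
  have hlim := tendsto_zero_of_hasDerivAt_of_integrableOn_Ioi hderiv i5 i1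
  have hcont : ContinuousWithinAt (hankelIntegrand (1 / 2) c y) (Ici 0) 0 := by
    refine Continuous.continuousWithinAt ?_
    unfold hankelIntegrand
    refine Continuous.mul ?_ ?_
    · refine Complex.continuous_ofReal.comp ?_
      exact (by fun_prop : Continuous fun u : ℝ => Real.exp (-u)).mul
        (Real.continuous_rpow_const (by norm_num))
    · rw [← continuousOn_univ]
      exact ContinuousOn.cpow_const (by fun_prop) fun u _ => one_add_I_mul_mem_slitPlane _
  have h := integral_Ioi_of_hasDerivAt_of_tendsto hcont hderiv i5 hlim
  have h0 : hankelIntegrand (1 / 2) c y 0 = 0 := by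
    simp [hankelIntegrand]
  rw [h0, sub_zero] at h
  have e1 : ∫ u in Ioi (0 : ℝ), (-hankelIntegrand (1 / 2) c y u +
      (1 / 2 * hankelIntegrand (-1 / 2) c y u +
        Complex.I * y * c * hankelIntegrand (1 / 2) (c - 1) y u)) =
      -hankelInt (1 / 2) c y + (1 / 2 * hankelInt (-1 / 2) c y +
      Complex.I * y * c * hankelInt (1 / 2) (c - 1) y) := by
    rw [integral_add (f := fun u => -hankelIntegrand (1 / 2) c y u) i1.neg i4, integral_add (i2.const_mul (1 / 2 : ℂ))
      (i3.const_mul (Complex.I * y * c)), integral_neg, integral_const_mul, integral_const_mul]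
    rfl
  rw [e1] at h
  linear_combination -h

/-- This is `H_0' = -H_1` with the factors `z^{-1/2} e^{iz}` removed and `y = 1/(2z)`. It is a
linear combination of two integrations by parts and one splitting of a factor `1 + iuy`. -/
theorem hankelInt_identity (y : ℝ) :
    (Complex.I - y) * hankelInt (-1 / 2) (-1 / 2) y + Complex.I * y ^ 2 *
      hankelInt (1 / 2) (-3 / 2) y = 2 * Complex.I * hankelInt (1 / 2) (1 / 2) y := by
  have h1 := hankelInt_half_eq (c := -1 / 2) (by norm_num) y
  have h2 := hankelInt_half_eq (c := 1 / 2) (by norm_num) y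
  have h3 := hankelInt_add_one (p := -1 / 2) (c := -1 / 2) (by norm_num) (by norm_num) y
  rw [show (-1 / 2 : ℝ) = -(1 / 2) by norm_num, show (-3 / 2 : ℝ) = -(3 / 2) by norm_num]
  norm_num at h1 h2 h3
  rw [h2, h3, h1]
  linear_combination (-(y : ℂ) * hankelInt (-(1 / 2)) (-(1 / 2)) y +
    Complex.I * y ^ 2 * hankelInt (1 / 2) (-(3 / 2)) y) * Complex.I_sq

/-- `β(y) = ∫_0^∞ e^{-u} u^{1/2} (1 + iuy)^{1/2} du`. -/
def hankelBeta : ℝ → ℂ := hankelInt (1 / 2) (1 / 2)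

/-- `(2/π)^{1/2} e^{-3πi/4} / Γ(3/2)`. -/
def hankelConst : ℂ :=
  ((Real.sqrt (2 / Real.pi) / Real.Gamma (3 / 2) : ℝ) : ℂ) *
    Complex.exp (-(Complex.I * (3 * Real.pi / 4)))

theorem contDiff_hankelBeta : ContDiff ℝ ∞ hankelBeta :=
  contDiff_hankelInt (by norm_num) (by norm_num)

theorem sqrt_two_div_pi_mul {z : ℝ} (hz : 0 < z) :
    Real.sqrt (2 / (Real.pi * z)) = Real.sqrt (2 / Real.pi) * z ^ (-1 / 2 : ℝ) := by
  rw [← div_div, div_eq_mul_inv (2 / Real.pi) z, Real.sqrt_mul (by positivity), Real.sqrt_inv,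
    Real.sqrt_eq_rpow z, ← Real.rpow_neg hz.le]
  norm_num

theorem hankelOne_one_eq {z : ℝ} (hz : 0 < z) :
    hankelOne 1 z = hankelConst * ((z ^ (-1 / 2 : ℝ) : ℝ) : ℂ) * Complex.exp (Complex.I * z) *
      hankelBeta (1 / (2 * z)) := by
  have e1 : ∫ u in Ioi (0 : ℝ), ((Real.exp (-u) * u ^ (((1 : ℕ) : ℝ) - 1 / 2) : ℝ) : ℂ) *
      (1 + Complex.I * ((u / (2 * z) : ℝ) : ℂ)) ^ (((1 : ℕ) : ℂ) - 1 / 2) =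
      hankelBeta (1 / (2 * z)) := by
    refine setIntegral_congr_fun measurableSet_Ioi fun u _ => ?_
    simp only [hankelIntegrand]
    rw [show u * (1 / (2 * z)) = u / (2 * z) by ring, show ((1 : ℕ) : ℝ) - 1 / 2 = 1 / 2 by norm_num]
    congr 2
    push_cast; norm_num
  rw [hankelOne, e1, sqrt_two_div_pi_mul hz, hankelConst,
    show ((1 : ℕ) : ℝ) + 1 / 2 = 3 / 2 by norm_num,
    show Complex.I * ((z - (1 : ℕ) * Real.pi / 2 - Real.pi / 4 : ℝ) : ℂ) =
      -(Complex.I * (3 * Real.pi / 4)) + Complex.I * z by push_cast; ring, Complex.exp_add]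
  push_cast
  ring

theorem hankelOne_zero_eq {z : ℝ} (hz : 0 < z) :
    hankelOne 0 z = -(hankelConst / (2 * Complex.I)) * ((z ^ (-1 / 2 : ℝ) : ℝ) : ℂ) *
      Complex.exp (Complex.I * z) * hankelInt (-1 / 2) (-1 / 2) (1 / (2 * z)) := by
  have e1 : ∫ u in Ioi (0 : ℝ), ((Real.exp (-u) * u ^ (((0 : ℕ) : ℝ) - 1 / 2) : ℝ) : ℂ) *
      (1 + Complex.I * ((u / (2 * z) : ℝ) : ℂ)) ^ (((0 : ℕ) : ℂ) - 1 / 2) =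
      hankelInt (-1 / 2) (-1 / 2) (1 / (2 * z)) := by
    refine setIntegral_congr_fun measurableSet_Ioi fun u _ => ?_
    simp only [hankelIntegrand]
    rw [show u * (1 / (2 * z)) = u / (2 * z) by ring,
      show ((0 : ℕ) : ℝ) - 1 / 2 = -1 / 2 by norm_num]
    congr 2
    push_cast; norm_num
  -- The normalising constants of orders 0 and 1 differ by the factor 2 from `Γ(3/2) = Γ(1/2)/2` and
  -- the factor `-i` from the phases.
  have hG : Real.Gamma (3 / 2) = 1 / 2 * Real.Gamma (1 / 2) := by
    rw [show (3 / 2 : ℝ) = 1 / 2 + 1 by norm_num, Real.Gamma_add_one (by norm_num)]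
  have hG0 : (Real.Gamma (1 / 2) : ℂ) ≠ 0 := by
    exact_mod_cast (Real.Gamma_pos_of_pos (by norm_num)).ne'
  have hexp : Complex.exp (-(Complex.I * (3 * Real.pi / 4))) =
      Complex.exp (-(Complex.I * (Real.pi / 4))) * (-Complex.I) := by
    have : Complex.exp (-(Real.pi / 2 * Complex.I)) = -Complex.I := by
      rw [Complex.exp_neg, Complex.exp_pi_div_two_mul_I, Complex.inv_I]
    rw [← this, ← Complex.exp_add]
    congr 1; ring
  rw [hankelOne, e1, sqrt_two_div_pi_mul hz, hankelConst, hexp, hG,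
    show ((0 : ℕ) : ℝ) + 1 / 2 = 1 / 2 by norm_num,
    show Complex.I * ((z - (0 : ℕ) * Real.pi / 2 - Real.pi / 4 : ℝ) : ℂ) =
      -(Complex.I * (Real.pi / 4)) + Complex.I * z by push_cast; ring, Complex.exp_add]
  push_cast
  field_simp

theorem hasDerivAt_hankelOne_zero {z : ℝ} (hz : 0 < z) :
    HasDerivAt (hankelOne 0) (-hankelOne 1 z) z := by
  set c : ℂ := -(hankelConst / (2 * Complex.I))
  have hz' : (z : ℂ) ≠ 0 := by exact_mod_cast hz.ne'
  have h1 : HasDerivAt (fun z : ℝ => ((z ^ (-1 / 2 : ℝ) : ℝ) : ℂ))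
      (((-1 / 2 * z ^ (-1 / 2 - 1 : ℝ) : ℝ)) : ℂ) z :=
    (Real.hasDerivAt_rpow_const (p := -1 / 2) (Or.inl hz.ne')).ofReal_comp
  have h2 : HasDerivAt (fun z : ℝ => Complex.exp (Complex.I * z))
      (Complex.exp (Complex.I * z) * (Complex.I * 1)) z :=
    ((Complex.ofRealCLM.hasDerivAt (x := z)).const_mul Complex.I).cexp
  have h3 : HasDerivAt (fun z : ℝ => 1 / (2 * z)) (-(1 / (2 * z ^ 2))) z := by
    have := ((hasDerivAt_id z).const_mul (2 : ℝ)).inv (by simpa using hz.ne')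
    refine (this.congr_of_eventuallyEq (Eventually.of_forall fun y => ?_)).congr_deriv ?_
    · simp
    · simp only [id_eq]; field_simp
  have h4 := (hasDerivAt_hankelInt (p := -1 / 2) (c := -1 / 2) (by norm_num) (by norm_num)
    (1 / (2 * z))).scomp z h3
  have h5 := ((h1.const_mul c).mul h2).mul h4
  have hev : hankelOne 0 =ᶠ[𝓝 z] fun z => c * ((z ^ (-1 / 2 : ℝ) : ℝ) : ℂ) *
      Complex.exp (Complex.I * z) * hankelInt (-1 / 2) (-1 / 2) (1 / (2 * z)) := by
    filter_upwards [lt_mem_nhds hz] with y hy using hankelOne_zero_eq hy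
  refine (h5.congr_of_eventuallyEq hev).congr_deriv ?_
  have hid := hankelInt_identity (1 / (2 * z))
  rw [hankelOne_one_eq hz, hankelBeta]
  have e1 : hankelConst = -2 * Complex.I * c := by
    simp only [c]; field_simp
  rw [e1]
  clear_value c
  simp only [Complex.real_smul, Function.comp, Pi.mul_apply]
  rw [Real.rpow_sub hz, Real.rpow_one, show (-1 / 2 + 1 : ℝ) = 1 / 2 by norm_num,
    show (-1 / 2 - 1 : ℝ) = -3 / 2 by norm_num]
  push_cast at hid ⊢
  linear_combination (c * ((z ^ (-1 / 2 : ℝ) : ℝ) : ℂ) * Complex.exp (Complex.I * z)) * hid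

/-- The Taylor coefficients of `β` at `0`. -/
theorem exists_hankelBeta_taylor (N : ℕ) {Y : ℝ} (hY : 0 < Y) : ∃ C : ℝ, ∀ y ∈ Icc 0 Y,
    ‖hankelBeta y - ∑ n ∈ Finset.range N, (y : ℂ) ^ n *
      (iteratedDeriv n hankelBeta 0 / n.factorial)‖ ≤ C * y ^ N := by
  -- Taylor's formula of degree `n` has a remainder of order `n + 1`, so `N = 0` is a plain bound.
  rcases Nat.eq_zero_or_pos N with rfl | hN
  · obtain ⟨C, hC⟩ := isCompact_Icc.exists_bound_of_continuousOn
      (contDiff_hankelBeta.continuous.continuousOn (s := Icc 0 Y))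
    exact ⟨C, fun y hy => by simpa using hC y hy⟩
  · obtain ⟨n, rfl⟩ : ∃ n, N = n + 1 := ⟨N - 1, by omega⟩
    obtain ⟨C, hC⟩ := exists_taylor_mean_remainder_bound (f := hankelBeta) (n := n) hY.le
      ((contDiff_hankelBeta.of_le (by exact_mod_cast le_top)).contDiffOn)
    refine ⟨C, fun y hy => ?_⟩
    have h := hC y hy
    rw [taylor_within_apply, sub_zero] at h
    refine le_trans (le_of_eq ?_) h
    congr 2
    refine Finset.sum_congr rfl fun j _ => ?_
    rw [iteratedDerivWithin_eq_iteratedDeriv (uniqueDiffOn_Icc hY)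
      ((contDiff_hankelBeta.of_le (by exact_mod_cast le_top)).contDiffAt) ⟨le_rfl, hY.le⟩,
      Complex.real_smul]
    push_cast
    field_simp

/-- The recursion `Γ(s+1) = sΓ(s)` is used at half-integers, which may be negative but never meet a
pole. -/
theorem prod_half_sub (n : ℕ) :
    (∏ j ∈ Finset.range n, ((1 : ℝ) / 2 - j)) * Real.Gamma (3 / 2 - n) = Real.Gamma (3 / 2) := by
  induction n with
  | zero => simp
  | succ n ih =>
    rw [← ih, Finset.prod_range_succ]
    have hne : (1 : ℝ) / 2 - n ≠ 0 := by
      intro h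
      have h2 : (1 : ℝ) = 2 * n := by linarith
      have h3 : (1 : ℤ) = 2 * n := by exact_mod_cast h2
      omega
    have h := Real.Gamma_add_one hne
    rw [show (1 : ℝ) / 2 - n + 1 = 3 / 2 - n by ring] at h
    rw [h, show (3 : ℝ) / 2 - (n + 1 : ℕ) = 1 / 2 - n by push_cast; ring]
    ring

theorem Gamma_three_half_sub_ne_zero (n : ℕ) : Real.Gamma (3 / 2 - n) ≠ 0 := by
  intro h
  have h1 := prod_half_sub n
  rw [h, mul_zero] at h1
  exact (Real.Gamma_pos_of_pos (by norm_num : (0 : ℝ) < 3 / 2)).ne h1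

/-- The stated constants are Taylor coefficients of `β` at 0; the factor `2^{-n}` comes from
evaluating `β` at `1/(2z)`. -/
theorem hankelCoeff_one_eq (n : ℕ) : hankelCoeff 1 n =
    hankelConst * (iteratedDeriv n hankelBeta 0 / n.factorial) * ((2 : ℂ) ^ n)⁻¹ := by
  have hsum : (-1 : ℝ) < 1 / 2 + n := by have := n.cast_nonneg (α := ℝ); linarith
  rw [hankelBeta, iteratedDeriv_hankelInt (by norm_num) (by norm_num), hankelInt_zero hsum,
    hankelCoeff, hankelConst]
  have hP := prod_half_sub n
  have hG := Gamma_three_half_sub_ne_zero n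
  have hG3 : Real.Gamma (3 / 2) ≠ 0 := (Real.Gamma_pos_of_pos (by norm_num : (0 : ℝ) < 3 / 2)).ne'
  have hP' : (∏ j ∈ Finset.range n, ((1 : ℝ) / 2 - j)) =
    Real.Gamma (3 / 2) / Real.Gamma (3 / 2 - n) := by rw [eq_div_iff hG, hP]
  rw [hP', show (1 : ℝ) / 2 + n + 1 = (1 : ℕ) + n + 1 / 2 by push_cast; ring,
    show ((1 : ℕ) : ℝ) - n + 1 / 2 = 3 / 2 - n by push_cast; ring]
  have h2 : ((2 : ℝ) ^ ((n : ℝ) - 1 / 2)) = 2 ^ n / Real.sqrt 2 := by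
    rw [Real.rpow_sub (by norm_num), Real.rpow_natCast, Real.sqrt_eq_rpow]
  have hpi : Real.sqrt Real.pi ≠ 0 := by positivity
  have h2' : Real.sqrt 2 ≠ 0 := by positivity
  have hexp : Complex.exp (Complex.I * Real.pi * (2 * ((1 : ℕ) : ℂ) + 1) / 4) *
      Complex.exp (-(Complex.I * (3 * Real.pi / 4))) = 1 := by
    rw [← Complex.exp_add, Nat.cast_one]
    ring_nf
    exact Complex.exp_zero
  have hE := Complex.exp_ne_zero (Complex.I * Real.pi * (2 * ((1 : ℕ) : ℂ) + 1) / 4)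
  have hexp' := eq_inv_of_mul_eq_one_right hexp
  rw [h2, Real.sqrt_div (by norm_num), hexp']
  have c1 : (Real.Gamma (3 / 2 - n) : ℂ) ≠ 0 := by exact_mod_cast hG
  have c2 : (Real.Gamma (3 / 2) : ℂ) ≠ 0 := by exact_mod_cast hG3
  have c3 : (Real.sqrt Real.pi : ℂ) ≠ 0 := by exact_mod_cast hpi
  have c4 : (Real.sqrt 2 : ℂ) ≠ 0 := by exact_mod_cast h2'
  have c5 : (n.factorial : ℂ) ≠ 0 := by exact_mod_cast n.factorial_ne_zero
  simp only [Complex.ofReal_div, Complex.ofReal_pow, Complex.ofReal_ofNat]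
  field_simp

theorem hasFDerivAt_norm_sub {x y : Plane} (h : x ≠ y) :
    HasFDerivAt (fun y : Plane => ‖x - y‖) (-(innerSL ℝ (unitVec (x - y)))) y := by
  have hne : ‖x - y‖ ≠ 0 := norm_ne_zero_iff.2 (sub_ne_zero.2 h)
  have h1 : HasFDerivAt (fun y : Plane => x - y) (-(ContinuousLinearMap.id ℝ Plane)) y :=
    (hasFDerivAt_id y).const_sub x
  have h2 := h1.norm_sq.sqrt (pow_ne_zero 2 hne)
  refine (h2.congr_of_eventuallyEq (Eventually.of_forall fun z => ?_)).congr_fderiv ?_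
  · simp [Real.sqrt_sq]
  · ext v
    simp only [Real.sqrt_sq (norm_nonneg _), unitVec, map_smul]
    simp
    field_simp
    ring

/-- Two minus signs cancel: one from `H_0' = -H_1`, one from differentiating `|x - y|` in `y`. -/
theorem fderiv_green {k : ℝ} (hk : 0 < k) {x y : Plane} (h : x ≠ y) (v : Plane) :
    fderiv ℝ (fun y => green k x y) y v =
      Complex.I / 4 * k * hankelOne 1 (k * ‖x - y‖) * (⟪unitVec (x - y), v⟫ : ℝ) := by
  have hr : 0 < ‖x - y‖ := norm_pos_iff.2 (sub_ne_zero.2 h)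
  have h1 := (hasFDerivAt_norm_sub h).const_mul k
  have h2 := (hasDerivAt_hankelOne_zero (mul_pos hk hr)).hasFDerivAt.comp y h1
  have h3 : HasFDerivAt (fun y => green k x y) _ y := h2.const_mul (Complex.I / 4)
  rw [h3.fderiv]
  simp
  ring

end Hankel

/-! ### The Fresnel integral with a cutoff -/

section Fresnel

open MeasureTheory

/-- Smooth functions that vanish near `0` and equal `c / v^j` for large `|v|`. -/
structure IsTail (r ε : ℝ) (j : ℕ) (ζ : ℝ → ℂ) : Prop where
  smooth : ContDiff ℝ ∞ ζ
  zero : ∀ v, |v| < r → ζ v = 0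
  tail : ∃ c : ℂ, ∀ v, ε < |v| → ζ v = c / (v : ℂ) ^ j

variable {r ε : ℝ} {j : ℕ} {ζ : ℝ → ℂ}

/-- Vanishing near 0 makes division by `v` harmless, and the tail decays one power faster. -/
theorem IsTail.div (hr : 0 < r) (hζ : IsTail r ε j ζ) : IsTail r ε (j + 1) fun v => ζ v / v := by
  refine ⟨?_, fun v hv => by simp [hζ.zero v hv], ?_⟩
  · rw [contDiff_iff_contDiffAt]
    intro v
    rcases eq_or_ne v 0 with rfl | hv
    · have : (fun v : ℝ => ζ v / v) =ᶠ[𝓝 0] fun _ => 0 := by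
        filter_upwards [Metric.ball_mem_nhds (0 : ℝ) hr] with v hv
        rw [hζ.zero v (by simpa using hv), zero_div]
      exact contDiffAt_const.congr_of_eventuallyEq this
    · simp only [div_eq_mul_inv]
      have hv' : (v : ℂ) ≠ 0 := by exact_mod_cast hv
      exact hζ.smooth.contDiffAt.mul
        ((Complex.ofRealCLM.contDiff.contDiffAt (x := v)).inv hv')
  · obtain ⟨c, hc⟩ := hζ.tail
    exact ⟨c, fun v hv => by rw [hc v hv, pow_succ, div_div]⟩

theorem IsTail.isTail_deriv (hε : 0 < ε) (hζ : IsTail r ε j ζ) :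
    IsTail r ε (j + 1) (deriv ζ) := by
  refine ⟨(contDiff_infty_iff_deriv.1 hζ.smooth).2, fun v hv => ?_, ?_⟩
  · have : ζ =ᶠ[𝓝 v] fun _ => 0 := by
      filter_upwards [(isOpen_lt continuous_abs continuous_const).mem_nhds hv] with y hy
        using hζ.zero y hy
    rw [this.deriv_eq, deriv_const]
  · obtain ⟨c, hc⟩ := hζ.tail
    refine ⟨-c * j, fun v hv => ?_⟩
    have hv0 : (v : ℂ) ≠ 0 := by
      have : v ≠ 0 := abs_pos.1 (hε.trans hv)
      exact_mod_cast this
    have hev : ζ =ᶠ[𝓝 v] fun v => c * ((v : ℂ) ^ j)⁻¹ := by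
      filter_upwards [(isOpen_lt continuous_const continuous_abs).mem_nhds hv] with y hy
      rw [hc y hy, div_eq_mul_inv]
    have h1 : HasDerivAt (fun v : ℝ => (v : ℂ)) 1 v := Complex.ofRealCLM.hasDerivAt
    have h3 : HasDerivAt (fun v : ℝ => c * ((v : ℂ) ^ j)⁻¹)
      (c * (-(j * (v : ℂ) ^ (j - 1) * 1) / ((v : ℂ) ^ j) ^ 2)) v :=
      ((h1.pow j).inv (pow_ne_zero _ hv0)).const_mul c
    rw [hev.deriv_eq, h3.deriv]
    rcases Nat.eq_zero_or_pos j with rfl | hj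
    · simp
    · obtain ⟨i, rfl⟩ : ∃ i, j = i + 1 := ⟨j - 1, by omega⟩
      simp only [Nat.add_sub_cancel]
      field_simp
      ring

theorem IsTail.bounded (hε : 0 < ε) (hζ : IsTail r ε j ζ) : ∃ C : ℝ, ∀ v, ‖ζ v‖ ≤ C := by
  obtain ⟨C, hC⟩ := isCompact_Icc.exists_bound_of_continuousOn
    (hζ.smooth.continuous.continuousOn (s := Icc (-ε) ε))
  obtain ⟨c, hc⟩ := hζ.tail
  refine ⟨max C (‖c‖ / ε ^ j), fun v => ?_⟩
  rcases le_or_gt |v| ε with h | h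
  · exact (hC v (abs_le.1 h)).trans (le_max_left _ _)
  · rw [hc v h, norm_div, norm_pow, Complex.norm_real, Real.norm_eq_abs]
    refine le_trans ?_ (le_max_right _ _)
    gcongr

theorem IsTail.integrable (hε : 0 < ε) (hζ : IsTail r ε j ζ) (hj : 2 ≤ j) : Integrable ζ := by
  obtain ⟨i, rfl⟩ : ∃ i, j = i + 2 := ⟨j - 2, by omega⟩
  obtain ⟨C, hC⟩ := hζ.bounded hε
  obtain ⟨c, hc⟩ := hζ.tail
  have hC0 : 0 ≤ C := (norm_nonneg _).trans (hC 0)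
  refine Integrable.mono' (g := fun v => (C * (1 + ε ^ 2) + ‖c‖ / ε ^ i * (1 + (ε ^ 2)⁻¹)) *
    (1 + v ^ 2)⁻¹) (integrable_inv_one_add_sq.const_mul _)
    hζ.smooth.continuous.aestronglyMeasurable (Eventually.of_forall fun v => ?_)
  have hv0 : 0 < 1 + v ^ 2 := by positivity
  rw [← div_eq_mul_inv, le_div_iff₀ hv0]
  rcases le_or_gt |v| ε with h | h
  · have h1 : ‖ζ v‖ * (1 + v ^ 2) ≤ C * (1 + ε ^ 2) := by
      have : v ^ 2 ≤ ε ^ 2 := sq_le_sq' (abs_le.1 h).1 (abs_le.1 h).2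
      gcongr
      exact hC v
    have h2 : 0 ≤ ‖c‖ / ε ^ i * (1 + (ε ^ 2)⁻¹) := by positivity
    linarith
  · have hv : 0 < |v| := hε.trans h
    have e1 : ‖ζ v‖ * (1 + v ^ 2) = ‖c‖ / |v| ^ i * (1 + (|v| ^ 2)⁻¹) := by
      rw [hc v h, norm_div, norm_pow, Complex.norm_real, Real.norm_eq_abs, ← sq_abs v]
      field_simp
      ring
    rw [e1]
    have h1 : ‖c‖ / |v| ^ i * (1 + (|v| ^ 2)⁻¹) ≤ ‖c‖ / ε ^ i * (1 + (ε ^ 2)⁻¹) := by gcongr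
    have h2 : 0 ≤ C * (1 + ε ^ 2) := by positivity
    linarith

/-- Write `ζ = v · (ζ/v)` and integrate by parts, since `v e^{-bv²}` is `-1/(2b)` times a
derivative. -/
theorem IsTail.integral_gaussian (hr : 0 < r) (hε : 0 < ε) (hζ : IsTail r ε j ζ) {b : ℂ}
    (hb : 0 < b.re) :
    ∫ v : ℝ, Complex.exp (-b * v ^ 2) * ζ v =
      1 / (2 * b) * ∫ v : ℝ, Complex.exp (-b * v ^ 2) * deriv (fun v => ζ v / v) v := by
  have hb0 : b ≠ 0 := by rintro rfl; simp at hb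
  have hξ := hζ.div hr
  have hξ' := hξ.isTail_deriv hε
  have hder : ∀ v : ℝ, HasDerivAt (fun v : ℝ => Complex.exp (-b * v ^ 2))
      (-(2 * b) * (v * Complex.exp (-b * v ^ 2))) v := fun v => by
    have h1 : HasDerivAt (fun v : ℝ => (v : ℂ)) 1 v := Complex.ofRealCLM.hasDerivAt
    have h2 := ((h1.pow 2).const_mul (-b)).cexp
    refine h2.congr_deriv ?_
    simp
    ring
  have hint := integrable_cexp_neg_mul_sq hb
  have hint' := integrable_mul_cexp_neg_mul_sq hb
  have hbdd : ∀ {i : ℕ} {g : ℝ → ℂ} {f : ℝ → ℂ}, IsTail r ε i g → Integrable f →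
      Integrable (fun v => f v * g v) := fun hg hf => by
    obtain ⟨C, hC⟩ := hg.bounded hε
    exact hf.mul_bdd (c := C) hg.smooth.continuous.aestronglyMeasurable (Eventually.of_forall hC)
  have key := integral_mul_deriv_eq_deriv_mul_of_integrable
    (u := fun v : ℝ => Complex.exp (-b * v ^ 2)) (v := fun v => ζ v / v)
    (u' := fun v => -(2 * b) * (v * Complex.exp (-b * v ^ 2))) (v' := deriv fun v => ζ v / v)
    (fun v _ => hder v) (fun v _ => (hξ.smooth.differentiable (by simp) v).hasDerivAt)
    (hbdd hξ' hint) (hbdd hξ (hint'.const_mul _)) (hbdd hξ hint)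
  rw [key, ← integral_neg, ← integral_const_mul]
  refine integral_congr_ae ?_
  filter_upwards [Measure.ae_ne volume (0 : ℝ)] with v hv
  have : (v : ℂ) ≠ 0 := by exact_mod_cast hv
  field_simp

/-- Every integration by parts gains `1/(2b)` and raises the tail exponent by two, so the last
integrand is absolutely integrable whatever `j` is. The constant does not depend on `b`, which
permits the limit `Re b → 0`. -/
theorem IsTail.exists_bound (hr : 0 < r) (hε : 0 < ε) (hζ : IsTail r ε j ζ) (n : ℕ) :
    ∃ C : ℝ, ∀ b : ℂ, 0 < b.re →
      ‖∫ v : ℝ, Complex.exp (-b * v ^ 2) * ζ v‖ ≤ C * (‖2 * b‖ ^ (n + 1))⁻¹ := by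
  induction n generalizing ζ j with
  | zero =>
    have hξ' := (hζ.div hr).isTail_deriv hε
    have hint := hξ'.integrable hε (by omega)
    refine ⟨∫ v, ‖deriv (fun v => ζ v / v) v‖, fun b hb => ?_⟩
    rw [hζ.integral_gaussian hr hε hb, norm_mul, norm_div, norm_one, mul_comm, zero_add, pow_one,
      one_div]
    gcongr
    refine (norm_integral_le_integral_norm _).trans ?_
    refine integral_mono_of_nonneg (Eventually.of_forall fun v => norm_nonneg _) hint.norm
      (Eventually.of_forall fun v => ?_)
    simp only
    rw [norm_mul, Complex.norm_exp]
    refine mul_le_of_le_one_left (norm_nonneg _) (Real.exp_le_one_iff.2 ?_)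
    rw [← Complex.ofReal_pow, Complex.re_mul_ofReal, Complex.neg_re]
    nlinarith [sq_nonneg v]
  | succ n ih =>
    obtain ⟨C, hC⟩ := ih ((hζ.div hr).isTail_deriv hε)
    refine ⟨C, fun b hb => ?_⟩
    rw [hζ.integral_gaussian hr hε hb, norm_mul, norm_div, norm_one, pow_succ, mul_inv, ← mul_assoc,
      mul_comm, one_div]
    gcongr
    exact hC b hb

theorem I_mul_cpow_half {c : ℝ} (hc : 0 < c) : (Complex.I * c) ^ (1 / 2 : ℂ) =
    Real.sqrt c * Complex.exp (Complex.I * Real.pi / 4) := by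
  have h0 : (c : ℂ) * Complex.I ≠ 0 := mul_ne_zero (by exact_mod_cast hc.ne') Complex.I_ne_zero
  rw [mul_comm, Complex.cpow_def_of_ne_zero h0, Complex.log_ofReal_mul hc Complex.I_ne_zero,
    Complex.log_I, add_mul, Complex.exp_add, Real.sqrt_eq_rpow, Real.rpow_def_of_pos hc]
  push_cast
  congr 2
  ring

/-- The Fresnel integral with a smooth cutoff. -/
theorem fresnel_cutoff (hr : 0 < r) (hε : 0 < ε) {χ : ℝ → ℝ} (hχ : ContDiff ℝ ∞ χ)
    (h1 : ∀ v, |v| < r → χ v = 1) (h0 : ∀ v, ε < |v| → χ v = 0) (n : ℕ) :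
    ∃ C : ℝ, ∀ k : ℝ, 0 < k →
      ‖(∫ v : ℝ, Complex.exp (Complex.I * ((k * v ^ 2 : ℝ) : ℂ)) * χ v) -
        Real.sqrt (Real.pi / k) * Complex.exp (Complex.I * Real.pi / 4)‖ ≤ C * (k ^ (n + 1))⁻¹ := by
  have hζ : IsTail r ε 0 fun v => 1 - (χ v : ℂ) :=
    ⟨contDiff_const.sub (Complex.ofRealCLM.contDiff.comp hχ), fun v hv => by simp [h1 v hv],
      1, fun v hv => by simp [h0 v hv]⟩
  obtain ⟨C, hC⟩ := hζ.exists_bound hr hε n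
  refine ⟨|C|, fun k hk => ?_⟩
  have hχs : HasCompactSupport χ := HasCompactSupport.of_support_subset_isCompact
    (isCompact_Icc (a := -ε) (b := ε)) fun v hv => by
      by_contra hv'
      refine hv (h0 v ?_)
      rw [← not_le, abs_le]
      exact hv'
  have hχint : Integrable χ := hχ.continuous.integrable_of_hasCompactSupport hχs
  -- Damping: for `s > 0` the full Gaussian integral converges and is known exactly; then `s → 0+`.
  set b : ℝ → ℂ := fun s => s - Complex.I * k with hb
  have hbre : ∀ s : ℝ, (b s).re = s := fun s => by simp [hb]
  have hlim1 : Tendsto (fun s : ℝ => ∫ v : ℝ, Complex.exp (-b s * v ^ 2) * χ v) (𝓝[>] 0)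
      (𝓝 (∫ v : ℝ, Complex.exp (-b 0 * v ^ 2) * χ v)) := by
    refine tendsto_integral_filter_of_dominated_convergence (fun v => ‖χ v‖) ?_ ?_ hχint.norm ?_
    · refine Eventually.of_forall fun s => Continuous.aestronglyMeasurable ?_
      have := hχ.continuous
      fun_prop
    · filter_upwards [self_mem_nhdsWithin] with s hs
      refine Eventually.of_forall fun v => ?_
      rw [norm_mul, Complex.norm_exp, Complex.norm_real]
      refine mul_le_of_le_one_left (norm_nonneg _) (Real.exp_le_one_iff.2 ?_)
      rw [← Complex.ofReal_pow, Complex.re_mul_ofReal, Complex.neg_re, hbre]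
      have : (0 : ℝ) < s := hs
      nlinarith [sq_nonneg v]
    · refine Eventually.of_forall fun v => ?_
      refine Tendsto.mono_left ?_ nhdsWithin_le_nhds
      have : Continuous fun s : ℝ => Complex.exp (-b s * v ^ 2) * χ v := by simp only [hb]; fun_prop
      exact this.tendsto 0
  have hb0 : (Real.pi : ℂ) / b 0 = Complex.I * ((Real.pi / k : ℝ) : ℂ) := by
    have : (k : ℂ) ≠ 0 := by exact_mod_cast hk.ne'
    simp only [hb]
    push_cast
    rw [zero_sub, div_neg, div_mul_eq_div_div, Complex.div_I]
    ring
  have hlim2 : Tendsto (fun s : ℝ => ((Real.pi : ℂ) / b s) ^ (1 / 2 : ℂ)) (𝓝[>] 0)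
      (𝓝 (((Real.pi : ℂ) / b 0) ^ (1 / 2 : ℂ))) := by
    refine Tendsto.mono_left ?_ nhdsWithin_le_nhds
    have hne : b 0 ≠ 0 := by simp [hb, hk.ne']
    have hc : ContinuousAt (fun s : ℝ => (Real.pi : ℂ) / b s) 0 :=
      ContinuousAt.div continuousAt_const (by simp only [hb]; fun_prop) hne
    -- The limit `π / b 0 = iπ/k` is off the branch cut, so the principal square root is continuous
    -- there.
    refine (ContinuousAt.cpow hc continuousAt_const ?_).tendsto
    rw [hb0]
    right
    simp [hk.ne', Real.pi_ne_zero]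
  have hlim := (hlim1.sub hlim2).norm
  rw [hb0, I_mul_cpow_half (by positivity)] at hlim
  have e0 : (fun v : ℝ => Complex.exp (-b 0 * v ^ 2) * χ v) =
      fun v : ℝ => Complex.exp (Complex.I * ((k * v ^ 2 : ℝ) : ℂ)) * χ v := by
    ext v
    simp only [hb]
    push_cast
    ring_nf
  rw [e0] at hlim
  refine le_of_tendsto hlim ?_
  filter_upwards [self_mem_nhdsWithin] with s hs
  have hs0 : (0 : ℝ) < s := hs
  have hbs : 0 < (b s).re := by rw [hbre]; exact hs0
  have hint := integrable_cexp_neg_mul_sq hbs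
  have hbd : ∃ D : ℝ, ∀ v, ‖(χ v : ℂ)‖ ≤ D := by
    obtain ⟨D, hD⟩ := hχ.continuous.bounded_above_of_compact_support hχs
    exact ⟨D, fun v => by simpa using hD v⟩
  obtain ⟨D, hD⟩ := hbd
  have hint2 : Integrable fun v : ℝ => Complex.exp (-b s * v ^ 2) * (χ v : ℂ) :=
    hint.mul_bdd (c := D) (Complex.continuous_ofReal.comp hχ.continuous).aestronglyMeasurable
      (Eventually.of_forall hD)
  -- The deviation from the exact Gaussian value is the integral against `1 - χ`, which vanishes
  -- near 0 and is bounded uniformly in `s`.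
  have e1 : (∫ v : ℝ, Complex.exp (-b s * v ^ 2) * χ v) - ((Real.pi : ℂ) / b s) ^ (1 / 2 : ℂ) =
      -∫ v : ℝ, Complex.exp (-b s * v ^ 2) * (1 - (χ v : ℂ)) := by
    rw [← integral_gaussian_complex hbs, ← integral_sub hint2 hint, ← integral_neg]
    refine integral_congr_ae (Eventually.of_forall fun v => ?_)
    simp only
    ring
  rw [e1, norm_neg]
  refine (hC (b s) hbs).trans ?_
  have hkb : k ≤ ‖2 * b s‖ := by
    have h2 := Complex.abs_im_le_norm (b s)
    have h3 : |(b s).im| = k := by simp [hb, abs_of_pos hk]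
    rw [norm_mul, Complex.norm_ofNat]
    linarith [norm_nonneg (b s)]
  calc C * (‖2 * b s‖ ^ (n + 1))⁻¹ ≤ |C| * (‖2 * b s‖ ^ (n + 1))⁻¹ := by
        gcongr; exact le_abs_self C
    _ ≤ |C| * (k ^ (n + 1))⁻¹ := by gcongr

end Fresnel

/-! ### Lagrange inversion: derivatives in the Morse coordinate -/

section Lagrange

variable {O : Set ℝ}

theorem contDiffOn_iteratedDeriv (hO : IsOpen O) {v : ℝ → ℂ} (hv : ContDiffOn ℝ ∞ v O) (n : ℕ) :
    ContDiffOn ℝ ∞ (iteratedDeriv n v) O :=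
  (contDiffOn_dirD_iterate hO hv 1 n).congr fun _ ht =>
    iteratedDeriv_comp_line hO hv (c := fun t => t) hasDerivAt_id n ht

theorem hasDerivAt_iteratedDeriv (hO : IsOpen O) {v : ℝ → ℂ} (hv : ContDiffOn ℝ ∞ v O) (n : ℕ)
    {t : ℝ} (ht : t ∈ O) : HasDerivAt (iteratedDeriv n v) (iteratedDeriv (n + 1) v t) t := by
  rw [iteratedDeriv_succ]
  refine DifferentiableAt.hasDerivAt ?_
  exact ((contDiffOn_iteratedDeriv hO hv n).contDiffAt (hO.mem_nhds ht)).differentiableAt (by simp)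

theorem iteratedDeriv_id_mul (hO : IsOpen O) {v : ℝ → ℂ} (hv : ContDiffOn ℝ ∞ v O) (n : ℕ)
    {t : ℝ} (ht : t ∈ O) : iteratedDeriv (n + 1) (fun t : ℝ => (t : ℂ) * v t) t =
      t * iteratedDeriv (n + 1) v t + (n + 1) * iteratedDeriv n v t := by
  have hid : ∀ t : ℝ, HasDerivAt (fun t : ℝ => (t : ℂ)) 1 t := fun t =>
    Complex.ofRealCLM.hasDerivAt
  induction n generalizing t with
  | zero =>
    rw [iteratedDeriv_one, iteratedDeriv_zero]
    have h0 := hasDerivAt_iteratedDeriv hO hv 0 ht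
    rw [iteratedDeriv_zero] at h0
    have := ((hid t).mul h0).deriv
    rw [show (fun t : ℝ => (t : ℂ) * v t) = (fun t : ℝ => (t : ℂ)) * v from rfl, this]
    simp
    ring
  | succ n ih =>
    rw [iteratedDeriv_succ]
    have hev : iteratedDeriv (n + 1) (fun t : ℝ => (t : ℂ) * v t) =ᶠ[𝓝 t] fun t =>
        t * iteratedDeriv (n + 1) v t + (n + 1) * iteratedDeriv n v t := by
      filter_upwards [hO.mem_nhds ht] with s hs using ih hs
    rw [hev.deriv_eq]
    have h1 := ((hid t).mul (hasDerivAt_iteratedDeriv hO hv (n + 1) ht)).add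
      ((hasDerivAt_iteratedDeriv hO hv n ht).const_mul ((n : ℂ) + 1))
    have h2 : HasDerivAt (fun t : ℝ => t * iteratedDeriv (n + 1) v t +
      (n + 1) * iteratedDeriv n v t) _ t := h1
    rw [h2.deriv]
    push_cast
    ring

theorem iteratedDeriv_id_mul_zero (hO : IsOpen O) (h0 : (0 : ℝ) ∈ O) {v : ℝ → ℂ}
    (hv : ContDiffOn ℝ ∞ v O) (n : ℕ) : iteratedDeriv (n + 1) (fun t : ℝ => (t : ℂ) * v t) 0 =
      (n + 1) * iteratedDeriv n v 0 := by
  rw [iteratedDeriv_id_mul hO hv n h0]; simp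

theorem contDiffOn_id_mul {v : ℝ → ℂ} (hv : ContDiffOn ℝ ∞ v O) :
    ContDiffOn ℝ ∞ (fun t : ℝ => (t : ℂ) * v t) O :=
  Complex.ofRealCLM.contDiff.contDiffOn.mul hv

theorem contDiffOn_deriv_of_isOpen (hO : IsOpen O) {v : ℝ → ℂ} (hv : ContDiffOn ℝ ∞ v O) :
    ContDiffOn ℝ ∞ (deriv v) O := hv.deriv_of_isOpen hO (by simp)

theorem iteratedDeriv_congr_on (hO : IsOpen O) {f g : ℝ → ℂ} (h : ∀ t ∈ O, f t = g t) (n : ℕ)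
    {t : ℝ} (ht : t ∈ O) : iteratedDeriv n f t = iteratedDeriv n g t := by
  have : f =ᶠ[𝓝 t] g := by filter_upwards [hO.mem_nhds ht] with s hs using h s hs
  exact this.iteratedDeriv_eq n

/-- The functional `(d/dτ)^n [κ^{n+1} f]` at `0`. -/
def lagrangeT (κ : ℝ → ℂ) (n : ℕ) (f : ℝ → ℂ) : ℂ :=
  iteratedDeriv n (fun τ => κ τ ^ (n + 1) * f τ) 0

/-- With `w = τ/κ`, `lagrangeT κ n f` is the `n`-th `w`-derivative at 0 of `f dτ/dw`. For `f = w'`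
this amplitude is the constant 1, so all positive orders vanish. -/
theorem lagrangeT_deriv (hO : IsOpen O) (h0 : (0 : ℝ) ∈ O) {κ : ℝ → ℂ} (hκ : ContDiffOn ℝ ∞ κ O)
    (hne : ∀ τ ∈ O, κ τ ≠ 0) (n : ℕ) :
    lagrangeT κ (n + 1) (deriv fun τ : ℝ => (τ : ℂ) / κ τ) = 0 := by
  have hder : ∀ τ ∈ O, HasDerivAt κ (deriv κ τ) τ := fun τ hτ => by
    simpa using hasDerivAt_iteratedDeriv hO hκ 0 hτ
  set u : ℝ → ℂ := fun τ => κ τ ^ (n + 1) with hu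
  have hus : ContDiffOn ℝ ∞ u O := hκ.pow _
  have hu' : ∀ τ ∈ O, HasDerivAt u ((n + 1 : ℕ) * κ τ ^ n * deriv κ τ) τ := fun τ hτ => by
    exact (hder τ hτ).pow (n + 1)
  have hw : ∀ τ ∈ O, deriv (fun τ : ℝ => (τ : ℂ) / κ τ) τ = (κ τ - τ * deriv κ τ) / κ τ ^ 2 :=
    fun τ hτ => by
      have h1 : HasDerivAt (fun v : ℝ => (v : ℂ)) 1 τ := Complex.ofRealCLM.hasDerivAt
      simpa using (h1.fun_div (hder τ hτ) (hne τ hτ)).deriv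
  -- The integrand is `u - τu'/(n+1)` with `u = κ^{n+1}`, and the `(n+1)`-st derivative of `τu'` at
  -- 0 is `(n+1)u^{(n+1)}(0)`: the two terms cancel.
  have e : ∀ τ ∈ O, κ τ ^ (n + 1 + 1) * deriv (fun τ : ℝ => (τ : ℂ) / κ τ) τ =
      u τ - ((n : ℂ) + 1)⁻¹ * (τ * deriv u τ) := fun τ hτ => by
    rw [hw τ hτ, (hu' τ hτ).deriv, hu]
    have h1 := hne τ hτ
    have h2 : (n : ℂ) + 1 ≠ 0 := by exact_mod_cast n.succ_ne_zero
    push_cast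
    field_simp
    ring
  rw [lagrangeT, iteratedDeriv_congr_on hO e _ h0]
  have hd := contDiffOn_deriv_of_isOpen hO hus
  have hc1 : ContDiffAt ℝ ((n + 1 : ℕ) : WithTop ℕ∞) u 0 :=
    (hus.contDiffAt (hO.mem_nhds h0)).of_le (by exact_mod_cast le_top)
  have hc2 : ContDiffAt ℝ ((n + 1 : ℕ) : WithTop ℕ∞) (fun τ : ℝ => (τ : ℂ) * deriv u τ) 0 :=
    ((contDiffOn_id_mul hd).contDiffAt (hO.mem_nhds h0)).of_le (by exact_mod_cast le_top)
  rw [iteratedDeriv_fun_sub hc1 (contDiffAt_const.mul hc2), iteratedDeriv_const_mul_field,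
    iteratedDeriv_id_mul_zero hO h0 hd, ← iteratedDeriv_succ']
  have h2 : (n : ℂ) + 1 ≠ 0 := by exact_mod_cast n.succ_ne_zero
  field_simp
  ring

/-- In the coordinate `w` the amplitude is `w g`, whose `(n+2)`-nd derivative at 0 is `n + 2` times
the `(n+1)`-st derivative of `g`; and `dg/dw` is the `w`-amplitude that belongs to `f = dg/dτ`. -/
theorem lagrangeT_mul_deriv (hO : IsOpen O) (h0 : (0 : ℝ) ∈ O) {κ g : ℝ → ℂ}
    (hκ : ContDiffOn ℝ ∞ κ O) (hg : ContDiffOn ℝ ∞ g O) (hne : ∀ τ ∈ O, κ τ ≠ 0) (n : ℕ) :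
    lagrangeT κ (n + 2) (fun τ : ℝ => (τ : ℂ) / κ τ * deriv (fun τ : ℝ => (τ : ℂ) / κ τ) τ * g τ) =
      (n + 2) * lagrangeT κ n (deriv g) := by
  have hder : ∀ {f : ℝ → ℂ}, ContDiffOn ℝ ∞ f O → ∀ τ ∈ O, HasDerivAt f (deriv f τ) τ :=
    fun hf τ hτ => by simpa using hasDerivAt_iteratedDeriv hO hf 0 hτ
  set u : ℝ → ℂ := fun τ => κ τ ^ (n + 1) with hu
  have hus : ContDiffOn ℝ ∞ u O := hκ.pow _
  have hu' : ∀ τ ∈ O, HasDerivAt u ((n + 1 : ℕ) * κ τ ^ n * deriv κ τ) τ := fun τ hτ => by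
    exact (hder hκ τ hτ).pow (n + 1)
  have hw : ∀ τ ∈ O, deriv (fun τ : ℝ => (τ : ℂ) / κ τ) τ = (κ τ - τ * deriv κ τ) / κ τ ^ 2 :=
    fun τ hτ => by
      have h1 : HasDerivAt (fun v : ℝ => (v : ℂ)) 1 τ := Complex.ofRealCLM.hasDerivAt
      simpa using (h1.fun_div (hder hκ τ hτ) (hne τ hτ)).deriv
  set a : ℝ → ℂ := fun τ => u τ * g τ with ha
  have has : ContDiffOn ℝ ∞ a O := hus.mul hg
  have ha' : ∀ τ ∈ O, deriv a τ = (n + 1 : ℕ) * κ τ ^ n * deriv κ τ * g τ + u τ * deriv g τ :=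
    fun τ hτ => ((hu' τ hτ).mul (hder hg τ hτ)).deriv
  set d : ℝ → ℂ := fun τ => u τ * deriv g τ with hd
  have hds : ContDiffOn ℝ ∞ d O := hus.mul (contDiffOn_deriv_of_isOpen hO hg)
  have has' := contDiffOn_deriv_of_isOpen hO has
  have h2 : (n : ℂ) + 1 ≠ 0 := by exact_mod_cast n.succ_ne_zero
  have e : ∀ τ ∈ O, κ τ ^ (n + 2 + 1) * ((τ : ℂ) / κ τ * deriv (fun τ : ℝ => (τ : ℂ) / κ τ) τ * g τ) =
      τ * a τ - ((n : ℂ) + 1)⁻¹ * (τ * (τ * deriv a τ)) + ((n : ℂ) + 1)⁻¹ * (τ * (τ * d τ)) :=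
    fun τ hτ => by
    rw [hw τ hτ, ha' τ hτ]
    simp only [ha, hd, hu]
    have h1 := hne τ hτ
    push_cast
    field_simp
    ring
  have hca : ∀ {f : ℝ → ℂ}, ContDiffOn ℝ ∞ f O → ContDiffAt ℝ ((n + 2 : ℕ) : WithTop ℕ∞) f 0 :=
    fun hf => contDiffAt_infty.1 (hf.contDiffAt (hO.mem_nhds h0)) _
  rw [lagrangeT, iteratedDeriv_congr_on hO e _ h0]
  have c1 := hca (contDiffOn_id_mul has)
  have c2 := hca (contDiffOn_const (c := ((n : ℂ) + 1)⁻¹)|>.mul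
    (contDiffOn_id_mul (contDiffOn_id_mul has')))
  have c3 := hca (contDiffOn_const (c := ((n : ℂ) + 1)⁻¹)|>.mul
    (contDiffOn_id_mul (contDiffOn_id_mul hds)))
  rw [iteratedDeriv_fun_add (c1.sub c2) c3, iteratedDeriv_fun_sub c1 c2,
    iteratedDeriv_const_mul_field, iteratedDeriv_const_mul_field,
    iteratedDeriv_id_mul_zero hO h0 has, iteratedDeriv_id_mul_zero hO h0 (contDiffOn_id_mul has'),
    iteratedDeriv_id_mul_zero hO h0 (contDiffOn_id_mul hds),
    iteratedDeriv_id_mul_zero hO h0 has', iteratedDeriv_id_mul_zero hO h0 hds,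
    ← iteratedDeriv_succ', lagrangeT]
  push_cast
  field_simp
  ring

end Lagrange

/-! ### Stationary phase: one integration by parts -/

section StationaryPhase

variable {V : Type} [NormedAddCommGroup V] [NormedSpace ℝ V]

/-- The phase is `w²`, `w = τ / κ(τ,x)`, where `w` is a coordinate on `(-δ,δ)` for `x ∈ B`. -/
structure IsPhase (B : Set V) (δ b ε : ℝ) (κ : ℝ × V → ℝ) : Prop where
  isOpen : IsOpen B
  b_pos : 0 < b
  b_lt : b < δ
  ε_pos : 0 < ε
  smooth : ContDiffOn ℝ ∞ κ (Ioo (-δ) δ ×ˢ B)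
  pos : ∀ τ ∈ Ioo (-δ) δ, ∀ x ∈ B, 0 < κ (τ, x)
  deriv_pos : ∀ τ ∈ Ioo (-δ) δ, ∀ x ∈ B, 0 < deriv (fun τ => τ / κ (τ, x)) τ
  right : ∀ x ∈ B, ε ≤ b / κ (b, x)
  left : ∀ x ∈ B, ε ≤ b / κ (-b, x)

/-- Smooth amplitudes that vanish for `|τ| > b`. -/
structure IsAmplitude (B : Set V) (δ b : ℝ) (f : ℝ × V → ℂ) : Prop where
  smooth : ContDiffOn ℝ ∞ f (Ioo (-δ) δ ×ˢ B)
  zero : ∀ τ ∈ Ioo (-δ) δ, ∀ x ∈ B, b < |τ| → f (τ, x) = 0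

/-- `∫ e^{ikw²} f dτ`. -/
def oscInt (κ : ℝ × V → ℝ) (b : ℝ) (f : ℝ × V → ℂ) (x : V) (k : ℝ) : ℂ :=
  ∫ τ in (-b)..b, Complex.exp (Complex.I * ((k * (τ / κ (τ, x)) ^ 2 : ℝ) : ℂ)) * f (τ, x)

/-- A smooth cutoff, equal to `1` for `|v| ≤ ε/2` and to `0` for `|v| ≥ ε`. -/
def cutoff (ε : ℝ) (hε : 0 < ε) : ContDiffBump (0 : ℝ) := ⟨ε / 2, ε, by positivity, by linarith⟩

/-- The Fresnel integral with cutoff. -/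
def fresnelInt (ε : ℝ) (hε : 0 < ε) (k : ℝ) : ℂ :=
  ∫ v : ℝ, Complex.exp (Complex.I * ((k * v ^ 2 : ℝ) : ℂ)) * (cutoff ε hε v : ℝ)

theorem cutoff_eq_one {ε : ℝ} (hε : 0 < ε) {v : ℝ} (hv : |v| < ε / 2) : cutoff ε hε v = 1 :=
  (cutoff ε hε).one_of_mem_closedBall (by simpa [cutoff] using hv.le)

theorem cutoff_eq_zero {ε : ℝ} (hε : 0 < ε) {v : ℝ} (hv : ε ≤ |v|) : cutoff ε hε v = 0 :=
  (cutoff ε hε).zero_of_le_dist (by simpa [cutoff] using hv)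

theorem fresnelInt_asymptotics {ε : ℝ} (hε : 0 < ε) (n : ℕ) : ∃ C : ℝ, ∀ k : ℝ, 0 < k →
    ‖fresnelInt ε hε k - Real.sqrt (Real.pi / k) * Complex.exp (Complex.I * Real.pi / 4)‖
      ≤ C * (k ^ (n + 1))⁻¹ :=
  fresnel_cutoff (r := ε / 2) (by positivity) hε (cutoff ε hε).contDiff
    (fun _ hv => cutoff_eq_one hε hv) (fun _ hv => cutoff_eq_zero hε hv.le) n

variable {B : Set V} {δ b ε : ℝ} {κ : ℝ × V → ℝ} {f : ℝ × V → ℂ}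

/-- By continuity from outside `[-b,b]`; this removes the boundary terms. -/
theorem IsAmplitude.zero_end (hB : IsOpen B) (hb : 0 < b) (hbδ : b < δ)
    (hf : IsAmplitude B δ b f) {x : V} (hx : x ∈ B) : f (b, x) = 0 ∧ f (-b, x) = 0 := by
  have hΩ : IsOpen (Ioo (-δ) δ ×ˢ B) := isOpen_Ioo.prod hB
  have hc : ∀ τ ∈ Ioo (-δ) δ, ContinuousAt (fun τ => f (τ, x)) τ := fun τ hτ =>
    ((hf.smooth.contDiffAt (hΩ.mem_nhds ⟨hτ, hx⟩)).continuousAt).comp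
      (f := fun τ => (τ, x)) (by fun_prop)
  constructor
  · have hm : b ∈ Ioo (-δ) δ := ⟨by linarith, hbδ⟩
    refine tendsto_nhds_unique ((hc b hm).tendsto.mono_left
      (nhdsWithin_le_nhds (s := Ioi b))) (tendsto_const_nhds.congr' ?_)
    filter_upwards [self_mem_nhdsWithin, nhdsWithin_le_nhds (isOpen_Ioo.mem_nhds hm)] with τ h1 h2
    exact (hf.zero τ h2 x hx ((show b < τ from h1).trans_le (le_abs_self τ))).symm
  · have hm : -b ∈ Ioo (-δ) δ := ⟨by linarith, by linarith⟩
    refine tendsto_nhds_unique ((hc (-b) hm).tendsto.mono_left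
      (nhdsWithin_le_nhds (s := Iio (-b)))) (tendsto_const_nhds.congr' ?_)
    filter_upwards [self_mem_nhdsWithin, nhdsWithin_le_nhds (isOpen_Ioo.mem_nhds hm)] with τ h1 h2
    have h1' : τ < -b := h1
    exact (hf.zero τ h2 x hx (by rw [lt_abs]; right; linarith)).symm

theorem IsPhase.zero_mem (hκ : IsPhase B δ b ε κ) : (0 : ℝ) ∈ Ioo (-δ) δ :=
  ⟨by linarith [hκ.b_pos, hκ.b_lt], by linarith [hκ.b_pos, hκ.b_lt]⟩

theorem IsPhase.uIcc_subset (hκ : IsPhase B δ b ε κ) : uIcc (-b) b ⊆ Ioo (-δ) δ := by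
  rw [uIcc_of_le (by linarith [hκ.b_pos])]
  exact fun τ hτ => ⟨by linarith [hκ.b_lt, hτ.1], by linarith [hκ.b_lt, hτ.2]⟩

theorem IsPhase.contDiffOn_w (hκ : IsPhase B δ b ε κ) :
    ContDiffOn ℝ ∞ (fun p : ℝ × V => p.1 / κ p) (Ioo (-δ) δ ×ˢ B) :=
  contDiffOn_fst.div hκ.smooth fun p hp => (hκ.pos p.1 hp.1 p.2 hp.2).ne'

theorem IsPhase.contDiffOn_w' (hκ : IsPhase B δ b ε κ) :
    ContDiffOn ℝ ∞ (fun p : ℝ × V => deriv (fun τ => τ / κ (τ, p.2)) p.1) (Ioo (-δ) δ ×ˢ B) :=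
  contDiffOn_deriv_fst (isOpen_Ioo.prod hκ.isOpen) hκ.contDiffOn_w

theorem IsPhase.hasDerivAt_w (hκ : IsPhase B δ b ε κ) {τ : ℝ} (hτ : τ ∈ Ioo (-δ) δ) {x : V}
    (hx : x ∈ B) :
    HasDerivAt (fun τ => τ / κ (τ, x)) (deriv (fun τ => τ / κ (τ, x)) τ) τ :=
  (hasDerivAt_comp_line (isOpen_Ioo.prod hκ.isOpen) hκ.contDiffOn_w (c := fun τ => (τ, x))
    ((hasDerivAt_id τ).prodMk (hasDerivAt_const τ x)) ⟨hτ, hx⟩).differentiableAt.hasDerivAt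

/-- `w` increases with `τ`, so the values at `±b` control everything beyond. Hence a cutoff of
radius `ε` in `w` lives inside `|τ| ≤ b`. -/
theorem IsPhase.le_abs_w (hκ : IsPhase B δ b ε κ) {τ : ℝ} (hτ : τ ∈ Ioo (-δ) δ) {x : V}
    (hx : x ∈ B) (hbτ : b ≤ |τ|) : ε ≤ |τ / κ (τ, x)| := by
  have hmono : StrictMonoOn (fun τ => τ / κ (τ, x)) (Ioo (-δ) δ) := by
    refine strictMonoOn_of_deriv_pos (convex_Ioo _ _)
      (fun t ht => (hκ.hasDerivAt_w ht hx).continuousAt.continuousWithinAt) fun t ht => ?_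
    rw [interior_Ioo] at ht
    exact hκ.deriv_pos t ht x hx
  have hbp := hκ.b_pos
  have hbl := hκ.b_lt
  rcases le_abs.1 hbτ with h | h
  · have := hmono.monotoneOn ⟨by linarith, hbl⟩ hτ h
    exact (hκ.right x hx).trans (this.trans (le_abs_self _))
  · have := hmono.monotoneOn hτ (show -b ∈ Ioo (-δ) δ from ⟨by linarith, by linarith⟩)
      (show τ ≤ -b by linarith)
    have h2 := hκ.left x hx
    simp only [neg_div] at this
    rw [le_abs]
    right
    linarith

/-- The functional `(d/dτ)^n [κ^{n+1} f]` at `τ = 0`. -/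
def ampCoeff (κ : ℝ × V → ℝ) (n : ℕ) (f : ℝ × V → ℂ) (x : V) : ℂ :=
  lagrangeT (fun τ => (κ (τ, x) : ℂ)) n (fun τ => f (τ, x))

/-- One integration by parts in the method of stationary phase. -/
theorem IsPhase.step [ProperSpace V] (hκ : IsPhase B δ b ε κ) (hf : IsAmplitude B δ b f) :
    ∃ f₁ : ℝ × V → ℂ, IsAmplitude B δ b f₁ ∧
      (∀ x ∈ B, ∀ n : ℕ, ampCoeff κ (n + 2) f x = (n + 2) * ampCoeff κ n f₁ x) ∧
      ∀ x ∈ B, ∀ k : ℝ, 0 < k → oscInt κ b f x k =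
        ampCoeff κ 0 f x * fresnelInt ε hκ.ε_pos k + Complex.I / (2 * k) * oscInt κ b f₁ x k := by
  have hB := hκ.isOpen
  have hΩ : IsOpen (Ioo (-δ) δ ×ˢ B) := isOpen_Ioo.prod hB
  have h0 := hκ.zero_mem
  set χ := cutoff ε hκ.ε_pos with hχ
  set W : ℝ × V → ℝ := fun p => p.1 / κ p with hW
  set wp : ℝ × V → ℝ := fun p => deriv (fun τ => τ / κ (τ, p.2)) p.1 with hwp
  have hWs := hκ.contDiffOn_w
  have hwps := hκ.contDiffOn_w'
  have hwp0 : ∀ p ∈ Ioo (-δ) δ ×ˢ B, wp p ≠ 0 := fun p hp => (hκ.deriv_pos p.1 hp.1 p.2 hp.2).ne'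
  have ofReal : ∀ {h : ℝ × V → ℝ}, ContDiffOn ℝ ∞ h (Ioo (-δ) δ ×ˢ B) →
      ContDiffOn ℝ ∞ (fun p => (h p : ℂ)) (Ioo (-δ) δ ×ˢ B) := fun hh =>
    Complex.ofRealCLM.contDiff.comp_contDiffOn hh
  -- `g = f / w'` is the amplitude with respect to `dw`.
  set g : ℝ × V → ℂ := fun p => f p * ((wp p : ℂ))⁻¹ with hg
  have hgs : ContDiffOn ℝ ∞ g (Ioo (-δ) δ ×ˢ B) :=
    hf.smooth.mul ((ofReal hwps).inv fun p hp => by exact_mod_cast hwp0 p hp)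
  -- Subtracting a cutoff that is a function of `w` makes the leading term a pure Fresnel integral,
  -- independent of `x` up to the factor `g(0,x)`.
  set N : ℝ × V → ℂ := fun p => g p - g (0, p.2) * (χ (W p) : ℝ) with hN
  have hNs : ContDiffOn ℝ ∞ N (Ioo (-δ) δ ×ˢ B) := by
    refine hgs.sub (ContDiffOn.mul ?_ (ofReal (χ.contDiff.comp_contDiffOn hWs)))
    exact hgs.comp (f := fun p : ℝ × V => ((0 : ℝ), p.2)) (by fun_prop) fun p hp => ⟨h0, hp.2⟩
  have hN0 : ∀ x, N (0, x) = 0 := fun x => by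
    have : χ 0 = 1 := cutoff_eq_one hκ.ε_pos (by simpa using hκ.ε_pos)
    simp [hN, hW, this]
  -- `N` vanishes at `τ = 0`, and `N/w = κ · N/τ` is smooth by Hadamard's lemma. The integration by
  -- parts puts its `τ`-derivative in place of `f`.
  set gt : ℝ × V → ℂ := fun p => κ p * hadamardQuot N p with hgt
  have hgts : ContDiffOn ℝ ∞ gt (Ioo (-δ) δ ×ˢ B) :=
    (ofReal hκ.smooth).mul (contDiffOn_hadamardQuot hB hNs)
  have hWgt : ∀ τ ∈ Ioo (-δ) δ, ∀ x ∈ B, (W (τ, x) : ℂ) * gt (τ, x) = N (τ, x) := by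
    intro τ hτ x hx
    have h1 := smul_hadamardQuot hB hNs hτ hx
    rw [hN0, sub_zero, Complex.real_smul] at h1
    have h2 : (κ (τ, x) : ℂ) ≠ 0 := by exact_mod_cast (hκ.pos τ hτ x hx).ne'
    rw [← h1, hgt, hW]
    push_cast
    field_simp
  have hfeq : ∀ τ ∈ Ioo (-δ) δ, ∀ x ∈ B, f (τ, x) = g (0, x) * ((wp (τ, x) : ℂ) * (χ (W (τ, x)) : ℝ)) +
      (W (τ, x) : ℂ) * wp (τ, x) * gt (τ, x) := by
    intro τ hτ x hx
    have h1 := hWgt τ hτ x hx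
    have h2 : (wp (τ, x) : ℂ) ≠ 0 := by exact_mod_cast hwp0 (τ, x) ⟨hτ, hx⟩
    have h3 : f (τ, x) = g (τ, x) * wp (τ, x) := by simp only [hg]; field_simp
    have h4 : N (τ, x) = g (τ, x) - g (0, x) * (χ (W (τ, x)) : ℝ) := rfl
    rw [h3]
    linear_combination (-(wp (τ, x) : ℂ)) * h1 - (wp (τ, x) : ℂ) * h4
  have hgtz : ∀ τ ∈ Ioo (-δ) δ, ∀ x ∈ B, b < |τ| → gt (τ, x) = 0 := by
    intro τ hτ x hx hbτ
    have h1 := hWgt τ hτ x hx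
    have h2 := hκ.le_abs_w hτ hx hbτ.le
    have h3 : χ (W (τ, x)) = 0 := cutoff_eq_zero hκ.ε_pos h2
    have h4 : N (τ, x) = 0 := by
      simp only [hN, h3, hg, hf.zero τ hτ x hx hbτ]
      simp
    rw [h4] at h1
    have h5 : (W (τ, x) : ℂ) ≠ 0 := by
      have : W (τ, x) ≠ 0 := abs_pos.1 (hκ.ε_pos.trans_le h2)
      exact_mod_cast this
    exact (mul_eq_zero.1 h1).resolve_left h5
  have hgta : IsAmplitude B δ b gt := ⟨hgts, hgtz⟩
  have hg0 : ∀ x ∈ B, g (0, x) = ampCoeff κ 0 f x := by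
    intro x hx
    have h1 : HasDerivAt (fun τ => τ / κ (τ, x)) (1 / κ (0, x)) 0 := by
      have h2 : HasDerivAt (fun τ => κ (τ, x)) (deriv (fun τ => κ (τ, x)) 0) 0 :=
        (hasDerivAt_comp_line hΩ hκ.smooth (c := fun τ => (τ, x))
          ((hasDerivAt_id 0).prodMk (hasDerivAt_const 0 x)) ⟨h0, hx⟩).differentiableAt.hasDerivAt
      have hne := (hκ.pos 0 h0 x hx).ne'
      refine ((hasDerivAt_id (0 : ℝ)).fun_div h2 hne).congr_deriv ?_
      simp
      field_simp
    simp only [hg, hwp, ampCoeff, lagrangeT, iteratedDeriv_zero, h1.deriv]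
    push_cast
    simp
    ring
  refine ⟨fun p => deriv (fun τ => gt (τ, p.2)) p.1, ⟨contDiffOn_deriv_fst hΩ hgts, ?_⟩, ?_, ?_⟩
  · intro τ hτ x hx hbτ
    have hev : (fun τ => gt (τ, x)) =ᶠ[𝓝 τ] fun _ => 0 := by
      filter_upwards [isOpen_Ioo.mem_nhds hτ,
        (isOpen_lt continuous_const continuous_abs).mem_nhds hbτ] with s h1 h2
        using hgtz s h1 x hx h2
    simp only
    rw [hev.deriv_eq, deriv_const]
  · intro x hx n
    have hline : ∀ {G : Type} [NormedAddCommGroup G] [NormedSpace ℝ G] {h : ℝ × V → G},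
        ContDiffOn ℝ ∞ h (Ioo (-δ) δ ×ˢ B) → ContDiffOn ℝ ∞ (fun τ => h (τ, x)) (Ioo (-δ) δ) :=
      fun hh => hh.comp (by fun_prop) fun τ hτ => ⟨hτ, hx⟩
    -- Where `χ(w) = 1`; there `f = g(0) w' + w w' · gt`, to which the two Lagrange identities
    -- apply.
    set O : Set ℝ := Ioo (-δ) δ ∩ (fun τ => W (τ, x)) ⁻¹' Ioo (-(ε / 2)) (ε / 2) with hO
    have hOo : IsOpen O := (hline hWs).continuousOn.isOpen_inter_preimage isOpen_Ioo isOpen_Ioo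
    have hO0 : (0 : ℝ) ∈ O := ⟨h0, by simp [hW, hκ.ε_pos]⟩
    have hOI : O ⊆ Ioo (-δ) δ := inter_subset_left
    set κc : ℝ → ℂ := fun τ => (κ (τ, x) : ℂ) with hκc
    have hκs : ContDiffOn ℝ ∞ κc O := (hline (ofReal hκ.smooth)).mono hOI
    have hκne : ∀ τ ∈ O, κc τ ≠ 0 := fun τ hτ => by
      simp only [hκc]
      exact_mod_cast (hκ.pos τ (hOI hτ) x hx).ne'
    have hgO : ContDiffOn ℝ ∞ (fun τ => gt (τ, x)) O := (hline hgts).mono hOI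
    have hderW : ∀ τ ∈ O, deriv (fun τ : ℝ => (τ : ℂ) / κc τ) τ = (wp (τ, x) : ℂ) := by
      intro τ hτ
      have := (hκ.hasDerivAt_w (hOI hτ) hx).ofReal_comp
      rw [← this.deriv]
      congr 1
      ext s
      simp [hκc]
    have hcong : ∀ τ ∈ O, κc τ ^ (n + 2 + 1) * f (τ, x) =
        g (0, x) * (κc τ ^ (n + 1 + 1 + 1) * deriv (fun τ : ℝ => (τ : ℂ) / κc τ) τ) +
        κc τ ^ (n + 2 + 1) * ((τ : ℂ) / κc τ * deriv (fun τ : ℝ => (τ : ℂ) / κc τ) τ * gt (τ, x)) := by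
      intro τ hτ
      have h1 : χ (W (τ, x)) = 1 := cutoff_eq_one hκ.ε_pos (abs_lt.2 hτ.2)
      have h2 : ((W (τ, x) : ℝ) : ℂ) = (τ : ℂ) / κc τ := by simp [hW, hκc]
      rw [hfeq τ (hOI hτ) x hx, h1, hderW τ hτ, h2]
      push_cast
      ring
    have hWc : ContDiffOn ℝ ∞ (fun τ : ℝ => (τ : ℂ) / κc τ) O := by
      simp only [div_eq_mul_inv]
      exact Complex.ofRealCLM.contDiff.contDiffOn.mul (hκs.inv hκne)
    have hWd := contDiffOn_deriv_of_isOpen hOo hWc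
    have hca : ∀ {h : ℝ → ℂ}, ContDiffOn ℝ ∞ h O → ContDiffAt ℝ ((n + 2 : ℕ) : WithTop ℕ∞) h 0 :=
      fun hh => contDiffAt_infty.1 (hh.contDiffAt (hOo.mem_nhds hO0)) _
    have e1 := lagrangeT_deriv hOo hO0 hκs hκne (n + 1)
    have e2 := lagrangeT_mul_deriv hOo hO0 hκs hgO hκne n
    rw [ampCoeff, lagrangeT, iteratedDeriv_congr_on hOo hcong _ hO0, iteratedDeriv_fun_add
      (hca (contDiffOn_const.mul ((hκs.pow _).mul hWd)))
      (hca ((hκs.pow _).mul ((hWc.mul hWd).mul hgO))), iteratedDeriv_const_mul_field]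
    rw [lagrangeT] at e1 e2
    rw [e1, e2, mul_zero, zero_add]
    rfl
  · intro x hx k hk
    have hsub := hκ.uIcc_subset
    have hline : ∀ {G : Type} [NormedAddCommGroup G] [NormedSpace ℝ G] {h : ℝ × V → G},
        ContDiffOn ℝ ∞ h (Ioo (-δ) δ ×ˢ B) → ContinuousOn (fun τ => h (τ, x)) (uIcc (-b) b) :=
      fun hh => (hh.continuousOn.comp (f := fun τ => (τ, x)) (by fun_prop)
        fun τ hτ => ⟨hτ, hx⟩).mono hsub
    set e : ℝ → ℂ := fun τ => Complex.exp (Complex.I * ((k * W (τ, x) ^ 2 : ℝ) : ℂ)) with he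
    have hec : ContinuousOn e (uIcc (-b) b) := by
      exact Complex.continuous_exp.comp_continuousOn (continuousOn_const.mul
        (Complex.continuous_ofReal.comp_continuousOn (continuousOn_const.mul ((hline hWs).pow 2))))
    have hed : ∀ τ ∈ uIcc (-b) b, HasDerivAt e
        (2 * Complex.I * k * (e τ * (W (τ, x) * wp (τ, x)))) τ := by
      intro τ hτ
      have h1 := hκ.hasDerivAt_w (hsub hτ) hx
      have h2 := (((h1.fun_pow 2).const_mul k).ofReal_comp.const_mul Complex.I).cexp
      refine h2.congr_deriv ?_
      simp only [he, hW, hwp]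
      push_cast
      ring
    have hgd : ∀ τ ∈ uIcc (-b) b, HasDerivAt (fun τ => gt (τ, x))
        (deriv (fun τ => gt (τ, x)) τ) τ := fun τ hτ =>
      (hasDerivAt_comp_line hΩ hgts (c := fun τ => (τ, x))
        ((hasDerivAt_id τ).prodMk (hasDerivAt_const τ x)) ⟨hsub hτ, hx⟩).differentiableAt.hasDerivAt
    have hibp := intervalIntegral.integral_mul_deriv_eq_deriv_mul (u := e)
      (v := fun τ => gt (τ, x)) hed hgd
      (ContinuousOn.intervalIntegrable (continuousOn_const.mul
        (hec.mul ((hline (ofReal hWs)).mul (hline (ofReal hwps))))))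
      (hline (contDiffOn_deriv_fst hΩ hgts)).intervalIntegrable
    obtain ⟨z1, z2⟩ := hgta.zero_end hB hκ.b_pos hκ.b_lt hx
    simp only [z1, z2, mul_zero, sub_zero, zero_sub] at hibp
    -- Substitution `v = w(τ)`; the image of `[-b,b]` covers the support of the cutoff.
    have hfres : ∫ τ in (-b)..b, e τ * ((wp (τ, x) : ℂ) * (χ (W (τ, x)) : ℝ)) =
        fresnelInt ε hκ.ε_pos k := by
      have h1 := intervalIntegral.integral_deriv_smul_comp (a := -b) (b := b)
        (f := fun τ => W (τ, x)) (f' := fun τ => wp (τ, x))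
        (g := fun v : ℝ => Complex.exp (Complex.I * ((k * v ^ 2 : ℝ) : ℂ)) * (χ v : ℝ))
        (fun τ hτ => hκ.hasDerivAt_w (hsub hτ) hx) (hline hwps)
        (by have := χ.continuous; fun_prop)
      rw [fresnelInt, ← intervalIntegral.integral_eq_integral_of_support_subset
        (a := W (-b, x)) (b := W (b, x)), ← h1]
      · refine intervalIntegral.integral_congr fun τ _ => ?_
        simp only [he, Function.comp, Complex.real_smul]
        ring
      · intro v hv
        have hv' : |v| < ε := by
          by_contra hcon
          exact hv (by simp [cutoff_eq_zero hκ.ε_pos (not_lt.1 hcon)])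
        have h3 := hκ.right x hx
        have h4 := hκ.left x hx
        rw [abs_lt] at hv'
        simp only [hW, neg_div]
        exact ⟨by linarith [hv'.1], by linarith [hv'.2]⟩
    have hk' : (k : ℂ) ≠ 0 := by exact_mod_cast hk.ne'
    have hsplit : oscInt κ b f x k = g (0, x) * (∫ τ in (-b)..b, e τ * ((wp (τ, x) : ℂ) * (χ (W (τ, x)) : ℝ))) +
        (2 * Complex.I * k)⁻¹ * ∫ τ in (-b)..b, 2 * Complex.I * k * (e τ * (W (τ, x) * wp (τ, x))) * gt (τ, x) := by
      rw [oscInt, ← intervalIntegral.integral_const_mul, ← intervalIntegral.integral_const_mul,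
        ← intervalIntegral.integral_add]
      · refine intervalIntegral.integral_congr fun τ hτ => ?_
        have h2 : (2 * Complex.I * k : ℂ) ≠ 0 := by simp [hk']
        rw [hfeq τ (hsub hτ) x hx]
        simp only [he, hW]
        field_simp
      · refine ContinuousOn.intervalIntegrable (continuousOn_const.mul (hec.mul
          ((hline (ofReal hwps)).mul (hline (ofReal (χ.contDiff.comp_contDiffOn hWs))))))
      · refine ContinuousOn.intervalIntegrable (continuousOn_const.mul ((continuousOn_const.mul
        (hec.mul ((hline (ofReal hWs)).mul (hline (ofReal hwps))))).mul (hline hgts)))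
    rw [hsplit, hfres, ← hg0 x hx]
    congr 1
    have e3 : ∫ τ in (-b)..b, 2 * Complex.I * k * (e τ * (W (τ, x) * wp (τ, x))) * gt (τ, x) =
        -oscInt κ b (fun p => deriv (fun τ => gt (τ, p.2)) p.1) x k := by
      rw [oscInt]
      simp only [he, hW] at hibp ⊢
      rw [hibp, neg_neg]
    rw [e3]
    have : (2 * Complex.I * k : ℂ)⁻¹ = -(Complex.I / (2 * k)) := by
      field_simp
      rw [Complex.I_sq, neg_neg]
    rw [this]
    ring

end StationaryPhase

/-! ### Stationary phase: the full expansion -/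

section StationaryPhase

variable {V : Type} [NormedAddCommGroup V] [NormedSpace ℝ V]
  {B : Set V} {δ b ε : ℝ} {κ : ℝ × V → ℝ} {f : ℝ × V → ℂ}

/-- Iteration of `IsPhase.step`. The successive factors `2q, 2q-2, …, 2` from the recursion for
`ampCoeff` multiply to `2^q q!`. -/
theorem IsPhase.exists_oscInt_eq_sum [ProperSpace V] (hκ : IsPhase B δ b ε κ) (Q : ℕ) :
    ∀ f : ℝ × V → ℂ, IsAmplitude B δ b f → ∃ f' : ℝ × V → ℂ, IsAmplitude B δ b f' ∧
      ∀ x ∈ B, ∀ k : ℝ, 0 < k → oscInt κ b f x k =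
        ∑ q ∈ Finset.range Q, (Complex.I / (2 * k)) ^ q *
          (ampCoeff κ (2 * q) f x / (2 ^ q * q.factorial)) * fresnelInt ε hκ.ε_pos k +
        (Complex.I / (2 * k)) ^ Q * oscInt κ b f' x k := by
  induction Q with
  | zero => exact fun f hf => ⟨f, hf, fun x _ k _ => by simp⟩
  | succ Q ih =>
    intro f hf
    obtain ⟨f₁, hf₁, hT, hosc⟩ := hκ.step hf
    obtain ⟨f', hf', h⟩ := ih f₁ hf₁
    refine ⟨f', hf', fun x hx k hk => ?_⟩
    rw [hosc x hx k hk, h x hx k hk, Finset.sum_range_succ', mul_add, Finset.mul_sum]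
    have hterm : ∀ q : ℕ, (Complex.I / (2 * k)) ^ (q + 1) *
          (ampCoeff κ (2 * (q + 1)) f x / (2 ^ (q + 1) * (q + 1).factorial)) *
            fresnelInt ε hκ.ε_pos k =
        Complex.I / (2 * k) * ((Complex.I / (2 * k)) ^ q *
          (ampCoeff κ (2 * q) f₁ x / (2 ^ q * q.factorial)) * fresnelInt ε hκ.ε_pos k) := by
      intro q
      have h1 : (q.factorial : ℂ) ≠ 0 := by exact_mod_cast q.factorial_ne_zero
      have h2 : ((q : ℂ) + 1) ≠ 0 := by exact_mod_cast q.succ_ne_zero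
      rw [show 2 * (q + 1) = 2 * q + 2 by ring, hT x hx (2 * q), Nat.factorial_succ]
      push_cast
      have h3 : (2 * (q : ℂ) + 2) * ampCoeff κ (2 * q) f₁ x /
          (2 ^ (q + 1) * ((q + 1) * q.factorial)) =
          ampCoeff κ (2 * q) f₁ x / (2 ^ q * q.factorial) := by
        field_simp
        ring
      rw [h3]
      ring
    simp only [hterm]
    simp
    ring

theorem IsPhase.contDiffOn_ampCoeff (hκ : IsPhase B δ b ε κ)
    (hf : ContDiffOn ℝ ∞ f (Ioo (-δ) δ ×ˢ B)) (n : ℕ) : ContDiffOn ℝ ∞ (ampCoeff κ n f) B := by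
  have h1 : ContDiffOn ℝ ∞ (fun p : ℝ × V => ((κ p : ℝ) : ℂ) ^ (n + 1) * f p)
      (Ioo (-δ) δ ×ˢ B) :=
    ((Complex.ofRealCLM.contDiff.comp_contDiffOn hκ.smooth).pow _).mul hf
  exact (contDiffOn_iteratedDeriv_fst (isOpen_Ioo.prod hκ.isOpen) h1 n).comp
    (f := fun x => ((0 : ℝ), x)) (by fun_prop) fun x hx => ⟨hκ.zero_mem, hx⟩

theorem IsPhase.exists_bound_oscInt (hκ : IsPhase B δ b ε κ) (hf : IsAmplitude B δ b f)
    {S : Set V} (hS : IsCompact S) (hSB : S ⊆ B) :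
    ∃ C : ℝ, 0 ≤ C ∧ ∀ x ∈ S, ∀ k : ℝ, ‖oscInt κ b f x k‖ ≤ C := by
  obtain ⟨C, hC⟩ := (isCompact_uIcc.prod hS).exists_bound_of_continuousOn
    (hf.smooth.continuousOn.mono (prod_mono hκ.uIcc_subset hSB))
  refine ⟨max C 0 * |b - -b|, by positivity, fun x hx k => ?_⟩
  refine intervalIntegral.norm_integral_le_of_norm_le_const fun τ hτ => ?_
  rw [norm_mul, mul_comm Complex.I, Complex.norm_exp_ofReal_mul_I, one_mul]
  exact (hC (τ, x) ⟨uIoc_subset_uIcc hτ, hx⟩).trans (le_max_left _ _)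

/-- The constants of the method of stationary phase at a minimum of the phase. -/
def statConst (q : ℕ) : ℂ :=
  Complex.exp (Complex.I * Real.pi * (2 * q + 1) / 4) *
    ((Real.Gamma ((q : ℝ) + 1 / 2) / ((2 * q).factorial : ℝ) : ℝ) : ℂ)

/-- The left side is the constant of the statement, the right side what repeated integration by
parts yields. They agree by `(2q)! = 2^q q! (2q-1)!!` and the value of `Γ` at half-integers. -/
theorem statConst_eq (q : ℕ) : statConst q =
    (Complex.I / 2) ^ q / (2 ^ q * q.factorial) *
      (Real.sqrt Real.pi * Complex.exp (Complex.I * Real.pi / 4)) := by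
  have h1 : Complex.exp (Complex.I * Real.pi * (2 * q + 1) / 4) =
      Complex.I ^ q * Complex.exp (Complex.I * Real.pi / 4) := by
    rw [show Complex.I * Real.pi * (2 * q + 1) / 4 =
      q * (Real.pi / 2 * Complex.I) + Complex.I * Real.pi / 4 by ring, Complex.exp_add,
      Complex.exp_nat_mul, Complex.exp_pi_div_two_mul_I]
  have h2 : Real.Gamma ((q : ℝ) + 1 / 2) / ((2 * q).factorial : ℝ) =
      Real.sqrt Real.pi / (2 ^ q * 2 ^ q * q.factorial) := by
    have h3 : ((2 * q).factorial : ℝ) = 2 ^ q * q.factorial * (2 * q - 1 : ℕ).doubleFactorial := by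
      rcases q with _ | q
      · simp
      · rw [show 2 * (q + 1) = 2 * q + 1 + 1 by ring,
          Nat.factorial_eq_mul_doubleFactorial, show 2 * q + 1 + 1 = 2 * (q + 1) by ring,
          Nat.doubleFactorial_two_mul, show 2 * (q + 1) - 1 = 2 * q + 1 by omega]
        push_cast
        ring
    have h4 : ((2 * q - 1 : ℕ).doubleFactorial : ℝ) ≠ 0 := by
      exact_mod_cast (Nat.doubleFactorial_pos _).ne'
    have h5 : (q.factorial : ℝ) ≠ 0 := by exact_mod_cast q.factorial_ne_zero
    rw [Real.Gamma_nat_add_half, h3]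
    field_simp
  rw [statConst, h1, h2]
  push_cast
  rw [div_pow]
  field_simp

/-- One term more than required is expanded: the last integral is only bounded, and the factor `√k`
would otherwise cost half a power. -/
theorem IsPhase.oscInt_asymptotics [ProperSpace V] (hκ : IsPhase B δ b ε κ)
    (hf : IsAmplitude B δ b f) (Q : ℕ) {S : Set V} (hS : IsCompact S) (hSB : S ⊆ B)
    {k₀ : ℝ} (hk₀ : 0 < k₀) :
    ∃ C : ℝ, ∀ x ∈ S, ∀ k : ℝ, k₀ ≤ k →
      ‖Real.sqrt k * oscInt κ b f x k - ∑ q ∈ Finset.range Q,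
        ((k : ℂ) ^ q)⁻¹ * (statConst q * ampCoeff κ (2 * q) f x)‖ ≤ C * (k ^ Q)⁻¹ := by
  obtain ⟨f', hf', hosc⟩ := hκ.exists_oscInt_eq_sum (Q + 1) f hf
  obtain ⟨Co, hCo0, hCo⟩ := hκ.exists_bound_oscInt hf' hS hSB
  obtain ⟨CF, hCF⟩ := fresnelInt_asymptotics hκ.ε_pos Q
  have hT : ∀ q : ℕ, ∃ C : ℝ, 0 ≤ C ∧ ∀ x ∈ S,
      ‖ampCoeff κ (2 * q) f x / (2 ^ q * q.factorial)‖ ≤ C := by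
    intro q
    obtain ⟨C, hC⟩ := hS.exists_bound_of_continuousOn
      (((hκ.contDiffOn_ampCoeff hf.smooth (2 * q)).continuousOn.mono hSB).div_const
        ((2 : ℂ) ^ q * q.factorial))
    exact ⟨max C 0, le_max_right _ _, fun x hx => (hC x hx).trans (le_max_left _ _)⟩
  choose CT hCT0 hCT using hT
  set c : ℂ := Real.sqrt Real.pi * Complex.exp (Complex.I * Real.pi / 4) with hc
  have hCF0 : 0 ≤ CF := by
    have := (norm_nonneg _).trans (hCF 1 one_pos)
    simpa using this
  have hs0 : 0 < Real.sqrt k₀ := Real.sqrt_pos.2 hk₀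
  refine ⟨(1 / 2) ^ Q * CT Q * ‖c‖ + (∑ q ∈ Finset.range (Q + 1), (1 / (2 * k₀)) ^ q * CT q *
    (CF * (Real.sqrt k₀)⁻¹)) + (1 / 2) ^ (Q + 1) * (Real.sqrt k₀)⁻¹ * Co, fun x hx k hk => ?_⟩
  have hkp : 0 < k := hk₀.trans_le hk
  have hkc : (k : ℂ) ≠ 0 := by exact_mod_cast hkp.ne'
  have hsk : Real.sqrt k ≤ (Real.sqrt k₀)⁻¹ * k := by
    have h1 : Real.sqrt k₀ ≤ Real.sqrt k := Real.sqrt_le_sqrt hk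
    have h2 : Real.sqrt k * Real.sqrt k = k := Real.mul_self_sqrt hkp.le
    rw [inv_mul_eq_div, le_div_iff₀ hs0]
    nlinarith [Real.sqrt_nonneg k]
  set R : ℂ := Real.sqrt k * fresnelInt ε hκ.ε_pos k - c with hR
  have hRb : ‖R‖ ≤ CF * (Real.sqrt k₀)⁻¹ * (k ^ Q)⁻¹ := by
    have h1 : R = Real.sqrt k * (fresnelInt ε hκ.ε_pos k -
        Real.sqrt (Real.pi / k) * Complex.exp (Complex.I * Real.pi / 4)) := by
      have h2 : Real.sqrt (Real.pi / k) = Real.sqrt Real.pi / Real.sqrt k :=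
        Real.sqrt_div Real.pi_pos.le k
      have h3 : (Real.sqrt k : ℂ) ≠ 0 := by exact_mod_cast (Real.sqrt_pos.2 hkp).ne'
      rw [hR, hc, h2]
      push_cast
      field_simp
    rw [h1, norm_mul, Complex.norm_real, Real.norm_of_nonneg (Real.sqrt_nonneg _)]
    calc Real.sqrt k * _ ≤ ((Real.sqrt k₀)⁻¹ * k) * (CF * (k ^ (Q + 1))⁻¹) :=
          mul_le_mul hsk (hCF k hkp) (norm_nonneg _) (by positivity)
      _ = _ := by
          field_simp
          ring
  have hIk : ∀ q : ℕ, ‖(Complex.I / (2 * k)) ^ q‖ = (1 / 2) ^ q * (k ^ q)⁻¹ := by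
    intro q
    rw [norm_pow, norm_div, Complex.norm_I, norm_mul, Complex.norm_real, Real.norm_of_nonneg hkp.le,
      Complex.norm_ofNat, ← inv_pow, ← mul_pow]
    congr 1
    field_simp
  have hIk' : ∀ q : ℕ, ‖(Complex.I / (2 * k)) ^ q‖ ≤ (1 / (2 * k₀)) ^ q := by
    intro q
    rw [hIk q, ← inv_pow, ← mul_pow]
    refine pow_le_pow_left₀ (by positivity) ?_ q
    rw [← one_div, div_mul_div_comm, one_mul]
    exact one_div_le_one_div_of_le (by positivity) (by linarith)
  set T : ℕ → ℂ := fun q => ampCoeff κ (2 * q) f x / (2 ^ q * q.factorial) with hTdef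
  have key : Real.sqrt k * oscInt κ b f x k - ∑ q ∈ Finset.range Q,
        ((k : ℂ) ^ q)⁻¹ * (statConst q * ampCoeff κ (2 * q) f x) =
      (Complex.I / (2 * k)) ^ Q * T Q * c +
      ∑ q ∈ Finset.range (Q + 1), (Complex.I / (2 * k)) ^ q * T q * R +
      (Complex.I / (2 * k)) ^ (Q + 1) * Real.sqrt k * oscInt κ b f' x k := by
    have h1 : ∀ q : ℕ, ((k : ℂ) ^ q)⁻¹ * (statConst q * ampCoeff κ (2 * q) f x) =
        (Complex.I / (2 * k)) ^ q * T q * c := by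
      intro q
      rw [statConst_eq, hTdef, hc]
      simp only [div_pow, mul_pow]
      field_simp
    simp only [h1]
    have h2 : ∑ q ∈ Finset.range (Q + 1), (Complex.I / (2 * k)) ^ q * T q * R =
        Real.sqrt k * ∑ q ∈ Finset.range (Q + 1), (Complex.I / (2 * k)) ^ q * T q *
          fresnelInt ε hκ.ε_pos k -
        ∑ q ∈ Finset.range (Q + 1), (Complex.I / (2 * k)) ^ q * T q * c := by
      rw [Finset.mul_sum, ← Finset.sum_sub_distrib]
      refine Finset.sum_congr rfl fun q _ => ?_
      rw [hR]
      ring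
    rw [hosc x (hSB hx) k hkp, h2, Finset.sum_range_succ (fun q => (Complex.I / (2 * k)) ^ q * T q * c)]
    ring
  rw [key, add_mul, add_mul]
  refine (norm_add₃_le).trans (add_le_add (add_le_add ?_ ?_) ?_)
  · rw [norm_mul, norm_mul, hIk Q]
    have := hCT Q x hx
    calc (1 / 2) ^ Q * (k ^ Q)⁻¹ * ‖T Q‖ * ‖c‖ ≤ (1 / 2) ^ Q * (k ^ Q)⁻¹ * CT Q * ‖c‖ := by gcongr
      _ = _ := by ring
  · rw [Finset.sum_mul]
    refine (norm_sum_le _ _).trans (Finset.sum_le_sum fun q _ => ?_)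
    rw [norm_mul, norm_mul]
    have := hCT q x hx
    calc ‖(Complex.I / (2 * k)) ^ q‖ * ‖T q‖ * ‖R‖
        ≤ (1 / (2 * k₀)) ^ q * CT q * (CF * (Real.sqrt k₀)⁻¹ * (k ^ Q)⁻¹) :=
          mul_le_mul (mul_le_mul (hIk' q) this (norm_nonneg _) (by positivity)) hRb (norm_nonneg _)
            (mul_nonneg (by positivity) (hCT0 q))
      _ = _ := by ring
  · rw [norm_mul, norm_mul, hIk, Complex.norm_real, Real.norm_of_nonneg (Real.sqrt_nonneg _)]
    calc (1 / 2) ^ (Q + 1) * (k ^ (Q + 1))⁻¹ * Real.sqrt k * ‖oscInt κ b f' x k‖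
        ≤ (1 / 2) ^ (Q + 1) * (k ^ (Q + 1))⁻¹ * ((Real.sqrt k₀)⁻¹ * k) * Co := by
          gcongr
          exact hCo x hx k
      _ = _ := by
          field_simp
          ring

end StationaryPhase

/-! ### Nonstationary phase for rough amplitudes -/

section Nonstationary

variable {X : Type} {A : Set X} {r : X → ℝ} {T : Set ℝ}

/-- Families of smooth functions with `|F^{(i)}| ≤ C r^{e+i}` on `T`. -/
structure IsRough (A : Set X) (r : X → ℝ) (T : Set ℝ) (e : ℕ) (F : X → ℝ → ℂ) : Prop where
  smooth : ∀ p ∈ A, ContDiff ℝ ∞ (F p)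
  bound : ∀ i : ℕ, ∃ C : ℝ, 0 ≤ C ∧ ∀ p ∈ A, ∀ t ∈ T, ‖iteratedDeriv i (F p) t‖ ≤ C * r p ^ (e + i)

theorem IsRough.mul {F G : X → ℝ → ℂ} {e e' : ℕ} (hF : IsRough A r T e F)
    (hG : IsRough A r T e' G) : IsRough A r T (e + e') fun p t => F p t * G p t := by
  refine ⟨fun p hp => (hF.smooth p hp).mul (hG.smooth p hp), fun i => ?_⟩
  choose CF hCF0 hCF using hF.bound
  choose CG hCG0 hCG using hG.bound
  refine ⟨∑ j ∈ Finset.range (i + 1), (i.choose j : ℝ) * CF j * CG (i - j),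
    Finset.sum_nonneg fun j _ =>
      mul_nonneg (mul_nonneg (Nat.cast_nonneg _) (hCF0 j)) (hCG0 _), fun p hp t ht => ?_⟩
  have h := norm_iteratedFDeriv_mul_le_of_isOpen isOpen_univ (hF.smooth p hp).contDiffOn
    (hG.smooth p hp).contDiffOn (mem_univ t) i
  simp only [norm_iteratedFDeriv_eq_norm_iteratedDeriv] at h
  refine h.trans ?_
  rw [Finset.sum_mul]
  refine Finset.sum_le_sum fun j hj => ?_
  have hj' : j ≤ i := Nat.lt_succ_iff.1 (Finset.mem_range.1 hj)
  have h1 := hCF j p hp t ht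
  have h2 := hCG (i - j) p hp t ht
  calc (i.choose j : ℝ) * ‖iteratedDeriv j (F p) t‖ * ‖iteratedDeriv (i - j) (G p) t‖
      ≤ (i.choose j : ℝ) * (CF j * r p ^ (e + j)) * (CG (i - j) * r p ^ (e' + (i - j))) :=
        mul_le_mul (mul_le_mul_of_nonneg_left h1 (Nat.cast_nonneg _)) h2 (norm_nonneg _)
          (mul_nonneg (Nat.cast_nonneg _) ((norm_nonneg _).trans h1))
    _ = (i.choose j : ℝ) * CF j * CG (i - j) * (r p ^ (e + j) * r p ^ (e' + (i - j))) := by ring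
    _ = _ := by rw [← pow_add, show e + j + (e' + (i - j)) = e + e' + i by omega]

theorem IsRough.deriv_family {F : X → ℝ → ℂ} {e : ℕ} (hF : IsRough A r T e F) :
    IsRough A r T (e + 1) fun p => deriv (F p) := by
  refine ⟨fun p hp => (contDiff_infty_iff_deriv.1 (hF.smooth p hp)).2, fun i => ?_⟩
  obtain ⟨C, hC0, hC⟩ := hF.bound (i + 1)
  refine ⟨C, hC0, fun p hp t ht => ?_⟩
  rw [← iteratedDeriv_succ', show e + 1 + i = e + (i + 1) by ring]
  exact hC p hp t ht

/-- A smooth function equal to `1/s` for `|s| ≥ c`. -/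
def regInv (c : ℝ) (hc : 0 < c) (s : ℝ) : ℝ := s / (s ^ 2 + cutoff c hc s)

theorem regInv_denom_pos {c : ℝ} (hc : 0 < c) (s : ℝ) : 0 < s ^ 2 + cutoff c hc s := by
  rcases eq_or_ne s 0 with rfl | hs
  · rw [cutoff_eq_one hc (by simpa using hc)]
    norm_num
  · have := (cutoff c hc).nonneg (x := s)
    have := sq_pos_of_ne_zero hs
    linarith

theorem contDiff_regInv {c : ℝ} (hc : 0 < c) : ContDiff ℝ ∞ (regInv c hc) :=
  contDiff_id.div ((contDiff_id.pow 2).add (cutoff c hc).contDiff)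
    fun s => (regInv_denom_pos hc s).ne'

theorem regInv_mul {c : ℝ} (hc : 0 < c) {s : ℝ} (hs : c ≤ |s|) : regInv c hc s * s = 1 := by
  have h0 : s ≠ 0 := abs_pos.1 (hc.trans_le hs)
  rw [regInv, cutoff_eq_zero hc hs, add_zero]
  field_simp

/-- Serves as `1/Θ'` on the support of the amplitude while remaining smooth everywhere. Its
derivatives are bounded, so it costs no power of `r`. -/
theorem isRough_regInv {c : ℝ} (hc : 0 < c) {Θ : X → ℝ → ℝ} (hr : ∀ p ∈ A, 1 ≤ r p)
    (hΘ : ∀ p ∈ A, ContDiff ℝ ∞ (Θ p))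
    (hΘb : ∀ i : ℕ, ∃ C : ℝ, ∀ p ∈ A, ∀ t ∈ T, |iteratedDeriv i (Θ p) t| ≤ C) :
    IsRough A r T 0 fun p t => (regInv c hc (deriv (Θ p) t) : ℂ) := by
  have hd : ∀ p ∈ A, ContDiff ℝ ∞ (deriv (Θ p)) := fun p hp =>
    (contDiff_infty_iff_deriv.1 (hΘ p hp)).2
  have hg : ContDiff ℝ ∞ fun s => (regInv c hc s : ℂ) :=
    Complex.ofRealCLM.contDiff.comp (contDiff_regInv hc)
  refine ⟨fun p hp => hg.comp (hd p hp), fun n => ?_⟩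
  choose C hC using hΘb
  have hgb : ∀ i, ∃ c' : ℝ, ∀ s ∈ Icc (-|C 1|) |C 1|,
      ‖iteratedFDeriv ℝ i (fun s => (regInv c hc s : ℂ)) s‖ ≤ c' := fun i =>
    isCompact_Icc.exists_bound_of_continuousOn
      (hg.continuous_iteratedFDeriv (by exact_mod_cast le_top)).continuousOn
  choose c' hc' using hgb
  set R : ℝ := 1 + ∑ i ∈ Finset.range (n + 1), |C (i + 1)| with hR
  have hR1 : 1 ≤ R := by
    have : 0 ≤ ∑ i ∈ Finset.range (n + 1), |C (i + 1)| := Finset.sum_nonneg fun _ _ => abs_nonneg _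
    linarith
  refine ⟨n.factorial * (∑ i ∈ Finset.range (n + 1), |c' i|) * R ^ n, ?_, fun p hp t ht => ?_⟩
  · have : 0 ≤ ∑ i ∈ Finset.range (n + 1), |c' i| := Finset.sum_nonneg fun _ _ => abs_nonneg _
    positivity
  · have h := norm_iteratedFDeriv_comp_le_of_isOpen isOpen_univ isOpen_univ hg.contDiffOn
      (hd p hp).contDiffOn (mapsTo_univ _ _) (mem_univ t) (n := n)
      (C := ∑ i ∈ Finset.range (n + 1), |c' i|) (R := R) (fun i hi => ?_) (fun i h1 hi => ?_)
    · rw [norm_iteratedFDeriv_eq_norm_iteratedDeriv] at h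
      refine h.trans (le_mul_of_one_le_right ((norm_nonneg _).trans h) (one_le_pow₀ (hr p hp)))
    · have h1 : |deriv (Θ p) t| ≤ |C 1| := by
        have := hC 1 p hp t ht
        rw [iteratedDeriv_one] at this
        exact this.trans (le_abs_self _)
      refine (hc' i _ (abs_le.1 h1)).trans ((le_abs_self _).trans ?_)
      exact Finset.single_le_sum (f := fun i => |c' i|) (fun _ _ => abs_nonneg _)
        (Finset.mem_range.2 (by omega))
    · rw [norm_iteratedFDeriv_eq_norm_iteratedDeriv, ← iteratedDeriv_succ', Real.norm_eq_abs]
      refine ((hC _ p hp t ht).trans (le_abs_self _)).trans (le_trans ?_ (le_self_pow₀ hR1 (by omega)))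
      have := Finset.single_le_sum (f := fun i => |C (i + 1)|) (fun _ _ => abs_nonneg _)
        (Finset.mem_range.2 (show i < n + 1 by omega))
      linarith

/-- The principle of nonstationary phase. -/
theorem nonstationary_phase {k : X → ℝ} {Θ : X → ℝ → ℝ} {a a' b b' c : ℝ} (hc : 0 < c)
    (hk : ∀ p ∈ A, 0 < k p) (hr : ∀ p ∈ A, 1 ≤ r p) (hΘ : ∀ p ∈ A, ContDiff ℝ ∞ (Θ p))
    (hΘb : ∀ i : ℕ, ∃ C : ℝ, ∀ p ∈ A, ∀ t ∈ uIcc a b, |iteratedDeriv i (Θ p) t| ≤ C)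
    (ha : a < a') (hb : b' < b) (n : ℕ) : ∀ (e : ℕ) (F : X → ℝ → ℂ), IsRough A r (uIcc a b) e F →
    (∀ p ∈ A, ∀ t, |deriv (Θ p) t| < c → F p t = 0) →
    (∀ p ∈ A, ∀ t ∉ Icc a' b', F p t = 0) →
    ∃ C : ℝ, ∀ p ∈ A,
      ‖∫ t in a..b, Complex.exp (Complex.I * ((k p * Θ p t : ℝ) : ℂ)) * F p t‖ ≤
        C * (r p ^ e * (r p / k p) ^ n) := by
  induction n with
  | zero =>
    intro e F hF _ _
    obtain ⟨C, hC0, hC⟩ := hF.bound 0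
    refine ⟨C * |b - a|, fun p hp => ?_⟩
    refine (intervalIntegral.norm_integral_le_of_norm_le_const
      (C := C * r p ^ e) fun t ht => ?_).trans_eq (by simp; ring)
    rw [norm_mul, mul_comm Complex.I, Complex.norm_exp_ofReal_mul_I, one_mul]
    simpa using hC p hp t (uIoc_subset_uIcc ht)
  | succ n ih =>
    intro e F hF h1 h2
    -- Integration by parts replaces `F` by the derivative of `F/Θ'`: one factor `r` is lost and one
    -- factor `1/k` is gained. The induction therefore runs over all orders `e`.
    have hG := (isRough_regInv hc hr hΘ hΘb).mul hF
    have hG' := hG.deriv_family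
    rw [zero_add] at hG'
    set G : X → ℝ → ℂ := fun p t => (regInv c hc (deriv (Θ p) t) : ℂ) * F p t with hGdef
    have hz1 : ∀ p ∈ A, ∀ t, |deriv (Θ p) t| < c → deriv (G p) t = 0 := by
      intro p hp t ht
      have hcont : Continuous (deriv (Θ p)) := (contDiff_infty_iff_deriv.1 (hΘ p hp)).2.continuous
      have hev : G p =ᶠ[𝓝 t] fun _ => 0 := by
        filter_upwards [(isOpen_lt hcont.abs continuous_const).mem_nhds ht] with s hs
        simp [hGdef, h1 p hp s hs]
      rw [hev.deriv_eq, deriv_const]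
    have hz2 : ∀ p ∈ A, ∀ t ∉ Icc a' b', deriv (G p) t = 0 := by
      intro p hp t ht
      have hev : G p =ᶠ[𝓝 t] fun _ => 0 := by
        filter_upwards [isClosed_Icc.isOpen_compl.mem_nhds ht] with s hs
        simp [hGdef, h2 p hp s hs]
      rw [hev.deriv_eq, deriv_const]
    obtain ⟨C, hC⟩ := ih (e + 1) (fun p => deriv (G p)) hG' hz1 hz2
    refine ⟨C, fun p hp => ?_⟩
    have hkp := hk p hp
    have hkc : (k p : ℂ) ≠ 0 := by exact_mod_cast hkp.ne'
    set E : ℝ → ℂ := fun t => Complex.exp (Complex.I * ((k p * Θ p t : ℝ) : ℂ)) with hE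
    have hEs : ContDiff ℝ ∞ E :=
      (contDiff_const.mul (Complex.ofRealCLM.contDiff.comp (contDiff_const.mul (hΘ p hp)))).cexp
    have hEd : ∀ t, HasDerivAt E (Complex.I * k p * (E t * (deriv (Θ p) t : ℝ))) t := by
      intro t
      have h3 : HasDerivAt (Θ p) (deriv (Θ p) t) t :=
        ((hΘ p hp).differentiable (by simp) t).hasDerivAt
      refine (((h3.const_mul (k p)).ofReal_comp).const_mul Complex.I).cexp.congr_deriv ?_
      simp only [hE]
      push_cast
      ring
    have hGs := hG.smooth p hp
    have hG's := hG'.smooth p hp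
    have hibp := intervalIntegral.integral_mul_deriv_eq_deriv_mul (a := a) (b := b) (u := E)
      (v := G p) (u' := fun t => Complex.I * k p * (E t * (deriv (Θ p) t : ℝ)))
      (v' := deriv (G p)) (fun t _ => hEd t)
      (fun t _ => (hGs.differentiable (by simp) t).hasDerivAt)
      (Continuous.intervalIntegrable (continuous_const.mul (hEs.continuous.mul
        (Complex.continuous_ofReal.comp (contDiff_infty_iff_deriv.1 (hΘ p hp)).2.continuous))) _ _)
      (hG's.continuous.intervalIntegrable _ _)
    have hGa : G p a = 0 := by simp [hGdef, h2 p hp a (fun h => by linarith [h.1])]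
    have hGb : G p b = 0 := by simp [hGdef, h2 p hp b (fun h => by linarith [h.2])]
    rw [hGa, hGb, mul_zero, mul_zero, sub_zero, zero_sub] at hibp
    -- Where the regularised inverse is not `1/Θ'`, the amplitude vanishes.
    have hmul : ∀ t, Complex.I * k p * (E t * (deriv (Θ p) t : ℝ)) * G p t =
        Complex.I * k p * (E t * F p t) := by
      intro t
      rcases lt_or_ge |deriv (Θ p) t| c with h | h
      · simp [hGdef, h1 p hp t h]
      · have h3 : ((regInv c hc (deriv (Θ p) t) : ℝ) : ℂ) * (deriv (Θ p) t : ℝ) = 1 := by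
          exact_mod_cast regInv_mul hc h
        simp only [hGdef]
        linear_combination (Complex.I * k p * E t * F p t) * h3
    simp only [hmul] at hibp
    rw [intervalIntegral.integral_const_mul] at hibp
    have hfin : ‖∫ t in a..b, E t * F p t‖ * k p = ‖∫ t in a..b, E t * deriv (G p) t‖ := by
      rw [hibp, norm_neg, norm_mul, norm_mul, Complex.norm_I, Complex.norm_real,
        Real.norm_of_nonneg hkp.le]
      ring
    have h4 : ‖∫ t in a..b, E t * deriv (G p) t‖ ≤ C * (r p ^ (e + 1) * (r p / k p) ^ n) := hC p hp
    rw [← hfin, ← le_div_iff₀ hkp] at h4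
    refine h4.trans_eq ?_
    rw [div_pow, div_pow]
    field_simp
    ring

end Nonstationary

/-! ### Reflections in the plane -/

section PlaneGeometry

theorem plane_inner (v w : Plane) : ⟪v, w⟫ = v 0 * w 0 + v 1 * w 1 := by
  simp [PiLp.inner_apply, Fin.sum_univ_two]
  ring

theorem inner_rot_self (v : Plane) : ⟪v, rot v⟫ = 0 := by
  simp [plane_inner, rot]
  ring

theorem inner_rot_rot (v w : Plane) : ⟪rot v, rot w⟫ = ⟪v, w⟫ := by
  simp [plane_inner, rot]
  ring

theorem norm_rot (v : Plane) : ‖rot v‖ = ‖v‖ := by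
  have h : ‖rot v‖ ^ 2 = ‖v‖ ^ 2 := by
    rw [← real_inner_self_eq_norm_sq, ← real_inner_self_eq_norm_sq, inner_rot_rot]
  exact (sq_eq_sq₀ (norm_nonneg _) (norm_nonneg _)).1 h

theorem contDiff_rot : ContDiff ℝ ∞ rot := by
  rw [contDiff_euclidean]
  intro i
  fin_cases i
  · simp only [rot]
    simpa using (EuclideanSpace.proj (𝕜 := ℝ) (1 : Fin 2)).contDiff
  · simp only [rot]
    simpa using (EuclideanSpace.proj (𝕜 := ℝ) (0 : Fin 2)).contDiff.neg

theorem eq_add_rot {τ : Plane} (hτ : ‖τ‖ = 1) (v : Plane) :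
    v = ⟪v, τ⟫ • τ + ⟪v, rot τ⟫ • rot τ := by
  have h : τ 0 * τ 0 + τ 1 * τ 1 = 1 := by
    rw [← plane_inner, real_inner_self_eq_norm_sq, hτ, one_pow]
  ext i
  fin_cases i
  · simp [plane_inner, rot]
    linear_combination (-(v 0)) * h
  · simp [plane_inner, rot]
    linear_combination (-(v 1)) * h

theorem inner_eq_add_rot {τ : Plane} (hτ : ‖τ‖ = 1) (v w : Plane) :
    ⟪v, w⟫ = ⟪v, τ⟫ * ⟪w, τ⟫ + ⟪v, rot τ⟫ * ⟪w, rot τ⟫ := by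
  conv_lhs => rw [eq_add_rot hτ v]
  rw [inner_add_left, inner_smul_left, inner_smul_left, real_inner_comm w τ, real_inner_comm w (rot τ)]
  simp

theorem inner_reflect_tangent {v n τ : Plane} (h : ⟪n, τ⟫ = 0) : ⟪reflect v n, τ⟫ = ⟪v, τ⟫ := by
  rw [reflect, inner_sub_left, inner_smul_left, h, mul_zero, sub_zero]

theorem inner_reflect_normal {v n : Plane} (hn : ‖n‖ = 1) : ⟪reflect v n, n⟫ = -⟪v, n⟫ := by
  rw [reflect, inner_sub_left, inner_smul_left, real_inner_self_eq_norm_sq, hn]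
  simp
  ring

theorem norm_reflect {v n : Plane} (hn : ‖n‖ = 1) : ‖reflect v n‖ = ‖v‖ := by
  have h : ‖reflect v n‖ ^ 2 = ‖v‖ ^ 2 := by
    rw [reflect, norm_sub_sq_real, inner_smul_right, norm_smul, hn, Real.norm_eq_abs, mul_one,
      sq_abs]
    ring
  exact (sq_eq_sq₀ (norm_nonneg _) (norm_nonneg _)).1 h

theorem norm_unitVec {v : Plane} (hv : v ≠ 0) : ‖unitVec v‖ = 1 := by
  rw [unitVec, norm_smul, norm_inv, norm_norm, inv_mul_cancel₀ (norm_ne_zero_iff.2 hv)]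

theorem norm_smul_unitVec (v : Plane) : ‖v‖ • unitVec v = v := by
  rcases eq_or_ne v 0 with rfl | hv
  · simp [unitVec]
  · rw [unitVec, smul_smul, mul_inv_cancel₀ (norm_ne_zero_iff.2 hv), one_smul]

theorem unitVec_smul {e : Plane} (he : ‖e‖ = 1) {t : ℝ} (ht : 0 < t) : unitVec (t • e) = e := by
  rw [unitVec, norm_smul, he, Real.norm_of_nonneg ht.le, mul_one, smul_smul,
    inv_mul_cancel₀ ht.ne', one_smul]

theorem eq_of_inner_eq_one {u v : Plane} (hu : ‖u‖ = 1) (hv : ‖v‖ = 1) (h : ⟪u, v⟫ = 1) :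
    u = v := (inner_eq_one_iff_of_norm_eq_one hu hv).1 h

theorem inner_le_one {u v : Plane} (hu : ‖u‖ = 1) (hv : ‖v‖ = 1) : ⟪u, v⟫ ≤ 1 := by
  simpa [hu, hv] using real_inner_le_norm u v

/-- A unit vector with the same tangential component as `i` is `i` or its reflection. -/
theorem eq_or_eq_reflect {τ d i : Plane} (hτ : ‖τ‖ = 1) (hd : ‖d‖ = 1) (hi : ‖i‖ = 1)
    (h : ⟪d, τ⟫ = ⟪i, τ⟫) : d = i ∨ d = reflect i (rot τ) := by
  have h1 := inner_eq_add_rot hτ d d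
  have h2 := inner_eq_add_rot hτ i i
  rw [real_inner_self_eq_norm_sq, hd] at h1
  rw [real_inner_self_eq_norm_sq, hi] at h2
  have h3 : ⟪d, rot τ⟫ * ⟪d, rot τ⟫ = ⟪i, rot τ⟫ * ⟪i, rot τ⟫ := by
    rw [h] at h1
    linarith
  rcases mul_self_eq_mul_self_iff.1 h3 with h4 | h4
  · left
    rw [eq_add_rot hτ d, eq_add_rot hτ i, h, h4]
  · right
    have e := eq_add_rot hτ i
    calc d = (⟪i, τ⟫ • τ + ⟪i, rot τ⟫ • rot τ) - (2 * ⟪i, rot τ⟫) • rot τ := by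
          rw [eq_add_rot hτ d, h, h4]
          module
      _ = reflect i (rot τ) := by rw [← e, reflect]

end PlaneGeometry

/-! ### Boundary geometry of a strictly convex obstacle -/

namespace Obstacle

variable (O : Obstacle)

theorem γ_mem_frontier (s : ℝ) : O.γ s ∈ frontier O.carrier := O.range_eq ▸ mem_range_self s

theorem frontier_subset : frontier O.carrier ⊆ O.carrier := O.isCompact.isClosed.frontier_subset

theorem γ_mem (s : ℝ) : O.γ s ∈ O.carrier := O.frontier_subset (O.γ_mem_frontier s)

theorem nonempty : O.carrier.Nonempty := ⟨_, O.γ_mem 0⟩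

theorem exists_of_mem_frontier {y : Plane} (hy : y ∈ frontier O.carrier) : ∃ s, O.γ s = y := by
  rwa [← O.range_eq] at hy

theorem exists_int_of_γ_eq {s s' : ℝ} (h : O.γ s = O.γ s') : ∃ n : ℤ, s' = s + n * O.period := by
  have hP := O.period_pos
  have h1 : ∀ s, O.γ (toIcoMod hP 0 s) = O.γ s := fun s => by
    rw [toIcoMod, O.periodic.sub_zsmul_eq]
  have h2 : toIcoMod hP 0 s = toIcoMod hP 0 s' := by
    refine O.injOn ?_ ?_ (by rw [h1, h1, h])
    · simpa using toIcoMod_mem_Ico hP 0 s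
    · simpa using toIcoMod_mem_Ico hP 0 s'
  refine ⟨toIcoDiv hP 0 s' - toIcoDiv hP 0 s, ?_⟩
  rw [toIcoMod, toIcoMod, zsmul_eq_mul, zsmul_eq_mul] at h2
  push_cast
  linarith

theorem γ_param {y : Plane} (hy : y ∈ frontier O.carrier) : O.γ (O.param y) = y := by
  obtain ⟨s, rfl⟩ := O.exists_of_mem_frontier hy
  refine Function.invFunOn_eq ⟨toIcoMod O.period_pos 0 s, ?_, ?_⟩
  · simpa using toIcoMod_mem_Ico O.period_pos 0 s
  · rw [toIcoMod, O.periodic.sub_zsmul_eq]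

theorem periodic_deriv : Function.Periodic (deriv O.γ) O.period := fun s => by
  rw [← deriv_comp_add_const]
  congr 1
  ext1 t
  exact O.periodic t

theorem normal_γ (s : ℝ) : O.normal (O.γ s) = rot (deriv O.γ s) := by
  obtain ⟨n, hn⟩ := O.exists_int_of_γ_eq (O.γ_param (O.γ_mem_frontier s))
  have h : deriv O.γ s = deriv O.γ (O.param (O.γ s)) := by
    conv_lhs => rw [hn]
    exact O.periodic_deriv.int_mul n _
  rw [normal, h]

theorem norm_normal_γ (s : ℝ) : ‖O.normal (O.γ s)‖ = 1 := by
  rw [normal_γ, norm_rot, O.unit_speed]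

theorem norm_normal {y : Plane} (hy : y ∈ frontier O.carrier) : ‖O.normal y‖ = 1 := by
  obtain ⟨s, rfl⟩ := O.exists_of_mem_frontier hy
  exact O.norm_normal_γ s

theorem inner_normal_γ_deriv (s : ℝ) : ⟪O.normal (O.γ s), deriv O.γ s⟫ = 0 := by
  rw [normal_γ, real_inner_comm, inner_rot_self]

theorem inner_normal_nonpos {y z : Plane} (hy : y ∈ frontier O.carrier) (hz : z ∈ O.carrier) :
    ⟪z - y, O.normal y⟫ ≤ 0 := by
  obtain ⟨s, rfl⟩ := O.exists_of_mem_frontier hy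
  rw [normal_γ]
  exact O.outward s z hz

/-- The midpoint of two distinct points is interior, so it can be pushed a little along the normal
and still satisfies the nonstrict inequality. -/
theorem inner_normal_neg {y z : Plane} (hy : y ∈ frontier O.carrier) (hz : z ∈ O.carrier)
    (hne : z ≠ y) : ⟪z - y, O.normal y⟫ < 0 := by
  have hmid := O.strictConvex hz (O.frontier_subset hy) hne (a := 1 / 2) (b := 1 / 2)
    (by norm_num) (by norm_num) (by norm_num)
  obtain ⟨ε, hε, hball⟩ := Metric.isOpen_iff.1 isOpen_interior _ hmid
  have hn := O.norm_normal hy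
  have h1 : (1 / 2 : ℝ) • z + (1 / 2 : ℝ) • y + (ε / 2) • O.normal y ∈ O.carrier := by
    refine interior_subset (hball ?_)
    rw [Metric.mem_ball, dist_eq_norm, add_sub_cancel_left, norm_smul, hn, mul_one,
      Real.norm_of_nonneg (by positivity)]
    linarith
  have h2 := O.inner_normal_nonpos hy h1
  have h3 : (1 / 2 : ℝ) • z + (1 / 2 : ℝ) • y + (ε / 2) • O.normal y - y =
      (1 / 2 : ℝ) • (z - y) + (ε / 2) • O.normal y := by module
  rw [h3, inner_add_left, inner_smul_left, inner_smul_left, real_inner_self_eq_norm_sq, hn] at h2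
  simp at h2
  linarith

theorem hasDerivAt_γ (s : ℝ) : HasDerivAt O.γ (deriv O.γ s) s :=
  (O.smooth.differentiable (by simp) s).hasDerivAt

theorem contDiff_deriv_γ : ContDiff ℝ ∞ (deriv O.γ) := (contDiff_infty_iff_deriv.1 O.smooth).2

theorem contDiff_normal_γ : ContDiff ℝ ∞ fun s => O.normal (O.γ s) := by
  simp only [normal_γ]
  exact contDiff_rot.comp O.contDiff_deriv_γ

/-- The curvature has the sign of a convex curve. -/
theorem inner_normal_deriv_deriv_nonpos (s : ℝ) :
    ⟪O.normal (O.γ s), deriv (deriv O.γ) s⟫ ≤ 0 := by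
  set n := O.normal (O.γ s) with hn
  have hd : ∀ t, HasDerivAt (fun t => ⟪n, O.γ t⟫) ⟪n, deriv O.γ t⟫ t := fun t => by
    simpa using (hasDerivAt_const t n).inner ℝ (O.hasDerivAt_γ t)
  have hd2 : HasDerivAt (fun t => ⟪n, deriv O.γ t⟫) ⟪n, deriv (deriv O.γ) s⟫ s := by
    simpa using (hasDerivAt_const s n).inner ℝ
      ((O.contDiff_deriv_γ.differentiable (by simp) s).hasDerivAt)
  by_contra! hcon
  have hderiv : deriv (fun t => ⟪n, O.γ t⟫) = fun t => ⟪n, deriv O.γ t⟫ := funext fun t => (hd t).deriv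
  have hmin : IsLocalMin (fun t => ⟪n, O.γ t⟫) s :=
    isLocalMin_of_deriv_deriv_pos (by rw [hderiv, hd2.deriv]; exact hcon)
      (by rw [hderiv]; exact O.inner_normal_γ_deriv s) (hd s).continuousAt
  -- The height over the tangent line has its strict global maximum at the point of contact. If it
  -- also had a local minimum there, `γ` would be locally constant, against unit speed.
  have hloc : ∀ᶠ t in 𝓝 s, O.γ t = O.γ s := by
    filter_upwards [hmin] with t ht
    by_contra hne
    have := O.inner_normal_neg (O.γ_mem_frontier s) (O.γ_mem t) hne
    rw [← hn, inner_sub_left, real_inner_comm, real_inner_comm n (O.γ s)] at this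
    linarith
  have h0 : deriv O.γ s = 0 := by
    have : O.γ =ᶠ[𝓝 s] fun _ => O.γ s := hloc
    rw [this.deriv_eq, deriv_const]
  have := O.unit_speed s
  rw [h0, norm_zero] at this
  exact zero_ne_one this

end Obstacle

/-! ### Multiply reflected rays: monotonicity and uniqueness -/

/-- The standing assumptions on the incident direction and on the sequence of obstacles. -/
structure Admissible (K : ℕ → Obstacle) (α : Plane) : Prop where
  unit : ‖α‖ = 1
  disjoint : ∀ j, Disjoint (K j).carrier (K (j + 1)).carrier
  noOcclusion : NoOcclusion K α
  visibility : Visibility K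

/-- `IncRay K α m x e φ`: a ray reflected successively at illuminated points of
`∂K_0, …, ∂K_{m-1}` passes through `x` with direction `e` and phase `φ`. -/
inductive IncRay (K : ℕ → Obstacle) (α : Plane) : ℕ → Plane → Plane → ℝ → Prop
  | zero (x : Plane) : IncRay K α 0 x α ⟪α, x⟫
  | succ (m : ℕ) (y i : Plane) (φ t : ℝ) (hy : y ∈ frontier (K m).carrier)
      (h : IncRay K α m y i φ) (hi : ⟪i, (K m).normal y⟫ < 0) (ht : 0 < t) :
      IncRay K α (m + 1) (y + t • reflect i ((K m).normal y)) (reflect i ((K m).normal y)) (φ + t)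

variable {K : ℕ → Obstacle} {α : Plane}

theorem incRay_zero_iff {x e : Plane} {φ : ℝ} :
    IncRay K α 0 x e φ ↔ e = α ∧ φ = ⟪α, x⟫ := by
  constructor
  · intro h
    cases h
    exact ⟨rfl, rfl⟩
  · rintro ⟨rfl, rfl⟩
    exact .zero x

theorem incRay_succ_iff {m : ℕ} {x e : Plane} {φ : ℝ} :
    IncRay K α (m + 1) x e φ ↔ ∃ y ∈ frontier (K m).carrier, ∃ i φ' t,
      IncRay K α m y i φ' ∧ ⟪i, (K m).normal y⟫ < 0 ∧ 0 < t ∧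
        e = reflect i ((K m).normal y) ∧ x = y + t • e ∧ φ = φ' + t := by
  constructor
  · intro h
    cases h with
    | succ _ y i φ' t hy h hi ht => exact ⟨y, hy, i, φ', t, h, hi, ht, rfl, rfl, rfl⟩
  · rintro ⟨y, hy, i, φ', t, h, hi, ht, rfl, rfl, rfl⟩
    exact .succ m y i φ' t hy h hi ht

theorem IncRay.norm_eq_one (hα : ‖α‖ = 1) {m : ℕ} {x e : Plane} {φ : ℝ}
    (h : IncRay K α m x e φ) : ‖e‖ = 1 := by
  induction h with
  | zero => exact hα
  | succ m y i φ t hy h hi ht ih => rw [norm_reflect ((K m).norm_normal hy), ih]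

theorem IncRay.forward {m : ℕ} {x e : Plane} {φ : ℝ} (h : IncRay K α m x e φ) {s : ℝ}
    (hs : 0 ≤ s) : ∃ φ', IncRay K α m (x + s • e) e φ' := by
  cases h with
  | zero => exact ⟨_, .zero _⟩
  | succ m y i φ t hy h hi ht =>
    refine ⟨φ + (t + s), ?_⟩
    rw [add_assoc, ← add_smul]
    exact .succ m y i φ (t + s) hy h hi (by linarith)

/-- The reflection adds two terms to `⟪i - i', y - y'⟫`, each a product of two nonpositive numbers:
the ray comes in against the normal, and the other point lies behind the tangent line. Strict
convexity makes them positive when the points differ. -/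
theorem inner_reflect_sub {O : Obstacle} {y y' i i' : Plane} (hy : y ∈ frontier O.carrier)
    (hy' : y' ∈ frontier O.carrier) (hi : ⟪i, O.normal y⟫ < 0) (hi' : ⟪i', O.normal y'⟫ < 0)
    (hmono : 0 ≤ ⟪i - i', y - y'⟫) :
    0 ≤ ⟪reflect i (O.normal y) - reflect i' (O.normal y'), y - y'⟫ ∧
      (y ≠ y' → 0 < ⟪reflect i (O.normal y) - reflect i' (O.normal y'), y - y'⟫) := by
  have h1 : ⟪reflect i (O.normal y) - reflect i' (O.normal y'), y - y'⟫ = ⟪i - i', y - y'⟫ +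
      2 * (⟪i, O.normal y⟫ * ⟪y' - y, O.normal y⟫) +
      2 * (⟪i', O.normal y'⟫ * ⟪y - y', O.normal y'⟫) := by
    simp only [reflect, inner_sub_left, inner_sub_right, inner_smul_left,
      real_inner_comm (O.normal y), real_inner_comm (O.normal y')]
    simp
    ring
  have h2 := mul_nonneg_of_nonpos_of_nonpos hi.le (O.inner_normal_nonpos hy (O.frontier_subset hy'))
  have h3 := mul_nonneg_of_nonpos_of_nonpos hi'.le
    (O.inner_normal_nonpos hy' (O.frontier_subset hy))
  refine ⟨by rw [h1]; linarith, fun hne => ?_⟩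
  have h4 := mul_pos_of_neg_of_neg hi (O.inner_normal_neg hy (O.frontier_subset hy') hne.symm)
  rw [h1]
  linarith

/-- Free flight: the added term is nonnegative for unit directions. -/
theorem inner_sub_add_smul {e e' y y' : Plane} (he : ‖e‖ = 1) (he' : ‖e'‖ = 1) (t t' : ℝ) :
    ⟪e - e', (y + t • e) - (y' + t' • e')⟫ = ⟪e - e', y - y'⟫ + (t + t') * (1 - ⟪e, e'⟫) := by
  have h1 : ⟪e, e⟫ = 1 := by rw [real_inner_self_eq_norm_sq, he, one_pow]
  have h2 : ⟪e', e'⟫ = 1 := by rw [real_inner_self_eq_norm_sq, he', one_pow]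
  simp only [inner_sub_left, inner_sub_right, inner_add_right, inner_smul_right, h1, h2,
    real_inner_comm e' e]
  ring

/-- The direction field of a family of multiply reflected rays is monotone. -/
theorem IncRay.monotone (hα : ‖α‖ = 1) {m : ℕ} {x e : Plane} {φ : ℝ} (h : IncRay K α m x e φ) :
    ∀ {x' e' : Plane} {φ' : ℝ}, IncRay K α m x' e' φ' → 0 ≤ ⟪e - e', x - x'⟫ := by
  induction h with
  | zero x =>
    intro x' e' φ' h'
    rw [(incRay_zero_iff.1 h').1, sub_self, inner_zero_left]
  | succ m y i φ t hy h hi ht ih =>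
    intro x' e' φ' h'
    obtain ⟨y', hy', i', φ'', t', h'', hi', ht', rfl, rfl, rfl⟩ := incRay_succ_iff.1 h'
    have hn1 : ‖reflect i ((K m).normal y)‖ = 1 := by
      rw [norm_reflect ((K m).norm_normal hy), h.norm_eq_one hα]
    have hn2 : ‖reflect i' ((K m).normal y')‖ = 1 := by
      rw [norm_reflect ((K m).norm_normal hy'), h''.norm_eq_one hα]
    rw [inner_sub_add_smul hn1 hn2]
    have h1 := (inner_reflect_sub hy hy' hi hi' (ih h'')).1
    have h2 := inner_le_one hn1 hn2
    have : 0 ≤ (t + t') * (1 - ⟪reflect i ((K m).normal y), reflect i' ((K m).normal y')⟫) :=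
      mul_nonneg (by linarith) (by linarith)
    linarith

/-- At a common point the monotone quantity is zero, but distinct reflection points would make it
positive. -/
theorem reflect_point_unique (hα : ‖α‖ = 1) {m : ℕ} {y y' i i' : Plane} {φ φ' t t' : ℝ}
    (hy : y ∈ frontier (K m).carrier) (hy' : y' ∈ frontier (K m).carrier)
    (h : IncRay K α m y i φ) (h' : IncRay K α m y' i' φ') (hi : ⟪i, (K m).normal y⟫ < 0)
    (hi' : ⟪i', (K m).normal y'⟫ < 0) (ht : 0 < t) (ht' : 0 < t')
    (heq : y + t • reflect i ((K m).normal y) = y' + t' • reflect i' ((K m).normal y')) :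
    y = y' := by
  by_contra hne
  have hn1 : ‖reflect i ((K m).normal y)‖ = 1 := by
    rw [norm_reflect ((K m).norm_normal hy), h.norm_eq_one hα]
  have hn2 : ‖reflect i' ((K m).normal y')‖ = 1 := by
    rw [norm_reflect ((K m).norm_normal hy'), h'.norm_eq_one hα]
  have h0 := inner_sub_add_smul (y := y) (y' := y') hn1 hn2 t t'
  rw [heq, sub_self, inner_zero_right] at h0
  have h1 := (inner_reflect_sub hy hy' hi hi' (h.monotone hα h')).2 hne
  have h2 := inner_le_one hn1 hn2
  have : 0 ≤ (t + t') * (1 - ⟪reflect i ((K m).normal y), reflect i' ((K m).normal y')⟫) :=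
    mul_nonneg (by linarith) (by linarith)
  linarith

theorem IncRay.unique (hα : ‖α‖ = 1) {m : ℕ} {x e : Plane} {φ : ℝ} (h : IncRay K α m x e φ) :
    ∀ {e' : Plane} {φ' : ℝ}, IncRay K α m x e' φ' → e = e' ∧ φ = φ' := by
  induction h with
  | zero x =>
    intro e' φ' h'
    exact ⟨(incRay_zero_iff.1 h').1.symm, (incRay_zero_iff.1 h').2.symm⟩
  | succ m y i φ t hy h hi ht ih =>
    intro e' φ' h'
    obtain ⟨y', hy', i', φ'', t', h'', hi', ht', rfl, heq, rfl⟩ := incRay_succ_iff.1 h'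
    obtain rfl := reflect_point_unique hα hy hy' h h'' hi hi' ht ht' heq
    obtain ⟨rfl, rfl⟩ := ih h''
    refine ⟨rfl, ?_⟩
    have hn1 : ‖reflect i ((K m).normal y)‖ = 1 := by
      rw [norm_reflect ((K m).norm_normal hy), h.norm_eq_one hα]
    have h0 : reflect i ((K m).normal y) ≠ 0 := fun h0 => by rw [h0, norm_zero] at hn1; linarith
    rw [smul_left_injective ℝ h0 (add_left_cancel heq)]

/-- A reflected ray does not meet the forward prolongation of another incident ray. -/
theorem IncRay.not_shadow (hα : ‖α‖ = 1) {m : ℕ} {y i y' i' : Plane} {φ φ' : ℝ}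
    (h : IncRay K α m y i φ) (h' : IncRay K α m y' i' φ') (hy : y ∈ frontier (K m).carrier)
    (hy' : y' ∈ frontier (K m).carrier) (hi : ⟪i, (K m).normal y⟫ < 0) {t s : ℝ} (ht : 0 < t)
    (hs : 0 < s) : y + t • reflect i ((K m).normal y) ≠ y' + s • i' := by
  intro heq
  set n := (K m).normal y with hn
  set e := reflect i n with he
  have hn1 : ‖n‖ = 1 := (K m).norm_normal hy
  have hen : 0 < ⟪e, n⟫ := by rw [he, inner_reflect_normal hn1]; linarith
  have he1 : ‖e‖ = 1 := by rw [he, norm_reflect hn1, h.norm_eq_one hα]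
  have hi1 : ‖i'‖ = 1 := h'.norm_eq_one hα
  have h1 : ⟪y' - y, n⟫ ≤ 0 := (K m).inner_normal_nonpos hy ((K m).frontier_subset hy')
  have h2 : ⟪y' - y, n⟫ + s * ⟪i', n⟫ = t * ⟪e, n⟫ := by
    have : ⟪(y' - y) + s • i', n⟫ = ⟪t • e, n⟫ := by
      congr 1
      rw [sub_add_eq_add_sub, ← heq]
      abel
    rwa [inner_add_left, inner_smul_left, inner_smul_left] at this
  have hin : 0 < ⟪i', n⟫ := by
    by_contra! hcon
    nlinarith [mul_pos ht hen, mul_nonneg hs.le (neg_nonneg.2 hcon)]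
  -- the point where the incident ray crosses the tangent line at `y`
  set s₁ := -⟪y' - y, n⟫ / ⟪i', n⟫ with hs₁
  have hs₁0 : 0 ≤ s₁ := div_nonneg (by linarith) hin.le
  have hs₁e : s₁ * ⟪i', n⟫ = -⟪y' - y, n⟫ := div_mul_cancel₀ _ hin.ne'
  have ha : 0 < s - s₁ := by
    have : 0 < (s - s₁) * ⟪i', n⟫ := by
      rw [sub_mul, hs₁e]
      linarith [mul_pos ht hen]
    exact (pos_iff_pos_of_mul_pos this).2 hin
  obtain ⟨ψ, hq⟩ := h'.forward hs₁0
  set q := y' + s₁ • i' with hqdef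
  have hqy : q - y = t • e - (s - s₁) • i' := by
    have : q = y + t • e - (s - s₁) • i' := by rw [heq, hqdef]; module
    rw [this]
    abel
  have hqn : ⟪q - y, n⟫ = 0 := by
    rw [hqdef, add_sub_right_comm, inner_add_left, inner_smul_left]
    simp only [conj_trivial]
    linarith
  have hmono := hq.monotone hα h
  -- `q - y` is tangential, so it does not see the difference between `i` and its reflection `e`.
  have hei : ⟪i' - i, q - y⟫ = ⟪i' - e, q - y⟫ := by
    have : i' - e = (i' - i) + (2 * ⟪i, n⟫) • n := by rw [he, reflect]; abel
    rw [this, inner_add_left, inner_smul_left, real_inner_comm, real_inner_comm (q - y) n, hqn]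
    simp
  have hee : ⟪e, e⟫ = 1 := by rw [real_inner_self_eq_norm_sq, he1, one_pow]
  have hii : ⟪i', i'⟫ = 1 := by rw [real_inner_self_eq_norm_sq, hi1, one_pow]
  have hval : ⟪i' - e, q - y⟫ = (t + (s - s₁)) * (⟪i', e⟫ - 1) := by
    rw [hqy, inner_sub_left, inner_sub_right, inner_sub_right, inner_smul_right, inner_smul_right,
      inner_smul_right, inner_smul_right, hee, hii, real_inner_comm i' e]
    ring
  rw [hei, hval] at hmono
  have hc1 := inner_le_one hi1 he1
  -- Monotonicity leaves only `i' = e` and hence `q = y`. Then `i` and `e` are both incident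
  -- directions at `y`, contrary to their signs against the normal.
  have hc : ⟪i', e⟫ = 1 := by
    have := nonneg_of_mul_nonneg_right hmono (by linarith)
    linarith
  have hie := eq_of_inner_eq_one hi1 he1 hc
  have hts : t - (s - s₁) = 0 := by
    have : (t - (s - s₁)) * ⟪e, n⟫ = 0 := by
      rw [← hqn, hqy, hie, ← sub_smul, inner_smul_left]
      simp
    exact (mul_eq_zero.1 this).resolve_right hen.ne'
  have hqy' : q = y := by
    rw [← sub_eq_zero, hqy, hie, ← sub_smul, hts, zero_smul]
  rw [hqy'] at hq
  have := (h.unique hα hq).1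
  rw [this, hie] at hi
  linarith

/-! ### Existence of rays by Fermat's principle -/

variable {K : ℕ → Obstacle} {α : Plane}

/-- The least travel time from the incident wave to `x` along `m` intermediate obstacles. -/
def travelTime (K : ℕ → Obstacle) (α : Plane) : ℕ → Plane → ℝ
  | 0 => fun x => ⟪α, x⟫
  | m + 1 => fun x => sInf ((fun y => travelTime K α m y + ‖x - y‖) '' (K m).carrier)

theorem continuous_travelTime (m : ℕ) : Continuous (travelTime K α m) := by
  induction m with
  | zero => simp only [travelTime]; fun_prop
  | succ m ih =>
    simp only [travelTime]
    refine (K m).isCompact.continuous_sInf (f := fun x y => travelTime K α m y + ‖x - y‖) ?_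
    exact (ih.comp continuous_snd).add (by fun_prop)

theorem travelTime_succ_le {m : ℕ} (x : Plane) {y : Plane} (hy : y ∈ (K m).carrier) :
    travelTime K α (m + 1) x ≤ travelTime K α m y + ‖x - y‖ := by
  refine csInf_le (((K m).isCompact.image ?_).bddBelow) (mem_image_of_mem _ hy)
  exact (continuous_travelTime m).add (by fun_prop)

theorem exists_travelTime_succ_eq (m : ℕ) (x : Plane) :
    ∃ y ∈ (K m).carrier, travelTime K α (m + 1) x = travelTime K α m y + ‖x - y‖ := by
  have hc : Continuous fun y => travelTime K α m y + ‖x - y‖ :=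
    (continuous_travelTime m).add (by fun_prop)
  obtain ⟨y, hy, h⟩ := ((K m).isCompact.image hc).sInf_mem ((K m).nonempty.image _)
  exact ⟨y, hy, h.symm⟩

theorem unitVec_neg (v : Plane) : unitVec (-v) = -unitVec v := by
  rw [unitVec, unitVec, norm_neg, smul_neg]

theorem hasFDerivAt_norm_sub_left {x y : Plane} (hxy : x ≠ y) :
    HasFDerivAt (fun z : Plane => ‖z - y‖) (innerSL ℝ (unitVec (x - y))) x := by
  have h := hasFDerivAt_norm_sub hxy.symm
  rw [← neg_sub x y, unitVec_neg, map_neg, neg_neg] at h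
  simpa only [norm_sub_rev y] using h

/-- The first order condition for reflection. -/
theorem eq_reflect_of_inner_nonneg {O : Obstacle} {y i e : Plane} (hy : y ∈ O.carrier)
    (hi : ‖i‖ = 1) (he : ‖e‖ = 1) (hne : i ≠ e) (h : ∀ z ∈ O.carrier, 0 ≤ ⟪i - e, z - y⟫) :
    y ∈ frontier O.carrier ∧ e = reflect i (O.normal y) ∧ ⟪i, O.normal y⟫ < 0 := by
  have hw : i - e ≠ 0 := sub_ne_zero.2 hne
  have hfr : y ∈ frontier O.carrier := by
    rw [O.isCompact.isClosed.frontier_eq]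
    refine ⟨hy, fun hint => ?_⟩
    obtain ⟨ε, hε, hball⟩ := Metric.isOpen_iff.1 isOpen_interior _ hint
    have hpos : 0 < ‖i - e‖ := norm_pos_iff.2 hw
    have hz : y - (ε / 2 / ‖i - e‖) • (i - e) ∈ O.carrier := by
      refine interior_subset (hball ?_)
      rw [Metric.mem_ball, dist_eq_norm, sub_sub_cancel_left, norm_neg, norm_smul,
        Real.norm_of_nonneg (by positivity), div_mul_cancel₀ _ hpos.ne']
      linarith
    have h1 := h _ hz
    rw [sub_sub_cancel_left, inner_neg_right, inner_smul_right, real_inner_self_eq_norm_sq] at h1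
    have : 0 < ε / 2 / ‖i - e‖ * ‖i - e‖ ^ 2 := by positivity
    linarith
  obtain ⟨s, rfl⟩ := O.exists_of_mem_frontier hfr
  -- Stationarity along the boundary equates the tangential components of `i` and `e`; as `i ≠ e`,
  -- only the reflection remains.
  have htan : ⟪i - e, deriv O.γ s⟫ = 0 := by
    have hd : HasDerivAt (fun t => ⟪i - e, O.γ t⟫) ⟪i - e, deriv O.γ s⟫ s := by
      simpa using (hasDerivAt_const s (i - e)).inner ℝ (O.hasDerivAt_γ s)
    refine IsLocalMin.hasDerivAt_eq_zero (Eventually.of_forall fun t => ?_) hd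
    have := h _ (O.γ_mem t)
    rw [inner_sub_right] at this
    linarith
  have hτ := O.unit_speed s
  rw [inner_sub_left, sub_eq_zero] at htan
  have hre : e = reflect i (rot (deriv O.γ s)) :=
    (eq_or_eq_reflect hτ he hi htan.symm).resolve_left hne.symm
  rw [← O.normal_γ] at hre
  refine ⟨hfr, hre, ?_⟩
  set n := O.normal (O.γ s) with hn
  have hdiff : i - e = (2 * ⟪i, n⟫) • n := by rw [hre, reflect]; abel
  have hin : ⟪i, n⟫ ≠ 0 := fun h0 => hw (by rw [hdiff, h0, mul_zero, zero_smul])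
  -- Any second point of the obstacle lies strictly behind the tangent line and fixes the sign of
  -- `⟪i, n⟫`; half a period away is one.
  have hP : O.γ (s + O.period / 2) ≠ O.γ s := by
    intro heq
    obtain ⟨k, hk⟩ := O.exists_int_of_γ_eq heq.symm
    have h1 : (O.period : ℝ) * (1 / 2 - k) = 0 := by linarith
    rcases mul_eq_zero.1 h1 with h2 | h2
    · exact O.period_pos.ne' h2
    · have h3 : (2 * k : ℝ) = 1 := by linarith
      have h4 : (2 * k : ℤ) = 1 := by exact_mod_cast h3
      omega
  have h1 := h _ (O.γ_mem (s + O.period / 2))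
  have h2 := O.inner_normal_neg hfr (O.γ_mem (s + O.period / 2)) hP
  rw [hdiff, inner_smul_left, real_inner_comm _ n] at h1
  simp only [conj_trivial] at h1
  rw [← hn] at h2
  rcases lt_or_gt_of_ne hin with h3 | h3
  · exact h3
  · nlinarith

/-- For `m = 0` this is no-occlusion. Otherwise `y ∈ K_m` would lie on the segment from the previous
reflection point in `K_{m-1}` to `x ∈ K_{m+1}`, against visibility. -/
theorem IncRay.not_straight (hA : Admissible K α) {m : ℕ} {y i x : Plane} {φ t : ℝ}
    (h : IncRay K α m y i φ) (hy : y ∈ (K m).carrier) (hx : x ∈ (K (m + 1)).carrier) (ht : 0 < t) :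
    x ≠ y + t • i := by
  intro heq
  rcases m with _ | m
  · obtain ⟨rfl, -⟩ := incRay_zero_iff.1 h
    exact (Set.eq_empty_iff_forall_notMem.1 hA.noOcclusion x) ⟨⟨y, hy, t, ht.le, heq⟩, hx⟩
  · obtain ⟨y', hy', i', φ', t', -, -, ht', -, hyy', -⟩ := incRay_succ_iff.1 h
    refine (Set.eq_empty_iff_forall_notMem.1 (hA.visibility m) y) ⟨hy, subset_closure ?_⟩
    have h1 : y' ∈ convexHull ℝ ((K m).carrier ∪ (K (m + 2)).carrier) :=
      subset_convexHull _ _ (Or.inl ((K m).frontier_subset hy'))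
    have h2 : x ∈ convexHull ℝ ((K m).carrier ∪ (K (m + 2)).carrier) :=
      subset_convexHull _ _ (Or.inr hx)
    have hpos : 0 < t + t' := by linarith
    have h3 := (convex_convexHull ℝ ((K m).carrier ∪ (K (m + 2)).carrier)) h1 h2
      (a := t / (t + t')) (b := t' / (t + t')) (by positivity) (by positivity) (by field_simp)
    convert h3 using 1
    rw [heq, hyy', smul_add, smul_add, ← add_assoc, ← add_assoc, ← add_smul, smul_smul, smul_smul,
      add_assoc, ← add_smul]
    have e1 : t / (t + t') + t' / (t + t') = 1 := by field_simp
    have e2 : t' / (t + t') * t' + t' / (t + t') * t = t' := by field_simp; ring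
    rw [e1, one_smul, e2]

/-- An infimum need not be differentiable, so the induction carries a majorant of the travel time
that touches it at `x` and has gradient `e` there. At a minimiser `y`, the majorant plus the
distance is again minimal, and the first-order condition on the convex set forces a reflection. -/
theorem exists_incRay (hA : Admissible K α) (m : ℕ) : ∀ x ∈ (K m).carrier, ∃ (e : Plane) (φ : ℝ),
    IncRay K α m x e φ ∧ ∃ f : Plane → ℝ, HasFDerivAt f (innerSL ℝ e) x ∧
      f x = travelTime K α m x ∧ ∀ z, travelTime K α m z ≤ f z := by
  induction m with
  | zero =>
    intro x _
    exact ⟨α, _, .zero x, fun z => ⟪α, z⟫, (innerSL ℝ α).hasFDerivAt, rfl, fun z => le_rfl⟩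
  | succ m ih =>
    intro x hx
    obtain ⟨y, hy, hV⟩ := exists_travelTime_succ_eq (K := K) (α := α) m x
    obtain ⟨i, φ, hray, f, hf, hfy, hle⟩ := ih y hy
    have hxy : x ≠ y := fun h => Set.disjoint_left.1 (hA.disjoint m) hy (h ▸ hx)
    have hsub : x - y ≠ 0 := sub_ne_zero.2 hxy
    set e := unitVec (x - y) with he
    have he1 : ‖e‖ = 1 := norm_unitVec hsub
    have hxe : x = y + ‖x - y‖ • e := by rw [he, norm_smul_unitVec]; abel
    have hne : i ≠ e := fun h => hray.not_straight hA hy hx (norm_pos_iff.2 hsub) (by rw [h]; exact hxe)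
    have hcond : ∀ z ∈ (K m).carrier, 0 ≤ ⟪i - e, z - y⟫ := by
      intro z hz
      have hg : HasFDerivAt (fun z => f z + ‖x - z‖) (innerSL ℝ (i - e)) y := by
        have := hf.add (hasFDerivAt_norm_sub hxy)
        rw [map_sub, sub_eq_add_neg]
        exact this
      have hmin : IsMinOn (fun z => f z + ‖x - z‖) (K m).carrier y := by
        intro z hz
        have h1 := travelTime_succ_le (K := K) (α := α) x hz
        have h2 := hle z
        simp only [mem_ofPred_eq]
        linarith
      have hcone : z - y ∈ posTangentConeAt (K m).carrier y :=
        sub_mem_posTangentConeAt_of_segment_subset ((K m).strictConvex.convex.segment_subset hy hz)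
      simpa [inner_sub_left] using hmin.localize.hasFDerivWithinAt_nonneg hg.hasFDerivWithinAt hcone
    obtain ⟨hfr, hre, hlit⟩ := eq_reflect_of_inner_nonneg hy (hray.norm_eq_one hA.unit) he1 hne hcond
    refine ⟨e, φ + ‖x - y‖, ?_, fun z => travelTime K α m y + ‖z - y‖, ?_, hV.symm,
      fun z => travelTime_succ_le z hy⟩
    · exact incRay_succ_iff.2 ⟨y, hfr, i, φ, ‖x - y‖, hray, hlit, norm_pos_iff.2 hsub, hre, hxe, rfl⟩
    · exact (hasFDerivAt_norm_sub_left hxy).const_add _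

/-- Leaving along the outer normal and the reflection law together give incidence against the
normal, the condition required of an `IncRay`. -/
theorem IsBrokenRay.incRay (hα : ‖α‖ = 1) {m : ℕ} {x : Plane} {X : ℕ → Plane}
    (h : IsBrokenRay K α m x X) : ∀ j, j + 1 ≤ m →
      IncRay K α (j + 1) (X (j + 1)) (unitVec (X (j + 1) - X j))
        (⟪α, X 0⟫ + ∑ l ∈ Finset.range (j + 1), ‖X (l + 1) - X l‖) := by
  intro j
  induction j with
  | zero =>
    intro hm
    have hfr := h.mem 0 (by omega)
    have h1 : ‖unitVec (X 1 - X 0)‖ = 1 := by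
      rw [h.refl_zero, norm_reflect ((K 0).norm_normal hfr), hα]
    have h2 : X 1 - X 0 ≠ 0 := fun h0 => by
      rw [h0, unitVec, smul_zero, norm_zero] at h1
      exact zero_ne_one h1
    refine incRay_succ_iff.2 ⟨X 0, hfr, α, _, ‖X 1 - X 0‖, .zero _, h.lit, norm_pos_iff.2 h2,
      h.refl_zero, ?_, by simp⟩
    rw [norm_smul_unitVec]
    abel
  | succ j ih =>
    intro hm
    have hfr := h.mem (j + 1) (by omega)
    have hn := (K (j + 1)).norm_normal hfr
    have hout := h.outgoing (j + 1) (by omega) (by omega)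
    have hrefl := h.refl_succ (j + 1) (by omega) (by omega)
    rw [Nat.add_sub_cancel] at hrefl
    have h2 : X (j + 1 + 1) - X (j + 1) ≠ 0 := fun h0 => by
      rw [h0, inner_zero_left] at hout
      exact lt_irrefl _ hout
    have hpos := norm_pos_iff.2 h2
    have hlit : ⟪unitVec (X (j + 1) - X j), (K (j + 1)).normal (X (j + 1))⟫ < 0 := by
      have h3 := inner_reflect_normal (v := unitVec (X (j + 1) - X j)) hn
      rw [← hrefl, unitVec, inner_smul_left] at h3
      have : 0 < ‖X (j + 1 + 1) - X (j + 1)‖⁻¹ *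
        ⟪X (j + 1 + 1) - X (j + 1), (K (j + 1)).normal (X (j + 1))⟫ := by positivity
      simp only [conj_trivial] at h3
      linarith
    refine incRay_succ_iff.2 ⟨X (j + 1), hfr, _, _, ‖X (j + 1 + 1) - X (j + 1)‖, ih (by omega), hlit,
      hpos, hrefl, ?_, ?_⟩
    · rw [norm_smul_unitVec]
      abel
    · rw [Finset.sum_range_succ _ (j + 1)]
      ring

/-- Converse translation: it shows that the choice in `brokenRay` is not vacuous. -/
theorem IncRay.exists_brokenRay (hα : ‖α‖ = 1) (m : ℕ) : ∀ {x e : Plane} {φ : ℝ},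
    IncRay K α (m + 1) x e φ → x ∈ frontier (K (m + 1)).carrier →
    ∃ X, IsBrokenRay K α (m + 1) x X ∧ e = unitVec (X (m + 1) - X m) := by
  induction m with
  | zero =>
    intro x e φ h hx
    obtain ⟨y, hy, i, φ', t, hray, hlit, ht, rfl, rfl, -⟩ := incRay_succ_iff.1 h
    obtain ⟨rfl, -⟩ := incRay_zero_iff.1 hray
    have hu : ‖reflect i ((K 0).normal y)‖ = 1 := by
      rw [norm_reflect ((K 0).norm_normal hy), hα]
    have he : reflect i ((K 0).normal y) =
        unitVec (y + t • reflect i ((K 0).normal y) - y) := by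
      rw [add_sub_cancel_left, unitVec_smul hu ht]
    refine ⟨fun j => if j = 0 then y else y + t • reflect i ((K 0).normal y), ⟨?_, ?_, ?_, ?_, ?_, ?_⟩, ?_⟩
    · intro j hj
      interval_cases j
      · simpa using hy
      · simpa using hx
    · simpa using hlit
    · simpa using he.symm
    · intro j h1 h2
      omega
    · intro j h1 h2
      omega
    · simp
    · simpa using he
  | succ m ih =>
    intro x e φ h hx
    obtain ⟨y, hy, i, φ', t, hray, hlit, ht, rfl, rfl, -⟩ := incRay_succ_iff.1 h
    obtain ⟨X, hX, hi⟩ := ih hray hy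
    have hn := (K (m + 1)).norm_normal hy
    have hu : ‖reflect i ((K (m + 1)).normal y)‖ = 1 := by
      rw [norm_reflect hn, hray.norm_eq_one hα]
    set e := reflect i ((K (m + 1)).normal y) with he
    have heu : e = unitVec (y + t • e - y) := by
      rw [add_sub_cancel_left, unitVec_smul hu ht]
    have hlast := hX.last
    have hXle : ∀ j, j ≤ m + 1 → (if j ≤ m + 1 then X j else y + t • e) = X j :=
      fun j hj => if_pos hj
    have hXlast : (if m + 1 + 1 ≤ m + 1 then X (m + 1 + 1) else y + t • e) = y + t • e :=
      if_neg (by omega)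
    refine ⟨fun j => if j ≤ m + 1 then X j else y + t • e, ⟨?_, ?_, ?_, ?_, ?_, ?_⟩, ?_⟩
    · intro j hj
      rcases Nat.lt_or_ge (m + 1) j with h1 | h1
      · obtain rfl : j = m + 1 + 1 := by omega
        simp only [hXlast]
        exact hx
      · simp only [hXle j h1]
        exact hX.mem j h1
    · simpa using hX.lit
    · simpa using hX.refl_zero
    · intro j h1 h2
      rcases Nat.lt_or_ge j (m + 1) with h3 | h3
      · simp only [hXle j h3.le, hXle (j + 1) h3]
        exact hX.outgoing j h1 h3
      · obtain rfl : j = m + 1 := by omega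
        simp only [hXlast, hXle (m + 1) le_rfl]
        rw [hlast, add_sub_cancel_left, inner_smul_left, he, inner_reflect_normal hn]
        simp only [conj_trivial]
        exact mul_pos ht (by linarith)
    · intro j h1 h2
      rcases Nat.lt_or_ge j (m + 1) with h3 | h3
      · simp only [hXle j h3.le, hXle (j + 1) h3, hXle (j - 1) (by omega)]
        exact hX.refl_succ j h1 h3
      · obtain rfl : j = m + 1 := by omega
        simp only [hXlast, hXle (m + 1) le_rfl, Nat.add_sub_cancel, hXle m (by omega)]
        rw [hlast, ← heu, he, hi, hlast]
    · exact hXlast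
    · simp only [hXlast, hXle (m + 1) le_rfl]
      rw [hlast]
      exact heu

/-- The ray incident at a boundary point. -/
theorem incRay_frontier (hA : Admissible K α) {m : ℕ} {x : Plane}
    (hx : x ∈ frontier (K m).carrier) : IncRay K α m x (incDir K α m x) (phase K α m x) := by
  rcases m with _ | m
  · simpa [incDir, phase] using IncRay.zero (K := K) x
  · obtain ⟨e, φ, hray, -⟩ := exists_incRay hA (m + 1) x ((K (m + 1)).frontier_subset hx)
    obtain ⟨X, hX, -⟩ := hray.exists_brokenRay hA.unit m hx
    have hB : IsBrokenRay K α (m + 1) x (brokenRay K α (m + 1) x) := Classical.epsilon_spec ⟨X, hX⟩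
    have h := hB.incRay hA.unit m le_rfl
    have hlast := hB.last
    simp only [incDir, phase, if_neg (Nat.succ_ne_zero m), Nat.add_sub_cancel]
    rwa [hlast] at h ⊢

/-! ### Smooth dependence of rays on the end point -/

theorem exists_smooth_local_inverse {Φ : ℝ × ℝ → Plane} (hΦ : ContDiff ℝ ∞ Φ) {W : Set (ℝ × ℝ)}
    (hW : IsOpen W) (hinj : ∀ p ∈ W, Function.Injective (fderiv ℝ Φ p)) {p₀ : ℝ × ℝ} (hp₀ : p₀ ∈ W) :
    ∃ B : Set Plane, IsOpen B ∧ Φ p₀ ∈ B ∧ ∃ g : Plane → ℝ × ℝ, ContDiffOn ℝ ∞ g B ∧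
      g (Φ p₀) = p₀ ∧ ∀ x ∈ B, g x ∈ W ∧ Φ (g x) = x := by
  -- Invertibility is needed at every point of `W`, not only at `p₀`, for the inverse to be smooth
  -- on an entire neighbourhood.
  have hequiv : ∀ p ∈ W, ∃ f' : (ℝ × ℝ) ≃L[ℝ] Plane, HasFDerivAt Φ (f' : (ℝ × ℝ) →L[ℝ] Plane) p := by
    intro p hp
    refine ⟨(LinearMap.linearEquivOfInjective (fderiv ℝ Φ p : (ℝ × ℝ) →ₗ[ℝ] Plane) (hinj p hp)
      (by simp)).toContinuousLinearEquiv, ?_⟩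
    exact (hΦ.differentiable (by simp) p).hasFDerivAt.congr_fderiv
      (ContinuousLinearMap.ext fun _ => rfl)
  obtain ⟨f', hf'⟩ := hequiv p₀ hp₀
  set e := ((hΦ.contDiffAt (x := p₀)).toOpenPartialHomeomorph Φ hf' (by simp)).restrOpen W hW with he
  have hcoe : ∀ p, e p = Φ p := fun p => rfl
  have hsrc : ∀ p ∈ e.source, p ∈ W := fun p hp => by
    rw [he, OpenPartialHomeomorph.restrOpen_source] at hp
    exact hp.2
  have hp₀s : p₀ ∈ e.source := by
    rw [he, OpenPartialHomeomorph.restrOpen_source]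
    exact ⟨ContDiffAt.mem_toOpenPartialHomeomorph_source _ _ _, hp₀⟩
  refine ⟨e.target, e.open_target, e.map_source hp₀s, e.symm, fun x hx => ?_, e.left_inv hp₀s,
    fun x hx => ⟨hsrc _ (e.map_target hx), e.right_inv hx⟩⟩
  obtain ⟨f'', hf''⟩ := hequiv _ (hsrc _ (e.map_target hx))
  exact (e.contDiffAt_symm hx (f₀' := f'') hf'' hΦ.contDiffAt).contDiffWithinAt

/-- The limit of products of difference quotients; it turns monotonicity of rays into an
infinitesimal inequality. -/
theorem inner_deriv_nonneg {c d : ℝ → Plane} {c' d' : Plane} {s : ℝ} (hc : HasDerivAt c c' s)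
    (hd : HasDerivAt d d' s) (h : ∀ᶠ t in 𝓝 s, 0 ≤ ⟪c t - c s, d t - d s⟫) : 0 ≤ ⟪c', d'⟫ := by
  have h1 := (hasDerivAt_iff_tendsto_slope.1 hc).inner (𝕜 := ℝ) (hasDerivAt_iff_tendsto_slope.1 hd)
  refine ge_of_tendsto h1 ?_
  filter_upwards [nhdsWithin_le_nhds h] with t ht
  rw [slope_def_module, slope_def_module, inner_smul_left, inner_smul_right]
  simp only [conj_trivial]
  rw [← mul_assoc]
  exact mul_nonneg (mul_self_nonneg _) ht

variable {K : ℕ → Obstacle} {α : Plane} {m : ℕ}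

theorem norm_incDir (hA : Admissible K α) {y : Plane} (hy : y ∈ frontier (K m).carrier) :
    ‖incDir K α m y‖ = 1 := (incRay_frontier hA hy).norm_eq_one hA.unit

theorem norm_refDir (hA : Admissible K α) {y : Plane} (hy : y ∈ frontier (K m).carrier) :
    ‖refDir K α m y‖ = 1 := by
  rw [refDir, norm_reflect ((K m).norm_normal hy), norm_incDir hA hy]

theorem inner_refDir_normal {y : Plane} (hy : y ∈ frontier (K m).carrier) :
    ⟪refDir K α m y, (K m).normal y⟫ = -⟪incDir K α m y, (K m).normal y⟫ := by
  rw [refDir, inner_reflect_normal ((K m).norm_normal hy)]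

theorem inner_refDir_tangent (s : ℝ) : ⟪refDir K α m ((K m).γ s), deriv (K m).γ s⟫ =
    ⟪incDir K α m ((K m).γ s), deriv (K m).γ s⟫ := by
  rw [refDir, inner_reflect_tangent ((K m).inner_normal_γ_deriv s)]

theorem mem_openIlluminated_iff {x : Plane} : x ∈ openIlluminated K α m ↔
    ∃ y ∈ illuminated K α m, ∃ t : ℝ, 0 < t ∧ x = y + t • refDir K α m y := by
  simp [openIlluminated, ray]

theorem incRay_refl (hA : Admissible K α) {y : Plane} (hy : y ∈ illuminated K α m) {t : ℝ}
    (ht : 0 < t) : IncRay K α (m + 1) (y + t • refDir K α m y) (refDir K α m y)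
      (phase K α m y + t) :=
  .succ m y _ _ t hy.1 (incRay_frontier hA hy.1) hy.2 ht

/-- Uniqueness of the reflection point pins down the value chosen by `Classical.epsilon`. -/
theorem reflPoint_eq (hA : Admissible K α) {y : Plane} (hy : y ∈ illuminated K α m) {t : ℝ}
    (ht : 0 < t) : reflPoint K α m (y + t • refDir K α m y) = y := by
  obtain ⟨h1, s, hs, h2⟩ := Classical.epsilon_spec
    (p := fun z => z ∈ illuminated K α m ∧ y + t • refDir K α m y ∈ ray K α m z) ⟨y, hy, t, ht, rfl⟩
  exact (reflect_point_unique hA.unit hy.1 h1.1 (incRay_frontier hA hy.1)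
    (incRay_frontier hA h1.1) hy.2 h1.2 ht hs h2).symm

theorem exists_refl_of_frontier_succ (hA : Admissible K α) {x : Plane}
    (hx : x ∈ frontier (K (m + 1)).carrier) : ∃ y ∈ illuminated K α m, ∃ t : ℝ, 0 < t ∧
      x = y + t • refDir K α m y := by
  obtain ⟨y, hy, i, φ', t, hray, hlit, ht, he, hxe, -⟩ :=
    incRay_succ_iff.1 (incRay_frontier hA hx)
  obtain ⟨rfl, -⟩ := hray.unique hA.unit (incRay_frontier hA hy)
  rw [he] at hxe
  exact ⟨y, ⟨hy, hlit⟩, t, ht, hxe⟩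

theorem incDir_phase_succ (hA : Admissible K α) {y : Plane} (hy : y ∈ illuminated K α m) {t : ℝ}
    (ht : 0 < t) (hx : y + t • refDir K α m y ∈ frontier (K (m + 1)).carrier) :
    incDir K α (m + 1) (y + t • refDir K α m y) = refDir K α m y ∧
      phase K α (m + 1) (y + t • refDir K α m y) = phase K α m y + t :=
  (incRay_frontier hA hx).unique hA.unit (incRay_refl hA hy ht)

/-- The incident directions are smooth on `∂K_m`, and tangentially the gradient of the phase. -/
structure SmoothRays (K : ℕ → Obstacle) (α : Plane) (m : ℕ) : Prop where
  incDir : ContDiff ℝ ∞ fun s => incDir K α m ((K m).γ s)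
  phase : ∀ s, HasDerivAt (fun s => phase K α m ((K m).γ s))
    ⟪MultipleScattering.incDir K α m ((K m).γ s), deriv (K m).γ s⟫ s

theorem SmoothRays.contDiff_phase (h : SmoothRays K α m) :
    ContDiff ℝ ∞ fun s => MultipleScattering.phase K α m ((K m).γ s) := by
  rw [contDiff_infty_iff_deriv]
  refine ⟨fun s => (h.phase s).differentiableAt, ?_⟩
  rw [funext fun s => (h.phase s).deriv]
  exact h.incDir.inner ℝ (K m).contDiff_deriv_γ

theorem SmoothRays.contDiff_refDir (h : SmoothRays K α m) :
    ContDiff ℝ ∞ fun s => refDir K α m ((K m).γ s) := by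
  simp only [refDir, reflect]
  have h1 := (K m).contDiff_normal_γ
  exact h.incDir.sub ((contDiff_const.mul (h.incDir.inner ℝ h1)).smul h1)

theorem SmoothRays.isOpen_illuminated (h : SmoothRays K α m) :
    IsOpen ((K m).γ ⁻¹' illuminated K α m) := by
  have : (K m).γ ⁻¹' illuminated K α m =
      {s | ⟪MultipleScattering.incDir K α m ((K m).γ s), (K m).normal ((K m).γ s)⟫ < 0} := by
    ext s
    simp [illuminated, (K m).γ_mem_frontier]
  rw [this]
  exact isOpen_lt (h.incDir.inner ℝ (K m).contDiff_normal_γ).continuous continuous_const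

theorem SmoothRays.isOpen_shadow (h : SmoothRays K α m) :
    IsOpen ((K m).γ ⁻¹' shadow K α m) := by
  have : (K m).γ ⁻¹' shadow K α m =
      {s | 0 < ⟪MultipleScattering.incDir K α m ((K m).γ s), (K m).normal ((K m).γ s)⟫} := by
    ext s
    simp [shadow, (K m).γ_mem_frontier]
  rw [this]
  exact isOpen_lt continuous_const (h.incDir.inner ℝ (K m).contDiff_normal_γ).continuous

theorem SmoothRays.inner_deriv_incDir_nonneg (hA : Admissible K α) (h : SmoothRays K α m) (s : ℝ) :
    0 ≤ ⟪deriv (fun s => MultipleScattering.incDir K α m ((K m).γ s)) s, deriv (K m).γ s⟫ :=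
  inner_deriv_nonneg (h.incDir.differentiable (by simp) s).hasDerivAt ((K m).hasDerivAt_γ s)
    (Eventually.of_forall fun t => (incRay_frontier hA ((K m).γ_mem_frontier t)).monotone hA.unit
      (incRay_frontier hA ((K m).γ_mem_frontier s)))

theorem SmoothRays.inner_deriv_refDir_nonneg (hA : Admissible K α) (h : SmoothRays K α m) {s : ℝ}
    (hs : (K m).γ s ∈ illuminated K α m) :
    0 ≤ ⟪deriv (fun s => refDir K α m ((K m).γ s)) s, deriv (K m).γ s⟫ := by
  refine inner_deriv_nonneg (h.contDiff_refDir.differentiable (by simp) s).hasDerivAt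
    ((K m).hasDerivAt_γ s) ?_
  filter_upwards [h.isOpen_illuminated.mem_nhds hs] with t ht
  exact (inner_reflect_sub ht.1 hs.1 ht.2 hs.2 ((incRay_frontier hA ht.1).monotone hA.unit
    (incRay_frontier hA hs.1))).1

theorem inner_deriv_of_norm_eq_one {c : ℝ → Plane} {c' : Plane} {s : ℝ} (hc : HasDerivAt c c' s)
    (h : ∀ t, ‖c t‖ = 1) : ⟪c s, c'⟫ = 0 := by
  have h1 := hc.inner ℝ hc
  have h2 : (fun t => ⟪c t, c t⟫) = fun _ => (1 : ℝ) := funext fun t => by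
    rw [real_inner_self_eq_norm_sq, h, one_pow]
  rw [h2] at h1
  have h3 := h1.unique (hasDerivAt_const s (1 : ℝ))
  rw [real_inner_comm (c s) c'] at h3
  linarith

/-- The quantity is the squared normal component of a unit vector, nonzero because the point is lit.
-/
theorem one_sub_sq_inner_refDir_pos (hA : Admissible K α) {s : ℝ}
    (hs : (K m).γ s ∈ illuminated K α m) :
    0 < 1 - ⟪refDir K α m ((K m).γ s), deriv (K m).γ s⟫ ^ 2 := by
  have h1 := inner_eq_add_rot ((K m).unit_speed s) (refDir K α m ((K m).γ s))
    (refDir K α m ((K m).γ s))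
  rw [real_inner_self_eq_norm_sq, norm_refDir hA hs.1, ← (K m).normal_γ,
    inner_refDir_normal hs.1] at h1
  have h2 : 0 < ⟪MultipleScattering.incDir K α m ((K m).γ s), (K m).normal ((K m).γ s)⟫ ^ 2 :=
    sq_pos_of_neg hs.2
  nlinarith

/-- Local smooth coordinates along the reflected rays. -/
theorem SmoothRays.exists_local_coordinates (hA : Admissible K α) (h : SmoothRays K α m)
    {s₀ t₀ : ℝ} (hs₀ : (K m).γ s₀ ∈ illuminated K α m) (ht₀ : 0 < t₀) :
    ∃ B : Set Plane, IsOpen B ∧ (K m).γ s₀ + t₀ • refDir K α m ((K m).γ s₀) ∈ B ∧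
      ∃ σ τ : Plane → ℝ, ContDiffOn ℝ ∞ σ B ∧ ContDiffOn ℝ ∞ τ B ∧
        σ ((K m).γ s₀ + t₀ • refDir K α m ((K m).γ s₀)) = s₀ ∧
        ∀ x ∈ B, (K m).γ (σ x) ∈ illuminated K α m ∧ 0 < τ x ∧
          x = (K m).γ (σ x) + τ x • refDir K α m ((K m).γ (σ x)) := by
  set e : ℝ → Plane := fun s => refDir K α m ((K m).γ s) with he
  have hes := h.contDiff_refDir
  have hed : ∀ s, HasDerivAt e (deriv e s) s := fun s => (hes.differentiable (by simp) s).hasDerivAt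
  set Φ : ℝ × ℝ → Plane := fun p => (K m).γ p.1 + p.2 • e p.1 with hΦ
  have hΦs : ContDiff ℝ ∞ Φ := ((K m).smooth.comp contDiff_fst).add
    (contDiff_snd.smul (hes.comp contDiff_fst))
  set W : Set (ℝ × ℝ) := ((K m).γ ⁻¹' illuminated K α m) ×ˢ Ioi 0 with hW
  have hinj : ∀ p ∈ W, Function.Injective (fderiv ℝ Φ p) := by
    rintro ⟨s, t⟩ ⟨hs, ht⟩
    have ht' : 0 < t := ht
    have hd : ∀ a b : ℝ, fderiv ℝ Φ (s, t) (a, b) =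
        a • (deriv (K m).γ s + t • deriv e s) + b • e s := by
      intro a b
      have h1 : HasDerivAt (fun l : ℝ => ((s + l * a, t + l * b) : ℝ × ℝ)) (a, b) 0 := by
        have h2 : HasDerivAt (fun l : ℝ => s + l * a) a 0 := by
          simpa using ((hasDerivAt_id (0 : ℝ)).mul_const a).const_add s
        have h3 : HasDerivAt (fun l : ℝ => t + l * b) b 0 := by
          simpa using ((hasDerivAt_id (0 : ℝ)).mul_const b).const_add t
        exact h2.prodMk h3
      have h4 := (hΦs.differentiable (by simp) ((s + 0 * a, t + 0 * b) : ℝ × ℝ)).hasFDerivAt.comp_hasDerivAt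
        (0 : ℝ) h1
      simp only [zero_mul, add_zero] at h4
      have h2 : HasDerivAt (fun l : ℝ => s + l * a) a 0 := by
        simpa using ((hasDerivAt_id (0 : ℝ)).mul_const a).const_add s
      have h3 : HasDerivAt (fun l : ℝ => t + l * b) b 0 := by
        simpa using ((hasDerivAt_id (0 : ℝ)).mul_const b).const_add t
      have h5 : HasDerivAt (fun l : ℝ => (K m).γ (s + l * a)) (a • deriv (K m).γ s) 0 := by
        have := HasDerivAt.scomp (0 : ℝ) (h := fun l : ℝ => s + l * a)
          (g₁ := (K m).γ) (g₁' := deriv (K m).γ s) (by simpa using (K m).hasDerivAt_γ s) h2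
        exact this
      have h6 : HasDerivAt (fun l : ℝ => e (s + l * a)) (a • deriv e s) 0 := by
        have := HasDerivAt.scomp (0 : ℝ) (h := fun l : ℝ => s + l * a)
          (g₁ := e) (g₁' := deriv e s) (by simpa using hed s) h2
        exact this
      have h7 := h5.add (h3.smul h6)
      simp only [zero_mul, add_zero] at h7
      rw [h4.unique h7]
      module
    rw [injective_iff_map_eq_zero]
    rintro ⟨a, b⟩ hab
    rw [hd] at hab
    have hee : ⟪e s, e s⟫ = 1 := by
      rw [real_inner_self_eq_norm_sq, he, norm_refDir hA ((K m).γ_mem_frontier s), one_pow]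
    have hee' : ⟪e s, deriv e s⟫ = 0 := inner_deriv_of_norm_eq_one (hed s) fun t =>
      norm_refDir hA ((K m).γ_mem_frontier t)
    have hgg : ⟪deriv (K m).γ s, deriv (K m).γ s⟫ = 1 := by
      rw [real_inner_self_eq_norm_sq, (K m).unit_speed, one_pow]
    have h1 : ⟪e s, a • (deriv (K m).γ s + t • deriv e s) + b • e s⟫ = 0 := by
      rw [hab, inner_zero_right]
    have h2 : ⟪deriv (K m).γ s, a • (deriv (K m).γ s + t • deriv e s) + b • e s⟫ = 0 := by
      rw [hab, inner_zero_right]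
    simp only [inner_add_right, inner_smul_right, hee, hee', hgg] at h1 h2
    have h3 := one_sub_sq_inner_refDir_pos hA hs
    have h4 := h.inner_deriv_refDir_nonneg hA hs
    rw [real_inner_comm] at h4
    rw [real_inner_comm] at h3
    rw [real_inner_comm] at h1
    -- Eliminating `b` leaves a Jacobian factor that is positive because reflected rays spread out:
    -- no caustics form.
    have h5 : a * (1 - ⟪deriv (K m).γ s, e s⟫ ^ 2 + t * ⟪deriv (K m).γ s, deriv e s⟫) = 0 := by
      linear_combination h2 - ⟪deriv (K m).γ s, e s⟫ * h1
    have h6 : 0 < 1 - ⟪deriv (K m).γ s, e s⟫ ^ 2 + t * ⟪deriv (K m).γ s, deriv e s⟫ :=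
      add_pos_of_pos_of_nonneg h3 (mul_nonneg ht'.le h4)
    have ha : a = 0 := (mul_eq_zero.1 h5).resolve_right h6.ne'
    have hb : b = 0 := by
      rw [ha] at h1
      linarith
    rw [ha, hb]
    rfl
  obtain ⟨B, hB, hxB, g, hg, hg0, hgB⟩ := exists_smooth_local_inverse hΦs
    (h.isOpen_illuminated.prod isOpen_Ioi) hinj (p₀ := (s₀, t₀)) ⟨hs₀, ht₀⟩
  exact ⟨B, hB, hxB, fun x => (g x).1, fun x => (g x).2, contDiff_fst.comp_contDiffOn hg,
    contDiff_snd.comp_contDiffOn hg, congrArg Prod.fst hg0,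
    fun x hx => ⟨(hgB x hx).1.1, (hgB x hx).1.2, (hgB x hx).2.symm⟩⟩

/-- Every point of the next boundary is reached from a lit point of the previous one, so in the
coordinates along reflected rays the next direction and phase are compositions of smooth functions.
-/
theorem smoothRays (hA : Admissible K α) (m : ℕ) : SmoothRays K α m := by
  induction m with
  | zero =>
    refine ⟨by simpa [incDir] using contDiff_const, fun s => ?_⟩
    simp only [incDir, phase, if_true]
    simpa using (hasDerivAt_const s α).inner ℝ ((K 0).hasDerivAt_γ s)
  | succ m ih =>
    have key : ∀ s₀, ContDiffAt ℝ ∞ (fun s => incDir K α (m + 1) ((K (m + 1)).γ s)) s₀ ∧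
        HasDerivAt (fun s => phase K α (m + 1) ((K (m + 1)).γ s))
          ⟪incDir K α (m + 1) ((K (m + 1)).γ s₀), deriv (K (m + 1)).γ s₀⟫ s₀ := by
      intro s₀
      obtain ⟨y, hy, t, ht, hx⟩ := exists_refl_of_frontier_succ hA ((K (m + 1)).γ_mem_frontier s₀)
      obtain ⟨r, rfl⟩ := (K m).exists_of_mem_frontier hy.1
      obtain ⟨B, hB, hxB, σ, τ, hσ, hτ, -, hcoord⟩ := ih.exists_local_coordinates hA hy ht
      rw [← hx] at hxB
      set c := (K (m + 1)).γ with hc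
      have hcs : ContDiff ℝ ∞ c := (K (m + 1)).smooth
      have hev : ∀ᶠ s in 𝓝 s₀, c s ∈ B := hcs.continuous.continuousAt.eventually
        (hB.mem_nhds hxB)
      set e : ℝ → Plane := fun s => refDir K α m ((K m).γ s) with he
      have hes := ih.contDiff_refDir
      have hσc : ContDiffAt ℝ ∞ (fun s => σ (c s)) s₀ :=
        (hσ.contDiffAt (hB.mem_nhds hxB)).comp s₀ hcs.contDiffAt
      have hτc : ContDiffAt ℝ ∞ (fun s => τ (c s)) s₀ :=
        (hτ.contDiffAt (hB.mem_nhds hxB)).comp s₀ hcs.contDiffAt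
      have hval : ∀ s, c s ∈ B → incDir K α (m + 1) (c s) = e (σ (c s)) ∧
          phase K α (m + 1) (c s) = phase K α m ((K m).γ (σ (c s))) + τ (c s) := by
        intro s hs
        obtain ⟨h1, h2, h3⟩ := hcoord (c s) hs
        have hfr : c s ∈ frontier (K (m + 1)).carrier := (K (m + 1)).γ_mem_frontier s
        have := incDir_phase_succ hA h1 h2 (h3 ▸ hfr)
        rwa [← h3] at this
      constructor
      · refine (hes.contDiffAt.comp s₀ hσc).congr_of_eventuallyEq ?_
        filter_upwards [hev] with s hs using (hval s hs).1
      · set a' := deriv (fun s => σ (c s)) s₀ with ha'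
        set b' := deriv (fun s => τ (c s)) s₀ with hb'
        have ha : HasDerivAt (fun s => σ (c s)) a' s₀ :=
          (hσc.differentiableAt (by simp)).hasDerivAt
        have hb : HasDerivAt (fun s => τ (c s)) b' s₀ :=
          (hτc.differentiableAt (by simp)).hasDerivAt
        have hed : HasDerivAt e (deriv e (σ (c s₀))) (σ (c s₀)) :=
          (hes.differentiable (by simp) _).hasDerivAt
        have hp := ((ih.phase (σ (c s₀))).comp s₀ ha).add hb
        have hcd : HasDerivAt c (a' • deriv (K m).γ (σ (c s₀)) +
            (τ (c s₀) • (a' • deriv e (σ (c s₀))) + b' • e (σ (c s₀)))) s₀ := by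
          have h1 := (((K m).hasDerivAt_γ (σ (c s₀))).scomp s₀ ha).add
            (hb.smul (hed.scomp s₀ ha))
          refine h1.congr_of_eventuallyEq ?_
          filter_upwards [hev] with s hs using (hcoord (c s) hs).2.2
        have hee : ⟪e (σ (c s₀)), e (σ (c s₀))⟫ = 1 := by
          rw [real_inner_self_eq_norm_sq, he, norm_refDir hA ((K m).γ_mem_frontier _), one_pow]
        have hee' : ⟪e (σ (c s₀)), deriv e (σ (c s₀))⟫ = 0 := inner_deriv_of_norm_eq_one hed
          fun t => norm_refDir hA ((K m).γ_mem_frontier t)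
        have hev2 : (fun s => phase K α (m + 1) (c s)) =ᶠ[𝓝 s₀]
            fun s => phase K α m ((K m).γ (σ (c s))) + τ (c s) := by
          filter_upwards [hev] with s hs using (hval s hs).2
        -- The two derivatives agree because reflection keeps the tangential component and a unit
        -- vector field is orthogonal to its derivative.
        refine (hp.congr_of_eventuallyEq hev2).congr_deriv ?_
        rw [(hval s₀ hxB).1, hcd.deriv, ← inner_refDir_tangent]
        simp only [inner_add_right, inner_smul_right, hee, hee']
        ring
    exact ⟨contDiff_iff_contDiffAt.2 fun s => (key s).1, fun s => (key s).2⟩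

/-! ### A Morse coordinate with parameters -/

section MorseCoordinate

theorem iteratedDeriv_two_sq_mul {g : ℝ → ℝ} {O : Set ℝ} (hO : IsOpen O) (h0 : (0 : ℝ) ∈ O)
    (hg : ContDiffOn ℝ ∞ g O) : iteratedDeriv 2 (fun τ => τ ^ 2 * g τ) 0 = 2 * g 0 := by
  have hd : ∀ τ ∈ O, HasDerivAt g (deriv g τ) τ := fun τ hτ =>
    ((hg.contDiffAt (hO.mem_nhds hτ)).differentiableAt (by simp)).hasDerivAt
  have hd2 : HasDerivAt (deriv g) (deriv (deriv g) 0) 0 :=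
    (((hg.deriv_of_isOpen (m := ∞) hO (by simp)).contDiffAt (hO.mem_nhds h0)).differentiableAt
      (by simp)).hasDerivAt
  have hev : deriv (fun τ => τ ^ 2 * g τ) =ᶠ[𝓝 0] fun τ => 2 * τ * g τ + τ ^ 2 * deriv g τ := by
    filter_upwards [hO.mem_nhds h0] with τ hτ
    have := ((hasDerivAt_pow 2 τ).fun_mul (hd τ hτ)).deriv
    simpa using this
  rw [iteratedDeriv_succ, iteratedDeriv_one, hev.deriv_eq]
  have h1 : HasDerivAt (fun τ : ℝ => 2 * τ) 2 0 := by simpa using (hasDerivAt_id (0 : ℝ)).const_mul 2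
  have h2 : HasDerivAt (fun τ : ℝ => τ ^ 2) 0 0 := by simpa using hasDerivAt_pow 2 (0 : ℝ)
  have h3 := (h1.fun_mul (hd 0 h0)).fun_add (h2.fun_mul hd2)
  rw [h3.deriv]
  simp

variable {V : Type} [NormedAddCommGroup V] [NormedSpace ℝ V]

/-- Hadamard's lemma applied twice: both the value and the first derivative vanish at `τ = 0` for
every `x`. The second derivative gives the sign of the quotient. -/
theorem exists_sq_factor [ProperSpace V] {θ : ℝ × V → ℝ} {δ₀ : ℝ} (hδ₀ : 0 < δ₀) {B₀ : Set V}
    (hB₀ : IsOpen B₀) {x₀ : V} (hx₀ : x₀ ∈ B₀) (hθ : ContDiffOn ℝ ∞ θ (Ioo (-δ₀) δ₀ ×ˢ B₀))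
    (h0 : ∀ x ∈ B₀, θ (0, x) = 0) (h1 : ∀ x ∈ B₀, deriv (fun τ => θ (τ, x)) 0 = 0)
    (h2 : 0 < iteratedDeriv 2 (fun τ => θ (τ, x₀)) 0) :
    ∃ H : ℝ × V → ℝ, ContDiffOn ℝ ∞ H (Ioo (-δ₀) δ₀ ×ˢ B₀) ∧ 0 < H (0, x₀) ∧
      ∀ τ ∈ Ioo (-δ₀) δ₀, ∀ x ∈ B₀, θ (τ, x) = τ ^ 2 * H (τ, x) := by
  have hz : (0 : ℝ) ∈ Ioo (-δ₀) δ₀ := ⟨by linarith, hδ₀⟩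
  have hH₁s : ContDiffOn ℝ ∞ (hadamardQuot θ) (Ioo (-δ₀) δ₀ ×ˢ B₀) := contDiffOn_hadamardQuot hB₀ hθ
  have hHs := contDiffOn_hadamardQuot hB₀ hH₁s
  have hfac : ∀ τ ∈ Ioo (-δ₀) δ₀, ∀ x ∈ B₀,
      θ (τ, x) = τ ^ 2 * hadamardQuot (hadamardQuot θ) (τ, x) := by
    intro τ hτ x hx
    have e1 := smul_hadamardQuot hB₀ hθ hτ hx
    have e2 := smul_hadamardQuot hB₀ hH₁s hτ hx
    rw [h0 x hx, sub_zero, smul_eq_mul] at e1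
    rw [hadamardQuot_zero θ, h1 x hx, sub_zero, smul_eq_mul] at e2
    rw [← e1, ← e2]
    ring
  refine ⟨_, hHs, ?_, hfac⟩
  have hline : ContDiffOn ℝ ∞ (fun τ => hadamardQuot (hadamardQuot θ) (τ, x₀)) (Ioo (-δ₀) δ₀) :=
    hHs.comp (by fun_prop) fun τ hτ => ⟨hτ, hx₀⟩
  have hev : (fun τ => θ (τ, x₀)) =ᶠ[𝓝 0]
      fun τ => τ ^ 2 * hadamardQuot (hadamardQuot θ) (τ, x₀) := by
    filter_upwards [isOpen_Ioo.mem_nhds hz] with τ hτ using hfac τ hτ x₀ hx₀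
  rw [hev.iteratedDeriv_eq, iteratedDeriv_two_sq_mul isOpen_Ioo hz hline] at h2
  linarith

/-- A phase with a nondegenerate minimum is locally the square of a coordinate. -/
theorem exists_isPhase [ProperSpace V] {θ : ℝ × V → ℝ} {δ₀ : ℝ} (hδ₀ : 0 < δ₀) {B₀ : Set V}
    (hB₀ : IsOpen B₀) {x₀ : V} (hx₀ : x₀ ∈ B₀) (hθ : ContDiffOn ℝ ∞ θ (Ioo (-δ₀) δ₀ ×ˢ B₀))
    (h0 : ∀ x ∈ B₀, θ (0, x) = 0) (h1 : ∀ x ∈ B₀, deriv (fun τ => θ (τ, x)) 0 = 0)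
    (h2 : 0 < iteratedDeriv 2 (fun τ => θ (τ, x₀)) 0) :
    ∃ (δ b ε : ℝ) (κ : ℝ × V → ℝ) (B : Set V), δ ≤ δ₀ ∧ x₀ ∈ B ∧ B ⊆ B₀ ∧ IsPhase B δ b ε κ ∧
      ∀ x ∈ B, ∀ τ ∈ Ioo (-δ) δ, θ (τ, x) = (τ / κ (τ, x)) ^ 2 := by
  have hΩ : IsOpen (Ioo (-δ₀) δ₀ ×ˢ B₀) := isOpen_Ioo.prod hB₀
  have hz : (0 : ℝ) ∈ Ioo (-δ₀) δ₀ := ⟨by linarith, hδ₀⟩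
  obtain ⟨H, hHs, hHpos, hfac⟩ := exists_sq_factor hδ₀ hB₀ hx₀ hθ h0 h1 h2
  clear hθ h0 h1 h2
  -- With `θ = τ² H`, the coordinate is `w = τ√H`, that is `κ = H^{-1/2}`.
  set κ : ℝ × V → ℝ := fun p => (Real.sqrt (H p))⁻¹ with hκ
  set Ω₁ : Set (ℝ × V) := (Ioo (-δ₀) δ₀ ×ˢ B₀) ∩ H ⁻¹' Ioi 0 with hΩ₁
  have hΩ₁o : IsOpen Ω₁ := hHs.continuousOn.isOpen_inter_preimage hΩ isOpen_Ioi
  have hsq : ContDiffOn ℝ ∞ (fun p => Real.sqrt (H p)) Ω₁ :=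
    (hHs.mono inter_subset_left).sqrt fun p hp => (ne_of_gt hp.2)
  have hκs : ContDiffOn ℝ ∞ κ Ω₁ := hsq.inv fun p hp => (Real.sqrt_pos.2 hp.2).ne'
  have hws : ContDiffOn ℝ ∞ (fun p : ℝ × V => p.1 / κ p) Ω₁ := by
    simp only [hκ, div_inv_eq_mul]
    exact contDiffOn_fst.mul hsq
  have hwds := contDiffOn_deriv_fst hΩ₁o hws
  set Ω₂ : Set (ℝ × V) := Ω₁ ∩ (fun p : ℝ × V => deriv (fun τ => τ / κ (τ, p.2)) p.1) ⁻¹' Ioi 0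
    with hΩ₂
  have hΩ₂o : IsOpen Ω₂ := hwds.continuousOn.isOpen_inter_preimage hΩ₁o isOpen_Ioi
  have hmem : ((0 : ℝ), x₀) ∈ Ω₂ := by
    refine ⟨⟨⟨hz, hx₀⟩, hHpos⟩, ?_⟩
    have hd : HasDerivAt (fun τ => Real.sqrt (H (τ, x₀)))
        (deriv (fun τ => Real.sqrt (H (τ, x₀))) 0) 0 :=
      (hasDerivAt_comp_line hΩ₁o hsq (c := fun τ => (τ, x₀))
        ((hasDerivAt_id (0 : ℝ)).prodMk (hasDerivAt_const 0 x₀))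
        ⟨⟨hz, hx₀⟩, hHpos⟩).differentiableAt.hasDerivAt
    have hd2 := (hasDerivAt_id (0 : ℝ)).fun_mul hd
    simp only [mem_preimage, hκ, div_inv_eq_mul, mem_Ioi]
    simp only [id_eq] at hd2
    rw [hd2.deriv]
    simpa using hHpos
  obtain ⟨u, hu, v, hv, huv⟩ := mem_nhds_prod_iff.1 (hΩ₂o.mem_nhds hmem)
  obtain ⟨δ, hδ, hδu⟩ := Metric.mem_nhds_iff.1 hu
  rw [Real.ball_eq_Ioo, zero_sub, zero_add] at hδu
  obtain ⟨B₁, hB₁v, hB₁o, hxB₁⟩ := mem_nhds_iff.1 hv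
  have hsub : Ioo (-δ) δ ×ˢ B₁ ⊆ Ω₂ := (prod_mono hδu hB₁v).trans huv
  set b := δ / 2 with hb
  have hbm : b ∈ Ioo (-δ) δ := ⟨by linarith, by linarith⟩
  have hbm' : -b ∈ Ioo (-δ) δ := ⟨by linarith, by linarith⟩
  have hκpos : ∀ p ∈ Ω₂, 0 < κ p := fun p hp => inv_pos.2 (Real.sqrt_pos.2 hp.1.2)
  have hdpos : ∀ p ∈ Ω₂, 0 < deriv (fun τ => τ / κ (τ, p.2)) p.1 := fun p hp => hp.2
  have hcont : ∀ τ ∈ Ioo (-δ) δ, ContinuousOn (fun x => b / κ (τ, x)) B₁ := fun τ hτ =>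
    continuousOn_const.div (hκs.continuousOn.comp (by fun_prop) fun x hx => (hsub ⟨hτ, hx⟩).1)
      fun x hx => (hκpos _ (hsub ⟨hτ, hx⟩)).ne'
  have hb0 : 0 < b := by positivity
  have e1 : 0 < b / κ (b, x₀) := div_pos hb0 (hκpos _ (hsub ⟨hbm, hxB₁⟩))
  have e2 : 0 < b / κ (-b, x₀) := div_pos hb0 (hκpos _ (hsub ⟨hbm', hxB₁⟩))
  -- Half of the limiting value at `x₀`, so that by continuity the bound at both end points persists
  -- nearby.
  set ε := min (b / κ (b, x₀)) (b / κ (-b, x₀)) / 2 with hε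
  have hε0 : 0 < ε := by positivity
  set B := (B₁ ∩ (fun x => b / κ (b, x)) ⁻¹' Ioi ε) ∩ (B₁ ∩ (fun x => b / κ (-b, x)) ⁻¹' Ioi ε) with hB
  have hBo : IsOpen B := ((hcont b hbm).isOpen_inter_preimage hB₁o isOpen_Ioi).inter
    ((hcont (-b) hbm').isOpen_inter_preimage hB₁o isOpen_Ioi)
  have hBB₁ : B ⊆ B₁ := fun x hx => hx.1.1
  have hxB : x₀ ∈ B := by
    have m1 := min_le_left (b / κ (b, x₀)) (b / κ (-b, x₀))
    have m2 := min_le_right (b / κ (b, x₀)) (b / κ (-b, x₀))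
    refine ⟨⟨hxB₁, ?_⟩, hxB₁, ?_⟩
    · change ε < b / κ (b, x₀)
      linarith
    · change ε < b / κ (-b, x₀)
      linarith
  -- Otherwise the box would contain `(δ₀, x₀)`, which lies outside the domain of `H`.
  have hδ₀' : δ ≤ δ₀ := by
    by_contra! hcon
    have := (hsub (show (δ₀, x₀) ∈ Ioo (-δ) δ ×ˢ B₁ from ⟨⟨by linarith, hcon⟩, hxB₁⟩)).1.1.1.2
    exact lt_irrefl _ this
  refine ⟨δ, b, ε, κ, B, hδ₀', hxB, fun x hx => (hsub (show ((0 : ℝ), x) ∈ Ioo (-δ) δ ×ˢ B₁ from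
    ⟨⟨by linarith, hδ⟩, hBB₁ hx⟩)).1.1.2, ⟨hBo, hb0, by linarith, hε0,
    hκs.mono fun p hp => (hsub ⟨hp.1, hBB₁ hp.2⟩).1, fun τ hτ x hx => hκpos _ (hsub ⟨hτ, hBB₁ hx⟩),
    fun τ hτ x hx => hdpos (τ, x) (hsub ⟨hτ, hBB₁ hx⟩), fun x hx => le_of_lt hx.1.2, fun x hx => le_of_lt hx.2.2⟩,
    fun x hx τ hτ => ?_⟩
  obtain ⟨⟨⟨m1, m2⟩, m3⟩, -⟩ := hsub (show (τ, x) ∈ Ioo (-δ) δ ×ˢ B₁ from ⟨hτ, hBB₁ hx⟩)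
  rw [hfac τ m1 x m2]
  simp only [hκ, div_inv_eq_mul]
  rw [mul_pow, Real.sq_sqrt (le_of_lt m3)]

end MorseCoordinate

/-! ### Stationary points of the phase -/

section PhaseFunction

variable {K : ℕ → Obstacle} {α : Plane} {m : ℕ}

/-- The phase of the double-layer potential. -/
def layerPhase (K : ℕ → Obstacle) (α : Plane) (m : ℕ) (p : ℝ × Plane) : ℝ :=
  phase K α m ((K m).γ p.1) + ‖p.2 - (K m).γ p.1‖

theorem Obstacle.sub_γ_ne_zero (O : Obstacle) {x : Plane} (hx : x ∉ O.carrier) (t : ℝ) :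
    x - O.γ t ≠ 0 := fun h => hx (by rw [sub_eq_zero.1 h]; exact O.γ_mem t)

theorem Obstacle.contDiffOn_dist (O : Obstacle) :
    ContDiffOn ℝ ∞ (fun p : ℝ × Plane => ‖p.2 - O.γ p.1‖) (univ ×ˢ O.carrierᶜ) := by
  refine ContDiffOn.norm ℝ ?_ fun p hp => O.sub_γ_ne_zero hp.2 p.1
  exact (contDiff_snd.sub (O.smooth.comp contDiff_fst)).contDiffOn

theorem contDiffOn_layerPhase (h : SmoothRays K α m) :
    ContDiffOn ℝ ∞ (layerPhase K α m) (univ ×ˢ (K m).carrierᶜ) :=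
  (h.contDiff_phase.comp contDiff_fst).contDiffOn.add (K m).contDiffOn_dist

theorem hasDerivAt_dist_γ (O : Obstacle) {x : Plane} (hx : x ∉ O.carrier) (t : ℝ) :
    HasDerivAt (fun t => ‖x - O.γ t‖) (-⟪unitVec (x - O.γ t), deriv O.γ t⟫) t := by
  have hne : x ≠ O.γ t := fun h => hx (h ▸ O.γ_mem t)
  exact ((hasFDerivAt_norm_sub hne).comp_hasDerivAt t (O.hasDerivAt_γ t)).congr_deriv (by simp)

theorem hasDerivAt_layerPhase (h : SmoothRays K α m) {x : Plane} (hx : x ∉ (K m).carrier) (t : ℝ) :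
    HasDerivAt (fun t => layerPhase K α m (t, x))
      (⟪incDir K α m ((K m).γ t), deriv (K m).γ t⟫ -
        ⟪unitVec (x - (K m).γ t), deriv (K m).γ t⟫) t := by
  exact ((h.phase t).add (hasDerivAt_dist_γ (K m) hx t)).congr_deriv (sub_eq_add_neg _ _).symm

theorem notMem_carrier_of_refl {y : Plane} (hy : y ∈ illuminated K α m) {t : ℝ} (ht : 0 < t) :
    y + t • refDir K α m y ∉ (K m).carrier := by
  intro hmem
  have h1 := (K m).inner_normal_nonpos hy.1 hmem
  rw [add_sub_cancel_left, inner_smul_left, inner_refDir_normal hy.1] at h1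
  have h2 := hy.2
  simp only [conj_trivial] at h1
  nlinarith

theorem openIlluminated_subset_compl : openIlluminated K α m ⊆ (K m).carrierᶜ := fun x hx => by
  obtain ⟨y, hy, t, ht, rfl⟩ := mem_openIlluminated_iff.1 hx
  exact notMem_carrier_of_refl hy ht

theorem unitVec_refl (hA : Admissible K α) {y : Plane} (hy : y ∈ frontier (K m).carrier) {t : ℝ}
    (ht : 0 < t) : unitVec (y + t • refDir K α m y - y) = refDir K α m y := by
  rw [add_sub_cancel_left, unitVec_smul (norm_refDir hA hy) ht]

theorem deriv_layerPhase_eq_zero (hA : Admissible K α) {s : ℝ}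
    (hs : (K m).γ s ∈ illuminated K α m) {t : ℝ} (ht : 0 < t) :
    deriv (fun r => layerPhase K α m (r, (K m).γ s + t • refDir K α m ((K m).γ s))) s = 0 := by
  rw [(hasDerivAt_layerPhase (smoothRays hA m) (notMem_carrier_of_refl hs ht) s).deriv,
    unitVec_refl hA hs.1 ht, inner_refDir_tangent, sub_self]

/-- The only stationary point of the phase outside the shadow is the point of reflection. -/
theorem stationary_point_unique (hA : Admissible K α) {y : Plane} (hy : y ∈ illuminated K α m)
    {t : ℝ} (ht : 0 < t) {r : ℝ} (hr : (K m).γ r ∉ shadow K α m)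
    (h : deriv (fun r => layerPhase K α m (r, y + t • refDir K α m y)) r = 0) :
    y = (K m).γ r := by
  have hx := notMem_carrier_of_refl hy ht
  set x := y + t • refDir K α m y with hxdef
  have hfr := (K m).γ_mem_frontier r
  have hne := (K m).sub_γ_ne_zero hx r
  have hpos := norm_pos_iff.2 hne
  rw [(hasDerivAt_layerPhase (smoothRays hA m) hx r).deriv, sub_eq_zero] at h
  have hinc := incRay_frontier hA hfr
  have hinc0 := incRay_frontier hA hy.1
  have hle : ⟪incDir K α m ((K m).γ r), (K m).normal ((K m).γ r)⟫ ≤ 0 := by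
    by_contra! hcon
    exact hr ⟨hfr, hcon⟩
  have hstraight : x ≠ (K m).γ r + ‖x - (K m).γ r‖ • incDir K α m ((K m).γ r) :=
    hinc0.not_shadow hA.unit hinc hy.1 hfr hy.2 ht hpos
  have hxe : x = (K m).γ r + ‖x - (K m).γ r‖ • unitVec (x - (K m).γ r) := by
    rw [norm_smul_unitVec]
    abel
  -- Equal tangential components: the direction to `x` is either the incident one, excluded by
  -- `IncRay.not_shadow`, or the reflected one.
  rcases eq_or_eq_reflect ((K m).unit_speed r) (norm_unitVec hne) (norm_incDir hA hfr) h.symm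
    with h1 | h1
  · exact absurd (h1 ▸ hxe) hstraight
  · rw [← (K m).normal_γ] at h1
    rcases hle.lt_or_eq with h2 | h2
    · rw [h1, hxdef] at hxe
      exact reflect_point_unique hA.unit hy.1 hfr hinc0 hinc hy.2 h2 ht hpos hxe
    -- On the shadow boundary reflection is trivial, and the straight case applies again.
    · rw [reflect, h2, mul_zero, zero_smul, sub_zero] at h1
      exact absurd (h1 ▸ hxe) hstraight

/-- The phase has a nondegenerate minimum at the point of reflection. -/
theorem iteratedDeriv_two_layerPhase_pos (hA : Admissible K α) {s : ℝ}
    (hs : (K m).γ s ∈ illuminated K α m) {t : ℝ} (ht : 0 < t) :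
    0 < iteratedDeriv 2
      (fun r => layerPhase K α m (r, (K m).γ s + t • refDir K α m ((K m).γ s))) s := by
  have hx := notMem_carrier_of_refl hs ht
  have hu := unitVec_refl hA hs.1 ht
  set x := (K m).γ s + t • refDir K α m ((K m).γ s) with hxdef
  have hS := smoothRays hA m
  have hnorm : ‖x - (K m).γ s‖ = t := by
    rw [hxdef, add_sub_cancel_left, norm_smul, norm_refDir hA hs.1, mul_one,
      Real.norm_of_nonneg ht.le]
  have hsub : x - (K m).γ s = t • refDir K α m ((K m).γ s) := by rw [hxdef, add_sub_cancel_left]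
  rw [iteratedDeriv_succ, iteratedDeriv_one, funext fun r => (hasDerivAt_layerPhase hS hx r).deriv]
  have hg' : HasDerivAt (deriv (K m).γ) (deriv (deriv (K m).γ) s) s :=
    ((K m).contDiff_deriv_γ.differentiable (by simp) s).hasDerivAt
  have hi' : HasDerivAt (fun s => incDir K α m ((K m).γ s))
      (deriv (fun s => incDir K α m ((K m).γ s)) s) s :=
    (hS.incDir.differentiable (by simp) s).hasDerivAt
  have hd1 := hi'.inner ℝ hg'
  have hd2 : HasDerivAt (fun r => x - (K m).γ r) (-deriv (K m).γ s) s :=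
    ((K m).hasDerivAt_γ s).const_sub x
  have hd3 := (hd2.inner ℝ hg').fun_div (hasDerivAt_dist_γ (K m) hx s) (by rw [hnorm]; exact ht.ne')
  have hfun : (fun r => ⟪incDir K α m ((K m).γ r), deriv (K m).γ r⟫ -
      ⟪unitVec (x - (K m).γ r), deriv (K m).γ r⟫) = fun r =>
      ⟪incDir K α m ((K m).γ r), deriv (K m).γ r⟫ -
        ⟪x - (K m).γ r, deriv (K m).γ r⟫ / ‖x - (K m).γ r‖ := by
    ext r
    rw [unitVec, inner_smul_left, div_eq_inv_mul]
    rfl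
  rw [hfun, (hd1.fun_sub hd3).deriv, hnorm, hu, hsub]
  have hgg : ⟪deriv (K m).γ s, deriv (K m).γ s⟫ = 1 := by
    rw [real_inner_self_eq_norm_sq, (K m).unit_speed, one_pow]
  have h1 := hS.inner_deriv_incDir_nonneg hA s
  have h2 := one_sub_sq_inner_refDir_pos hA hs
  have h3 := (K m).inner_normal_deriv_deriv_nonpos s
  have h4 : ⟪refDir K α m ((K m).γ s), deriv (deriv (K m).γ) s⟫ =
      ⟪incDir K α m ((K m).γ s), deriv (deriv (K m).γ) s⟫ -
        2 * ⟪incDir K α m ((K m).γ s), (K m).normal ((K m).γ s)⟫ *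
          ⟪(K m).normal ((K m).γ s), deriv (deriv (K m).γ) s⟫ := by
    rw [refDir, reflect, inner_sub_left, inner_smul_left]
    simp
  have h5 := mul_nonneg_of_nonpos_of_nonpos hs.2.le h3
  simp only [inner_smul_left, inner_neg_left, hgg, conj_trivial, h4]
  have h6 : 0 < (1 - ⟪refDir K α m ((K m).γ s), deriv (K m).γ s⟫ ^ 2) / t := div_pos h2 ht
  -- The second derivative splits into the spreading of the incident rays, a curvature term, and the
  -- squared normal component divided by the distance. The first two are nonnegative and the last is
  -- positive.
  have h7 : ∀ a b c d e f : ℝ, a + b - ((t * (a - 2 * c * d) + -1) * t - t * e * -e) / t ^ 2 =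
      b + 2 * (c * d) + (1 - e ^ 2) / t := by
    intro a b c d e f
    field_simp
    ring
  rw [h7 _ _ _ _ _ 0]
  linarith

end PhaseFunction

/-! ### Crude polynomial bounds for derivatives -/

section PolynomialBounds

variable {V : Type} [NormedAddCommGroup V] [NormedSpace ℝ V]

/-- Families with `‖D^n f‖ ≤ C (1+k)^{e+n}`, uniformly for `t ∈ T`, `x ∈ S`, `k ≥ k₀`. -/
def PolyBound (T : Set ℝ) (S : Set V) (k₀ : ℝ) (e : ℕ) (f : ℝ → V × ℝ → ℂ) : Prop :=
  ∀ n : ℕ, ∃ C : ℝ, 0 ≤ C ∧ ∀ t ∈ T, ∀ x ∈ S, ∀ k : ℝ, k₀ ≤ k →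
    ‖iteratedFDeriv ℝ n (f t) (x, k)‖ ≤ C * (1 + k) ^ (e + n)

variable {T : Set ℝ} {S B : Set V} {k₀ : ℝ}

theorem PolyBound.mul (hB : IsOpen B) (hSB : S ⊆ B) (hk₀ : 0 < k₀) {e e' : ℕ}
    {f g : ℝ → V × ℝ → ℂ} (hf : PolyBound T S k₀ e f) (hg : PolyBound T S k₀ e' g)
    (hfs : ∀ t ∈ T, ContDiffOn ℝ ∞ (f t) (B ×ˢ Ioi 0))
    (hgs : ∀ t ∈ T, ContDiffOn ℝ ∞ (g t) (B ×ˢ Ioi 0)) :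
    PolyBound T S k₀ (e + e') fun t p => f t p * g t p := by
  intro n
  choose Cf hCf0 hCf using hf
  choose Cg hCg0 hCg using hg
  refine ⟨∑ j ∈ Finset.range (n + 1), (n.choose j : ℝ) * Cf j * Cg (n - j),
    Finset.sum_nonneg fun j _ => mul_nonneg (mul_nonneg (Nat.cast_nonneg _) (hCf0 j)) (hCg0 _),
    fun t ht x hx k hk => ?_⟩
  have hkp : 0 < k := hk₀.trans_le hk
  refine (norm_iteratedFDeriv_mul_le_of_isOpen (hB.prod isOpen_Ioi) (hfs t ht) (hgs t ht)
    (x := (x, k)) ⟨hSB hx, hkp⟩ n).trans ?_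
  rw [Finset.sum_mul]
  refine Finset.sum_le_sum fun j hj => ?_
  have hj' : j ≤ n := Nat.lt_succ_iff.1 (Finset.mem_range.1 hj)
  have h1 := hCf j t ht x hx k hk
  have h2 := hCg (n - j) t ht x hx k hk
  calc (n.choose j : ℝ) * ‖iteratedFDeriv ℝ j (f t) (x, k)‖ *
        ‖iteratedFDeriv ℝ (n - j) (g t) (x, k)‖
      ≤ (n.choose j : ℝ) * (Cf j * (1 + k) ^ (e + j)) * (Cg (n - j) * (1 + k) ^ (e' + (n - j))) :=
        mul_le_mul (mul_le_mul_of_nonneg_left h1 (Nat.cast_nonneg _)) h2 (norm_nonneg _)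
          (mul_nonneg (Nat.cast_nonneg _) ((norm_nonneg _).trans h1))
    _ = (n.choose j : ℝ) * Cf j * Cg (n - j) * ((1 + k) ^ (e + j) * (1 + k) ^ (e' + (n - j))) := by
        ring
    _ = _ := by rw [← pow_add, show e + j + (e' + (n - j)) = e + e' + n by omega]

theorem PolyBound.of_bounded (hk₀ : 0 < k₀) {f : ℝ → V × ℝ → ℂ}
    (h : ∀ n : ℕ, ∃ C : ℝ, ∀ t ∈ T, ∀ x ∈ S, ∀ k : ℝ, k₀ ≤ k →
      ‖iteratedFDeriv ℝ n (f t) (x, k)‖ ≤ C) : PolyBound T S k₀ 0 f := by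
  intro n
  obtain ⟨C, hC⟩ := h n
  refine ⟨|C|, abs_nonneg _, fun t ht x hx k hk => ?_⟩
  exact ((hC t ht x hx k hk).trans (le_abs_self C)).trans
    (le_mul_of_one_le_right (abs_nonneg _) (one_le_pow₀ (by linarith)))

theorem norm_iteratedFDeriv_snd_le (i : ℕ) (p : V × ℝ) (hi : 1 ≤ i) :
    ‖iteratedFDeriv ℝ i (Prod.snd : V × ℝ → ℝ) p‖ ≤ 1 := by
  obtain ⟨j, rfl⟩ : ∃ j, i = j + 1 := ⟨i - 1, by omega⟩
  have hfd : fderiv ℝ (Prod.snd : V × ℝ → ℝ) = fun _ => ContinuousLinearMap.snd ℝ V ℝ := by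
    ext1 y
    exact hasFDerivAt_snd.fderiv
  rw [← norm_iteratedFDeriv_fderiv, hfd]
  rcases Nat.eq_zero_or_pos j with rfl | hj
  · rw [norm_iteratedFDeriv_zero]; exact ContinuousLinearMap.norm_snd_le ℝ V ℝ
  · rw [iteratedFDeriv_const_of_ne (by omega)]; simp

theorem norm_iteratedFDeriv_fst_le (i : ℕ) (p : V × ℝ) (hi : 1 ≤ i) :
    ‖iteratedFDeriv ℝ i (Prod.fst : V × ℝ → V) p‖ ≤ 1 := by
  obtain ⟨j, rfl⟩ : ∃ j, i = j + 1 := ⟨i - 1, by omega⟩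
  have hfd : fderiv ℝ (Prod.fst : V × ℝ → V) = fun _ => ContinuousLinearMap.fst ℝ V ℝ := by
    ext1 y
    exact hasFDerivAt_fst.fderiv
  rw [← norm_iteratedFDeriv_fderiv, hfd]
  rcases Nat.eq_zero_or_pos j with rfl | hj
  · rw [norm_iteratedFDeriv_zero]; exact ContinuousLinearMap.norm_fst_le ℝ V ℝ
  · rw [iteratedFDeriv_const_of_ne (by omega)]; simp

theorem norm_iteratedFDeriv_comp_snd_le {G : Type} [NormedAddCommGroup G] [NormedSpace ℝ G]
    {g : ℝ → G} (hg : ContDiffOn ℝ ∞ g (Ioi 0)) {n : ℕ} {C : ℝ} {x : V} {k : ℝ} (hk : 0 < k)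
    (hC : ∀ i ≤ n, ‖iteratedDeriv i g k‖ ≤ C) :
    ‖iteratedFDeriv ℝ n (fun p : V × ℝ => g p.2) (x, k)‖ ≤ n.factorial * C := by
  have h := norm_iteratedFDeriv_comp_le_of_isOpen (isOpen_univ.prod (isOpen_Ioi (a := (0 : ℝ))))
    isOpen_Ioi hg (f := (Prod.snd : V × ℝ → ℝ)) contDiff_snd.contDiffOn
    (s := univ ×ˢ Ioi (0 : ℝ)) (fun p hp => hp.2) (x := (x, k)) ⟨mem_univ x, hk⟩ (n := n) (C := C)
    (R := 1)
    (fun i hi => by rw [norm_iteratedFDeriv_eq_norm_iteratedDeriv]; exact hC i hi)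
    (fun i h1 _ => by simpa using norm_iteratedFDeriv_snd_le i (x, k) h1)
  simpa using h

theorem iteratedDeriv_cexp_I (n : ℕ) : iteratedDeriv n (fun y : ℝ => Complex.exp (Complex.I * y)) =
    fun y : ℝ => Complex.I ^ n * Complex.exp (Complex.I * y) := by
  induction n with
  | zero => simp
  | succ n ih =>
    ext y
    rw [iteratedDeriv_succ, ih]
    have h1 : HasDerivAt (fun y : ℝ => Complex.I ^ n * Complex.exp (Complex.I * y))
        (Complex.I ^ n * (Complex.exp (Complex.I * y) * (Complex.I * 1))) y :=
      (((Complex.ofRealCLM.hasDerivAt (x := y)).const_mul Complex.I).cexp).const_mul _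
    rw [h1.deriv]
    ring

theorem contDiff_cexp_I : ContDiff ℝ ∞ fun y : ℝ => Complex.exp (Complex.I * y) :=
  (contDiff_const.mul Complex.ofRealCLM.contDiff).cexp

/-- All derivatives of `kΘ` are `O(1+k)`, so `n` derivatives of the exponential cost at most `n`
powers of `k`. -/
theorem polyBound_exp {U : Set ℝ} (hU : IsOpen U) (hB : IsOpen B) {Θ : ℝ × V → ℝ}
    (hΘ : ContDiffOn ℝ ∞ Θ (U ×ˢ B)) (hT : IsCompact T) (hTU : T ⊆ U) (hS : IsCompact S)
    (hSB : S ⊆ B) (hk₀ : 0 < k₀) : PolyBound T S k₀ 0 fun t p =>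
      Complex.exp (Complex.I * ((p.2 * Θ (t, p.1) : ℝ) : ℂ)) := by
  intro n
  have hΩ : IsOpen (U ×ˢ B) := hU.prod hB
  choose c hc using fun i => exists_bound_iteratedFDeriv_slice hΩ hΘ (hT.prod hS)
    (prod_mono hTU hSB) i
  set c' : ℕ → ℝ := fun i => i.factorial * ∑ j ∈ Finset.range (i + 1), |c j| with hc'
  have hslice : ∀ t ∈ T, ContDiffOn ℝ ∞ (fun x => Θ (t, x)) B := fun t ht =>
    hΘ.comp (by fun_prop) fun x hx => ⟨hTU ht, hx⟩
  have hslice' : ∀ t ∈ T, ContDiffOn ℝ ∞ (fun p : V × ℝ => Θ (t, p.1)) (B ×ˢ univ) := fun t ht =>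
    (hslice t ht).comp contDiff_fst.contDiffOn fun p hp => hp.1
  have hΘb : ∀ i, ∀ t ∈ T, ∀ x ∈ S, ∀ k : ℝ,
      ‖iteratedFDeriv ℝ i (fun p : V × ℝ => Θ (t, p.1)) (x, k)‖ ≤ c' i := by
    intro i t ht x hx k
    have h := norm_iteratedFDeriv_comp_le_of_isOpen (hB.prod (isOpen_univ (X := ℝ))) hB (hslice t ht)
      (f := (Prod.fst : V × ℝ → V)) contDiff_fst.contDiffOn (fun p hp => hp.1) (x := (x, k))
      ⟨hSB hx, mem_univ k⟩ (n := i) (C := ∑ j ∈ Finset.range (i + 1), |c j|) (R := 1)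
      (fun j hj => ((hc j (t, x) ⟨ht, hx⟩).trans (le_abs_self _)).trans
        (Finset.single_le_sum (f := fun j => |c j|) (fun _ _ => abs_nonneg _)
          (Finset.mem_range.2 (by omega))))
      (fun j h1 _ => by simpa using norm_iteratedFDeriv_fst_le j (x, k) h1)
    simpa using h
  have hc'0 : ∀ i, 0 ≤ c' i := fun i =>
    mul_nonneg (Nat.cast_nonneg _) (Finset.sum_nonneg fun _ _ => abs_nonneg _)
  set D : ℕ → ℝ := fun i => ∑ j ∈ Finset.range (i + 1), (i.choose j : ℝ) * c' (i - j) with hD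
  have hD0 : ∀ i, 0 ≤ D i := fun i =>
    Finset.sum_nonneg fun j _ => mul_nonneg (Nat.cast_nonneg _) (hc'0 _)
  have hprod : ∀ i, ∀ t ∈ T, ∀ x ∈ S, ∀ k : ℝ, k₀ ≤ k →
      ‖iteratedFDeriv ℝ i (fun p : V × ℝ => p.2 * Θ (t, p.1)) (x, k)‖ ≤ D i * (1 + k) := by
    intro i t ht x hx k hk
    have hkp : 0 < k := hk₀.trans_le hk
    refine (norm_iteratedFDeriv_mul_le_of_isOpen (hB.prod (isOpen_univ (X := ℝ)))
      contDiff_snd.contDiffOn (hslice' t ht) (x := (x, k)) ⟨hSB hx, mem_univ k⟩ i).trans ?_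
    rw [hD, Finset.sum_mul]
    refine Finset.sum_le_sum fun j _ => ?_
    have h1 : ‖iteratedFDeriv ℝ j (Prod.snd : V × ℝ → ℝ) (x, k)‖ ≤ 1 + k := by
      rcases Nat.eq_zero_or_pos j with rfl | hj
      · rw [norm_iteratedFDeriv_zero, Real.norm_of_nonneg hkp.le]
        simp
      · exact (norm_iteratedFDeriv_snd_le j (x, k) hj).trans (by linarith)
    calc (i.choose j : ℝ) * ‖iteratedFDeriv ℝ j (Prod.snd : V × ℝ → ℝ) (x, k)‖ *
          ‖iteratedFDeriv ℝ (i - j) (fun p : V × ℝ => Θ (t, p.1)) (x, k)‖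
        ≤ (i.choose j : ℝ) * (1 + k) * c' (i - j) :=
          mul_le_mul (mul_le_mul_of_nonneg_left h1 (Nat.cast_nonneg _)) (hΘb _ t ht x hx k)
            (norm_nonneg _) (by positivity)
      _ = _ := by ring
  set R : ℝ := 1 + ∑ i ∈ Finset.range (n + 1), D i with hR
  have hDsum : 0 ≤ ∑ i ∈ Finset.range (n + 1), D i := Finset.sum_nonneg fun i _ => hD0 i
  have hR1 : 1 ≤ R := by linarith
  refine ⟨n.factorial * R ^ n, by positivity, fun t ht x hx k hk => ?_⟩
  have hkp : 0 < k := hk₀.trans_le hk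
  have h := norm_iteratedFDeriv_comp_le_of_isOpen (hB.prod (isOpen_univ (X := ℝ))) isOpen_univ
    contDiff_cexp_I.contDiffOn (f := fun p : V × ℝ => p.2 * Θ (t, p.1))
    (contDiff_snd.contDiffOn.mul (hslice' t ht)) (mapsTo_univ _ _) (x := (x, k))
    ⟨hSB hx, mem_univ k⟩ (n := n) (C := 1) (R := R * (1 + k)) (fun i _ => ?_) (fun i h1 hi => ?_)
  · refine h.trans_eq ?_
    rw [mul_one, mul_pow, zero_add, mul_assoc]
  · rw [norm_iteratedFDeriv_eq_norm_iteratedDeriv, iteratedDeriv_cexp_I, norm_mul, norm_pow,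
      Complex.norm_I, one_pow, one_mul, mul_comm Complex.I, Complex.norm_exp_ofReal_mul_I]
  · refine (hprod i t ht x hx k hk).trans ?_
    have h2 : D i ≤ R := by
      have := Finset.single_le_sum (f := D) (fun i _ => hD0 i)
        (Finset.mem_range.2 (show i < n + 1 by omega))
      linarith
    calc D i * (1 + k) ≤ R * (1 + k) := by gcongr
      _ ≤ (R * (1 + k)) ^ i := le_self_pow₀ (by nlinarith) (by omega)

theorem contDiffOn_sqrt_pos : ContDiffOn ℝ ∞ (fun k : ℝ => ((Real.sqrt k : ℝ) : ℂ)) (Ioi 0) :=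
  Complex.ofRealCLM.contDiff.comp_contDiffOn
    (contDiffOn_id.sqrt fun _ hk => ne_of_gt hk)

theorem polyBound_sqrt (hk₀ : 0 < k₀) : PolyBound T S k₀ 1 fun _ p => ((Real.sqrt p.2 : ℝ) : ℂ) := by
  intro n
  set c : ℕ → ℝ := fun i => |(descPochhammer ℝ i).eval (1 / 2 : ℝ)| * (k₀ ^ i)⁻¹ with hc
  have hc0 : ∀ i, 0 ≤ c i := fun i => by positivity
  refine ⟨n.factorial * ∑ i ∈ Finset.range (n + 1), c i,
    mul_nonneg (Nat.cast_nonneg _) (Finset.sum_nonneg fun i _ => hc0 i), fun t _ x _ k hk => ?_⟩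
  have hkp : 0 < k := hk₀.trans_le hk
  have h1k : 1 ≤ 1 + k := by linarith
  have h := norm_iteratedFDeriv_comp_snd_le (V := V) contDiffOn_sqrt_pos (n := n)
    (C := (∑ i ∈ Finset.range (n + 1), c i) * (1 + k)) (x := x) hkp (fun i hi => ?_)
  · refine h.trans ?_
    rw [← mul_assoc]
    refine mul_le_mul_of_nonneg_left (le_self_pow₀ h1k (by omega)) ?_
    exact mul_nonneg (Nat.cast_nonneg _) (Finset.sum_nonneg fun i _ => hc0 i)
  · have e1 : iteratedDeriv i (fun k : ℝ => ((Real.sqrt k : ℝ) : ℂ)) k =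
        ((iteratedDeriv i (fun k : ℝ => k ^ (1 / 2 : ℝ)) k : ℝ) : ℂ) := by
      have : (fun k : ℝ => ((Real.sqrt k : ℝ) : ℂ)) =
          fun k : ℝ => Complex.ofRealCLM (k ^ (1 / 2 : ℝ)) := by
        ext k
        simp [Real.sqrt_eq_rpow]
      rw [this]
      have h2 := ContinuousLinearMap.iteratedFDeriv_comp_left (𝕜 := ℝ) Complex.ofRealCLM
        (f := fun k : ℝ => k ^ (1 / 2 : ℝ)) (x := k) (n := (i : ℕ)) (i := i)
        (Real.contDiffAt_rpow_const_of_ne hkp.ne') le_rfl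
      rw [iteratedDeriv_eq_iteratedFDeriv, iteratedDeriv_eq_iteratedFDeriv]
      exact congrArg (fun g => g fun _ => (1 : ℝ)) h2
    rw [e1, Complex.norm_real, iteratedDeriv_eq_iterate, Real.iter_deriv_rpow_const, norm_mul,
      Real.norm_eq_abs, Real.norm_of_nonneg (Real.rpow_nonneg hkp.le _)]
    have e2 : k ^ ((1 / 2 : ℝ) - i) ≤ (k₀ ^ i)⁻¹ * (1 + k) := by
      rw [Real.rpow_sub hkp, Real.rpow_natCast, div_eq_inv_mul, ← Real.sqrt_eq_rpow]
      have h3 : Real.sqrt k ≤ 1 + k := by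
        rw [Real.sqrt_le_left (by linarith)]
        nlinarith
      have h4 : (k ^ i)⁻¹ ≤ (k₀ ^ i)⁻¹ := by gcongr
      exact mul_le_mul h4 h3 (Real.sqrt_nonneg _) (by positivity)
    calc |(descPochhammer ℝ i).eval (1 / 2 : ℝ)| * k ^ ((1 / 2 : ℝ) - i)
        ≤ |(descPochhammer ℝ i).eval (1 / 2 : ℝ)| * ((k₀ ^ i)⁻¹ * (1 + k)) := by gcongr
      _ = c i * (1 + k) := by rw [hc]; ring
      _ ≤ _ := by
          gcongr
          exact Finset.single_le_sum (f := c) (fun i _ => hc0 i) (Finset.mem_range.2 (by omega))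

/-- For fixed `t` the density does not depend on `x`; only `k`-derivatives occur, and they do not
grow when `ϱ ≥ 0`. -/
theorem polyBound_hormander (hk₀ : 0 < k₀) {g : ℝ → ℝ → ℂ} {ϱ δ : ℝ} (hϱ : 0 ≤ ϱ)
    (hg : IsHormander univ 0 ϱ δ g) (hT : IsCompact T) :
    PolyBound T S k₀ 0 fun t p => g t p.2 := by
  refine .of_bounded hk₀ fun n => ?_
  have hb : ∀ i, ∃ C : ℝ, ∀ t ∈ T, ∀ k : ℝ, k₀ ≤ k → ‖iteratedDeriv i (g t) k‖ ≤ C := by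
    intro i
    obtain ⟨C, hC⟩ := hg.2 T (subset_univ _) hT k₀ hk₀ 0 i
    refine ⟨|C|, fun t ht k hk => ?_⟩
    have h := hC t ht k hk
    rw [norm_iteratedFDeriv_zero] at h
    refine h.trans ?_
    have h1 : (1 + k) ^ (0 - ϱ * i + δ * (0 : ℕ)) ≤ 1 := by
      refine Real.rpow_le_one_of_one_le_of_nonpos (by linarith) ?_
      have : 0 ≤ ϱ * i := by positivity
      simp
      linarith
    calc C * (1 + k) ^ (0 - ϱ * i + δ * (0 : ℕ)) ≤ |C| * (1 + k) ^ (0 - ϱ * i + δ * (0 : ℕ)) := by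
          refine mul_le_mul_of_nonneg_right (le_abs_self C) (Real.rpow_nonneg (by linarith) _)
      _ ≤ |C| := mul_le_of_le_one_right (abs_nonneg _) h1
  choose C hC using hb
  refine ⟨n.factorial * ∑ i ∈ Finset.range (n + 1), |C i|, fun t ht x _ k hk => ?_⟩
  have hgs : ContDiffOn ℝ ∞ (g t) (Ioi 0) :=
    hg.1.comp (f := fun k : ℝ => (t, k)) (by fun_prop) fun k hk => ⟨mem_univ t, hk⟩
  refine norm_iteratedFDeriv_comp_snd_le hgs (hk₀.trans_le hk) fun i hi => ?_
  exact ((hC i t ht k hk).trans (le_abs_self _)).trans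
    (Finset.single_le_sum (f := fun i => |C i|) (fun _ _ => abs_nonneg _)
      (Finset.mem_range.2 (by omega)))

end PolynomialBounds

/-! ### The scattered field as an oscillatory integral -/

section LayerIntegral

variable {K : ℕ → Obstacle} {α : Plane} {m : ℕ}

/-- The slowly varying factor of the kernel of the double-layer potential; the last variable is
`1/k`. -/
def layerSymbol (O : Obstacle) (z : ℝ × (Plane × ℝ)) : ℂ :=
  Complex.I / 4 * hankelConst * ((‖z.2.1 - O.γ z.1‖ ^ (-1 / 2 : ℝ) : ℝ) : ℂ) *
    hankelBeta (z.2.2 / (2 * ‖z.2.1 - O.γ z.1‖)) *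
    (⟪unitVec (z.2.1 - O.γ z.1), O.normal (O.γ z.1)⟫ : ℝ)

theorem Obstacle.contDiffOn_inner_unitVec (O : Obstacle) : ContDiffOn ℝ ∞ (fun p : ℝ × Plane =>
    ⟪unitVec (p.2 - O.γ p.1), O.normal (O.γ p.1)⟫) (univ ×ˢ O.carrierᶜ) := by
  refine ContDiffOn.inner ℝ ?_ (O.contDiff_normal_γ.comp contDiff_fst).contDiffOn
  exact (O.contDiffOn_dist.inv fun p hp => norm_ne_zero_iff.2 (O.sub_γ_ne_zero hp.2 p.1)).smul
    (contDiff_snd.sub (O.smooth.comp contDiff_fst)).contDiffOn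

theorem contDiffOn_rpow_dist (O : Obstacle) (s : ℝ) : ContDiffOn ℝ ∞ (fun p : ℝ × Plane =>
    ‖p.2 - O.γ p.1‖ ^ s) (univ ×ˢ O.carrierᶜ) :=
  O.contDiffOn_dist.rpow_const_of_ne fun p hp => norm_ne_zero_iff.2 (O.sub_γ_ne_zero hp.2 p.1)

theorem contDiffOn_layerSymbol (O : Obstacle) :
    ContDiffOn ℝ ∞ (layerSymbol O) (univ ×ˢ (O.carrierᶜ ×ˢ univ)) := by
  have hproj : ContDiff ℝ ∞ fun z : ℝ × (Plane × ℝ) => (z.1, z.2.1) := by fun_prop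
  have hmaps : MapsTo (fun z : ℝ × (Plane × ℝ) => (z.1, z.2.1)) (univ ×ˢ (O.carrierᶜ ×ˢ univ))
      (univ ×ˢ O.carrierᶜ) := fun z hz => ⟨mem_univ _, hz.2.1⟩
  have h1 := Complex.ofRealCLM.contDiff.comp_contDiffOn
    ((contDiffOn_rpow_dist O (-1 / 2)).comp hproj.contDiffOn hmaps)
  have h2 := Complex.ofRealCLM.contDiff.comp_contDiffOn
    (O.contDiffOn_inner_unitVec.comp hproj.contDiffOn hmaps)
  have h3 := O.contDiffOn_dist.comp hproj.contDiffOn hmaps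
  have h4 : ContDiffOn ℝ ∞ (fun z : ℝ × (Plane × ℝ) =>
      z.2.2 / (2 * ‖z.2.1 - O.γ z.1‖)) (univ ×ˢ (O.carrierᶜ ×ˢ univ)) := by
    refine (contDiff_snd.comp contDiff_snd).contDiffOn.div (contDiffOn_const.mul h3) fun z hz => ?_
    exact mul_ne_zero two_ne_zero (norm_ne_zero_iff.2 (O.sub_γ_ne_zero hz.2.1 z.1))
  exact ((contDiffOn_const.mul h1).mul (contDiff_hankelBeta.comp_contDiffOn h4)).mul h2

/-- The scattered field as an oscillatory integral. -/
theorem uSlow_eq (η : Plane → ℝ → ℂ) {x : Plane} (hx : x ∉ (K m).carrier) {k : ℝ} (hk : 0 < k) :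
    uSlow K α m η x k = Real.sqrt k * ∫ t in (0 : ℝ)..(K m).period,
      Complex.exp (Complex.I * ((k * (layerPhase K α m (t, x) - reflPhase K α m x) : ℝ) : ℂ)) *
        layerSymbol (K m) (t, (x, k⁻¹)) * etaSlow K α m η ((K m).γ t) k := by
  rw [uSlow, doubleLayer, ← intervalIntegral.integral_const_mul,
    ← intervalIntegral.integral_const_mul]
  refine intervalIntegral.integral_congr fun t _ => ?_
  have hne : x ≠ (K m).γ t := fun h => hx (h ▸ (K m).γ_mem t)
  have hr : 0 < ‖x - (K m).γ t‖ := norm_pos_iff.2 (sub_ne_zero.2 hne)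
  have hz : 0 < k * ‖x - (K m).γ t‖ := mul_pos hk hr
  beta_reduce
  rw [fderiv_green hk hne, hankelOne_one_eq hz, layerSymbol, etaSlow, layerPhase]
  set r := ‖x - (K m).γ t‖ with hrdef
  have e1 : 1 / (2 * (k * r)) = k⁻¹ / (2 * r) := by field_simp
  -- The kernel carries a factor `k` and the Hankel function `(kr)^{-1/2}`; together they leave
  -- `√k`.
  have e2 : (k : ℂ) * (((k * r) ^ (-1 / 2 : ℝ) : ℝ) : ℂ) =
      Real.sqrt k * ((r ^ (-1 / 2 : ℝ) : ℝ) : ℂ) := by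
    rw [Real.mul_rpow hk.le hr.le, Real.sqrt_eq_rpow]
    have : k * k ^ (-1 / 2 : ℝ) = k ^ (1 / 2 : ℝ) := by
      nth_rw 1 [← Real.rpow_one k]
      rw [← Real.rpow_add hk]
      norm_num
    rw [← this]
    push_cast
    ring
  have e3 : Complex.exp (Complex.I *
      ((k * (phase K α m ((K m).γ t) + r - reflPhase K α m x) : ℝ) : ℂ)) *
      Complex.exp (-Complex.I * ((k * phase K α m ((K m).γ t) : ℝ) : ℂ)) =
      Complex.exp (-Complex.I * ((k * reflPhase K α m x : ℝ) : ℂ)) *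
        Complex.exp (Complex.I * ((k * r : ℝ) : ℂ)) := by
    rw [← Complex.exp_add, ← Complex.exp_add]
    congr 1
    push_cast
    ring
  rw [e1]
  linear_combination (Complex.exp (-Complex.I * ((k * reflPhase K α m x : ℝ) : ℂ)) *
      Complex.exp (Complex.I * ((k * r : ℝ) : ℂ)) * (Complex.I / 4) * hankelConst *
      hankelBeta (k⁻¹ / (2 * r)) * (⟪unitVec (x - (K m).γ t), (K m).normal ((K m).γ t)⟫ : ℝ) *
      η ((K m).γ t) k) * e2 - (Real.sqrt k * ((r ^ (-1 / 2 : ℝ) : ℝ) : ℂ) * (Complex.I / 4) *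
      hankelConst * hankelBeta (k⁻¹ / (2 * r)) *
      (⟪unitVec (x - (K m).γ t), (K m).normal ((K m).γ t)⟫ : ℝ) * η ((K m).γ t) k) * e3

/-- Differentiation under the integral without using any cancellation. The loss of one power of `k`
per derivative is acceptable, because interpolation needs nothing better than polynomial growth. -/
theorem contDiffOn_uSlow_and_polynomial_bounds {η : Plane → ℝ → ℂ} (hA : Admissible K α)
    (hη : IsHormander univ 0 (2 / 3) (1 / 3) fun s k => etaSlow K α m η ((K m).γ s) k)
    {B : Set Plane} (hB : IsOpen B) (hBK : B ⊆ (K m).carrierᶜ)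
    (hψ : ContDiffOn ℝ ∞ (reflPhase K α m) B) :
    ContDiffOn ℝ ∞ (Function.uncurry (uSlow K α m η)) (B ×ˢ Ioi 0) ∧
      ∀ n, ∃ L : ℕ, HasOrder B L fun p =>
        ‖iteratedFDeriv ℝ n (Function.uncurry (uSlow K α m η)) p‖ := by
  set Θ : ℝ × Plane → ℝ := fun p => layerPhase K α m p - reflPhase K α m p.2 with hΘdef
  have hΘ : ContDiffOn ℝ ∞ Θ (univ ×ˢ B) :=
    ((contDiffOn_layerPhase (smoothRays hA m)).mono (prod_mono_right hBK)).sub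
      (hψ.comp contDiff_snd.contDiffOn fun p hp => hp.2)
  set F : ℝ × (Plane × ℝ) → ℂ := fun z => (Real.sqrt z.2.2 : ℝ) *
    (Complex.exp (Complex.I * ((z.2.2 * Θ (z.1, z.2.1) : ℝ) : ℂ)) *
      layerSymbol (K m) (z.1, (z.2.1, z.2.2⁻¹)) * etaSlow K α m η ((K m).γ z.1) z.2.2) with hF
  have hΩ : IsOpen (B ×ˢ Ioi (0 : ℝ)) := hB.prod isOpen_Ioi
  have f1 : ContDiffOn ℝ ∞ (fun z : ℝ × (Plane × ℝ) => ((Real.sqrt z.2.2 : ℝ) : ℂ))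
      (univ ×ˢ (B ×ˢ Ioi 0)) :=
    contDiffOn_sqrt_pos.comp (contDiff_snd.comp contDiff_snd).contDiffOn fun z hz => hz.2.2
  have f2 : ContDiffOn ℝ ∞ (fun z : ℝ × (Plane × ℝ) =>
      Complex.exp (Complex.I * ((z.2.2 * Θ (z.1, z.2.1) : ℝ) : ℂ))) (univ ×ˢ (B ×ˢ Ioi 0)) := by
    refine contDiff_cexp_I.comp_contDiffOn ((contDiff_snd.comp contDiff_snd).contDiffOn.mul
      (hΘ.comp (f := fun z : ℝ × (Plane × ℝ) => (z.1, z.2.1)) (by fun_prop) fun z hz => ?_))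
    exact ⟨mem_univ _, hz.2.1⟩
  have f3 : ContDiffOn ℝ ∞ (fun z : ℝ × (Plane × ℝ) =>
      layerSymbol (K m) (z.1, (z.2.1, z.2.2⁻¹))) (univ ×ˢ (B ×ˢ Ioi 0)) := by
    refine (contDiffOn_layerSymbol (K m)).comp (f := fun z : ℝ × (Plane × ℝ) =>
      (z.1, (z.2.1, z.2.2⁻¹))) ?_ fun z hz => ⟨mem_univ _, hBK hz.2.1, mem_univ _⟩
    refine contDiff_fst.contDiffOn.prodMk ((contDiff_fst.comp contDiff_snd).contDiffOn.prodMk ?_)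
    exact (contDiff_snd.comp contDiff_snd).contDiffOn.inv fun z hz => ne_of_gt hz.2.2
  have f4 : ContDiffOn ℝ ∞ (fun z : ℝ × (Plane × ℝ) => etaSlow K α m η ((K m).γ z.1) z.2.2)
      (univ ×ˢ (B ×ˢ Ioi 0)) :=
    hη.1.comp (f := fun z : ℝ × (Plane × ℝ) => (z.1, z.2.2)) (by fun_prop)
      fun z hz => ⟨mem_univ _, hz.2.2⟩
  have hFs : ContDiffOn ℝ ∞ F (univ ×ˢ (B ×ˢ Ioi 0)) := f1.mul ((f2.mul f3).mul f4)
  have heq : ∀ p ∈ B ×ˢ Ioi (0 : ℝ), Function.uncurry (uSlow K α m η) p =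
      ∫ t in (0 : ℝ)..(K m).period, F (t, p) := by
    rintro ⟨x, k⟩ ⟨hx, hk⟩
    have := uSlow_eq (K := K) (α := α) (m := m) η (hBK hx) (k := k) hk
    rw [← intervalIntegral.integral_const_mul] at this
    exact this
  have hslice : ∀ {G : ℝ × (Plane × ℝ) → ℂ}, ContDiffOn ℝ ∞ G (univ ×ˢ (B ×ˢ Ioi 0)) →
      ∀ t, ContDiffOn ℝ ∞ (fun p => G (t, p)) (B ×ˢ Ioi 0) := fun hG t =>
    hG.comp (by fun_prop) fun p hp => ⟨mem_univ t, hp⟩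
  refine ⟨(contDiffOn_parametric_integral isOpen_univ hΩ hFs (subset_univ _)).congr heq,
    fun n => ⟨1 + n, fun S hSB hS k₀ hk₀ => ?_⟩⟩
  have hT : IsCompact (uIcc 0 (K m).period) := isCompact_uIcc
  have p2 : PolyBound (uIcc 0 (K m).period) S k₀ 0 _ :=
    polyBound_exp isOpen_univ hB hΘ hT (subset_univ _) hS hSB hk₀
  have p3 : PolyBound (uIcc 0 (K m).period) S k₀ 0 fun t p =>
      layerSymbol (K m) (t, (p.1, p.2⁻¹)) := .of_bounded hk₀ fun n =>
    exists_bound_iteratedFDeriv_comp_inv isOpen_univ hB ((contDiffOn_layerSymbol (K m)).mono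
      (prod_mono_right (prod_mono_left hBK))) hT (subset_univ _) hS hSB hk₀ n
  have p4 : PolyBound (uIcc 0 (K m).period) S k₀ 0 fun t p => etaSlow K α m η ((K m).γ t) p.2 :=
    polyBound_hormander hk₀ (by norm_num) hη hT
  have p23 := p2.mul hB hSB hk₀ p3 (fun t _ => hslice f2 t) (fun t _ => hslice f3 t)
  have p234 := p23.mul hB hSB hk₀ p4 (fun t _ => hslice (f2.mul f3) t) (fun t _ => hslice f4 t)
  have pF := (polyBound_sqrt (T := uIcc 0 (K m).period) (S := S) hk₀).mul hB hSB hk₀ p234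
    (fun t _ => hslice f1 t) (fun t _ => hslice ((f2.mul f3).mul f4) t)
  obtain ⟨C, hC0, hC⟩ := pF n
  refine ⟨C * |(K m).period - 0|, fun x hx k hk => ?_⟩
  have hkp : 0 < k := hk₀.trans_le hk
  have hmem : (x, k) ∈ B ×ˢ Ioi (0 : ℝ) := ⟨hSB hx, hkp⟩
  have hev : Function.uncurry (uSlow K α m η) =ᶠ[𝓝 (x, k)]
      fun p => ∫ t in (0 : ℝ)..(K m).period, F (t, p) := by
    filter_upwards [hΩ.mem_nhds hmem] with p hp using heq p hp
  beta_reduce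
  rw [(hev.iteratedFDeriv ℝ n).eq_of_nhds]
  refine (norm_iteratedFDeriv_parametric_integral_le isOpen_univ hΩ hFs (subset_univ _) hmem n
    (C := C * (1 + k) ^ (1 + n)) fun t ht => ?_).trans_eq ?_
  · exact hC t ht x hx k hk
  · rw [zpow_natCast]
    ring

end LayerIntegral

/-! ### Calculus of uniform expansions without derivatives -/

section SupExpansion

variable {X : Type} {S : Set X} {k₀ : ℝ}

/-- Asymptotic expansions in powers of `1/k`, uniformly on `S`. -/
def HasSupExpansion (S : Set X) (k₀ : ℝ) (F : X → ℝ → ℂ) (A : ℕ → X → ℂ) : Prop :=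
  ∀ N : ℕ, ∃ C : ℝ, ∀ x ∈ S, ∀ k : ℝ, k₀ ≤ k →
    ‖F x k - ∑ p ∈ Finset.range N, ((k : ℂ) ^ p)⁻¹ * A p x‖ ≤ C * (k ^ N)⁻¹

theorem norm_inv_pow_ofReal {k : ℝ} (hk : 0 < k) (n : ℕ) : ‖((k : ℂ) ^ n)⁻¹‖ = (k ^ n)⁻¹ := by
  rw [norm_inv, norm_pow, Complex.norm_real, Real.norm_of_nonneg hk.le]

theorem sqrt_mul_inv_pow_succ_le {k : ℝ} (hk₀ : 0 < k₀) (hk : k₀ ≤ k) (N : ℕ) :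
    Real.sqrt k * (k ^ (N + 1))⁻¹ ≤ (Real.sqrt k₀)⁻¹ * (k ^ N)⁻¹ := by
  have hkp : 0 < k := hk₀.trans_le hk
  have hs0 : 0 < Real.sqrt k₀ := Real.sqrt_pos.2 hk₀
  have h1 : Real.sqrt k₀ ≤ Real.sqrt k := Real.sqrt_le_sqrt hk
  have h2 : 0 < Real.sqrt k := Real.sqrt_pos.2 hkp
  have h3 : Real.sqrt k * k⁻¹ = (Real.sqrt k)⁻¹ := by
    nth_rw 2 [← Real.mul_self_sqrt hkp.le]
    field_simp
  rw [pow_succ, mul_inv, mul_comm (k ^ N)⁻¹, ← mul_assoc, h3]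
  gcongr

theorem HasSupExpansion.bounded {F : X → ℝ → ℂ} {A : ℕ → X → ℂ} (h : HasSupExpansion S k₀ F A) :
    ∃ C : ℝ, 0 ≤ C ∧ ∀ x ∈ S, ∀ k : ℝ, k₀ ≤ k → ‖F x k‖ ≤ C := by
  obtain ⟨C, hC⟩ := h 0
  exact ⟨|C|, abs_nonneg _, fun x hx k hk => by simpa using (hC x hx k hk).trans (by simpa using le_abs_self C)⟩

/-- Expansions can be inserted into an expansion whose remainder is `O(k^{1/2-N})`. -/
theorem HasSupExpansion.sum (hk₀ : 0 < k₀) {F : X → ℝ → ℂ} {E : ℕ → X → ℝ → ℂ}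
    {A : ℕ → ℕ → X → ℂ} (hE : ∀ n, HasSupExpansion S k₀ (E n) (A n))
    (hF : ∀ N : ℕ, ∃ C : ℝ, ∀ x ∈ S, ∀ k : ℝ, k₀ ≤ k →
      ‖F x k - ∑ n ∈ Finset.range N, ((k : ℂ) ^ n)⁻¹ * E n x k‖ ≤ C * (Real.sqrt k * (k ^ N)⁻¹)) :
    HasSupExpansion S k₀ F fun p x => ∑ i ∈ Finset.HasAntidiagonal.antidiagonal p, A i.1 i.2 x := by
  intro N
  -- One extra term absorbs the factor `√k` in the remainder.
  obtain ⟨CF, hCF⟩ := hF (N + 1)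
  obtain ⟨CN, hCN0, hCN⟩ := (hE N).bounded
  choose CE hCE using fun n => hE n (N - n)
  have hs0 : 0 < Real.sqrt k₀ := Real.sqrt_pos.2 hk₀
  refine ⟨|CF| * (Real.sqrt k₀)⁻¹ + CN + ∑ n ∈ Finset.range N, CE n, fun x hx k hk => ?_⟩
  have hkp : 0 < k := hk₀.trans_le hk
  have hsum : ∑ p ∈ Finset.range N, ((k : ℂ) ^ p)⁻¹ * ∑ i ∈ Finset.HasAntidiagonal.antidiagonal p, A i.1 i.2 x =
      ∑ n ∈ Finset.range N, ((k : ℂ) ^ n)⁻¹ * ∑ q ∈ Finset.range (N - n), ((k : ℂ) ^ q)⁻¹ * A n q x := by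
    have h1 := Finset.sum_range_diag_flip N fun n q => ((k : ℂ) ^ (n + q))⁻¹ * A n q x
    have h2 : ∀ p, ((k : ℂ) ^ p)⁻¹ * ∑ i ∈ Finset.HasAntidiagonal.antidiagonal p, A i.1 i.2 x =
        ∑ n ∈ Finset.range (p + 1), ((k : ℂ) ^ (n + (p - n)))⁻¹ * A n (p - n) x := by
      intro p
      rw [Finset.Nat.sum_antidiagonal_eq_sum_range_succ (fun n q => A n q x), Finset.mul_sum]
      refine Finset.sum_congr rfl fun n hn => ?_
      rw [Nat.add_sub_cancel' (Nat.lt_succ_iff.1 (Finset.mem_range.1 hn))]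
    simp only [h2, h1]
    refine Finset.sum_congr rfl fun n _ => ?_
    rw [Finset.mul_sum]
    refine Finset.sum_congr rfl fun q _ => ?_
    rw [pow_add, mul_inv]
    ring
  have key : F x k - ∑ p ∈ Finset.range N, ((k : ℂ) ^ p)⁻¹ * ∑ i ∈ Finset.HasAntidiagonal.antidiagonal p, A i.1 i.2 x =
      (F x k - ∑ n ∈ Finset.range (N + 1), ((k : ℂ) ^ n)⁻¹ * E n x k) + ((k : ℂ) ^ N)⁻¹ * E N x k +
      ∑ n ∈ Finset.range N, ((k : ℂ) ^ n)⁻¹ *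
        (E n x k - ∑ q ∈ Finset.range (N - n), ((k : ℂ) ^ q)⁻¹ * A n q x) := by
    rw [hsum, Finset.sum_range_succ]
    simp only [mul_sub, Finset.sum_sub_distrib]
    ring
  rw [key, add_mul, add_mul, Finset.sum_mul]
  refine norm_add₃_le.trans (add_le_add (add_le_add ?_ ?_) ?_)
  · refine (hCF x hx k hk).trans ?_
    have hsk := sqrt_mul_inv_pow_succ_le hk₀ hk N
    calc CF * (Real.sqrt k * (k ^ (N + 1))⁻¹) ≤ |CF| * (Real.sqrt k * (k ^ (N + 1))⁻¹) :=
          mul_le_mul_of_nonneg_right (le_abs_self _) (by positivity)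
      _ ≤ |CF| * ((Real.sqrt k₀)⁻¹ * (k ^ N)⁻¹) := by gcongr
      _ = _ := by ring
  · rw [norm_mul, norm_inv_pow_ofReal hkp, mul_comm]
    exact mul_le_mul_of_nonneg_right (hCN x hx k hk) (by positivity)
  · refine (norm_sum_le _ _).trans (Finset.sum_le_sum fun n hn => ?_)
    rw [norm_mul, norm_inv_pow_ofReal hkp]
    have hn' : n ≤ N := (Finset.mem_range.1 hn).le
    calc (k ^ n)⁻¹ * _ ≤ (k ^ n)⁻¹ * (CE n * (k ^ (N - n))⁻¹) :=
          mul_le_mul_of_nonneg_left (hCE n x hx k hk) (by positivity)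
      _ = CE n * (k ^ N)⁻¹ := by
          rw [← Nat.add_sub_cancel' hn', pow_add, Nat.add_sub_cancel_left, mul_inv]
          ring

theorem HasSupExpansion.const_mul {F : X → ℝ → ℂ} {A : ℕ → X → ℂ} (h : HasSupExpansion S k₀ F A)
    (hk₀ : 0 < k₀) {c : X → ℂ} (hc : ∃ C : ℝ, ∀ x ∈ S, ‖c x‖ ≤ C) :
    HasSupExpansion S k₀ (fun x k => c x * F x k) fun p x => c x * A p x := by
  intro N
  obtain ⟨C, hC⟩ := h N
  obtain ⟨D, hD⟩ := hc
  refine ⟨|D| * C, fun x hx k hk => ?_⟩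
  have hkp : 0 < k := hk₀.trans_le hk
  have e : c x * F x k - ∑ p ∈ Finset.range N, ((k : ℂ) ^ p)⁻¹ * (c x * A p x) =
      c x * (F x k - ∑ p ∈ Finset.range N, ((k : ℂ) ^ p)⁻¹ * A p x) := by
    rw [mul_sub, Finset.mul_sum]
    congr 1
    exact Finset.sum_congr rfl fun p _ => by ring
  rw [e, norm_mul, mul_assoc]
  exact mul_le_mul ((hD x hx).trans (le_abs_self _)) (hC x hx k hk) (norm_nonneg _) (abs_nonneg _)

theorem HasSupExpansion.mul (hk₀ : 0 < k₀) {F G : X → ℝ → ℂ} {A A' : ℕ → X → ℂ}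
    (hF : HasSupExpansion S k₀ F A) (hG : HasSupExpansion S k₀ G A')
    (hA : ∀ n, ∃ C : ℝ, ∀ x ∈ S, ‖A n x‖ ≤ C) :
    HasSupExpansion S k₀ (fun x k => F x k * G x k)
      fun p x => ∑ i ∈ Finset.HasAntidiagonal.antidiagonal p, A i.1 x * A' i.2 x := by
  refine HasSupExpansion.sum hk₀ (E := fun n x k => A n x * G x k) (A := fun n q x => A n x * A' q x)
    (fun n => hG.const_mul hk₀ (hA n)) fun N => ?_
  obtain ⟨C, hC⟩ := hF N
  obtain ⟨D, hD0, hD⟩ := hG.bounded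
  have hs0 : 0 < Real.sqrt k₀ := Real.sqrt_pos.2 hk₀
  refine ⟨|C| * D * (Real.sqrt k₀)⁻¹, fun x hx k hk => ?_⟩
  have hkp : 0 < k := hk₀.trans_le hk
  have e : F x k * G x k - ∑ n ∈ Finset.range N, ((k : ℂ) ^ n)⁻¹ * (A n x * G x k) =
      (F x k - ∑ n ∈ Finset.range N, ((k : ℂ) ^ n)⁻¹ * A n x) * G x k := by
    rw [sub_mul, Finset.sum_mul]
    congr 1
    exact Finset.sum_congr rfl fun p _ => by ring
  rw [e, norm_mul]
  have h1 : 1 ≤ (Real.sqrt k₀)⁻¹ * Real.sqrt k := by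
    rw [inv_mul_eq_div, one_le_div hs0]
    exact Real.sqrt_le_sqrt hk
  have h2 : ‖F x k - ∑ n ∈ Finset.range N, ((k : ℂ) ^ n)⁻¹ * A n x‖ ≤ |C| * (k ^ N)⁻¹ :=
    (hC x hx k hk).trans (mul_le_mul_of_nonneg_right (le_abs_self _) (by positivity))
  calc _ ≤ |C| * (k ^ N)⁻¹ * D := mul_le_mul h2 (hD x hx k hk) (norm_nonneg _) (by positivity)
    _ ≤ |C| * (k ^ N)⁻¹ * D * ((Real.sqrt k₀)⁻¹ * Real.sqrt k) :=
        le_mul_of_one_le_right (by positivity) h1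
    _ = _ := by ring

theorem HasSupExpansion.comp {Y : Type} {S' : Set Y} {F : X → ℝ → ℂ} {A : ℕ → X → ℂ}
    (h : HasSupExpansion S k₀ F A) {g : Y → X} (hg : MapsTo g S' S) :
    HasSupExpansion S' k₀ (fun y k => F (g y) k) fun p y => A p (g y) := by
  intro N
  obtain ⟨C, hC⟩ := h N
  exact ⟨C, fun y hy k hk => hC (g y) (hg hy) k hk⟩

end SupExpansion

/-! ### Expansion of the kernel in powers of `1/k` -/

section SymbolExpansion

variable {k₀ : ℝ}

/-- The coefficients of the expansion of the kernel. -/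
def symbolCoeff (O : Obstacle) (s : ℕ) (p : ℝ × Plane) : ℂ :=
  Complex.I / 4 * hankelCoeff 1 s * ((⟪unitVec (p.2 - O.γ p.1), O.normal (O.γ p.1)⟫ /
    ‖p.2 - O.γ p.1‖ ^ ((s : ℝ) + 1 / 2) : ℝ) : ℂ)

theorem contDiffOn_symbolCoeff (O : Obstacle) (s : ℕ) :
    ContDiffOn ℝ ∞ (symbolCoeff O s) (univ ×ˢ O.carrierᶜ) := by
  refine contDiffOn_const.mul (Complex.ofRealCLM.contDiff.comp_contDiffOn
    (O.contDiffOn_inner_unitVec.div (contDiffOn_rpow_dist O _) fun p hp => ?_))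
  exact (Real.rpow_pos_of_pos (norm_pos_iff.2 (O.sub_γ_ne_zero hp.2 p.1)) _).ne'

/-- Taylor expansion of `β` at `y = 1/(2k|x-γ|)`; on a compact set away from the obstacle the
distance is bounded below, so `y = O(1/k)` uniformly. -/
theorem hasSupExpansion_layerSymbol (O : Obstacle) (hk₀ : 0 < k₀) {Q : Set (ℝ × Plane)}
    (hQ : IsCompact Q) (hQK : Q ⊆ univ ×ˢ O.carrierᶜ) :
    HasSupExpansion Q k₀ (fun p k => layerSymbol O (p.1, (p.2, k⁻¹))) (symbolCoeff O) := by
  have hpos : ∀ p ∈ Q, 0 < ‖p.2 - O.γ p.1‖ := fun p hp =>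
    norm_pos_iff.2 (O.sub_γ_ne_zero (hQK hp).2 p.1)
  obtain ⟨R, hR⟩ := hQ.exists_bound_of_continuousOn (f := fun p : ℝ × Plane => ‖p.2 - O.γ p.1‖⁻¹)
    ((O.contDiffOn_dist.continuousOn.mono hQK).inv₀ fun p hp => (hpos p hp).ne')
  obtain ⟨D, hD⟩ := hQ.exists_bound_of_continuousOn (f := fun p : ℝ × Plane =>
      Complex.I / 4 * hankelConst * ((‖p.2 - O.γ p.1‖ ^ (-1 / 2 : ℝ) : ℝ) : ℂ) *
      ((⟪unitVec (p.2 - O.γ p.1), O.normal (O.γ p.1)⟫ : ℝ) : ℂ))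
    (((continuousOn_const.mul (Complex.continuous_ofReal.comp_continuousOn
      ((contDiffOn_rpow_dist O (-1 / 2)).continuousOn.mono hQK)))).mul
      (Complex.continuous_ofReal.comp_continuousOn (O.contDiffOn_inner_unitVec.continuousOn.mono hQK)))
  intro N
  set R' : ℝ := |R| + 1 with hR'
  have hR'0 : 0 < R' := by positivity
  obtain ⟨C, hC⟩ := exists_hankelBeta_taylor N (Y := k₀⁻¹ * R') (by positivity)
  refine ⟨|D| * (|C| * R' ^ N), fun p hp k hk => ?_⟩
  have hkp : 0 < k := hk₀.trans_le hk
  have hr := hpos p hp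
  have hrR : ‖p.2 - O.γ p.1‖⁻¹ ≤ R' := by
    have h1 := hR p hp
    rw [Real.norm_of_nonneg (by positivity)] at h1
    linarith [le_abs_self R]
  set r := ‖p.2 - O.γ p.1‖ with hrdef
  set y := k⁻¹ / (2 * r) with hy
  have hyR : y ≤ k⁻¹ * R' := by
    rw [hy, div_eq_mul_inv, mul_inv]
    have : (2 : ℝ)⁻¹ * r⁻¹ ≤ R' := by
      have : 0 < r⁻¹ := by positivity
      linarith
    gcongr
  have hy0 : 0 ≤ y := by positivity
  have hyY : y ≤ k₀⁻¹ * R' := hyR.trans (by gcongr)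
  have hβ := hC y ⟨hy0, hyY⟩
  have hterm : ∀ n : ℕ, ((k : ℂ) ^ n)⁻¹ * symbolCoeff O n p =
      (Complex.I / 4 * hankelConst * ((r ^ (-1 / 2 : ℝ) : ℝ) : ℂ) *
        ((⟪unitVec (p.2 - O.γ p.1), O.normal (O.γ p.1)⟫ : ℝ) : ℂ)) *
      ((y : ℂ) ^ n * (iteratedDeriv n hankelBeta 0 / n.factorial)) := by
    intro n
    rw [symbolCoeff, hankelCoeff_one_eq]
    have e1 : ⟪unitVec (p.2 - O.γ p.1), O.normal (O.γ p.1)⟫ / r ^ ((n : ℝ) + 1 / 2) =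
        r ^ (-1 / 2 : ℝ) * ⟪unitVec (p.2 - O.γ p.1), O.normal (O.γ p.1)⟫ * (r ^ n)⁻¹ := by
      rw [Real.rpow_add hr, Real.rpow_natCast, neg_div, Real.rpow_neg hr.le]
      have : (r ^ (1 / 2 : ℝ)) ≠ 0 := (Real.rpow_pos_of_pos hr _).ne'
      field_simp
    have e2 : (y : ℂ) ^ n = ((k : ℂ) ^ n)⁻¹ * ((2 : ℂ) ^ n)⁻¹ * ((r : ℂ) ^ n)⁻¹ := by
      rw [hy]
      push_cast
      rw [div_eq_mul_inv, mul_inv, mul_pow, mul_pow, inv_pow, inv_pow, inv_pow]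
      ring
    rw [← hrdef, e1, e2]
    push_cast
    ring
  have hsplit : layerSymbol O (p.1, (p.2, k⁻¹)) - ∑ n ∈ Finset.range N, ((k : ℂ) ^ n)⁻¹ * symbolCoeff O n p =
      (Complex.I / 4 * hankelConst * ((r ^ (-1 / 2 : ℝ) : ℝ) : ℂ) *
        ((⟪unitVec (p.2 - O.γ p.1), O.normal (O.γ p.1)⟫ : ℝ) : ℂ)) *
      (hankelBeta y - ∑ n ∈ Finset.range N, (y : ℂ) ^ n * (iteratedDeriv n hankelBeta 0 / n.factorial)) := by
    simp only [hterm]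
    rw [← Finset.mul_sum, layerSymbol]
    ring
  rw [hsplit, norm_mul]
  calc _ ≤ |D| * (|C| * (k⁻¹ * R') ^ N) := by
        refine mul_le_mul ((hD p hp).trans (le_abs_self _)) (hβ.trans ?_) (norm_nonneg _)
          (abs_nonneg _)
        exact mul_le_mul (le_abs_self C) (pow_le_pow_left₀ hy0 hyR N) (by positivity) (abs_nonneg _)
    _ = _ := by rw [mul_pow, inv_pow]; ring

theorem HasClassicalExpansion.hasSupExpansion {U : Set ℝ} {f : ℝ → ℝ → ℂ} {A : ℕ → ℝ → ℂ}
    (h : HasClassicalExpansion U f A) (hk₀ : 0 < k₀) {T : Set ℝ} (hT : IsCompact T) (hTU : T ⊆ U) :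
    HasSupExpansion T k₀ f A := by
  intro N
  obtain ⟨C, hC⟩ := (h.2 N).2 T hTU hT k₀ hk₀ 0 0
  refine ⟨|C|, fun t ht k hk => ?_⟩
  have hkp : 0 < k := hk₀.trans_le hk
  have h1 := hC t ht k hk
  simp only [norm_iteratedFDeriv_zero, iteratedDeriv_zero] at h1
  refine h1.trans ?_
  have h2 : (1 + k) ^ (-(N : ℝ) - 1 * (0 : ℕ) + 0 * (0 : ℕ)) = ((1 + k) ^ N)⁻¹ := by
    simp [Real.rpow_neg (by linarith : 0 ≤ 1 + k)]
  rw [h2]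
  calc C * ((1 + k) ^ N)⁻¹ ≤ |C| * ((1 + k) ^ N)⁻¹ :=
        mul_le_mul_of_nonneg_right (le_abs_self _) (by positivity)
    _ ≤ |C| * (k ^ N)⁻¹ := by
        gcongr
        linarith

end SymbolExpansion

/-! ### Stationary phase for `k`-dependent amplitudes -/

section OscillatoryExpansion

variable {V : Type} [NormedAddCommGroup V] [NormedSpace ℝ V] {B S : Set V} {δ b ε k₀ : ℝ}
  {κ : ℝ × V → ℝ}

theorem IsPhase.mono (hκ : IsPhase B δ b ε κ) {B' : Set V} (hB' : IsOpen B') (h : B' ⊆ B) :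
    IsPhase B' δ b ε κ where
  isOpen := hB'
  b_pos := hκ.b_pos
  b_lt := hκ.b_lt
  ε_pos := hκ.ε_pos
  smooth := hκ.smooth.mono (prod_mono_right h)
  pos τ hτ x hx := hκ.pos τ hτ x (h hx)
  deriv_pos τ hτ x hx := hκ.deriv_pos τ hτ x (h hx)
  right x hx := hκ.right x (h hx)
  left x hx := hκ.left x (h hx)

theorem IsPhase.continuousOn_exp (hκ : IsPhase B δ b ε κ) {x : V} (hx : x ∈ B) (k : ℝ) :
    ContinuousOn (fun τ => Complex.exp (Complex.I * ((k * (τ / κ (τ, x)) ^ 2 : ℝ) : ℂ)))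
      (uIcc (-b) b) := by
  have h1 : ContinuousOn (fun τ => κ (τ, x)) (uIcc (-b) b) :=
    hκ.smooth.continuousOn.comp (by fun_prop) fun τ hτ => ⟨hκ.uIcc_subset hτ, hx⟩
  have h2 : ContinuousOn (fun τ => k * (τ / κ (τ, x)) ^ 2) (uIcc (-b) b) :=
    continuousOn_const.mul ((continuousOn_id.div h1 fun τ hτ =>
      (hκ.pos τ (hκ.uIcc_subset hτ) x hx).ne').pow 2)
  exact Complex.continuous_exp.comp_continuousOn (continuousOn_const.mul
    (Complex.continuous_ofReal.comp_continuousOn h2))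

/-- Stationary phase for amplitudes with an expansion in powers of `1/k`. -/
theorem HasSupExpansion.oscInt [ProperSpace V] (hκ : IsPhase B δ b ε κ) (hS : IsCompact S)
    (hSB : S ⊆ B) (hk₀ : 0 < k₀) {E : ℝ × V → ℝ → ℂ} {f : ℕ → ℝ × V → ℂ}
    (hf : ∀ n, IsAmplitude B δ b (f n)) (hE : HasSupExpansion (uIcc (-b) b ×ˢ S) k₀ E f)
    (hEc : ∀ x ∈ S, ∀ k, k₀ ≤ k → ContinuousOn (fun τ => E (τ, x) k) (uIcc (-b) b)) :
    HasSupExpansion S k₀ (fun x k => Real.sqrt k * ∫ τ in (-b)..b,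
        Complex.exp (Complex.I * ((k * (τ / κ (τ, x)) ^ 2 : ℝ) : ℂ)) * E (τ, x) k)
      fun p x => ∑ i ∈ Finset.HasAntidiagonal.antidiagonal p,
        statConst i.2 * ampCoeff κ (2 * i.2) (f i.1) x := by
  refine HasSupExpansion.sum hk₀
    (E := fun n x k => Real.sqrt k * MultipleScattering.oscInt κ b (f n) x k)
    (A := fun n q x => statConst q * ampCoeff κ (2 * q) (f n) x)
    (fun n Q => hκ.oscInt_asymptotics (hf n) Q hS hSB hk₀) fun N => ?_
  obtain ⟨C, hC⟩ := hE N
  refine ⟨C * |b - -b|, fun x hx k hk => ?_⟩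
  have hkp : 0 < k := hk₀.trans_le hk
  have hexp := hκ.continuousOn_exp (hSB hx) k
  have hfc : ∀ n, ContinuousOn (fun τ => f n (τ, x)) (uIcc (-b) b) := fun n =>
    (hf n).smooth.continuousOn.comp (by fun_prop) fun τ hτ => ⟨hκ.uIcc_subset hτ, hSB hx⟩
  have hsplit : (∫ τ in (-b)..b, Complex.exp (Complex.I * ((k * (τ / κ (τ, x)) ^ 2 : ℝ) : ℂ)) *
        E (τ, x) k) - ∑ n ∈ Finset.range N, ((k : ℂ) ^ n)⁻¹ * MultipleScattering.oscInt κ b (f n) x k =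
      ∫ τ in (-b)..b, Complex.exp (Complex.I * ((k * (τ / κ (τ, x)) ^ 2 : ℝ) : ℂ)) *
        (E (τ, x) k - ∑ n ∈ Finset.range N, ((k : ℂ) ^ n)⁻¹ * f n (τ, x)) := by
    simp only [MultipleScattering.oscInt, ← intervalIntegral.integral_const_mul]
    rw [← intervalIntegral.integral_finsetSum, ← intervalIntegral.integral_sub]
    · refine intervalIntegral.integral_congr fun τ _ => ?_
      simp only [mul_sub, Finset.mul_sum]
      congr 1
      exact Finset.sum_congr rfl fun n _ => by ring
    · exact (hexp.mul (hEc x hx k hk)).intervalIntegrable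
    · exact (continuousOn_finsetSum _ fun n _ =>
        continuousOn_const.mul (hexp.mul (hfc n))).intervalIntegrable
    · exact fun n _ => (continuousOn_const.mul (hexp.mul (hfc n))).intervalIntegrable
  -- The truncation error is estimated by its absolute value only, so no derivatives of the
  -- `k`-dependent amplitude are required.
  have hle : ‖∫ τ in (-b)..b, Complex.exp (Complex.I * ((k * (τ / κ (τ, x)) ^ 2 : ℝ) : ℂ)) *
        (E (τ, x) k - ∑ n ∈ Finset.range N, ((k : ℂ) ^ n)⁻¹ * f n (τ, x))‖ ≤
      C * (k ^ N)⁻¹ * |b - -b| := by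
    refine intervalIntegral.norm_integral_le_of_norm_le_const fun τ hτ => ?_
    rw [norm_mul, mul_comm Complex.I, Complex.norm_exp_ofReal_mul_I, one_mul]
    exact hC (τ, x) ⟨uIoc_subset_uIcc hτ, hx⟩ k hk
  have e : (Real.sqrt k : ℂ) * (∫ τ in (-b)..b, Complex.exp
        (Complex.I * ((k * (τ / κ (τ, x)) ^ 2 : ℝ) : ℂ)) * E (τ, x) k) -
      ∑ n ∈ Finset.range N, ((k : ℂ) ^ n)⁻¹ *
        (Real.sqrt k * MultipleScattering.oscInt κ b (f n) x k) =
      Real.sqrt k * ∫ τ in (-b)..b, Complex.exp (Complex.I * ((k * (τ / κ (τ, x)) ^ 2 : ℝ) : ℂ)) *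
        (E (τ, x) k - ∑ n ∈ Finset.range N, ((k : ℂ) ^ n)⁻¹ * f n (τ, x)) := by
    rw [← hsplit, mul_sub, Finset.mul_sum]
    congr 1
    exact Finset.sum_congr rfl fun n _ => by ring
  rw [e, norm_mul, Complex.norm_real, Real.norm_of_nonneg (Real.sqrt_nonneg k)]
  calc Real.sqrt k * _ ≤ Real.sqrt k * (C * (k ^ N)⁻¹ * |b - -b|) :=
        mul_le_mul_of_nonneg_left hle (Real.sqrt_nonneg k)
    _ = _ := by ring

end OscillatoryExpansion

/-! ### Charts at the point of reflection -/

section Chart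

variable {K : ℕ → Obstacle} {α : Plane} {m : ℕ}

/-- Near a point of the illuminated region, `σ x` is the parameter of the point of reflection, and
the phase is a square in a suitable coordinate on the boundary. -/
structure IsChart (K : ℕ → Obstacle) (α : Plane) (m : ℕ) (s₀ : ℝ) (B : Set Plane) (σ : Plane → ℝ)
    (δ b ε : ℝ) (κ : ℝ × Plane → ℝ) : Prop where
  isPhase : IsPhase B δ b ε κ
  subset : B ⊆ openIlluminated K α m
  b_lt_period : b < (K m).period / 3
  lit_center : (K m).γ s₀ ∈ illuminated K α m
  smooth : ContDiffOn ℝ ∞ σ B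
  reflPhase_smooth : ContDiffOn ℝ ∞ (reflPhase K α m) B
  reflPoint_eq : ∀ x ∈ B, reflPoint K α m x = (K m).γ (σ x)
  close : ∀ x ∈ B, |σ x - s₀| < b / 4
  lit : ∀ x ∈ B, ∀ τ ∈ Ioo (-δ) δ, (K m).γ (σ x + τ) ∈ illuminated K α m
  phase_eq : ∀ x ∈ B, ∀ τ ∈ Ioo (-δ) δ,
    layerPhase K α m (σ x + τ, x) - reflPhase K α m x = (τ / κ (τ, x)) ^ 2

theorem IsChart.mono {s₀ δ b ε : ℝ} {B : Set Plane} {σ : Plane → ℝ} {κ : ℝ × Plane → ℝ}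
    (h : IsChart K α m s₀ B σ δ b ε κ) {B' : Set Plane} (hB' : IsOpen B') (hB : B' ⊆ B) :
    IsChart K α m s₀ B' σ δ b ε κ where
  isPhase := h.isPhase.mono hB' hB
  subset := hB.trans h.subset
  b_lt_period := h.b_lt_period
  lit_center := h.lit_center
  smooth := h.smooth.mono hB
  reflPhase_smooth := h.reflPhase_smooth.mono hB
  reflPoint_eq x hx := h.reflPoint_eq x (hB hx)
  close x hx := h.close x (hB hx)
  lit x hx := h.lit x (hB hx)
  phase_eq x hx := h.phase_eq x (hB hx)

theorem IsChart.subset_compl {s₀ δ b ε : ℝ} {B : Set Plane} {σ : Plane → ℝ} {κ : ℝ × Plane → ℝ}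
    (h : IsChart K α m s₀ B σ δ b ε κ) : B ⊆ (K m).carrierᶜ :=
  h.subset.trans openIlluminated_subset_compl

/-- Combines the ray coordinates, which make `σ` and the reflected phase smooth in `x`, with the
Morse coordinate for the phase shifted to its minimum `σ x`. -/
theorem exists_isChart (hA : Admissible K α) {s₀ t₀ : ℝ} (hs₀ : (K m).γ s₀ ∈ illuminated K α m)
    (ht₀ : 0 < t₀) : ∃ (B : Set Plane) (σ : Plane → ℝ) (δ b ε : ℝ) (κ : ℝ × Plane → ℝ),
      (K m).γ s₀ + t₀ • refDir K α m ((K m).γ s₀) ∈ B ∧ IsChart K α m s₀ B σ δ b ε κ := by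
  have hR := smoothRays hA m
  obtain ⟨B₁, hB₁, hxB₁, σ, τ, hσ, hτ, hσx, hcoord⟩ := hR.exists_local_coordinates hA hs₀ ht₀
  set x₀ := (K m).γ s₀ + t₀ • refDir K α m ((K m).γ s₀) with hx₀
  obtain ⟨d, hd, hball⟩ := Metric.isOpen_iff.1 hR.isOpen_illuminated s₀ hs₀
  -- `d/2`, because `σ x - s₀` and `τ` each use up `δ₀` while `σ x + τ` must stay lit; a third of
  -- the period, to leave room for the periodic cutoff.
  set δ₀ : ℝ := min (d / 2) ((K m).period / 3) with hδ₀def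
  have hP := (K m).period_pos
  have hδ₀ : 0 < δ₀ := by positivity
  set B₀ : Set Plane := B₁ ∩ σ ⁻¹' Metric.ball s₀ δ₀ with hB₀def
  have hB₀ : IsOpen B₀ := hσ.continuousOn.isOpen_inter_preimage hB₁ Metric.isOpen_ball
  have hxB₀ : x₀ ∈ B₀ := ⟨hxB₁, by simp [hσx, hδ₀]⟩
  have hBO : B₀ ⊆ openIlluminated K α m := fun x hx => by
    obtain ⟨h1, h2, h3⟩ := hcoord x hx.1
    exact mem_openIlluminated_iff.2 ⟨_, h1, _, h2, h3⟩
  have hBc := hBO.trans openIlluminated_subset_compl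
  have hrp : ∀ x ∈ B₀, reflPoint K α m x = (K m).γ (σ x) := fun x hx => by
    obtain ⟨h1, h2, h3⟩ := hcoord x hx.1
    conv_lhs => rw [h3]
    exact MultipleScattering.reflPoint_eq hA h1 h2
  have hrφ : ∀ x ∈ B₀, reflPhase K α m x = layerPhase K α m (σ x, x) := fun x hx => by
    rw [reflPhase, hrp x hx, layerPhase, add_comm]
  have hlit : ∀ x ∈ B₀, ∀ τ ∈ Ioo (-δ₀) δ₀, (K m).γ (σ x + τ) ∈ illuminated K α m := by
    intro x hx τ hτ
    refine hball ?_
    have h1 : |σ x - s₀| < δ₀ := by simpa [Real.dist_eq] using hx.2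
    have h2 : δ₀ ≤ d / 2 := min_le_left _ _
    rw [Metric.mem_ball, Real.dist_eq]
    rw [abs_lt] at h1 ⊢
    constructor <;> linarith [hτ.1, hτ.2, h1.1, h1.2]
  have hσ₀ : ContDiffOn ℝ ∞ σ B₀ := hσ.mono inter_subset_left
  have hψs : ContDiffOn ℝ ∞ (reflPhase K α m) B₀ :=
    ((contDiffOn_layerPhase hR).comp (f := fun x => (σ x, x)) (hσ₀.prodMk contDiffOn_id)
      fun x hx => ⟨mem_univ _, hBc hx⟩).congr hrφ
  set θ : ℝ × Plane → ℝ := fun p => layerPhase K α m (σ p.2 + p.1, p.2) - reflPhase K α m p.2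
    with hθdef
  have hσp : ContDiffOn ℝ ∞ (fun p : ℝ × Plane => (σ p.2 + p.1, p.2)) (Ioo (-δ₀) δ₀ ×ˢ B₀) :=
    ((hσ₀.comp contDiff_snd.contDiffOn fun p hp => hp.2).add contDiff_fst.contDiffOn).prodMk
      contDiff_snd.contDiffOn
  have hθ : ContDiffOn ℝ ∞ θ (Ioo (-δ₀) δ₀ ×ˢ B₀) :=
    ((contDiffOn_layerPhase hR).comp hσp fun p hp => ⟨mem_univ _, hBc hp.2⟩).sub
      (hψs.comp contDiff_snd.contDiffOn fun p hp => hp.2)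
  have h0 : ∀ x ∈ B₀, θ (0, x) = 0 := fun x hx => by simp [hθdef, hrφ x hx]
  have h1 : ∀ x ∈ B₀, deriv (fun τ => θ (τ, x)) 0 = 0 := by
    intro x hx
    obtain ⟨h1, h2, h3⟩ := hcoord x hx.1
    have h4 := deriv_layerPhase_eq_zero hA h1 h2
    rw [← h3] at h4
    simp only [hθdef]
    rw [deriv_sub_const, deriv_comp_const_add (f := fun t => layerPhase K α m (t, x)), add_zero, h4]
  have h2 : 0 < iteratedDeriv 2 (fun τ => θ (τ, x₀)) 0 := by
    have h4 := iteratedDeriv_two_layerPhase_pos hA hs₀ ht₀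
    rw [← hx₀] at h4
    simp only [hθdef]
    rw [hσx]
    have h5 := congrFun (iteratedDeriv_comp_const_add 2
      (fun t => layerPhase K α m (t, x₀) - reflPhase K α m x₀) s₀) 0
    rw [h5, add_zero]
    rw [iteratedDeriv_succ, iteratedDeriv_one] at h4 ⊢
    simpa only [deriv_sub_const_fun] using h4
  obtain ⟨δ, b, ε, κ, B, hδ, hxB, hBB, hκ, hθκ⟩ := exists_isPhase hδ₀ hB₀ hxB₀ hθ h0 h1 h2
  have hb := hκ.b_pos
  have hIoo : Ioo (-δ) δ ⊆ Ioo (-δ₀) δ₀ := Ioo_subset_Ioo (by linarith) hδ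
  -- With `|σ x - s₀| < b/4`, a cutoff around the fixed `s₀` of radius `b/2` is supported in `|τ| <
  -- b` and can equal 1 near `σ x`, for all `x` at once.
  set B' : Set Plane := B ∩ σ ⁻¹' Metric.ball s₀ (b / 4) with hB'def
  have hB'B : B' ⊆ B := inter_subset_left
  have hB' : IsOpen B' := (hσ₀.mono hBB).continuousOn.isOpen_inter_preimage hκ.isOpen
    Metric.isOpen_ball
  refine ⟨B', σ, δ, b, ε, κ, ⟨hxB, by simp [hσx, hb]⟩, hκ.mono hB' hB'B,
    (hB'B.trans hBB).trans hBO, ?_, hs₀, hσ₀.mono (hB'B.trans hBB), hψs.mono (hB'B.trans hBB),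
    fun x hx => hrp x (hBB (hB'B hx)), fun x hx => by simpa [Real.dist_eq] using hx.2,
    fun x hx τ hτ => hlit x (hBB (hB'B hx)) τ (hIoo hτ), fun x hx τ hτ => hθκ x (hB'B hx) τ hτ⟩
  have : δ₀ ≤ (K m).period / 3 := min_le_right _ _
  linarith [hκ.b_lt]

end Chart

variable {K : ℕ → Obstacle} {α : Plane} {m : ℕ} {a : ℕ → Plane → ℂ} {s₀ δ b ε : ℝ}
  {B : Set Plane} {σ : Plane → ℝ} {κ : ℝ × Plane → ℝ}

/-! ### Identification of the coefficients -/

section Coefficients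

/-- The parameter in `[0, P)` and the smooth `σ x` may differ by a multiple of the period;
periodicity makes this invisible. -/
theorem Obstacle.γ_param_add (O : Obstacle) {s : ℝ} (τ : ℝ) :
    O.γ (O.param (O.γ s) + τ) = O.γ (s + τ) := by
  obtain ⟨n, hn⟩ := O.exists_int_of_γ_eq (O.γ_param (O.γ_mem_frontier s)).symm
  rw [hn, show s + n * O.period + τ = s + τ + n * O.period by ring]
  exact O.periodic.int_mul n _

theorem IsChart.layerPhase_param_add (h : IsChart K α m s₀ B σ δ b ε κ) {x : Plane} (hx : x ∈ B)
    {τ : ℝ} (hτ : τ ∈ Ioo (-δ) δ) :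
    layerPhase K α m ((K m).param (reflPoint K α m x) + τ, x) =
      reflPhase K α m x + τ ^ 2 * (κ (τ, x) ^ 2)⁻¹ := by
  rw [h.reflPoint_eq x hx, layerPhase, (K m).γ_param_add, ← div_eq_mul_inv, ← div_pow,
    ← h.phase_eq x hx τ hτ, layerPhase]
  ring

theorem IsChart.iteratedDeriv_two (h : IsChart K α m s₀ B σ δ b ε κ) {x : Plane} (hx : x ∈ B) :
    iteratedDeriv 2 (fun t => layerPhase K α m (t, x)) ((K m).param (reflPoint K α m x)) =
      2 / κ (0, x) ^ 2 := by
  set t₀ := (K m).param (reflPoint K α m x) with ht₀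
  have hz := h.isPhase.zero_mem
  have h1 := congrFun (iteratedDeriv_comp_const_add 2 (fun t => layerPhase K α m (t, x)) t₀) 0
  rw [add_zero] at h1
  rw [← h1]
  have h2 : (fun τ => layerPhase K α m (t₀ + τ, x)) =ᶠ[𝓝 0]
      fun τ => reflPhase K α m x + τ ^ 2 * (κ (τ, x) ^ 2)⁻¹ := by
    filter_upwards [isOpen_Ioo.mem_nhds hz] with τ hτ using h.layerPhase_param_add hx hτ
  have hκx : ContDiffOn ℝ ∞ (fun τ => κ (τ, x)) (Ioo (-δ) δ) :=
    h.isPhase.smooth.comp (by fun_prop) fun τ hτ => ⟨hτ, hx⟩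
  rw [h2.iteratedDeriv_eq, iteratedDeriv_const_add (by norm_num),
    iteratedDeriv_two_sq_mul (g := fun τ => (κ (τ, x) ^ 2)⁻¹) isOpen_Ioo hz
      ((hκx.pow 2).inv fun τ hτ => pow_ne_zero 2 (h.isPhase.pos τ hτ x hx).ne'), div_eq_mul_inv]

/-- The phase is its minimum plus `(τ/κ)²`, so `h = κ²`, also at the removable singularity. -/
theorem IsChart.statPhaseH_eq (h : IsChart K α m s₀ B σ δ b ε κ) {x : Plane} (hx : x ∈ B)
    {τ : ℝ} (hτ : τ ∈ Ioo (-δ) δ) :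
    statPhaseH (fun t => layerPhase K α m (t, x)) ((K m).param (reflPoint K α m x))
      ((K m).param (reflPoint K α m x) + τ) = κ (τ, x) ^ 2 := by
  have hκ0 := h.isPhase.pos 0 h.isPhase.zero_mem x hx
  have hκτ := h.isPhase.pos τ hτ x hx
  rw [statPhaseH, h.iteratedDeriv_two hx]
  by_cases h0 : τ = 0
  · rw [if_pos (by simp [h0]), abs_of_pos (by positivity), h0]
    field_simp
  · have e0 := h.layerPhase_param_add hx h.isPhase.zero_mem
    rw [add_zero] at e0
    rw [if_neg (by simpa using h0), Real.sign_of_pos (by positivity), h.layerPhase_param_add hx hτ, e0,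
      one_mul, zero_pow two_ne_zero, zero_mul, add_zero, add_sub_cancel_left (reflPhase K α m x), add_sub_cancel_left, ← div_eq_mul_inv,
      div_div_cancel₀ (pow_ne_zero 2 h0)]

/-- `h^{q+1/2} = κ^{2q+1}` since `κ > 0`: the derivative in `S_q` is the Lagrange functional of
order `2q`. The sign of the second derivative is `+1`. -/
theorem IsChart.fieldTerm_eq (h : IsChart K α m s₀ B σ δ b ε κ) {x : Plane} (hx : x ∈ B)
    (j s q : ℕ) : fieldTerm K α m a j s q x = statConst q * ampCoeff κ (2 * q)
      (fun z => symbolCoeff (K m) s (σ z.2 + z.1, z.2) * a j ((K m).γ (σ z.2 + z.1))) x := by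
  have hκ0 := h.isPhase.pos 0 h.isPhase.zero_mem x hx
  have hsign : Real.sign (iteratedDeriv 2 (fun t => layerPhase K α m (t, x))
      ((K m).param (reflPoint K α m x))) = 1 := by
    rw [h.iteratedDeriv_two hx, Real.sign_of_pos (by positivity)]
  have hH := fun τ (hτ : τ ∈ Ioo (-δ) δ) => h.statPhaseH_eq hx hτ
  simp only [layerPhase] at hsign hH
  rw [fieldTerm, statPhaseCoeff, hsign]
  have hγ : ∀ τ, (K m).γ ((K m).param (reflPoint K α m x) + τ) = (K m).γ (σ x + τ) := fun τ => by
    rw [h.reflPoint_eq x hx, (K m).γ_param_add]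
  set t₀ := (K m).param (reflPoint K α m x) with ht₀
  set F : ℝ → ℂ := fun t => ((statPhaseH (fun t => phase K α m ((K m).γ t) + ‖x - (K m).γ t‖) t₀ t ^
    ((q : ℝ) + 1 / 2) : ℝ) : ℂ) * (((⟪unitVec (x - (K m).γ t), (K m).normal ((K m).γ t)⟫ /
          ‖x - (K m).γ t‖ ^ ((s : ℝ) + 1 / 2) : ℝ) : ℂ) * a j ((K m).γ t)) with hF
  have h1 := congrFun (iteratedDeriv_comp_const_add (2 * q) F t₀) 0
  rw [add_zero] at h1
  have h2 : (fun τ => ((κ (τ, x) : ℝ) : ℂ) ^ (2 * q + 1) *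
      (symbolCoeff (K m) s (σ x + τ, x) * a j ((K m).γ (σ x + τ)))) =ᶠ[𝓝 0]
      fun τ => (Complex.I / 4 * hankelCoeff 1 s) * F (t₀ + τ) := by
    filter_upwards [isOpen_Ioo.mem_nhds h.isPhase.zero_mem] with τ hτ
    have hκτ := h.isPhase.pos τ hτ x hx
    have e : (κ (τ, x) ^ 2) ^ ((q : ℝ) + 1 / 2) = κ (τ, x) ^ (2 * q + 1) := by
      rw [← Real.rpow_natCast, ← Real.rpow_mul hκτ.le, ← Real.rpow_natCast]
      congr 1
      push_cast
      ring
    simp only [hF]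
    rw [hH τ hτ, e, hγ, symbolCoeff]
    push_cast
    ring
  have h3 : ampCoeff κ (2 * q)
      (fun z => symbolCoeff (K m) s (σ z.2 + z.1, z.2) * a j ((K m).γ (σ z.2 + z.1))) x =
      Complex.I / 4 * hankelCoeff 1 s * iteratedDeriv (2 * q) F t₀ := by
    rw [← h1]
    exact (h2.iteratedDeriv_eq (2 * q)).trans
      (iteratedDeriv_const_mul_field (Complex.I / 4 * hankelCoeff 1 s) fun τ => F (t₀ + τ))
  rw [h3, statConst]
  push_cast
  rw [mul_one]
  ring

/-- The nesting follows the assembly of the expansion: kernel and density are multiplied first,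
stationary phase comes last. -/
theorem sum_antidiagonalTuple_three (g : ℕ → ℕ → ℕ → ℂ) (p : ℕ) :
    ∑ i ∈ Finset.Nat.antidiagonalTuple 3 p, g (i 0) (i 1) (i 2) =
      ∑ i ∈ Finset.HasAntidiagonal.antidiagonal p,
        ∑ l ∈ Finset.HasAntidiagonal.antidiagonal i.1, g l.2 l.1 i.2 := by
  rw [Finset.sum_sigma']
  refine Finset.sum_bij' (fun i _ => ⟨(i 0 + i 1, i 2), (i 1, i 0)⟩)
    (fun z _ => ![z.2.2, z.2.1, z.1.2]) ?_ ?_ ?_ ?_ ?_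
  · intro i hi
    rw [Finset.Nat.mem_antidiagonalTuple, Fin.sum_univ_three] at hi
    simp [hi, add_comm]
  · rintro ⟨⟨n, q⟩, s, j⟩ hz
    simp only [Finset.mem_sigma, Finset.HasAntidiagonal.mem_antidiagonal] at hz
    rw [Finset.Nat.mem_antidiagonalTuple, Fin.sum_univ_three]
    simp
    omega
  · intro i _
    ext l
    fin_cases l <;> rfl
  · rintro ⟨⟨n, q⟩, s, j⟩ hz
    simp only [Finset.mem_sigma, Finset.HasAntidiagonal.mem_antidiagonal] at hz
    obtain ⟨-, rfl⟩ := hz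
    simp [add_comm]
  · intro i _
    rfl

end Coefficients

/-! ### The contribution of the stationary point -/

section Stationary

/-- The amplitudes of the contribution of the stationary point. -/
def chartAmp (K : ℕ → Obstacle) (m : ℕ) (a : ℕ → Plane → ℂ) (σ : Plane → ℝ) (ρ : ℝ → ℝ) (n : ℕ)
    (z : ℝ × Plane) : ℂ :=
  (ρ (σ z.2 + z.1) : ℂ) * ∑ i ∈ Finset.HasAntidiagonal.antidiagonal n,
    symbolCoeff (K m) i.1 (σ z.2 + z.1, z.2) * a i.2 ((K m).γ (σ z.2 + z.1))

theorem IsChart.contDiffOn_shift (h : IsChart K α m s₀ B σ δ b ε κ) :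
    ContDiffOn ℝ ∞ (fun z : ℝ × Plane => σ z.2 + z.1) (Ioo (-δ) δ ×ˢ B) :=
  (h.smooth.comp contDiff_snd.contDiffOn fun _ hp => hp.2).add contDiff_fst.contDiffOn

theorem IsChart.contDiffOn_amp (h : IsChart K α m s₀ B σ δ b ε κ)
    (ha : ∀ j, ContDiffOn ℝ ∞ (fun s => a j ((K m).γ s)) ((K m).γ ⁻¹' illuminated K α m)) (s j : ℕ) :
    ContDiffOn ℝ ∞ (fun z : ℝ × Plane => symbolCoeff (K m) s (σ z.2 + z.1, z.2) *
      a j ((K m).γ (σ z.2 + z.1))) (Ioo (-δ) δ ×ˢ B) :=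
  ((contDiffOn_symbolCoeff (K m) s).comp (h.contDiffOn_shift.prodMk contDiff_snd.contDiffOn)
    fun _ hz => ⟨mem_univ _, h.subset_compl hz.2⟩).mul
    ((ha j).comp h.contDiffOn_shift fun z hz => h.lit z.2 hz.2 z.1 hz.1)

theorem IsChart.contDiffOn_fieldCoeff (h : IsChart K α m s₀ B σ δ b ε κ)
    (ha : ∀ j, ContDiffOn ℝ ∞ (fun s => a j ((K m).γ s)) ((K m).γ ⁻¹' illuminated K α m)) (p : ℕ) :
    ContDiffOn ℝ ∞ (fieldCoeff K α m a p) B := by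
  refine ContDiffOn.sum fun i _ => ?_
  exact (contDiffOn_const.mul (h.isPhase.contDiffOn_ampCoeff (h.contDiffOn_amp ha (i 1) (i 0))
    (2 * i 2))).congr fun x hx => h.fieldTerm_eq hx _ _ _

/-- If `|τ| > b` and `|σ x - s₀| < b/4`, then `σ x + τ` is farther than `b/2` from `s₀`, where `ρ`
vanishes. -/
theorem IsChart.isAmplitude (h : IsChart K α m s₀ B σ δ b ε κ)
    (ha : ∀ j, ContDiffOn ℝ ∞ (fun s => a j ((K m).γ s)) ((K m).γ ⁻¹' illuminated K α m))
    {ρ : ℝ → ℝ} (hρ : ContDiff ℝ ∞ ρ) (hρ0 : ∀ t, b / 2 ≤ |t - s₀| → ρ t = 0) (n : ℕ) :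
    IsAmplitude B δ b (chartAmp K m a σ ρ n) where
  smooth := (Complex.ofRealCLM.contDiff.comp_contDiffOn (hρ.comp_contDiffOn h.contDiffOn_shift)).mul
    (ContDiffOn.sum fun i _ => h.contDiffOn_amp ha i.1 i.2)
  zero τ hτ x hx hb := by
    have h1 := h.close x hx
    have h2 : b / 2 ≤ |σ x + τ - s₀| := by
      have := abs_sub_abs_le_abs_sub τ (-(σ x - s₀))
      rw [abs_neg, show τ - -(σ x - s₀) = σ x + τ - s₀ by ring] at this
      linarith [h.isPhase.b_pos]
    simp [chartAmp, hρ0 _ h2]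

/-- The cutoff equals 1 in a neighbourhood of `σ x`, so it does not contribute to the derivatives
taken there. -/
theorem IsChart.sum_ampCoeff_eq (h : IsChart K α m s₀ B σ δ b ε κ)
    (ha : ∀ j, ContDiffOn ℝ ∞ (fun s => a j ((K m).γ s)) ((K m).γ ⁻¹' illuminated K α m))
    {ρ : ℝ → ℝ} (hρ1 : ∀ t, |t - s₀| < b / 4 → ρ t = 1) (p : ℕ) {x : Plane} (hx : x ∈ B) :
    ∑ i ∈ Finset.HasAntidiagonal.antidiagonal p,
      statConst i.2 * ampCoeff κ (2 * i.2) (chartAmp K m a σ ρ i.1) x = fieldCoeff K α m a p x := by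
  rw [fieldCoeff, sum_antidiagonalTuple_three fun j s q => fieldTerm K α m a j s q x]
  refine Finset.sum_congr rfl fun i _ => ?_
  have hz := h.isPhase.zero_mem
  have hsm : ∀ l : ℕ × ℕ, ContDiffAt ℝ ∞ (fun τ => ((κ (τ, x) : ℝ) : ℂ) ^ (2 * i.2 + 1) *
      (symbolCoeff (K m) l.1 (σ x + τ, x) * a l.2 ((K m).γ (σ x + τ)))) 0 := fun l => by
    have h1 : ContDiffOn ℝ ∞ (fun z : ℝ × Plane => ((κ z : ℝ) : ℂ) ^ (2 * i.2 + 1) *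
        (symbolCoeff (K m) l.1 (σ z.2 + z.1, z.2) * a l.2 ((K m).γ (σ z.2 + z.1))))
        (Ioo (-δ) δ ×ˢ B) :=
      ((Complex.ofRealCLM.contDiff.comp_contDiffOn h.isPhase.smooth).pow _).mul
        (h.contDiffOn_amp ha l.1 l.2)
    exact (h1.comp (f := fun τ : ℝ => (τ, x)) (s := Ioo (-δ) δ) (by fun_prop)
      fun τ hτ => ⟨hτ, hx⟩).contDiffAt (isOpen_Ioo.mem_nhds hz)
  have hev : (fun τ => ((κ (τ, x) : ℝ) : ℂ) ^ (2 * i.2 + 1) * chartAmp K m a σ ρ i.1 (τ, x)) =ᶠ[𝓝 0]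
      fun τ => ∑ l ∈ Finset.HasAntidiagonal.antidiagonal i.1, ((κ (τ, x) : ℝ) : ℂ) ^ (2 * i.2 + 1) *
        (symbolCoeff (K m) l.1 (σ x + τ, x) * a l.2 ((K m).γ (σ x + τ))) := by
    have hc : Tendsto (fun τ : ℝ => |σ x + τ - s₀|) (𝓝 0) (𝓝 |σ x + 0 - s₀|) :=
      Continuous.tendsto (by fun_prop) 0
    filter_upwards [hc.eventually (gt_mem_nhds (by simpa using h.close x hx))] with τ hτ
    simp [chartAmp, hρ1 _ hτ, Finset.mul_sum]
  have hamp : ampCoeff κ (2 * i.2) (chartAmp K m a σ ρ i.1) x =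
      ∑ l ∈ Finset.HasAntidiagonal.antidiagonal i.1, ampCoeff κ (2 * i.2) (fun z =>
        symbolCoeff (K m) l.1 (σ z.2 + z.1, z.2) * a l.2 ((K m).γ (σ z.2 + z.1))) x := by
    refine (hev.iteratedDeriv_eq (2 * i.2)).trans ?_
    rw [iteratedDeriv_fun_sum fun l _ => contDiffAt_infty.1 (hsm l) _]
    rfl
  rw [hamp, Finset.mul_sum]
  exact Finset.sum_congr rfl fun l _ => (h.fieldTerm_eq hx _ _ _).symm

theorem IsChart.hasSupExpansion_amp (h : IsChart K α m s₀ B σ δ b ε κ) {η : Plane → ℝ → ℂ}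
    (hexp : HasClassicalExpansion ((K m).γ ⁻¹' illuminated K α m)
      (fun s k => etaSlow K α m η ((K m).γ s) k) fun j s => a j ((K m).γ s))
    {ρ : ℝ → ℝ} (hρ : ContDiff ℝ ∞ ρ) {S : Set Plane} (hS : IsCompact S) (hSB : S ⊆ B) {k₀ : ℝ}
    (hk₀ : 0 < k₀) :
    HasSupExpansion (uIcc (-b) b ×ˢ S) k₀ (fun z k => (ρ (σ z.2 + z.1) : ℂ) *
      (layerSymbol (K m) (σ z.2 + z.1, (z.2, k⁻¹)) * etaSlow K α m η ((K m).γ (σ z.2 + z.1)) k))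
      (chartAmp K m a σ ρ) := by
  have hQ : IsCompact (uIcc (-b) b ×ˢ S) := isCompact_uIcc.prod hS
  have hQΩ : uIcc (-b) b ×ˢ S ⊆ Ioo (-δ) δ ×ˢ B := prod_mono h.isPhase.uIcc_subset hSB
  have hc1 : ContinuousOn (fun z : ℝ × Plane => σ z.2 + z.1) (uIcc (-b) b ×ˢ S) :=
    h.contDiffOn_shift.continuousOn.mono hQΩ
  have hc2 : ContinuousOn (fun z : ℝ × Plane => (σ z.2 + z.1, z.2)) (uIcc (-b) b ×ˢ S) :=
    hc1.prodMk continuousOn_snd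
  have hs2 : (fun z : ℝ × Plane => (σ z.2 + z.1, z.2)) '' (uIcc (-b) b ×ˢ S) ⊆
      univ ×ˢ (K m).carrierᶜ := by
    rintro _ ⟨z, hz, rfl⟩
    exact ⟨mem_univ _, h.subset_compl (hSB hz.2)⟩
  have h1 := (hasSupExpansion_layerSymbol (K m) hk₀ (hQ.image_of_continuousOn hc2) hs2).comp
    (mapsTo_image _ _)
  have h2 := (hexp.hasSupExpansion hk₀ (hQ.image_of_continuousOn hc1) (by
    rintro _ ⟨z, hz, rfl⟩
    exact h.lit z.2 (hSB hz.2) z.1 (h.isPhase.uIcc_subset hz.1))).comp (mapsTo_image _ _)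
  have h3 := HasSupExpansion.mul hk₀ h1 h2 fun n => by
    exact hQ.exists_bound_of_continuousOn
      (((contDiffOn_symbolCoeff (K m) n).continuousOn.comp hc2 fun z hz => hs2 ⟨z, hz, rfl⟩))
  exact h3.const_mul hk₀ (c := fun z : ℝ × Plane => (ρ (σ z.2 + z.1) : ℂ))
    (hQ.exists_bound_of_continuousOn
      (Complex.continuous_ofReal.comp_continuousOn (hρ.continuous.comp_continuousOn hc1)))

/-- The part of the double-layer potential that is cut out by `ρ`. -/
def layerPiece (K : ℕ → Obstacle) (α : Plane) (m : ℕ) (η : Plane → ℝ → ℂ) (s₀ : ℝ) (ρ : ℝ → ℝ)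
    (x : Plane) (k : ℝ) : ℂ :=
  Real.sqrt k * ∫ t in (s₀ - (K m).period)..(s₀ + (K m).period),
    Complex.exp (Complex.I * ((k * (layerPhase K α m (t, x) - reflPhase K α m x) : ℝ) : ℂ)) *
      ((ρ t : ℂ) * (layerSymbol (K m) (t, (x, k⁻¹)) * etaSlow K α m η ((K m).γ t) k))

/-- The contribution of the stationary point. -/
theorem IsChart.stationary_contribution (h : IsChart K α m s₀ B σ δ b ε κ) {η : Plane → ℝ → ℂ}
    (hexp : HasClassicalExpansion ((K m).γ ⁻¹' illuminated K α m)
      (fun s k => etaSlow K α m η ((K m).γ s) k) fun j s => a j ((K m).γ s))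
    {ρ : ℝ → ℝ} (hρ : ContDiff ℝ ∞ ρ) (hρ0 : ∀ t, b / 2 ≤ |t - s₀| → ρ t = 0)
    (hρ1 : ∀ t, |t - s₀| < b / 4 → ρ t = 1) {S : Set Plane} (hS : IsCompact S) (hSB : S ⊆ B)
    {k₀ : ℝ} (hk₀ : 0 < k₀) :
    HasSupExpansion S k₀ (layerPiece K α m η s₀ ρ) (fieldCoeff K α m a) := by
  have hb := h.isPhase.b_pos
  have hP := (K m).period_pos
  have hbP := h.b_lt_period
  have hE := h.hasSupExpansion_amp hexp hρ hS hSB hk₀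
  have key := HasSupExpansion.oscInt h.isPhase hS hSB hk₀ (h.isAmplitude hexp.1 hρ hρ0) hE
    fun x hx k hk => by
      have hkp : 0 < k := hk₀.trans_le hk
      have h0 : ContinuousOn (fun τ : ℝ => σ x + τ) (uIcc (-b) b) := by fun_prop
      refine (Complex.continuous_ofReal.comp_continuousOn (hρ.continuous.comp_continuousOn h0)).mul
        (ContinuousOn.mul ?_ ?_)
      · exact (contDiffOn_layerSymbol (K m)).continuousOn.comp
          (f := fun τ : ℝ => (σ x + τ, (x, k⁻¹))) (by fun_prop)
          fun τ _ => ⟨mem_univ _, h.subset_compl (hSB hx), mem_univ _⟩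
      · exact hexp.isHormander.1.continuousOn.comp (f := fun τ : ℝ => (σ x + τ, k)) (by fun_prop)
          fun τ hτ => ⟨h.lit x (hSB hx) τ (h.isPhase.uIcc_subset hτ), hkp⟩
  intro N
  obtain ⟨C, hC⟩ := key N
  refine ⟨C, fun x hx k hk => ?_⟩
  have h1 := hC x hx k hk
  simp only [h.sum_ampCoeff_eq hexp.1 hρ1 _ (hSB hx)] at h1
  rw [layerPiece]
  convert h1 using 4
  set g : ℝ → ℂ := fun t =>
    Complex.exp (Complex.I * ((k * (layerPhase K α m (t, x) - reflPhase K α m x) : ℝ) : ℂ)) *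
      ((ρ t : ℂ) * (layerSymbol (K m) (t, (x, k⁻¹)) * etaSlow K α m η ((K m).γ t) k)) with hg
  have hsupp : ∀ t ∈ Function.support g, |t - s₀| < b / 2 := fun t ht => by
    by_contra hcon
    exact ht (by simp [hg, hρ0 t (not_lt.1 hcon)])
  have hcl := abs_lt.1 (h.close x (hSB hx))
  -- The cutoff confines the integrand to a set contained in both intervals of integration, so both
  -- integrals equal the one over the line.
  have e1 : ∫ t in (s₀ - (K m).period)..(s₀ + (K m).period), g t = ∫ t, g t :=
    intervalIntegral.integral_eq_integral_of_support_subset fun t ht => by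
      have := abs_lt.1 (hsupp t ht)
      exact ⟨by linarith, by linarith⟩
  have e2 : ∫ t in (σ x + -b)..(σ x + b), g t = ∫ t, g t :=
    intervalIntegral.integral_eq_integral_of_support_subset fun t ht => by
      have := abs_lt.1 (hsupp t ht)
      exact ⟨by linarith, by linarith⟩
  rw [e1, ← e2, ← intervalIntegral.integral_comp_add_left]
  refine intervalIntegral.integral_congr fun τ hτ => ?_
  simp only [hg]
  rw [h.phase_eq x (hSB hx) τ (h.isPhase.uIcc_subset hτ)]

end Stationary

/-! ### Negligible contributions -/

variable {K : ℕ → Obstacle} {α : Plane} {m : ℕ} {η : Plane → ℝ → ℂ} {s₀ k₀ : ℝ} {S : Set Plane}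

theorem exists_bound_layerSymbol (O : Obstacle) (hk₀ : 0 < k₀) {T : Set ℝ} (hT : IsCompact T)
    (hS : IsCompact S) (hSK : S ⊆ O.carrierᶜ) (i : ℕ) : ∃ C : ℝ, ∀ x ∈ S, ∀ k, k₀ ≤ k → ∀ t ∈ T,
      ‖iteratedDeriv i (fun t => layerSymbol O (t, (x, k⁻¹))) t‖ ≤ C := by
  have hΩ : IsOpen (univ ×ˢ (O.carrierᶜ ×ˢ univ) : Set (ℝ × (Plane × ℝ))) :=
    isOpen_univ.prod (O.isCompact.isClosed.isOpen_compl.prod isOpen_univ)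
  obtain ⟨C, hC⟩ := exists_bound_iteratedDeriv_fst hΩ (contDiffOn_layerSymbol O)
    (hT.prod (hS.prod (isCompact_Icc (a := (0 : ℝ)) (b := k₀⁻¹))))
    (fun z hz => ⟨mem_univ _, hSK hz.2.1, mem_univ _⟩) i
  refine ⟨C, fun x hx k hk t ht => hC (t, (x, k⁻¹)) ⟨ht, hx, ?_, ?_⟩⟩
  · exact inv_nonneg.2 (hk₀.le.trans hk)
  · exact inv_anti₀ hk₀ hk

/-- The part of the double-layer potential over the shadow is negligible. -/
theorem layerPiece_shadow (hη : ∀ N : ℕ, IsHormander ((K m).γ ⁻¹' shadow K α m) (-(N : ℝ)) 1 0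
      (fun s k => etaSlow K α m η ((K m).γ s) k)) {ρ : ℝ → ℝ} (hρ : Continuous ρ) {T : Set ℝ}
    (hT : IsCompact T) (hTs : T ⊆ (K m).γ ⁻¹' shadow K α m) (hρT : ∀ t ∉ T, ρ t = 0)
    (hS : IsCompact S) (hSK : S ⊆ (K m).carrierᶜ) (hk₀ : 0 < k₀) (N : ℕ) :
    ∃ C : ℝ, ∀ x ∈ S, ∀ k, k₀ ≤ k → ‖layerPiece K α m η s₀ ρ x k‖ ≤ C * (k ^ N)⁻¹ := by
  obtain ⟨C₁, hC₁⟩ := hT.exists_bound_of_continuousOn hρ.continuousOn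
  obtain ⟨C₂, hC₂⟩ := exists_bound_layerSymbol (K m) hk₀ hT hS hSK 0
  obtain ⟨C₃, hC₃⟩ := (hη (N + 1)).2 T hTs hT k₀ hk₀ 0 0
  simp only [norm_iteratedFDeriv_zero, iteratedDeriv_zero] at hC₂ hC₃
  set L := |s₀ + (K m).period - (s₀ - (K m).period)| with hL
  refine ⟨|C₁| * |C₂| * |C₃| * L * (Real.sqrt k₀)⁻¹, fun x hx k hk => ?_⟩
  have hkp : 0 < k := hk₀.trans_le hk
  have hint : ∀ t, ‖Complex.exp (Complex.I *
      ((k * (layerPhase K α m (t, x) - reflPhase K α m x) : ℝ) : ℂ)) *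
      ((ρ t : ℂ) * (layerSymbol (K m) (t, (x, k⁻¹)) * etaSlow K α m η ((K m).γ t) k))‖ ≤
      |C₁| * |C₂| * |C₃| * (k ^ (N + 1))⁻¹ := by
    intro t
    by_cases ht : t ∈ T
    · rw [norm_mul, mul_comm Complex.I, Complex.norm_exp_ofReal_mul_I, one_mul, norm_mul, norm_mul,
        Complex.norm_real]
      have h1 : ‖ρ t‖ ≤ |C₁| := (hC₁ t ht).trans (le_abs_self _)
      have h2 : ‖layerSymbol (K m) (t, (x, k⁻¹))‖ ≤ |C₂| := (hC₂ x hx k hk t ht).trans (le_abs_self _)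
      have h3 : ‖etaSlow K α m η ((K m).γ t) k‖ ≤ |C₃| * (k ^ (N + 1))⁻¹ := by
        refine (hC₃ t ht k hk).trans ?_
        have e : (1 + k) ^ (-((N + 1 : ℕ) : ℝ) - 1 * (0 : ℕ) + 0 * (0 : ℕ)) =
            ((1 + k) ^ (N + 1))⁻¹ := by
          rw [show -((N + 1 : ℕ) : ℝ) - 1 * (0 : ℕ) + 0 * (0 : ℕ) = -((N + 1 : ℕ) : ℝ) by simp,
            Real.rpow_neg (by linarith), Real.rpow_natCast]
        rw [e]
        calc C₃ * ((1 + k) ^ (N + 1))⁻¹ ≤ |C₃| * ((1 + k) ^ (N + 1))⁻¹ :=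
              mul_le_mul_of_nonneg_right (le_abs_self _) (by positivity)
          _ ≤ |C₃| * (k ^ (N + 1))⁻¹ := by
              gcongr
              linarith
      calc _ ≤ |C₁| * (|C₂| * (|C₃| * (k ^ (N + 1))⁻¹)) := by gcongr
        _ = _ := by ring
    · rw [hρT t ht]
      simp only [Complex.ofReal_zero, zero_mul, mul_zero, norm_zero]
      positivity
  have hle := intervalIntegral.norm_integral_le_of_norm_le_const (a := s₀ - (K m).period)
    (b := s₀ + (K m).period) fun t _ => hint t
  rw [layerPiece, norm_mul, Complex.norm_real, Real.norm_of_nonneg (Real.sqrt_nonneg k)]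
  calc _ ≤ Real.sqrt k * (|C₁| * |C₂| * |C₃| * (k ^ (N + 1))⁻¹ * L) :=
        mul_le_mul_of_nonneg_left hle (Real.sqrt_nonneg k)
    _ = |C₁| * |C₂| * |C₃| * L * (Real.sqrt k * (k ^ (N + 1))⁻¹) := by ring
    _ ≤ |C₁| * |C₂| * |C₃| * L * ((Real.sqrt k₀)⁻¹ * (k ^ N)⁻¹) :=
        mul_le_mul_of_nonneg_left (sqrt_mul_inv_pow_succ_le hk₀ hk N) (by positivity)
    _ = _ := by ring

/-- The scale `(1+k)^{1/3}` of the oscillations of the total field. -/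
def transScale (p : Plane × ℝ) : ℝ := (1 + p.2) ^ (1 / 3 : ℝ)

theorem transScale_pow {p : Plane × ℝ} (hp : 0 ≤ p.2) (i : ℕ) :
    transScale p ^ i = (1 + p.2) ^ (1 / 3 * i : ℝ) := by
  rw [transScale, ← Real.rpow_natCast, ← Real.rpow_mul (by linarith)]

theorem one_le_transScale {p : Plane × ℝ} (hp : 0 ≤ p.2) : 1 ≤ transScale p :=
  Real.one_le_rpow (by linarith) (by norm_num)

/-- One integration by parts gains about `k^{-2/3}`; three gain `k^{-2}`, of which only `k^{-1}` is
kept. -/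
theorem transScale_div_pow_le {p : Plane × ℝ} (hk₀ : 0 < k₀) (hp : k₀ ≤ p.2) (M : ℕ) :
    (transScale p / p.2) ^ (3 * M) ≤ ((1 + k₀⁻¹) * k₀⁻¹) ^ M * (p.2 ^ M)⁻¹ := by
  have hkp : 0 < p.2 := hk₀.trans_le hp
  have h3 : transScale p ^ 3 = 1 + p.2 := by
    rw [transScale_pow hkp.le]
    norm_num
  have hinv : p.2⁻¹ ≤ k₀⁻¹ := inv_anti₀ hk₀ hp
  have hinv0 : 0 < p.2⁻¹ := by positivity
  rw [pow_mul, div_pow, h3, ← inv_pow, ← mul_pow]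
  refine pow_le_pow_left₀ (by positivity) ?_ M
  have e : (1 + p.2) / p.2 ^ 3 = (1 + p.2⁻¹) * p.2⁻¹ * p.2⁻¹ := by
    field_simp
    ring
  rw [e]
  gcongr

/-- The part of the double-layer potential away from the stationary points is negligible. -/
theorem layerPiece_nonstationary (hA : Admissible K α)
    (hη : IsHormander univ 0 (2 / 3) (1 / 3) fun s k => etaSlow K α m η ((K m).γ s) k)
    {ρ : ℝ → ℝ} (hρ : ContDiff ℝ ∞ ρ) {T : Set ℝ} (hT : IsCompact T) (hρT : ∀ t ∉ T, ρ t = 0)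
    {a' b' : ℝ} (hTab : T ⊆ Icc a' b') (ha : s₀ - (K m).period < a') (hb : b' < s₀ + (K m).period)
    (hS : IsCompact S) (hSK : S ⊆ (K m).carrierᶜ)
    (hψ : ContinuousOn (reflPhase K α m) S)
    (hne : ∀ x ∈ S, ∀ t ∈ T, deriv (fun t => layerPhase K α m (t, x)) t ≠ 0)
    (hk₀ : 0 < k₀) (N : ℕ) :
    ∃ C : ℝ, ∀ x ∈ S, ∀ k, k₀ ≤ k → ‖layerPiece K α m η s₀ ρ x k‖ ≤ C * (k ^ N)⁻¹ := by
  have hR := smoothRays hA m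
  have hΩ : IsOpen (univ ×ˢ (K m).carrierᶜ : Set (ℝ × Plane)) :=
    isOpen_univ.prod (K m).isCompact.isClosed.isOpen_compl
  have hφ := contDiffOn_layerPhase hR
  have hTS : T ×ˢ S ⊆ univ ×ˢ (K m).carrierᶜ := prod_mono (subset_univ _) hSK
  obtain ⟨D, hD⟩ := (hT.prod hS).exists_bound_of_continuousOn
    (((contDiffOn_deriv_fst hΩ hφ).continuousOn.mono hTS).inv₀ fun p hp => hne p.2 hp.2 p.1 hp.1)
  -- A lower bound for the phase derivative from compactness of `T ×ˢ S`; adding 1 keeps it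
  -- positive.
  set c : ℝ := (|D| + 1)⁻¹ with hc
  have hc0 : 0 < c := by positivity
  have hcle : ∀ x ∈ S, ∀ t ∈ T, c ≤ |deriv (fun t => layerPhase K α m (t, x)) t| := by
    intro x hx t ht
    have h1 := hD (t, x) ⟨ht, hx⟩
    rw [Pi.inv_apply, norm_inv, Real.norm_eq_abs] at h1
    refine inv_le_of_inv_le₀ (abs_pos.2 (hne x hx t ht)) (h1.trans ?_)
    linarith [le_abs_self D]
  set A : Set (Plane × ℝ) := S ×ˢ Ici k₀ with hAdef
  set Θ : Plane × ℝ → ℝ → ℝ := fun p t => layerPhase K α m (t, p.1) - reflPhase K α m p.1 with hΘdef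
  have hkA : ∀ p ∈ A, 0 < p.2 := fun p hp => hk₀.trans_le hp.2
  have hΘs : ∀ p ∈ A, ContDiff ℝ ∞ (Θ p) := fun p hp => by
    have : ContDiffOn ℝ ∞ (fun t : ℝ => layerPhase K α m (t, p.1)) univ :=
      hφ.comp (by fun_prop) fun t _ => ⟨mem_univ _, hSK hp.1⟩
    exact (contDiffOn_univ.1 this).sub contDiff_const
  have hΘd : ∀ p t, deriv (Θ p) t = deriv (fun t => layerPhase K α m (t, p.1)) t := fun p t =>
    deriv_sub_const _
  set J : Set ℝ := uIcc (s₀ - (K m).period) (s₀ + (K m).period) with hJ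
  have hΘb : ∀ i : ℕ, ∃ C : ℝ, ∀ p ∈ A, ∀ t ∈ J, |iteratedDeriv i (Θ p) t| ≤ C := by
    intro i
    obtain ⟨C, hC⟩ := exists_bound_iteratedDeriv_fst hΩ hφ ((isCompact_uIcc : IsCompact J).prod hS)
      (prod_mono (subset_univ _) hSK) i
    obtain ⟨E, hE⟩ := hS.exists_bound_of_continuousOn hψ
    refine ⟨|E| + C, fun p hp t ht => ?_⟩
    have h1 := hC (t, p.1) ⟨ht, hp.1⟩
    have h2 := (hE p.1 hp.1).trans (le_abs_self E)
    rw [Real.norm_eq_abs] at h1 h2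
    have e : Θ p = fun t => -reflPhase K α m p.1 + layerPhase K α m (t, p.1) := by
      funext t
      simp only [hΘdef]
      ring
    rcases Nat.eq_zero_or_pos i with rfl | hi
    · rw [iteratedDeriv_zero, e]
      exact (abs_add_le _ _).trans (add_le_add (by rwa [abs_neg]) (by simpa using h1))
    · rw [e, iteratedDeriv_const_add hi]
      linarith [abs_nonneg E]
  have hρr : IsRough A transScale J 0 fun _ t => (ρ t : ℂ) := by
    refine ⟨fun p _ => Complex.ofRealCLM.contDiff.comp hρ, fun i => ?_⟩
    obtain ⟨C, hC⟩ := isCompact_uIcc.exists_bound_of_continuousOn (f := iteratedDeriv i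
      fun t => (ρ t : ℂ)) (ContDiff.continuous_iteratedDeriv i
        (Complex.ofRealCLM.contDiff.comp hρ) (by exact_mod_cast le_top)).continuousOn
    refine ⟨|C|, abs_nonneg _, fun p hp t ht => (hC t ht).trans ((le_abs_self C).trans ?_)⟩
    exact le_mul_of_one_le_right (abs_nonneg _) (one_le_pow₀ (one_le_transScale (hkA p hp).le))
  have hsr : IsRough A transScale J 0 fun p t => layerSymbol (K m) (t, (p.1, p.2⁻¹)) := by
    refine ⟨fun p hp => ?_, fun i => ?_⟩
    · exact contDiffOn_univ.1 ((contDiffOn_layerSymbol (K m)).comp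
        (f := fun t : ℝ => (t, (p.1, p.2⁻¹))) (by fun_prop)
        fun t _ => ⟨mem_univ _, hSK hp.1, mem_univ _⟩)
    · obtain ⟨C, hC⟩ := exists_bound_layerSymbol (K m) hk₀ (isCompact_uIcc : IsCompact J) hS hSK i
      refine ⟨|C|, abs_nonneg _, fun p hp t ht =>
        (hC p.1 hp.1 p.2 hp.2 t ht).trans ((le_abs_self C).trans ?_)⟩
      exact le_mul_of_one_le_right (abs_nonneg _) (one_le_pow₀ (one_le_transScale (hkA p hp).le))
  -- The density is the rough factor: each arc-length derivative costs `(1+k)^{1/3}`, the worst case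
  -- occurring across the shadow boundary.
  have hηr : IsRough A transScale J 0 fun p t => etaSlow K α m η ((K m).γ t) p.2 := by
    refine ⟨fun p hp => ?_, fun i => ?_⟩
    · exact contDiffOn_univ.1 (hη.1.comp (f := fun t : ℝ => (t, p.2)) (by fun_prop)
        fun t _ => ⟨mem_univ _, hkA p hp⟩)
    · obtain ⟨C, hC⟩ := hη.2 J (subset_univ _) isCompact_uIcc k₀ hk₀ i 0
      refine ⟨|C|, abs_nonneg _, fun p hp t ht => ?_⟩
      have h1 := hC t ht p.2 hp.2
      simp only [iteratedDeriv_zero, norm_iteratedFDeriv_eq_norm_iteratedDeriv] at h1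
      refine h1.trans ?_
      rw [zero_add, transScale_pow (hkA p hp).le]
      have : (0 : ℝ) - 2 / 3 * (0 : ℕ) + 1 / 3 * i = 1 / 3 * i := by simp
      rw [this]
      exact mul_le_mul_of_nonneg_right (le_abs_self _)
        (Real.rpow_nonneg (by linarith [hkA p hp]) _)
  -- `N + 1` triples of integrations by parts; the surplus power pays for `√k`.
  obtain ⟨C, hC⟩ := nonstationary_phase (k := fun p : Plane × ℝ => p.2) hc0 hkA
    (fun p hp => one_le_transScale (hkA p hp).le) hΘs hΘb ha hb (3 * (N + 1)) (0 + (0 + 0)) _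
    (hρr.mul (hsr.mul hηr))
    (fun p hp t ht => by
      rw [hΘd] at ht
      rw [hρT t fun h => absurd (hcle p.1 hp.1 t h) (not_le.2 ht), Complex.ofReal_zero, zero_mul])
    (fun p hp t ht => by
      rw [hρT t fun h => ht (hTab h), Complex.ofReal_zero, zero_mul])
  refine ⟨|C| * ((1 + k₀⁻¹) * k₀⁻¹) ^ (N + 1) * (Real.sqrt k₀)⁻¹, fun x hx k hk => ?_⟩
  have h1 := hC (x, k) ⟨hx, hk⟩
  have h2 := transScale_div_pow_le (p := (x, k)) hk₀ hk (N + 1)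
  have hkp : 0 < k := hk₀.trans_le hk
  have hr := one_le_transScale (p := (x, k)) hkp.le
  rw [layerPiece, norm_mul, Complex.norm_real, Real.norm_of_nonneg (Real.sqrt_nonneg k)]
  simp only [add_zero, pow_zero, one_mul] at h1 h2
  calc _ ≤ Real.sqrt k * (C * (transScale (x, k) / k) ^ (3 * (N + 1))) :=
        mul_le_mul_of_nonneg_left h1 (Real.sqrt_nonneg k)
    _ ≤ Real.sqrt k * (|C| * (((1 + k₀⁻¹) * k₀⁻¹) ^ (N + 1) * (k ^ (N + 1))⁻¹)) := by
        refine mul_le_mul_of_nonneg_left ?_ (Real.sqrt_nonneg k)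
        exact mul_le_mul (le_abs_self _) h2 (by positivity) (abs_nonneg _)
    _ = |C| * ((1 + k₀⁻¹) * k₀⁻¹) ^ (N + 1) * (Real.sqrt k * (k ^ (N + 1))⁻¹) := by ring
    _ ≤ |C| * ((1 + k₀⁻¹) * k₀⁻¹) ^ (N + 1) * ((Real.sqrt k₀)⁻¹ * (k ^ N)⁻¹) :=
        mul_le_mul_of_nonneg_left (sqrt_mul_inv_pow_succ_le hk₀ hk N) (by positivity)
    _ = _ := by ring

/-! ### Partition of the boundary and conclusion -/

variable {K : ℕ → Obstacle} {α : Plane} {m : ℕ} {η : Plane → ℝ → ℂ} {a : ℕ → Plane → ℂ} {s₀ : ℝ}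

/-- A smooth cutoff whose translates by multiples of `P` add up to `1`. -/
def periodCutoff (P s₀ t : ℝ) : ℝ :=
  Real.smoothTransition (3 * ((t - s₀) / P) + 2) - Real.smoothTransition (3 * ((t - s₀) / P) - 1)

theorem contDiff_periodCutoff (P s₀ : ℝ) : ContDiff ℝ ∞ (periodCutoff P s₀) := by
  unfold periodCutoff
  exact (Real.smoothTransition.contDiff.comp (by fun_prop)).sub
    (Real.smoothTransition.contDiff.comp (by fun_prop))

theorem periodCutoff_eq_one {P s₀ t : ℝ} (hP : 0 < P) (h : |t - s₀| ≤ P / 3) :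
    periodCutoff P s₀ t = 1 := by
  obtain ⟨h1, h2⟩ := abs_le.1 h
  have h3 : -(1 / 3) ≤ (t - s₀) / P := by
    rw [le_div_iff₀ hP]
    linarith
  have h4 : (t - s₀) / P ≤ 1 / 3 := by
    rw [div_le_iff₀ hP]
    linarith
  rw [periodCutoff, Real.smoothTransition.one_of_one_le (by linarith),
    Real.smoothTransition.zero_of_nonpos (by linarith), sub_zero]

theorem periodCutoff_eq_zero {P s₀ t : ℝ} (hP : 0 < P) (h : 2 * P / 3 < |t - s₀|) :
    periodCutoff P s₀ t = 0 := by
  rcases lt_abs.1 h with h | h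
  · have h3 : 2 / 3 ≤ (t - s₀) / P := by
      rw [le_div_iff₀ hP]
      linarith
    rw [periodCutoff, Real.smoothTransition.one_of_one_le (by linarith),
      Real.smoothTransition.one_of_one_le (by linarith), sub_self]
  · have h3 : (t - s₀) / P ≤ -(2 / 3) := by
      rw [div_le_iff₀ hP]
      linarith
    rw [periodCutoff, Real.smoothTransition.zero_of_nonpos (by linarith),
      Real.smoothTransition.zero_of_nonpos (by linarith), sub_self]

theorem periodCutoff_add {P s₀ t : ℝ} (hP : 0 < P) (h : t ∈ Icc s₀ (s₀ + P)) :
    periodCutoff P s₀ t + periodCutoff P s₀ (t - P) = 1 := by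
  have h1 : 0 ≤ (t - s₀) / P := div_nonneg (by linarith [h.1]) hP.le
  have h2 : (t - s₀) / P ≤ 1 := by
    rw [div_le_one hP]
    linarith [h.2]
  have h3 : (t - P - s₀) / P = (t - s₀) / P - 1 := by
    field_simp
    ring
  rw [periodCutoff, periodCutoff, h3, Real.smoothTransition.one_of_one_le (x := 3 * _ + 2) (by linarith),
    Real.smoothTransition.zero_of_nonpos (x := 3 * ((t - s₀) / P - 1) - 1) (by linarith),
    show 3 * ((t - s₀) / P - 1) + 2 = 3 * ((t - s₀) / P) - 1 by ring]
  ring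

theorem integral_periodCutoff {P : ℝ} (hP : 0 < P) (s₀ : ℝ) {g : ℝ → ℂ} (hg : Continuous g)
    (hper : Function.Periodic g P) :
    ∫ t in (s₀ - P)..(s₀ + P), (periodCutoff P s₀ t : ℂ) * g t = ∫ t in (0 : ℝ)..P, g t := by
  have hρ : Continuous fun t => (periodCutoff P s₀ t : ℂ) :=
    Complex.continuous_ofReal.comp (contDiff_periodCutoff P s₀).continuous
  have hi : ∀ u v, IntervalIntegrable (fun t => (periodCutoff P s₀ t : ℂ) * g t)
      MeasureTheory.volume u v := fun u v => (hρ.mul hg).intervalIntegrable u v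
  have h1 : ∫ t in (s₀ - P)..s₀, (periodCutoff P s₀ t : ℂ) * g t =
      ∫ t in s₀..(s₀ + P), (periodCutoff P s₀ (t - P) : ℂ) * g t := by
    have := intervalIntegral.integral_comp_sub_right (a := s₀) (b := s₀ + P)
      (fun t => (periodCutoff P s₀ t : ℂ) * g t) P
    rw [add_sub_cancel_right] at this
    rw [← this]
    refine intervalIntegral.integral_congr fun t _ => ?_
    simp only [hper.sub_eq]
  have h2 := hper.intervalIntegral_add_eq 0 s₀
  rw [zero_add] at h2
  rw [← intervalIntegral.integral_add_adjacent_intervals (hi _ s₀) (hi _ _), h1, h2,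
    ← intervalIntegral.integral_add]
  · refine intervalIntegral.integral_congr fun t ht => ?_
    rw [uIcc_of_le (by linarith)] at ht
    have := periodCutoff_add hP ht
    have h3 : (periodCutoff P s₀ (t - P) : ℂ) + (periodCutoff P s₀ t : ℂ) = 1 := by
      rw [add_comm]
      exact_mod_cast this
    rw [← add_mul, h3, one_mul]
  · exact ((hρ.comp (continuous_sub_right P)).mul hg).intervalIntegrable _ _
  · exact hi _ _

theorem continuous_layerIntegrand (hA : Admissible K α)
    (hη : IsHormander univ 0 (2 / 3) (1 / 3) fun s k => etaSlow K α m η ((K m).γ s) k)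
    {x : Plane} (hx : x ∉ (K m).carrier) {k : ℝ} (hk : 0 < k) :
    Continuous fun t => Complex.exp
      (Complex.I * ((k * (layerPhase K α m (t, x) - reflPhase K α m x) : ℝ) : ℂ)) *
        (layerSymbol (K m) (t, (x, k⁻¹)) * etaSlow K α m η ((K m).γ t) k) := by
  have h1 : Continuous fun t : ℝ => layerPhase K α m (t, x) :=
    continuousOn_univ.1 ((contDiffOn_layerPhase (smoothRays hA m)).continuousOn.comp
      (by fun_prop) fun t _ => ⟨mem_univ _, hx⟩)
  have h2 : Continuous fun t : ℝ => layerSymbol (K m) (t, (x, k⁻¹)) :=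
    continuousOn_univ.1 ((contDiffOn_layerSymbol (K m)).continuousOn.comp
      (by fun_prop) fun t _ => ⟨mem_univ _, hx, mem_univ _⟩)
  have h3 : Continuous fun t : ℝ => etaSlow K α m η ((K m).γ t) k :=
    continuousOn_univ.1 (hη.1.continuousOn.comp (f := fun t : ℝ => (t, k)) (by fun_prop)
      fun t _ => ⟨mem_univ _, hk⟩)
  fun_prop

/-- A smooth window centred at `s₀` replaces the interval `[0, P]`, whose end points could fall on
the stationary point or produce boundary terms. -/
theorem uSlow_eq_layerPiece (hA : Admissible K α)
    (hη : IsHormander univ 0 (2 / 3) (1 / 3) fun s k => etaSlow K α m η ((K m).γ s) k)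
    {x : Plane} (hx : x ∉ (K m).carrier) {k : ℝ} (hk : 0 < k) (s₀ : ℝ) :
    uSlow K α m η x k = layerPiece K α m η s₀ (periodCutoff (K m).period s₀) x k := by
  have hper : Function.Periodic (fun t => Complex.exp
      (Complex.I * ((k * (layerPhase K α m (t, x) - reflPhase K α m x) : ℝ) : ℂ)) *
        (layerSymbol (K m) (t, (x, k⁻¹)) * etaSlow K α m η ((K m).γ t) k)) (K m).period := by
    intro t
    simp only [layerPhase, layerSymbol, (K m).periodic t]
  have h1 := integral_periodCutoff (K m).period_pos s₀ (continuous_layerIntegrand hA hη hx hk) hper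
  rw [uSlow_eq η hx hk, layerPiece]
  simp only [mul_assoc] at h1 ⊢
  rw [← h1]
  congr 1
  exact intervalIntegral.integral_congr fun t _ => by ring

theorem layerPiece_add (hA : Admissible K α)
    (hη : IsHormander univ 0 (2 / 3) (1 / 3) fun s k => etaSlow K α m η ((K m).γ s) k)
    {x : Plane} (hx : x ∉ (K m).carrier) {k : ℝ} (hk : 0 < k) (s₀ : ℝ) {ρ ρ' : ℝ → ℝ}
    (hρ : Continuous ρ) (hρ' : Continuous ρ') :
    layerPiece K α m η s₀ (fun t => ρ t + ρ' t) x k =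
      layerPiece K α m η s₀ ρ x k + layerPiece K α m η s₀ ρ' x k := by
  have hg := continuous_layerIntegrand hA hη hx hk
  have hi : ∀ ρ : ℝ → ℝ, Continuous ρ → ∀ u v, IntervalIntegrable (fun t => Complex.exp
      (Complex.I * ((k * (layerPhase K α m (t, x) - reflPhase K α m x) : ℝ) : ℂ)) *
      ((ρ t : ℂ) * (layerSymbol (K m) (t, (x, k⁻¹)) * etaSlow K α m η ((K m).γ t) k)))
      MeasureTheory.volume u v := fun ρ hρ u v => by
    have hc : Continuous fun t => (ρ t : ℂ) := Complex.continuous_ofReal.comp hρ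
    refine ((hc.mul hg).congr fun t => ?_).intervalIntegrable u v
    rw [Pi.mul_apply]
    ring
  rw [layerPiece, layerPiece, layerPiece, ← mul_add, ← intervalIntegral.integral_add
    (hi ρ hρ _ _) (hi ρ' hρ' _ _)]
  congr 1
  refine intervalIntegral.integral_congr fun t _ => ?_
  push_cast
  ring

/-- Away from the point of reflection, all stationary points lie in the shadow. -/
theorem mem_shadow_of_stationary (hA : Admissible K α) (hs₀ : (K m).γ s₀ ∈ illuminated K α m)
    {t₀ : ℝ} (ht₀ : 0 < t₀) {t : ℝ} (h0 : t ≠ s₀) (h1 : |t - s₀| < (K m).period)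
    (h : deriv (fun r => layerPhase K α m (r, (K m).γ s₀ + t₀ • refDir K α m ((K m).γ s₀))) t = 0) :
    (K m).γ t ∈ shadow K α m := by
  by_contra hcon
  obtain ⟨n, hn⟩ := (K m).exists_int_of_γ_eq (stationary_point_unique hA hs₀ ht₀ hcon h)
  have hP := (K m).period_pos
  rw [hn, add_sub_cancel_left, abs_mul, abs_of_pos hP] at h1
  have h2 : |(n : ℝ)| < 1 := by
    by_contra hge
    nlinarith [not_lt.1 hge]
  have h3 : n = 0 := Int.abs_lt_one_iff.1 (by exact_mod_cast h2)
  exact h0 (by rw [hn, h3]; simp)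

/-- The cutoff is 1 on a whole neighbourhood of the stationary set, so that the complementary part
is supported in a compact set without stationary points. -/
theorem exists_shadow_cutoff {Z U : Set ℝ} (hZ : IsCompact Z) (hU : IsOpen U) (hZU : Z ⊆ U) :
    ∃ χ : ℝ → ℝ, ContDiff ℝ ∞ χ ∧ (∃ T, IsCompact T ∧ T ⊆ U ∧ ∀ t ∉ T, χ t = 0) ∧
      ∃ O, IsOpen O ∧ Z ⊆ O ∧ ∀ t ∈ O, χ t = 1 := by
  obtain ⟨T, hT, hZT, hTU⟩ := exists_compact_between hZ hU hZU
  obtain ⟨f, hf1, hf0, -⟩ := exists_contMDiffMap_one_nhds_of_subset_interior (n := ⊤)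
    (modelWithCornersSelf ℝ ℝ) hZ.isClosed hZT
  obtain ⟨O, hO, hZO, hO1⟩ := eventually_nhdsSet_iff_exists.1 hf1
  exact ⟨f, f.contMDiff.contDiff, ⟨T, hT, hTU, hf0⟩, O, hO, hZO, hO1⟩

/-- The tube lemma: nonvanishing on the compact set at `x₀` persists for `x` near `x₀`. -/
theorem exists_nhds_nonstationary (hA : Admissible K α) {x₀ : Plane} {W : Set ℝ}
    (hW : IsCompact W) (hx₀ : x₀ ∉ (K m).carrier)
    (hne : ∀ t ∈ W, deriv (fun t => layerPhase K α m (t, x₀)) t ≠ 0) :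
    ∃ B : Set Plane, IsOpen B ∧ x₀ ∈ B ∧ ∀ x ∈ B, ∀ t ∈ W,
      deriv (fun t => layerPhase K α m (t, x)) t ≠ 0 := by
  have hΩ : IsOpen (univ ×ˢ (K m).carrierᶜ : Set (ℝ × Plane)) :=
    isOpen_univ.prod (K m).isCompact.isClosed.isOpen_compl
  have hc := (contDiffOn_deriv_fst hΩ (contDiffOn_layerPhase (smoothRays hA m))).continuousOn
  have hopen := hc.isOpen_inter_preimage hΩ (isOpen_compl_singleton (x := (0 : ℝ)))
  obtain ⟨u, v, -, hv, hWu, hxv, huv⟩ := generalized_tube_lemma hW (isCompact_singleton (x := x₀))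
    hopen (by
      rintro ⟨t, x⟩ ⟨ht, rfl⟩
      exact ⟨⟨mem_univ _, hx₀⟩, hne t ht⟩)
  exact ⟨v, hv, hxv rfl, fun x hx t ht => (huv (mk_mem_prod (hWu ht) hx)).2⟩

/-- Near every point of the illuminated region, the scattered field has the asserted expansion,
without derivatives. -/
theorem exists_chart_hasSupExpansion (hA : Admissible K α) (hmain : HasBoundaryAsymptotics K α m η a)
    {x₀ : Plane} (hx₀ : x₀ ∈ openIlluminated K α m) :
    ∃ (s₀ : ℝ) (B : Set Plane) (σ : Plane → ℝ) (δ b ε : ℝ) (κ : ℝ × Plane → ℝ), x₀ ∈ B ∧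
      IsChart K α m s₀ B σ δ b ε κ ∧ ∀ S ⊆ B, IsCompact S → ∀ k₀ : ℝ, 0 < k₀ →
        HasSupExpansion S k₀ (uSlow K α m η) (fieldCoeff K α m a) := by
  obtain ⟨y, hy, t₀, ht₀, rfl⟩ := mem_openIlluminated_iff.1 hx₀
  obtain ⟨s₀, rfl⟩ := (K m).exists_of_mem_frontier hy.1
  obtain ⟨B, σ, δ, b, ε, κ, hxB, hch⟩ := exists_isChart hA hy ht₀
  set x₀ := (K m).γ s₀ + t₀ • refDir K α m ((K m).γ s₀) with hx₀def
  have hb := hch.isPhase.b_pos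
  have hP := (K m).period_pos
  have hbP := hch.b_lt_period
  have hx₀K : x₀ ∉ (K m).carrier := hch.subset_compl hxB
  have hR := smoothRays hA m
  set ρ : ℝ → ℝ := periodCutoff (K m).period s₀ with hρdef
  have hρs : ContDiff ℝ ∞ ρ := contDiff_periodCutoff _ _
  -- The piece near the reflection point; `b < P/3` ensures `ρ = 1` on its support.
  set ρ₁ : ℝ → ℝ := fun t => cutoff (b / 2) (by positivity) (t - s₀) with hρ₁def
  have hρ₁s : ContDiff ℝ ∞ ρ₁ := (cutoff (b / 2) _).contDiff.comp (by fun_prop)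
  have hρ₁0 : ∀ t, b / 2 ≤ |t - s₀| → ρ₁ t = 0 := fun t ht => cutoff_eq_zero _ ht
  have hρ₁1 : ∀ t, |t - s₀| < b / 4 → ρ₁ t = 1 := fun t ht => cutoff_eq_one _ (by linarith)
  -- Contains the support of `ρ - ρ₁`. It excludes `s₀` and, since `2P/3 < P`, all its translates by
  -- periods, hence every parameter of the reflection point of `x₀`.
  set W : Set ℝ := Icc (s₀ - 2 * (K m).period / 3) (s₀ + 2 * (K m).period / 3) ∩
    {t | b / 4 ≤ |t - s₀|} with hWdef
  have hW : IsCompact W := isCompact_Icc.inter_right (isClosed_le continuous_const (by fun_prop))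
  have hρW : ∀ t ∉ W, ρ t - ρ₁ t = 0 := by
    intro t ht
    by_cases h1 : |t - s₀| < b / 4
    · rw [hρ₁1 t h1, hρdef, periodCutoff_eq_one hP (by linarith), sub_self]
    · have h2 : 2 * (K m).period / 3 < |t - s₀| := by
        by_contra hle
        obtain ⟨h3, h4⟩ := abs_le.1 (not_lt.1 hle)
        exact ht ⟨⟨by linarith, by linarith⟩, not_lt.1 h1⟩
      rw [hρ₁0 t (by linarith), hρdef, periodCutoff_eq_zero hP h2, sub_self]
  have hΩ : IsOpen (univ ×ˢ (K m).carrierᶜ : Set (ℝ × Plane)) :=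
    isOpen_univ.prod (K m).isCompact.isClosed.isOpen_compl
  have hdc : Continuous (deriv fun t => layerPhase K α m (t, x₀)) :=
    continuousOn_univ.1 ((contDiffOn_deriv_fst hΩ (contDiffOn_layerPhase hR)).continuousOn.comp
      (f := fun t : ℝ => (t, x₀)) (by fun_prop) fun t _ => ⟨mem_univ _, hx₀K⟩)
  -- The remaining stationary points for `x₀`; by uniqueness they lie in the open shadow.
  set Z : Set ℝ := W ∩ {t | deriv (fun t => layerPhase K α m (t, x₀)) t = 0} with hZdef
  have hZ : IsCompact Z := hW.inter_right (isClosed_eq hdc continuous_const)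
  have hZs : Z ⊆ (K m).γ ⁻¹' shadow K α m := by
    rintro t ⟨⟨⟨h1, h2⟩, h3⟩, h4⟩
    have h3' : b / 4 ≤ |t - s₀| := h3
    refine mem_shadow_of_stationary hA hy ht₀ ?_ ?_ h4
    · rintro rfl
      rw [sub_self, abs_zero] at h3'
      linarith
    · rw [abs_lt]
      constructor <;> linarith
  obtain ⟨χ, hχs, ⟨T, hT, hTs, hχT⟩, O, hO, hZO, hχO⟩ :=
    exists_shadow_cutoff hZ hR.isOpen_shadow hZs
  have hW₃ : IsCompact (W \ O) := hW.diff hO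
  obtain ⟨B', hB', hxB', hBne⟩ := exists_nhds_nonstationary hA hW₃ hx₀K
    fun t ht h0 => ht.2 (hZO ⟨ht.1, h0⟩)
  refine ⟨s₀, B ∩ B', σ, δ, b, ε, κ, ⟨hxB, hxB'⟩,
    hch.mono (hch.isPhase.isOpen.inter hB') inter_subset_left, fun S hSB hS k₀ hk₀ N => ?_⟩
  have hSB₁ : S ⊆ B := hSB.trans inter_subset_left
  have hSK : S ⊆ (K m).carrierᶜ := hSB₁.trans hch.subset_compl
  obtain ⟨C₁, hC₁⟩ := hch.stationary_contribution hmain.illuminated_expansion hρ₁s hρ₁0 hρ₁1 hS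
    hSB₁ hk₀ N
  obtain ⟨C₂, hC₂⟩ := layerPiece_shadow (s₀ := s₀) hmain.shadow_decay
    (ρ := fun t => (ρ t - ρ₁ t) * χ t)
    ((hρs.continuous.sub hρ₁s.continuous).mul hχs.continuous) hT hTs
    (fun t ht => by rw [hχT t ht, mul_zero]) hS hSK hk₀ N
  obtain ⟨C₃, hC₃⟩ := layerPiece_nonstationary (s₀ := s₀) hA hmain.global_class
    (ρ := fun t => (ρ t - ρ₁ t) * (1 - χ t))
    ((hρs.sub hρ₁s).mul (contDiff_const.sub hχs)) hW₃
    (fun t ht => by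
      by_cases h : t ∈ W
      · rw [hχO t (by_contra fun h' => ht ⟨h, h'⟩), sub_self, mul_zero]
      · rw [hρW t h, zero_mul])
    (a' := s₀ - 2 * (K m).period / 3) (b' := s₀ + 2 * (K m).period / 3)
    (fun t ht => ht.1.1) (by linarith) (by linarith) hS hSK
    (hch.reflPhase_smooth.continuousOn.mono hSB₁) (fun x hx t ht => hBne x (hSB hx).2 t ht) hk₀ N
  refine ⟨C₁ + C₂ + C₃, fun x hx k hk => ?_⟩
  have hkp : 0 < k := hk₀.trans_le hk
  have hρc : ∀ {f : ℝ → ℝ}, ContDiff ℝ ∞ f → Continuous f := fun h => h.continuous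
  -- `ρ = ρ₁ + (ρ - ρ₁)χ + (ρ - ρ₁)(1 - χ)`: reflection point, shadow, no stationary points.
  have e : uSlow K α m η x k = layerPiece K α m η s₀ ρ₁ x k +
      (layerPiece K α m η s₀ (fun t => (ρ t - ρ₁ t) * χ t) x k +
        layerPiece K α m η s₀ (fun t => (ρ t - ρ₁ t) * (1 - χ t)) x k) := by
    rw [uSlow_eq_layerPiece hA hmain.global_class (hSK hx) hkp s₀,
      ← layerPiece_add hA hmain.global_class (hSK hx) hkp s₀
        (hρc ((hρs.sub hρ₁s).mul hχs)) (hρc ((hρs.sub hρ₁s).mul (contDiff_const.sub hχs))),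
      ← layerPiece_add hA hmain.global_class (hSK hx) hkp s₀ (hρc hρ₁s)
        (hρc (((hρs.sub hρ₁s).mul hχs).add ((hρs.sub hρ₁s).mul (contDiff_const.sub hχs))))]
    congr 1
    funext t
    ring
  rw [e, add_sub_right_comm, ← add_assoc, add_mul, add_mul]
  exact norm_add₃_le.trans (add_le_add (add_le_add (hC₁ x hx k hk) (hC₂ x hx k hk))
    (hC₃ x hx k hk))

/-- The claim is local in `x`. In a chart, the uniform expansion and the polynomial derivative
bounds are all that the interpolation argument requires. -/
theorem hasClassicalExpansion_uSlow (hA : Admissible K α) (hmain : HasBoundaryAsymptotics K α m η a) :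
    HasClassicalExpansion (openIlluminated K α m) (uSlow K α m η) (fieldCoeff K α m a) := by
  refine .of_locally fun x₀ hx₀ => ?_
  obtain ⟨s₀, B, σ, δ, b, ε, κ, hxB, hch, hexp⟩ := exists_chart_hasSupExpansion hA hmain hx₀
  have hB := hch.isPhase.isOpen
  obtain ⟨hf, hpoly⟩ := contDiffOn_uSlow_and_polynomial_bounds hA hmain.global_class hB
    hch.subset_compl hch.reflPhase_smooth
  refine ⟨B, hB, hxB, hch.subset, hasClassicalExpansion_of_hasOrder hB hf
    (hch.contDiffOn_fieldCoeff hmain.illuminated_expansion.1) hpoly fun N S hSB hS k₀ hk₀ => ?_⟩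
  obtain ⟨C, hC⟩ := hexp S hSB hS k₀ hk₀ N
  refine ⟨|C| * (1 + k₀⁻¹) ^ N, fun x hx k hk => (hC x hx k hk).trans ?_⟩
  have hkp : 0 < k := hk₀.trans_le hk
  have hinv : k⁻¹ ≤ k₀⁻¹ := inv_anti₀ hk₀ hk
  -- Passage from powers of `k` to the powers of `1 + k` in the symbol estimates.
  have h1 : k⁻¹ ≤ (1 + k₀⁻¹) * (1 + k)⁻¹ := by
    rw [← div_eq_mul_inv, le_div_iff₀ (by linarith)]
    calc k⁻¹ * (1 + k) = k⁻¹ + 1 := by field_simp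
      _ ≤ 1 + k₀⁻¹ := by linarith
  rw [zpow_neg, zpow_natCast, ← inv_pow, ← inv_pow]
  calc C * k⁻¹ ^ N ≤ |C| * k⁻¹ ^ N := mul_le_mul_of_nonneg_right (le_abs_self _) (by positivity)
    _ ≤ |C| * ((1 + k₀⁻¹) * (1 + k)⁻¹) ^ N := by gcongr
    _ = _ := by
        rw [mul_pow]
        ring

end MultipleScattering

end

theorem mainTheorem2 {J : Type*} [Finite J] (Ob : J → MultipleScattering.Obstacle)
    (hdisj : ∀ σ τ : J, σ ≠ τ → Disjoint (Ob σ).carrier (Ob τ).carrier)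
    (α : MultipleScattering.Plane) (hα : ‖α‖ = 1)
    (idx : ℕ → J) (hidx : ∀ j, idx (j + 1) ≠ idx j)
    (K : ℕ → MultipleScattering.Obstacle) (hK : ∀ j, K j = Ob (idx j))
    (hocc : MultipleScattering.NoOcclusion K α)
    (hvis : MultipleScattering.Visibility K)
    (m : ℕ)
    (η : ℕ → MultipleScattering.Plane → ℝ → ℂ)
    (hη : MultipleScattering.AreTotalFields K α m η)
    (a : ℕ → MultipleScattering.Plane → ℂ)
    (hmain : MultipleScattering.HasBoundaryAsymptotics K α m (η m) a) :
    MultipleScattering.IsHormander (MultipleScattering.openIlluminated K α m) 0 1 0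
        (MultipleScattering.uSlow K α m (η m)) ∧
      MultipleScattering.HasClassicalExpansion (MultipleScattering.openIlluminated K α m)
        (MultipleScattering.uSlow K α m (η m)) (MultipleScattering.fieldCoeff K α m a) := by
  have hA : MultipleScattering.Admissible K α := by
    refine ⟨hα, fun j => ?_, hocc, hvis⟩
    rw [hK, hK]
    exact hdisj _ _ (hidx j).symm
  have hexp := MultipleScattering.hasClassicalExpansion_uSlow hA hmain
  exact ⟨hexp.isHormander, hexp⟩
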